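/- **Setting.** All functions on the unit sphere $\mathbb S^2\subset\mathbb R^3$ are complex valued; $\nabla$, $\mathrm{div}$, $*d$, $d^*=-\mathrm{div}$ are the usual operators on $\mathbb S^2$, $V\cdot\nabla\xi$ is the covariant derivative, and $\Delta$ is the Laplace–Beltrami operator on functions and $-(dd^*+d^*d)$ on tangent fields. Let $$X=\{(\xi,\xi',\vartheta,\vartheta^*):\ \xi\in H^2,\ \xi'\in H^1\text{ tangent fields},\ \vartheta\in H^2,\ \textstyle\int_{\mathbb S^2}\vartheta=0,\ \vartheta^*\in H^1\},$$ $$\mathcal D=\{(\xi,\xi',\vartheta,\vartheta^*):\ \xi\in H^3,\ \xi'\in H^2\text{ tangent fields},\ \vartheta\in H^3,\ \textstyle\int_{\mathbb S^2}\vartheta=0,\ \vartheta^*\in H^2\},$$ $$\|(\xi,\xi',\vartheta,\vartheta^*)\|_X^2=\|{*d}\xi\|_{H^1}^2+\|d^*\xi\|_{H^1}^2+\|{*d}\xi'\|_{L^2}^2+\|d^*\xi'\|_{L^2}^2+\|\vartheta\|_{H^2}^2+\|\vartheta^*\|_{H^1}^2,$$ where $\|\phi\|_{H^m}^2=\|\Phi_0\|_{L^2}^2+\sum_{k\ge1}(k(k+1))^m\|\Phi_k\|_{L^2}^2$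 if $\phi=\sum_k\Phi_k$ with spherical harmonics $\Phi_k$ of degree $k$. For $b\in\mathbb R^3$, let $\epsilon\in[0,1)$ be given by $|b|=16\pi\big[\frac1\epsilon+\frac1{2\epsilon^2}\log\frac{1-\epsilon}{1+\epsilon}+\frac{4\epsilon}{3(1-\epsilon^2)}\big]$ ($\epsilon=0$ if $b=0$), let $\theta$ be the angle to $b$ and $e_\theta$ the corresponding unit field, and set $$\mathbf V=-\frac{2\epsilon\sin\theta}{1-\epsilon\cos\theta}\,e_\theta,\qquad F=2\Big[\frac{1-\epsilon^2}{(1-\epsilon\cos\theta)^2}-1\Big]$$ (the Landau solution on the sphere; $\mathbf V=0$, $F=0$ if $b=0$). Let $L=L_0+K:\mathcal D\to X$ with $$L_0\begin{pmatrix}\xi\\ \xi'\\ \vartheta\\ \vartheta^*\end{pmatrix}=\begin{pmatrix}-\xi'\\-\xi'+\Delta\xi-\nabla(q-2\vartheta)\\-\vartheta^*-q\\ \vartheta^*+3q+\Delta\vartheta\end{pmatrix},\quad K\begin{pmatrix}\xi\\ \xi'\\ \vartheta\\ \vartheta^*\end{pmatrix}=\begin{pmatrix}0\\-\mathbf V\cdot\nabla\xi-\xi\cdot\nabla\mathbf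 V-F\xi'\\0\\-\mathbf V\cdot\nabla\vartheta-\xi\cdot\nabla F+2\xi\cdot\mathbf V+2\vartheta F-\vartheta^*F-qF\end{pmatrix},$$ where $q=-(\mathrm{div}\,\xi+\vartheta+\vartheta^*)$. Let $$\Gamma_+=\{\Re\lambda\ge\tfrac32,\ |\Im\lambda|=(\Re\lambda-\tfrac32)^{7/8}\},\qquad \Gamma_-=\{\Re\lambda\le-\tfrac12,\ |\Im\lambda|=(-\Re\lambda-\tfrac12)^{7/8}\},$$ oriented so that the region around the real half-line is on the left ($\Gamma_+$ downwards, $\Gamma_-$ upwards), and for $\Xi\in X$ define $$e^{Ls}P_\pm^*\Xi=\frac1{2\pi i}\int_{\Gamma_\pm}e^{\lambda s}(\lambda-L)^{-1}\Xi\,d\lambda\quad(\pm s<0),\qquad P_j^*\Xi=\frac1{2\pi i}\int_{|\lambda-j|=1/2}(\lambda-L)^{-1}\Xi\,d\lambda\quad(j=0,1),$$ and, for $s=0$, $e^{L\cdot 0}P_+^*\Xi=P^*_+\Xi=\lim_{s\to0^-}e^{Ls}P^*_+\Xi$ and $e^{L\cdot 0}P_-^*\Xi=P^*_-\Xi=\lim_{s\to0^+}e^{Ls}P^*_-\Xi$.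 **Proposition 4.2.** There are constants $\kappa>0$ and $C>0$ such that the following holds for every $b\in\mathbb R^3$ with $|b|<\kappa$. The contours $\Gamma_\pm$, $|\lambda|=\frac12$, $|\lambda-1|=\frac12$ lie in the resolvent set of $L$ on $X$. For every $\Xi\in X$ the integrals above converge absolutely in $X$ (those over the two circles also with a factor $e^{\lambda s}$, $s\in\mathbb R$), the two limits exist in $X$, and all the resulting vectors lie in $X$; for $\Xi\in\mathcal D$, $P_\pm^*\Xi$ is also the limit in $X$, as $r\to\infty$, of $\frac1{2\pi i}\int_{\Gamma_\pm\cap\{|\Im\lambda|\le r\}}(\lambda-L)^{-1}\Xi\,d\lambda$. Moreover, for all $\Xi\in X$, $$\|e^{Ls}P_+^*\Xi\|_X\le C\,e^{7s/4}\|\Xi\|_X\quad(s\le0),\qquad \|e^{Ls}P_-^*\Xi\|_X\le C\,e^{-3s/4}\|\Xi\|_X\quad(s\ge0),$$ and on $X$, for $\sigma,\sigma'\in\{+,-,0,1\}$, $$P_\sigma^*P_{\sigma'}^*=\delta(\sigma\sigma')P_\sigma^*,\qquad I=P_+^*+P_-^*+P_0^*+P_1^*,$$ where $\delta(\sigma\sigma')$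 is $1$ if $\sigma=\sigma'$ and $0$ otherwise. -/

import Mathlib

open MeasureTheory Filter Topology

open scoped ContDiff

noncomputable section

namespace LandauSphere

/-! ### The unit sphere, square integrable fields, weak tangential derivatives -/

/-- Three-dimensional Euclidean space. -/
abbrev E3 : Type := EuclideanSpace ℝ (Fin 3)

/-- The unit sphere of three-dimensional Euclidean space. -/
abbrev S2 : Type := Metric.sphere (0 : E3) 1

/-- The surface measure of the unit sphere (of total mass `4π`). -/
def area : Measure S2 := (volume : Measure E3).toSphere

/-- Complex square integrable functions on the sphere. -/
abbrev L2 : Type := Lp ℂ 2 area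

/-- Complex square integrable vector fields along the sphere, by their Cartesian components. -/
abbrev L2Vec : Type := Fin 3 → L2

/-- The quadruples `(ξ, ξ', ϑ, ϑ*)`, with square integrable entries. The spaces `X` and `D` below
are subspaces of this Banach space. -/
abbrev State : Type := L2Vec × L2Vec × L2 × L2

/-- The `i`-th Cartesian component of the tangential gradient of a smooth function, at a point `y`
of the unit sphere: the derivative in the direction of the tangential projection `e_i - y_i y` of
the `i`-th basis vector. It depends only on the values of the function on the sphere. -/
def tangDeriv {G : Type*} [NormedAddCommGroup G] [NormedSpace ℝ G]
    (i : Fin 3) (φ : E3 → G) (y : E3) : G :=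
  fderiv ℝ φ y (EuclideanSpace.single i (1 : ℝ) - y i • y)

/-- `g` is the `i`-th Cartesian component of the weak tangential gradient of `f`. On the sphere
`∫ (D_i f) φ = ∫ f (2 y_i φ - D_i φ)` for smooth `f` and `φ`, because the divergence of the
tangent field `e_i - y_i y` is `-2 y_i`. -/
def HasWeakDeriv (i : Fin 3) (f g : L2) : Prop :=
  ∀ φ : E3 → ℂ, ContDiff ℝ ∞ φ →
    ∫ y : S2, g y * φ y ∂area =
      ∫ y : S2, f y * (2 * ((y.1 i : ℝ) : ℂ) * φ y - tangDeriv i φ y) ∂area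

open Classical in
/-- The `i`-th Cartesian component of the weak tangential gradient (`0` if there is none). -/
def weakDeriv (i : Fin 3) (f : L2) : L2 :=
  if h : ∃ g, HasWeakDeriv i f g then h.choose else 0

/-- The Sobolev spaces `H^k` of complex functions on the sphere: `f` lies in `H^(k+1)` if its weak
tangential gradient has its three components in `H^k`. -/
def MemH : ℕ → L2 → Prop
  | 0, _ => True
  | k + 1, f => ∀ i : Fin 3, ∃ g : L2, MemH k g ∧ HasWeakDeriv i f g

open Classical in
/-- Multiplication of a square integrable function by a (bounded measurable) real function. -/
def mulBy (a : E3 → ℝ) (f : L2) : L2 :=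
  if h : MemLp (fun y : S2 => ((a y.1 : ℝ) : ℂ) * f y) 2 area then h.toLp _ else 0

/-- The coordinate functions. -/
def coord (i : Fin 3) (y : E3) : ℝ := y i

/-- `∇ f`. -/
def grad (f : L2) : L2Vec := fun i => weakDeriv i f

/-- The Laplace-Beltrami operator on functions. -/
def lapl (f : L2) : L2 := ∑ i, weakDeriv i (weakDeriv i f)

/-- `div ξ`, for a tangent field `ξ`. -/
def divg (ξ : L2Vec) : L2 := ∑ i, weakDeriv i (ξ i)

/-- `d* ξ = - div ξ`. -/
def dstar (ξ : L2Vec) : L2 := -divg ξ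

/-- The scalar `* d ξ` (the normal component of the curl), for a tangent field `ξ`. -/
def curl (ξ : L2Vec) : L2 :=
  ∑ i : Fin 3, mulBy (coord i) (weakDeriv (i + 1) (ξ (i + 2)) - weakDeriv (i + 2) (ξ (i + 1)))

/-- The field `y × η(y)`: for a tangent field, the rotation by a right angle. -/
def rot (η : L2Vec) : L2Vec := fun i =>
  mulBy (coord (i + 1)) (η (i + 2)) - mulBy (coord (i + 2)) (η (i + 1))

/-- The Laplacian `-(d d* + d* d)` on tangent fields. -/
def hodgeLapl (ξ : L2Vec) : L2Vec := grad (divg ξ) + rot (grad (curl ξ))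

/-- The projection of a field along the sphere to its tangential part. -/
def tangProj (η : L2Vec) : L2Vec := fun i =>
  η i - ∑ j, mulBy (coord i) (mulBy (coord j) (η j))

/-- The field `ξ` is tangent to the sphere. -/
def IsTangent (ξ : L2Vec) : Prop :=
  ∀ᵐ y : S2 ∂area, ∑ i, ((y.1 i : ℝ) : ℂ) * ξ i y = 0

/-! ### The spaces `X` and `D` -/

/-- `X`: `ξ ∈ H²` and `ξ' ∈ H¹` are tangent fields, `ϑ ∈ H²` has mean zero, `ϑ* ∈ H¹`. -/
def X : Set State :=
  {Ξ | IsTangent Ξ.1 ∧ (∀ i, MemH 2 (Ξ.1 i)) ∧ IsTangent Ξ.2.1 ∧ (∀ i, MemH 1 (Ξ.2.1 i)) ∧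
    MemH 2 Ξ.2.2.1 ∧ ∫ y, Ξ.2.2.1 y ∂area = 0 ∧ MemH 1 Ξ.2.2.2}

/-- `D`: `ξ ∈ H³` and `ξ' ∈ H²` are tangent fields, `ϑ ∈ H³` has mean zero, `ϑ* ∈ H²`. -/
def D : Set State :=
  {Ξ | IsTangent Ξ.1 ∧ (∀ i, MemH 3 (Ξ.1 i)) ∧ IsTangent Ξ.2.1 ∧ (∀ i, MemH 2 (Ξ.2.1 i)) ∧
    MemH 3 Ξ.2.2.1 ∧ ∫ y, Ξ.2.2.1 y ∂area = 0 ∧ MemH 2 Ξ.2.2.2}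

/-- `‖Φ₀‖²` in `L²`, where the constant `Φ₀` is the mean of `f`. -/
def meanSq (f : L2) : ℝ := ‖∫ y, f y ∂area‖ ^ 2 / (4 * Real.pi)

/-- The squared `H¹` norm: for `f = ∑ Φ_k` with spherical harmonics `Φ_k` of degree `k` it equals
`‖Φ₀‖² + ∑_{k ≥ 1} k (k + 1) ‖Φ_k‖²`. -/
def h1Sq (f : L2) : ℝ := meanSq f + ∑ i, ‖weakDeriv i f‖ ^ 2

/-- The squared `H²` norm: for `f = ∑ Φ_k` with spherical harmonics `Φ_k` of degree `k` it equals
`‖Φ₀‖² + ∑_{k ≥ 1} (k (k + 1))² ‖Φ_k‖²`. -/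
def h2Sq (f : L2) : ℝ := meanSq f + ‖lapl f‖ ^ 2

/-- The norm of `X`. -/
def xNorm (Ξ : State) : ℝ :=
  Real.sqrt (h1Sq (curl Ξ.1) + h1Sq (dstar Ξ.1) + ‖curl Ξ.2.1‖ ^ 2 + ‖dstar Ξ.2.1‖ ^ 2 +
    h2Sq Ξ.2.2.1 + h1Sq Ξ.2.2.2)

/-! ### The Landau solutions -/

/-- The relation `|b| = f(ε)` between the strength of the force and the parameter `ε`. The
conventions on division by `0` give `f(0) = 0`, which is also the limit of `f` at `0`. -/
def landauF (ε : ℝ) : ℝ :=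
  16 * Real.pi * (1 / ε + 1 / (2 * ε ^ 2) * Real.log ((1 - ε) / (1 + ε)) +
    4 * ε / (3 * (1 - ε ^ 2)))

/-- The parameter `ε ∈ [0, 1)` with `f(ε) = |b|`. -/
def landauEps (b : E3) : ℝ := Function.invFunOn landauF (Set.Ico 0 1) ‖b‖

/-- The unit vector in the direction of `b` (`0` for `b = 0`, where `ε = 0` as well). -/
def landauDir (b : E3) : E3 := ‖b‖⁻¹ • b

/-- `cos θ`, where `θ` is the angle between `y` and `b`. -/
def cosAngle (b y : E3) : ℝ := inner ℝ y (landauDir b)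

/-- The components of the tangent field `V^b = -2 ε sin θ / (1 - ε cos θ) e_θ`; here
`sin θ e_θ = cos θ y - b / |b|`. -/
def landauV (b : E3) (i : Fin 3) (y : E3) : ℝ :=
  -(2 * landauEps b / (1 - landauEps b * cosAngle b y)) *
    (cosAngle b y * y i - landauDir b i)

/-- `F^b = 2 ((1 - ε²) / (1 - ε cos θ)² - 1)`. -/
def landauR (b : E3) (y : E3) : ℝ :=
  2 * ((1 - landauEps b ^ 2) / (1 - landauEps b * cosAngle b y) ^ 2 - 1)

/-! ### The operators `L₀`, `K` and `L = L₀ + K` -/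

/-- `q`, from `div ξ + ϑ + ϑ* + q = 0`. -/
def pressure (Ξ : State) : L2 := -(divg Ξ.1 + Ξ.2.2.1 + Ξ.2.2.2)

/-- `L₀`, as a map on quadruples; its domain is `D`. -/
def opL0 (Ξ : State) : State :=
  (-Ξ.2.1,
   -Ξ.2.1 + hodgeLapl Ξ.1 - grad (pressure Ξ - (2 : ℂ) • Ξ.2.2.1),
   -Ξ.2.2.2 - pressure Ξ,
   Ξ.2.2.2 + (3 : ℂ) • pressure Ξ + lapl Ξ.2.2.1)

/-- The covariant derivative `V^b · ∇ ξ`. -/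
def covV (b : E3) (ξ : L2Vec) : L2Vec :=
  tangProj fun i => ∑ j, mulBy (landauV b j) (weakDeriv j (ξ i))

/-- The covariant derivative `ξ · ∇ V^b`. -/
def covXiV (b : E3) (ξ : L2Vec) : L2Vec :=
  tangProj fun i => ∑ j, mulBy (tangDeriv j (landauV b i)) (ξ j)

/-- `K`, as a map on quadruples. -/
def opK (b : E3) (Ξ : State) : State :=
  (0,
   -covV b Ξ.1 - covXiV b Ξ.1 - (fun i => mulBy (landauR b) (Ξ.2.1 i)),
   0,
   -(∑ j, mulBy (landauV b j) (weakDeriv j Ξ.2.2.1))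
     - (∑ j, mulBy (tangDeriv j (landauR b)) (Ξ.1 j))
     + (2 : ℂ) • (∑ j, mulBy (landauV b j) (Ξ.1 j))
     + (2 : ℂ) • mulBy (landauR b) Ξ.2.2.1
     - mulBy (landauR b) Ξ.2.2.2
     - mulBy (landauR b) (pressure Ξ))

/-- `L = L₀ + K`, as a map on quadruples; its domain is `D`. -/
def opL (b : E3) (Ξ : State) : State := opL0 Ξ + opK b Ξ

/-- `z` lies in the resolvent set of `L`: the map `z - L` from `D` to `X` is a bijection, and its
inverse is bounded for the norm of `X`. -/
def InResolventSet (b : E3) (z : ℂ) : Prop :=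
  Set.BijOn (fun Ξ => z • Ξ - opL b Ξ) D X ∧
    ∃ M : ℝ, ∀ Ξ ∈ D, xNorm Ξ ≤ M * xNorm (z • Ξ - opL b Ξ)

/-- The resolvent `(z - L)⁻¹`, from `X` to `D`. -/
def resolventL (b : E3) (z : ℂ) : State → State :=
  Function.invFunOn (fun Ξ => z • Ξ - opL b Ξ) D

/-! ### The contours, the semigroups and the projections -/

/-- The four parts of the spectrum: `+`, `-`, and the parts near `0` and near `1`. -/
inductive Part : Type
  | plus
  | minus
  | zero
  | one

/-- Parametrized contours. `Γ₊` is `{Re z ≥ 3/2, |Im z| = (Re z - 3/2)^(7/8)}` and `Γ₋` is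
`{Re z ≤ -1/2, |Im z| = (-Re z - 1/2)^(7/8)}`, both parametrized by `∓ Im z`, so that the region
inside the curve (the side which contains the real half-line) is on the left. The others are the
circles of radius `1/2` about `0` and `1`, counterclockwise. -/
def contour : Part → ℝ → ℂ
  | .plus, t => ((3 / 2 + |t| ^ (8 / 7 : ℝ) : ℝ) : ℂ) - (t : ℂ) * Complex.I
  | .minus, t => ((-1 / 2 - |t| ^ (8 / 7 : ℝ) : ℝ) : ℂ) + (t : ℂ) * Complex.I
  | .zero, t => circleMap 0 (1 / 2) t
  | .one, t => circleMap 1 (1 / 2) t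

/-- The parameter domains of the contours. -/
def contourDom : Part → Set ℝ
  | .plus => Set.univ
  | .minus => Set.univ
  | .zero => Set.Icc 0 (2 * Real.pi)
  | .one => Set.Icc 0 (2 * Real.pi)

/-- The integrand of `∫ e^{zs} (z - L)⁻¹ Ξ dz`, pulled back to the parameter of the contour. -/
def contourIntegrand (b : E3) (σ : Part) (s : ℝ) (Ξ : State) (t : ℝ) : State :=
  (Complex.exp (contour σ t * s) * deriv (contour σ) t) • resolventL b (contour σ t) Ξ

/-- `(2πi)⁻¹ ∫ e^{zs} (z - L)⁻¹ Ξ dz` over the piece of the contour with parameters in `I`. -/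
def cauchyIntegral (b : E3) (σ : Part) (I : Set ℝ) (s : ℝ) (Ξ : State) : State :=
  (2 * Real.pi * Complex.I : ℂ)⁻¹ • ∫ t in I, contourIntegrand b σ s Ξ t

/-- The projections `P*`. On the two circles this is the contour integral with `s = 0`. On `Γ₊`
and `Γ₋` the integral with `s = 0` does not converge absolutely, and `P*` is the limit of the
contour integrals as `s → 0` through negative, respectively positive, values. -/
def specProj (b : E3) : Part → State → State
  | .plus, Ξ => limUnder (𝓝[<] (0 : ℝ)) fun s => cauchyIntegral b .plus (contourDom .plus) s Ξ
  | .minus, Ξ => limUnder (𝓝[>] (0 : ℝ)) fun s => cauchyIntegral b .minus (contourDom .minus) s Ξ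
  | .zero, Ξ => cauchyIntegral b .zero (contourDom .zero) 0 Ξ
  | .one, Ξ => cauchyIntegral b .one (contourDom .one) 0 Ξ

/-- The semigroups `e^{Ls} P*`, for `s ≤ 0` on the part `+` and for `s ≥ 0` on the part `-`. -/
def expProj (b : E3) (σ : Part) (s : ℝ) (Ξ : State) : State :=
  if s = 0 then specProj b σ Ξ else cauchyIntegral b σ (contourDom σ) s Ξ

/-- The contour integral of `e^{zs} (z - L)⁻¹ Ξ` converges absolutely in `X`. -/
def ConvergesInX (b : E3) (σ : Part) (s : ℝ) (Ξ : State) : Prop :=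
  (∀ t ∈ contourDom σ, contourIntegrand b σ s Ξ t ∈ X) ∧
    IntegrableOn (contourIntegrand b σ s Ξ) (contourDom σ) ∧
    IntegrableOn (fun t => xNorm (contourIntegrand b σ s Ξ t)) (contourDom σ)

end LandauSphere

end

/-! ### Harmonic analysis on the sphere: rotations, polynomials, spherical harmonics, Sobolev
spaces. -/

noncomputable section
namespace LandauSphere

/-! ### Rotation invariance of the surface measure -/

/-! The angular variables decouple. A tangent field is determined by its curl and its divergence
(`eq_field`), so a state is described by the six scalars (curl ξ, div ξ, curl ξ', div ξ', ϑ, ϑ*), on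
which L₀ acts as a 6 × 6 matrix in each degree k of spherical harmonics (`opL0_eq`, `proj_l0Comp`).
With weights that turn the norm of X into an ℓ² norm, this matrix is conjugate, by matrices that are
bounded together with their inverses uniformly in k (`sMat`, `siMat`), to a triangular one, with
eigenvalues k, -k-1, k+1, k-1, -k, -k-2 and two off-diagonal entries of size k (`nMat`). So the
eigenvalues are integers, but L₀ is not uniformly diagonalizable: a function g of L₀ is bounded if
both g(n) and n (g(n+2) - g(n)) are (`Adm`). For the resolvent this gives the size |z| / dist(z,
ℤ)². At the point of the contour with imaginary part of size t, z has size t^(8/7) and its distance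
to ℤ is of order t, so the resolvent decays like t^(-6/7) (`adm_res0`). This is where the exponent
7/8 of the contours enters.

K costs one derivative of ξ and ϑ, but its output only enters the components ξ' and ϑ*, where X asks
for one derivative less. Hence K is bounded on X with norm O(|b|) (`xNorm_opK_le`), and for small b
the resolvent R of L is obtained by inverting 1 - R₀K. The difference R - R₀ = R₀KR is O(|b|
t^(-12/7)); multiplied by the speed t^(1/7) of the contour it is integrable without any help from
the exponential. Therefore e^{Ls}P₊ is an explicit function of L₀ plus an absolutely convergent
correction of size O(|b|), down to s = 0 (`semi`, `Spec.semi_eq`). On D, the resolvent R₀(1/2)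
supplies the decay that makes the improper integrals converge (`Spec.tendsto_improper`).

No Cauchy theorem for operator-valued functions is used. The resolvent identity and Fubini's theorem
reduce products of contour integrals to scalar Cauchy integrals (`Path.Sep.int_mul_int`), which are
evaluated with explicit logarithms (`trunc_outside`, `trunc_inside`, `crv_integral`). Independence
of the contour follows from algebra: for nested contours P_a P_b = P_b P_a = P_b, so P_a - P_b is an
idempotent, and an idempotent of norm less than one vanishes (`eq_of_nested`). Shifting Γ₊ to the
right, up to real part 7/4, then improves the rate e^{3s/2} to e^{7s/4}
(`Spec.idempotent_and_bound`). Likewise 1 - (P₊ + P₋ + P₀ + P₁) is an idempotent; it is zero for L₀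
and small for L, hence zero (`Spec.sum_eq_one`).

The reflection z ↦ 1 - z exchanges Γ₊ with Γ₋ and the integers n ≥ 2 with n ≤ -1. So the minus part
is the plus part of 1 - L, and the extra factor e^s turns e^{-7s/4} into e^{-3s/4}. -/

instance : IsFiniteMeasure area := by unfold area; infer_instance

/-- The vector field of the rotations about the `a`-th axis. -/
def rotVec (a : Fin 3) (y : E3) : E3 :=
  y (a + 1) • EuclideanSpace.single (a + 2) (1 : ℝ) - y (a + 2) • EuclideanSpace.single (a + 1) (1 : ℝ)

/-- The projection to the plane orthogonal to the `a`-th axis. -/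
def planeVec (a : Fin 3) (y : E3) : E3 :=
  y (a + 1) • EuclideanSpace.single (a + 1) (1 : ℝ) + y (a + 2) • EuclideanSpace.single (a + 2) (1 : ℝ)

/-- The rotation by the angle `θ` about the `a`-th axis. -/
def rotIso (a : Fin 3) (θ : ℝ) : E3 ≃ₗᵢ[ℝ] E3 :=
  LinearIsometry.toLinearIsometryEquiv
    { toFun := fun y => y + (Real.sin θ • rotVec a y + (Real.cos θ - 1) • planeVec a y)
      map_add' := by
        intro x y; ext j; simp [rotVec, planeVec]; split_ifs <;> ring
      map_smul' := by
        intro c y; ext j; simp [rotVec, planeVec]; split_ifs <;> ring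
      norm_map' := by
        intro y
        rw [← sq_eq_sq₀ (norm_nonneg _) (norm_nonneg _), EuclideanSpace.real_norm_sq_eq,
          EuclideanSpace.real_norm_sq_eq]
        have h := Real.sin_sq_add_cos_sq θ
        fin_cases a <;> simp [rotVec, planeVec, Fin.sum_univ_three]
        · linear_combination (y 1 ^ 2 + y 2 ^ 2) * h
        · linear_combination (y 0 ^ 2 + y 2 ^ 2) * h
        · linear_combination (y 0 ^ 2 + y 1 ^ 2) * h }
    rfl

lemma rotIso_apply (a : Fin 3) (θ : ℝ) (y : E3) :
    rotIso a θ y = y + (Real.sin θ • rotVec a y + (Real.cos θ - 1) • planeVec a y) := rfl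

/-- The action of a linear isometry on the sphere. -/
def sphereHomeo (g : E3 ≃ₗᵢ[ℝ] E3) : S2 ≃ₜ S2 :=
  g.toHomeomorph.subtype (p := fun y => y ∈ Metric.sphere (0 : E3) 1)
    (q := fun y => y ∈ Metric.sphere (0 : E3) 1) (by intro x; simp)

lemma sphereHomeo_coe (g : E3 ≃ₗᵢ[ℝ] E3) (y : S2) : (sphereHomeo g y : E3) = g y := rfl

-- `toSphere` measures a set by the volume of the cone over it; a linear isometry commutes with
-- forming cones and preserves the volume.
open scoped Pointwise in
lemma measurePreserving_sphereHomeo (g : E3 ≃ₗᵢ[ℝ] E3) :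
    MeasurePreserving (sphereHomeo g) area area := by
  refine ⟨(sphereHomeo g).continuous.measurable, ?_⟩
  ext s hs
  rw [Measure.map_apply (sphereHomeo g).continuous.measurable hs]
  unfold area
  rw [Measure.toSphere_apply' _ hs,
    Measure.toSphere_apply' _ ((sphereHomeo g).continuous.measurable hs)]
  congr 1
  have : Set.Ioo (0 : ℝ) 1 • ((↑) '' (sphereHomeo g ⁻¹' s) : Set E3)
      = g ⁻¹' (Set.Ioo (0 : ℝ) 1 • ((↑) '' s : Set E3)) := by
    ext x
    simp only [Set.mem_smul, Set.mem_image, Set.mem_preimage]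
    constructor
    · rintro ⟨r, hr, _, ⟨y, hy, rfl⟩, rfl⟩
      exact ⟨r, hr, _, ⟨_, hy, rfl⟩, by simp [sphereHomeo_coe]⟩
    · rintro ⟨r, hr, _, ⟨y, hy, rfl⟩, h⟩
      refine ⟨r, hr, _, ⟨(sphereHomeo g).symm y, by simpa using hy, rfl⟩, ?_⟩
      apply g.injective
      rw [← h, map_smul, ← sphereHomeo_coe]; simp
  rw [this]
  exact g.measurePreserving.measure_preimage_emb g.toHomeomorph.measurableEmbedding _

/-- The derivative of a function in the direction of the rotations about the `a`-th axis. -/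
def rotDeriv (a : Fin 3) (φ : E3 → ℂ) (y : E3) : ℂ := fderiv ℝ φ y (rotVec a y)

lemma contDiff_rotVec (a : Fin 3) : ContDiff ℝ ∞ (rotVec a) := by
  unfold rotVec; fun_prop

lemma contDiff_planeVec (a : Fin 3) : ContDiff ℝ ∞ (planeVec a) := by
  unfold planeVec; fun_prop

lemma contDiff_rotDeriv (a : Fin 3) {φ : E3 → ℂ} (h : ContDiff ℝ ∞ φ) :
    ContDiff ℝ ∞ (rotDeriv a φ) :=
  (h.fderiv_right (m := ∞) (by simp)).clm_apply (contDiff_rotVec a)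

lemma contDiff_tangDeriv {G : Type*} [NormedAddCommGroup G] [NormedSpace ℝ G]
    (i : Fin 3) {φ : E3 → G} (h : ContDiff ℝ ∞ φ) :
    ContDiff ℝ ∞ (tangDeriv i φ) := by
  unfold tangDeriv
  exact (h.fderiv_right (m := ∞) (by simp)).clm_apply (by fun_prop)

lemma integrable_sphere {φ : E3 → ℂ} (h : Continuous φ) : Integrable (fun y : S2 => φ y) area :=
  (h.comp continuous_subtype_val).integrable_of_hasCompactSupport
    (HasCompactSupport.of_compactSpace _)

/-- The integral of φ composed with the rotation by the angle θ does not depend on θ;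
differentiation under the integral sign at θ = 0 gives the claim. The integrations by parts on the
sphere go back to this. -/
lemma integral_rotDeriv (a : Fin 3) {φ : E3 → ℂ} (h : ContDiff ℝ ∞ φ) :
    ∫ y : S2, rotDeriv a φ y ∂area = 0 := by
  set F' : ℝ → S2 → ℂ := fun θ y =>
    fderiv ℝ φ (rotIso a θ y) (Real.cos θ • rotVec a y - Real.sin θ • planeVec a y) with hF'
  have hcont : Continuous (fun p : ℝ × S2 => F' p.1 p.2) := by
    have h1 : Continuous (fderiv ℝ φ) := h.continuous_fderiv (by simp)
    have h2 := (contDiff_rotVec a).continuous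
    have h3 := (contDiff_planeVec a).continuous
    simp only [hF', rotIso_apply]
    fun_prop
  obtain ⟨C, hC⟩ := ((isCompact_Icc (a := (-1 : ℝ)) (b := 1)).prod
    (isCompact_univ (X := S2))).exists_bound_of_continuousOn hcont.continuousOn
  have hder := hasDerivAt_integral_of_dominated_loc_of_deriv_le (μ := area)
    (F := fun θ (y : S2) => φ (rotIso a θ y)) (F' := F') (x₀ := (0 : ℝ))
    (s := Set.Ioo (-1) 1) (bound := fun _ => C) (Ioo_mem_nhds (by norm_num) (by norm_num))
    (Filter.Eventually.of_forall fun θ =>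
      (integrable_sphere (h.continuous.comp (rotIso a θ).continuous)).aestronglyMeasurable)
    (integrable_sphere (h.continuous.comp (rotIso a 0).continuous))
    ((hcont.comp (by fun_prop : Continuous fun y : S2 => ((0 : ℝ), y))).aestronglyMeasurable)
    (Filter.Eventually.of_forall fun y θ hθ =>
      hC (θ, y) ⟨Set.Ioo_subset_Icc_self hθ, Set.mem_univ _⟩)
    (integrable_const _)
    (Filter.Eventually.of_forall fun y θ _ => by
      have h1 : HasDerivAt (fun θ => rotIso a θ (y : E3))
          (Real.cos θ • rotVec a y - Real.sin θ • planeVec a y) θ := by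
        simp only [rotIso_apply]
        have := (((Real.hasDerivAt_sin θ).smul_const (rotVec a (y : E3))).add
          (((Real.hasDerivAt_cos θ).sub_const 1).smul_const (planeVec a (y : E3)))).const_add (y : E3)
        exact this.congr_deriv (by rw [neg_smul, sub_eq_add_neg])
      exact ((h.differentiable (by simp)).differentiableAt.hasFDerivAt).comp_hasDerivAt θ h1)
  have hconst : (fun θ => ∫ y : S2, φ (rotIso a θ y) ∂area) = fun _ => ∫ y : S2, φ y ∂area := by
    funext θ
    exact (measurePreserving_sphereHomeo (rotIso a θ)).integral_comp
      (sphereHomeo _).measurableEmbedding (fun y : S2 => φ y)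
  have h0 := hder.2
  rw [hconst] at h0
  have := h0.unique (hasDerivAt_const _ _)
  simpa only [hF', rotIso_apply, rotDeriv, Real.sin_zero, Real.cos_zero, zero_smul, sub_self, add_zero,
    one_smul, sub_zero] using this

lemma rotDeriv_mul (a : Fin 3) {φ ψ : E3 → ℂ} (h : ContDiff ℝ ∞ φ) (h' : ContDiff ℝ ∞ ψ) (y : E3) :
    rotDeriv a (fun y => φ y * ψ y) y = φ y * rotDeriv a ψ y + rotDeriv a φ y * ψ y := by
  unfold rotDeriv
  rw [fderiv_fun_mul (h.differentiable (by simp)).differentiableAt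
    (h'.differentiable (by simp)).differentiableAt]
  simp [mul_comm]

lemma tangDeriv_mul (i : Fin 3) {φ ψ : E3 → ℂ} (h : ContDiff ℝ ∞ φ) (h' : ContDiff ℝ ∞ ψ) (y : E3) :
    tangDeriv i (fun y => φ y * ψ y) y = φ y * tangDeriv i ψ y + tangDeriv i φ y * ψ y := by
  unfold tangDeriv
  rw [fderiv_fun_mul (h.differentiable (by simp)).differentiableAt
    (h'.differentiable (by simp)).differentiableAt]
  simp [mul_comm]

lemma sphere_sq (y : S2) : y.1 0 ^ 2 + y.1 1 ^ 2 + y.1 2 ^ 2 = 1 := by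
  have h : ‖y.1‖ = 1 := by simp
  have := EuclideanSpace.real_norm_sq_eq y.1
  rw [h, Fin.sum_univ_three] at this
  linarith

/-- On the sphere e_i - y_i y = -y × (y × e_i), which expresses the tangential gradient by the
rotation fields. These have no divergence and preserve the degree of polynomials, so they replace
the gradient wherever spectral information is needed. -/
lemma tangDeriv_eq_rotDeriv (i : Fin 3) (φ : E3 → ℂ) (y : S2) :
    tangDeriv i φ y =
      ((y.1 (i + 2) : ℝ) : ℂ) * rotDeriv (i + 1) φ y - ((y.1 (i + 1) : ℝ) : ℂ) * rotDeriv (i + 2) φ y := by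
  have key : EuclideanSpace.single i (1 : ℝ) - y.1 i • y.1
      = y.1 (i + 2) • rotVec (i + 1) y.1 - y.1 (i + 1) • rotVec (i + 2) y.1 := by
    have h := sphere_sq y
    ext j
    fin_cases i <;> fin_cases j <;> simp [rotVec] <;> first | ring1 | linear_combination (-1 : ℝ) * h
  unfold tangDeriv rotDeriv
  rw [key, map_sub, map_smul, map_smul]
  simp

lemma rotDeriv_eq_tangDeriv (a : Fin 3) (φ : E3 → ℂ) (y : S2) :
    rotDeriv a φ y =
      ((y.1 (a + 1) : ℝ) : ℂ) * tangDeriv (a + 2) φ y - ((y.1 (a + 2) : ℝ) : ℂ) * tangDeriv (a + 1) φ y := by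
  have key : rotVec a y.1
      = y.1 (a + 1) • (EuclideanSpace.single (a + 2) (1 : ℝ) - y.1 (a + 2) • y.1)
        - y.1 (a + 2) • (EuclideanSpace.single (a + 1) (1 : ℝ) - y.1 (a + 1) • y.1) := by
    unfold rotVec
    module
  unfold tangDeriv rotDeriv
  rw [key, map_sub, map_smul, map_smul]
  simp

/-! ### `L²` as a module over the continuous functions -/

/-- Continuous complex functions on the sphere. -/
abbrev CS : Type := C(S2, ℂ)

/-- A continuous function as an element of `L²`. -/
def toL2 : CS →L[ℂ] L2 := ContinuousMap.toLp 2 area ℂ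

lemma toL2_coe (a : CS) : toL2 a =ᵐ[area] a := ContinuousMap.coeFn_toLp _ _

lemma memLp_mul (a : CS) (f : L2) : MemLp (fun y => a y * f y) 2 area := by
  refine (Lp.memLp f).of_le_mul (c := ‖a‖)
    (a.continuous.aestronglyMeasurable.mul (Lp.aestronglyMeasurable f)) ?_
  refine Filter.Eventually.of_forall fun y => ?_
  rw [norm_mul]
  gcongr
  exact a.norm_coe_le_norm y

/-- Multiplication by a continuous function. -/
def mulC (a : CS) (f : L2) : L2 := (memLp_mul a f).toLp _

lemma mulC_coe (a : CS) (f : L2) : mulC a f =ᵐ[area] fun y => a y * f y := MemLp.coeFn_toLp _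

/-- With this module structure, identities with variable coefficients are accessible to `module` and
`linear_combination`. -/
instance : Module CS L2 where
  smul a f := mulC a f
  one_smul f := by
    refine Lp.ext ?_
    filter_upwards [mulC_coe 1 f] with y h
    exact h.trans (by simp)
  mul_smul a b f := by
    refine Lp.ext ?_
    filter_upwards [mulC_coe (a * b) f, mulC_coe a (mulC b f), mulC_coe b f] with y h h1 h2
    refine h.trans (Eq.trans ?_ h1.symm)
    rw [h2]; simp [mul_assoc]
  smul_zero a := by
    refine Lp.ext ?_
    filter_upwards [mulC_coe a 0, Lp.coeFn_zero ℂ 2 area] with y h h1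
    refine h.trans ?_
    rw [h1]; simp
  smul_add a f g := by
    refine Lp.ext ?_
    filter_upwards [mulC_coe a (f + g), mulC_coe a f, mulC_coe a g, Lp.coeFn_add f g,
      Lp.coeFn_add (mulC a f) (mulC a g)] with y h h1 h2 h3 h4
    refine h.trans (Eq.trans ?_ h4.symm)
    rw [h3]; simp only [Pi.add_apply]; rw [h1, h2, mul_add]
  add_smul a b f := by
    refine Lp.ext ?_
    filter_upwards [mulC_coe (a + b) f, mulC_coe a f, mulC_coe b f,
      Lp.coeFn_add (mulC a f) (mulC b f)] with y h h1 h2 h4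
    refine h.trans (Eq.trans ?_ h4.symm)
    simp only [Pi.add_apply]; rw [h1, h2]; simp [add_mul]
  zero_smul f := by
    refine Lp.ext ?_
    filter_upwards [mulC_coe 0 f, Lp.coeFn_zero ℂ 2 area] with y h h1
    refine h.trans ?_
    rw [h1]; simp

lemma smulC_coe (a : CS) (f : L2) : (a • f : L2) =ᵐ[area] fun y => a y * f y := mulC_coe a f

instance : IsScalarTower ℂ CS L2 where
  smul_assoc c a f := by
    refine Lp.ext ?_
    filter_upwards [smulC_coe (c • a) f, smulC_coe a f, Lp.coeFn_smul c (a • f)] with y h h1 h2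
    rw [h, h2]; simp [h1, mul_assoc]

instance : SMulCommClass ℂ CS L2 where
  smul_comm c a f := by
    refine Lp.ext ?_
    filter_upwards [smulC_coe a (c • f), smulC_coe a f, Lp.coeFn_smul c (a • f),
      Lp.coeFn_smul c f] with y h h1 h2 h3
    rw [h, h2, h3]; simp [h1, mul_left_comm]

instance : SMulCommClass CS ℂ L2 := SMulCommClass.symm _ _ _

lemma norm_smulC_le (a : CS) (f : L2) : ‖a • f‖ ≤ ‖a‖ * ‖f‖ := by
  refine Lp.norm_le_mul_norm_of_ae_le_mul ?_
  filter_upwards [smulC_coe a f] with y h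
  rw [h, norm_mul]
  gcongr
  exact a.norm_coe_le_norm y

/-- Multiplication by a continuous function, as an operator. -/
def mulL (a : CS) : L2 →L[ℂ] L2 :=
  LinearMap.mkContinuous
    { toFun := fun f => a • f
      map_add' := smul_add a
      map_smul' := fun c f => smul_comm a c f } ‖a‖ (norm_smulC_le a)

@[simp] lemma mulL_apply (a : CS) (f : L2) : mulL a f = a • f := rfl

/-- The bilinear pairing `∫ f a`. -/
def pair (a : CS) : L2 →L[ℂ] ℂ := innerSL ℂ (toL2 (star a))

lemma pair_eq_integral (a : CS) (f : L2) : pair a f = ∫ y, f y * a y ∂area := by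
  simp only [pair, innerSL_apply_apply]
  rw [L2.inner_def]
  refine integral_congr_ae ?_
  filter_upwards [toL2_coe (star a)] with y h
  simp [h]

lemma inner_toL2 (a : CS) (f : L2) : inner ℂ (toL2 a) f = pair (star a) f := by
  simp [pair]

lemma pair_smul (a b : CS) (f : L2) : pair a (b • f) = pair (a * b) f := by
  rw [pair_eq_integral, pair_eq_integral]
  refine integral_congr_ae ?_
  filter_upwards [smulC_coe b f] with y h
  rw [h]; simp; ring

lemma pair_add (a b : CS) (f : L2) : pair (a + b) f = pair a f + pair b f := by
  simp [pair]

lemma pair_neg (a : CS) (f : L2) : pair (-a) f = -pair a f := by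
  simp [pair]

lemma pair_sub (a b : CS) (f : L2) : pair (a - b) f = pair a f - pair b f := by
  simp [pair]

lemma pair_toL2 (a b : CS) : pair a (toL2 b) = ∫ y, b y * a y ∂area := by
  rw [pair_eq_integral]
  refine integral_congr_ae ?_
  filter_upwards [toL2_coe b] with y h
  rw [h]

/-- The restriction of a continuous function to the sphere. -/
def res (φ : E3 → ℂ) (h : Continuous φ) : CS := ⟨fun y => φ y, h.comp continuous_subtype_val⟩

@[simp] lemma res_apply (φ : E3 → ℂ) (h : Continuous φ) (y : S2) : res φ h y = φ y := rfl

/-- The coordinate functions on the sphere. -/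
def Y (i : Fin 3) : CS := ⟨fun y => ((y.1 i : ℝ) : ℂ), by fun_prop⟩

@[simp] lemma Y_apply (i : Fin 3) (y : S2) : Y i y = ((y.1 i : ℝ) : ℂ) := rfl

lemma Y_sq : Y 0 ^ 2 + Y 1 ^ 2 + Y 2 ^ 2 = 1 := by
  ext y
  have := congrArg (fun x : ℝ => (x : ℂ)) (sphere_sq y)
  push_cast at this
  simpa using this

lemma star_Y (i : Fin 3) : star (Y i) = Y i := by ext y; simp

end LandauSphere
end

noncomputable section
namespace LandauSphere

/-! ### Polynomials on the sphere -/

/-- Polynomials in the three Cartesian coordinates. -/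
abbrev Pol : Type := MvPolynomial (Fin 3) ℂ

open MvPolynomial hiding X

/-- Restriction of a polynomial to the sphere. -/
def iota : Pol →ₐ[ℂ] CS := aeval Y

/-- A polynomial as a function on the Euclidean space. -/
def pev (p : Pol) (y : E3) : ℂ := eval (fun i => ((y i : ℝ) : ℂ)) p

lemma iota_apply (p : Pol) (y : S2) : iota p y = pev p y := by
  unfold iota pev
  induction p using MvPolynomial.induction_on with
  | C a => simp [Algebra.algebraMap_eq_smul_one, ← algebraMap_eq]
  | add p q hp hq => simp [hp, hq]
  | mul_X p i hp => simp [hp]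

lemma contDiff_pev (p : Pol) : ContDiff ℝ ∞ (pev p) := by
  unfold pev
  induction p using MvPolynomial.induction_on with
  | C a => simpa using contDiff_const
  | add p q hp hq => simpa using hp.add hq
  | mul_X p i hp =>
    simp only [map_mul, eval_X]
    refine hp.mul ?_
    exact Complex.ofRealCLM.contDiff.comp (by fun_prop : ContDiff ℝ ∞ fun y : E3 => y i)

lemma fderiv_pev (p : Pol) (y v : E3) :
    fderiv ℝ (pev p) y v = ∑ i, ((v i : ℝ) : ℂ) * pev (pderiv i p) y := by
  induction p using MvPolynomial.induction_on with
  | C a =>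
    have : pev (C a) = fun _ => a := by funext y; simp [pev]
    simp [this, pev]
  | add p q hp hq =>
    have : pev (p + q) = fun y => pev p y + pev q y := by funext y; simp [pev]
    rw [this, fderiv_fun_add ((contDiff_pev p).differentiable (by simp)).differentiableAt
      ((contDiff_pev q).differentiable (by simp)).differentiableAt]
    simp only [add_apply, hp, hq, ← Finset.sum_add_distrib]
    exact Finset.sum_congr rfl fun i _ => by simp [pev]; ring
  | mul_X p i hp =>
    have : pev (p * MvPolynomial.X i) = fun y => pev p y * ((y i : ℝ) : ℂ) := by funext y; simp [pev]
    have hd : HasFDerivAt (fun y : E3 => ((y i : ℝ) : ℂ))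
        (Complex.ofRealCLM.comp (EuclideanSpace.proj i : E3 →L[ℝ] ℝ)) y :=
      (Complex.ofRealCLM.comp (EuclideanSpace.proj i : E3 →L[ℝ] ℝ)).hasFDerivAt
    rw [this, fderiv_fun_mul ((contDiff_pev p).differentiable (by simp)).differentiableAt
      hd.differentiableAt, hd.fderiv]
    simp only [add_apply, smul_apply, hp]
    have : ∀ j, ((v j : ℝ) : ℂ) * pev (pderiv j (p * MvPolynomial.X i)) y
        = (if j = i then pev p y * ((v j : ℝ) : ℂ) else 0)
          + ((y i : ℝ) : ℂ) * (((v j : ℝ) : ℂ) * pev (pderiv j p) y) := by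
      intro j
      by_cases h : j = i
      · subst h; simp [pev]; ring
      · simp [pev, h, pderiv_X_of_ne (Ne.symm h)]; ring
    simp only [this, Finset.sum_add_distrib, ← Finset.mul_sum]
    simp

/-- The derivation of the rotations about the `a`-th axis. -/
def Jp (a : Fin 3) : Derivation ℂ Pol Pol :=
  (MvPolynomial.X (a + 1) : Pol) • pderiv (a + 2) - (MvPolynomial.X (a + 2) : Pol) • pderiv (a + 1)

lemma Jp_apply (a : Fin 3) (p : Pol) :
    Jp a p = MvPolynomial.X (a + 1) * pderiv (a + 2) p - MvPolynomial.X (a + 2) * pderiv (a + 1) p := by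
  simp [Jp]

lemma rotDeriv_pev (a : Fin 3) (p : Pol) : rotDeriv a (pev p) = pev (Jp a p) := by
  funext y
  unfold rotDeriv
  rw [fderiv_pev, Jp_apply, Fin.sum_univ_three]
  fin_cases a <;> simp [rotVec, pev] <;> ring

lemma Jp_comm (a : Fin 3) (p : Pol) :
    Jp a (Jp (a + 1) p) - Jp (a + 1) (Jp a p) = -Jp (a + 2) p := by
  have : ⁅Jp a, Jp (a + 1)⁆ = -Jp (a + 2) := by
    refine derivation_ext fun i => ?_
    rw [Derivation.commutator_apply]
    fin_cases a <;> fin_cases i <;> simp [Jp_apply, pderiv_X]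
  rw [← Derivation.commutator_apply, this]
  simp

/-- Complex conjugation of the coefficients. -/
def cbar : Pol →+* Pol := map (starRingEnd ℂ)

lemma iota_cbar (p : Pol) : iota (cbar p) = star (iota p) := by
  unfold iota cbar
  induction p using MvPolynomial.induction_on with
  | C a => rw [map_C, aeval_C, aeval_C]; ext y; simp
  | add p q hp hq => simp [hp, hq]
  | mul_X p i hp => simp [hp, star_Y]

lemma Jp_cbar (a : Fin 3) (p : Pol) : Jp a (cbar p) = cbar (Jp a p) := by
  simp [Jp_apply, cbar, pderiv_map]

lemma res_pev (p : Pol) : res (pev p) (contDiff_pev p).continuous = iota p := by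
  ext y; simp [iota_apply]

/-- A polynomial as an element of `L²`. -/
def iotaL : Pol →ₗ[ℂ] L2 := toL2.toLinearMap ∘ₗ iota.toLinearMap

lemma iotaL_apply (p : Pol) : iotaL p = toL2 (iota p) := rfl

/-- By Stone–Weierstrass: the polynomials form an algebra that is closed under conjugation, and the
coordinates separate points. Continuous functions are dense in L². -/
lemma denseRange_iotaL : DenseRange iotaL := by
  let A : StarSubalgebra ℂ CS :=
    { iota.range with
      star_mem' := by
        rintro _ ⟨p, rfl⟩
        exact ⟨cbar p, iota_cbar p⟩ }
  have hA : A.topologicalClosure = ⊤ := by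
    apply ContinuousMap.starSubalgebra_topologicalClosure_eq_top_of_separatesPoints
    intro x y hxy
    have : ∃ i, x.1 i ≠ y.1 i := by
      by_contra! h
      exact hxy (Subtype.ext (by ext i; exact h i))
    obtain ⟨i, hi⟩ := this
    refine ⟨Y i, ⟨Y i, ⟨MvPolynomial.X i, by simp [iota]⟩, rfl⟩, ?_⟩
    simpa using hi
  have h1 : DenseRange iota := by
    intro f
    have : f ∈ A.topologicalClosure := by rw [hA]; trivial
    exact this
  exact (ContinuousMap.toLp_denseRange ℂ area ℂ (by norm_num)).comp h1
    (ContinuousMap.toLp (E := ℂ) 2 area ℂ).continuous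

lemma ext_iotaL {f g : L2} (h : ∀ p, inner ℂ (iotaL p) f = inner ℂ (iotaL p) g) : f = g := by
  refine ext_inner_left ℂ fun v => ?_
  refine denseRange_iotaL.induction_on v ?_ h
  exact isClosed_eq (by fun_prop) (by fun_prop)

lemma ext_pair {f g : L2} (h : ∀ p, pair (iota p) f = pair (iota p) g) : f = g := by
  refine ext_iotaL fun p => ?_
  rw [iotaL_apply, inner_toL2, inner_toL2, ← iota_cbar, h]

/-! ### Weak derivatives along the rotations -/

/-- `g` is the weak derivative of `f` along the rotations about the `a`-th axis. -/
def HasJ (a : Fin 3) (f g : L2) : Prop :=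
  ∀ φ : E3 → ℂ, ∀ h : ContDiff ℝ ∞ φ,
    pair (res φ h.continuous) g = -pair (res (rotDeriv a φ) (contDiff_rotDeriv a h).continuous) f

lemma HasJ.add {a : Fin 3} {f g f' g' : L2} (h : HasJ a f g) (h' : HasJ a f' g') :
    HasJ a (f + f') (g + g') := by
  intro φ hφ; simp only [map_add, h φ hφ, h' φ hφ]; ring

lemma HasJ.smul {a : Fin 3} {f g : L2} (c : ℂ) (h : HasJ a f g) : HasJ a (c • f) (c • g) := by
  intro φ hφ; simp only [map_smul, h φ hφ, smul_neg]

lemma hasJ_iotaL (a : Fin 3) (p : Pol) : HasJ a (iotaL p) (iotaL (Jp a p)) := by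
  intro φ hφ
  rw [iotaL_apply, iotaL_apply, pair_toL2, pair_toL2, eq_neg_iff_add_eq_zero, ← integral_add,
    ← integral_rotDeriv a (hφ.mul (contDiff_pev p))]
  · refine integral_congr_ae (Filter.Eventually.of_forall fun y => ?_)
    simp only
    rw [rotDeriv_mul a hφ (contDiff_pev p), rotDeriv_pev]
    simp [iota_apply]; ring
  · simp only [iota_apply, res_apply]
    exact integrable_sphere ((contDiff_pev _).continuous.mul hφ.continuous)
  · simp only [iota_apply, res_apply]
    exact integrable_sphere ((contDiff_pev _).continuous.mul (contDiff_rotDeriv a hφ).continuous)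

lemma HasJ.pair_iota {a : Fin 3} {f g : L2} (h : HasJ a f g) (p : Pol) :
    pair (iota p) g = -pair (iota (Jp a p)) f := by
  rw [← res_pev p, h _ (contDiff_pev p), ← res_pev (Jp a p)]
  have : ∀ h h', res (rotDeriv a (pev p)) h = res (pev (Jp a p)) h' := by rw [rotDeriv_pev]; simp
  rw [this]

lemma HasJ.inner_iotaL {a : Fin 3} {f g : L2} (h : HasJ a f g) (p : Pol) :
    inner ℂ (iotaL p) g = -inner ℂ (iotaL (Jp a p)) f := by
  rw [iotaL_apply, iotaL_apply, inner_toL2, inner_toL2, ← iota_cbar, ← iota_cbar, h.pair_iota,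
    Jp_cbar]

lemma HasJ.unique {a : Fin 3} {f g g' : L2} (h : HasJ a f g) (h' : HasJ a f g') : g = g' :=
  ext_iotaL fun p => by rw [h.inner_iotaL, h'.inner_iotaL]

lemma inner_Jp (a : Fin 3) (p q : Pol) :
    inner ℂ (iotaL p) (iotaL (Jp a q)) = -inner ℂ (iotaL (Jp a p)) (iotaL q) :=
  (hasJ_iotaL a q).inner_iotaL p

/-! ### Polynomials of bounded degree and spherical harmonics -/

/-- The Casimir operator of the rotations: the Laplacian of the sphere on polynomials. -/
def Cas (p : Pol) : Pol := ∑ a, Jp a (Jp a p)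

/-- The Euler operator. -/
def Eu (p : Pol) : Pol := ∑ i, MvPolynomial.X i * pderiv i p

/-- The Laplacian of the Euclidean space. -/
def Lap (p : Pol) : Pol := ∑ i, pderiv i (pderiv i p)

lemma pderiv_comm (i j : Fin 3) (p : Pol) : pderiv i (pderiv j p) = pderiv j (pderiv i p) := by
  have : ⁅(pderiv i : Derivation ℂ Pol Pol), (pderiv j : Derivation ℂ Pol Pol)⁆ = 0 := by
    refine derivation_ext fun k => ?_
    rw [Derivation.commutator_apply]
    simp [pderiv_X, Pi.single_apply, apply_ite]
  have h := congrArg (fun D => D p) this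
  simp only [Derivation.commutator_apply, Derivation.coe_zero, Pi.zero_apply] at h
  exact sub_eq_zero.mp h

/-- The classical identity |x|² Δ = ∑ J_a² + E² + E. On the unit sphere it compares the Casimir
operator with the Euclidean Laplacian, which lowers the degree. -/
lemma Cas_eq (p : Pol) :
    Cas p = (∑ i, MvPolynomial.X i ^ 2) * Lap p - (Eu (Eu p) + Eu p) := by
  have h1 := pderiv_comm 1 0 p
  have h2 := pderiv_comm 2 0 p
  have h3 := pderiv_comm 2 1 p
  simp only [Cas, Eu, Lap, Fin.sum_univ_three, Jp_apply, map_sub, map_add, Derivation.leibniz,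
    smul_eq_mul, pderiv_X, Pi.single_apply]
  simp [h1, h2, h3]
  ring

/-- Polynomials of degree less than `n`. -/
def PD (n : ℕ) : Submodule ℂ Pol :=
  Submodule.span ℂ ((fun s => monomial s (1 : ℂ)) '' {s : Fin 3 →₀ ℕ | s.degree < n})

lemma monomial_mem_PD {n : ℕ} {s : Fin 3 →₀ ℕ} (h : s.degree < n) (c : ℂ) :
    monomial s c ∈ PD n := by
  have : monomial s c = c • monomial s (1 : ℂ) := by simp [smul_monomial]
  rw [this]
  exact Submodule.smul_mem _ _ (Submodule.subset_span ⟨s, h, rfl⟩)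

lemma PD_mono {m n : ℕ} (h : m ≤ n) : PD m ≤ PD n :=
  Submodule.span_mono (Set.image_mono fun _ hs => lt_of_lt_of_le hs h)

lemma pderiv_mem_PD (n : ℕ) (i : Fin 3) {p : Pol} (hp : p ∈ PD (n + 1)) : pderiv i p ∈ PD n := by
  induction hp using Submodule.span_induction with
  | mem x hx =>
    obtain ⟨s, hs, rfl⟩ := hx
    simp only [pderiv_monomial, one_mul]
    by_cases h0 : s i = 0
    · simp [h0]
    · refine monomial_mem_PD ?_ _
      have hle : Finsupp.single i 1 ≤ s := by simpa using Nat.one_le_iff_ne_zero.mpr h0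
      have : s.degree = (s - Finsupp.single i 1).degree + 1 := by
        conv_lhs => rw [← tsub_add_cancel_of_le hle]
        simp [map_add]
      simp only [Set.mem_ofPred_eq] at hs
      omega
  | zero => simp
  | add x y _ _ hx hy => rw [map_add]; exact add_mem hx hy
  | smul c x _ hx => rw [Derivation.map_smul]; exact Submodule.smul_mem _ _ hx

lemma X_mul_mem_PD (n : ℕ) (i : Fin 3) {p : Pol} (hp : p ∈ PD n) : MvPolynomial.X i * p ∈ PD (n + 1) := by
  induction hp using Submodule.span_induction with
  | mem x hx =>
    obtain ⟨s, hs, rfl⟩ := hx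
    simp only [Set.mem_ofPred_eq] at hs
    rw [MvPolynomial.X, monomial_mul]
    refine monomial_mem_PD ?_ _
    simp [map_add]; omega
  | zero => simp
  | add x y _ _ hx hy => rw [mul_add]; exact add_mem hx hy
  | smul c x _ hx => rw [mul_smul_comm]; exact Submodule.smul_mem _ _ hx

lemma Jp_mem_PD (n : ℕ) (a : Fin 3) {p : Pol} (hp : p ∈ PD n) : Jp a p ∈ PD n := by
  cases n with
  | zero =>
    have : p = 0 := by simpa [PD] using hp
    simp [this]
  | succ n =>
    rw [Jp_apply]
    exact sub_mem (X_mul_mem_PD _ _ (pderiv_mem_PD _ _ hp)) (X_mul_mem_PD _ _ (pderiv_mem_PD _ _ hp))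

lemma Eu_monomial (s : Fin 3 →₀ ℕ) (c : ℂ) :
    Eu (monomial s c) = (s.degree : ℂ) • monomial s c := by
  have h := (isHomogeneous_monomial c (rfl : s.degree = s.degree)).sum_X_mul_pderiv
  unfold Eu
  rw [h]
  simp [smul_monomial]

lemma Eu_smul (c : ℂ) (p : Pol) : Eu (c • p) = c • Eu p := by
  simp [Eu, Finset.smul_sum]

/-- The eigenvalues `n (n + 1)` of the negative Laplacian of the sphere. -/
def mu (n : ℕ) : ℝ := n * (n + 1)

lemma iota_sq : iota (∑ i, MvPolynomial.X i ^ 2) = 1 := by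
  simp [iota, Fin.sum_univ_three, Y_sq]

/-- Restrictions to the sphere of the polynomials of degree less than `n`. -/
def VD (n : ℕ) : Submodule ℂ L2 := (PD n).map iotaL

lemma VD_mono {m n : ℕ} (h : m ≤ n) : VD m ≤ VD n := Submodule.map_mono (PD_mono h)

/-- By `Cas_eq`, a monomial p of degree d restricts to Cas p = Δp - d (d + 1) p. The term Δp has
smaller degree; the other cancels against n (n + 1) p if d = n, and has degree less than n
otherwise. -/
lemma Cas_add_mem_VD (n : ℕ) {p : Pol} (hp : p ∈ PD (n + 1)) :
    iotaL (Cas p + (mu n : ℂ) • p) ∈ VD n := by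
  induction hp using Submodule.span_induction with
  | mem x hx =>
    obtain ⟨s, hs, rfl⟩ := hx
    simp only [Set.mem_ofPred_eq] at hs
    set d := s.degree with hd
    have h1 : iotaL (Cas (monomial s (1 : ℂ)) + (mu n : ℂ) • monomial s (1 : ℂ))
        = iotaL (Lap (monomial s (1 : ℂ))) + ((mu n : ℂ) - mu d) • iotaL (monomial s (1 : ℂ)) := by
      rw [Cas_eq, Eu_monomial, Eu_smul, Eu_monomial, ← hd]
      simp only [map_add, map_sub, map_smul]
      have : iotaL ((∑ i, MvPolynomial.X i ^ 2) * Lap (monomial s (1 : ℂ))) = iotaL (Lap (monomial s (1 : ℂ))) := by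
        rw [iotaL_apply, map_mul, iota_sq, one_mul, iotaL_apply]
      rw [this]
      unfold mu
      push_cast
      module
    rw [h1]
    refine add_mem ?_ ?_
    · refine ⟨_, ?_, rfl⟩
      refine Submodule.sum_mem _ fun i _ => ?_
      cases n with
      | zero =>
        have : s = 0 := by
          have : s.degree = 0 := by omega
          exact (Finsupp.degree_eq_zero_iff s).1 this
        simp [this, pderiv_monomial]
      | succ n =>
        exact PD_mono (Nat.le_succ n) (pderiv_mem_PD _ _ (pderiv_mem_PD _ _ (monomial_mem_PD hs 1)))
    · by_cases h : d = n
      · simp [h]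
      · exact Submodule.smul_mem _ _ ⟨_, monomial_mem_PD (by omega) 1, rfl⟩
  | zero => simp [Cas]
  | add x y _ _ hx hy =>
    have : Cas (x + y) + (mu n : ℂ) • (x + y) = (Cas x + (mu n : ℂ) • x) + (Cas y + (mu n : ℂ) • y) := by
      simp only [Cas, map_add, Finset.sum_add_distrib]; module
    rw [this, map_add]; exact add_mem hx hy
  | smul c x _ hx =>
    have : Cas (c • x) + (mu n : ℂ) • (c • x) = c • (Cas x + (mu n : ℂ) • x) := by
      simp only [Cas, Derivation.map_smul, ← Finset.smul_sum]; module
    rw [this, map_smul]; exact Submodule.smul_mem _ _ hx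

lemma finite_degree_lt (n : ℕ) : {s : Fin 3 →₀ ℕ | s.degree < n}.Finite := by
  refine Set.Finite.subset (Set.finite_Iic (Finsupp.equivFunOnFinite.symm fun _ => n)) ?_
  intro s hs i
  simp only [Set.mem_ofPred_eq] at hs
  exact (Finsupp.le_degree i s).trans hs.le

instance (n : ℕ) : FiniteDimensional ℂ (PD n) :=
  FiniteDimensional.span_of_finite ℂ ((finite_degree_lt n).image _)

instance (n : ℕ) : FiniteDimensional ℂ (VD n) := by unfold VD; infer_instance

/-- The spherical harmonics of degree `n`. -/
def Har (n : ℕ) : Submodule ℂ L2 := VD (n + 1) ⊓ (VD n)ᗮ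

instance (n : ℕ) : FiniteDimensional ℂ (Har n) := Submodule.finiteDimensional_inf_left _ _

/-- Harmonic polynomials are not needed. The restriction of Cas p + n (n + 1) p comes from degree
less than n by `Cas_add_mem_VD`, and it is orthogonal to all such restrictions because the Casimir
operator is symmetric and preserves them; so it is zero. In the same way, skew-symmetry shows that
the rotations preserve `Har n`. -/
lemma exists_pol_of_mem_Har {n : ℕ} {f : L2} (hf : f ∈ Har n) :
    ∃ p, iotaL p = f ∧ iotaL (Cas p) = -(mu n : ℂ) • f ∧
      (∀ a, iotaL (Jp a p) ∈ Har n) := by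
  obtain ⟨⟨p, hp, rfl⟩, hf⟩ := hf
  rw [SetLike.mem_coe, Submodule.mem_orthogonal] at hf
  refine ⟨p, rfl, ?_, fun a => ⟨⟨_, Jp_mem_PD _ _ hp, rfl⟩, ?_⟩⟩
  · have h1 := Cas_add_mem_VD n hp
    have h2 : iotaL (Cas p + (mu n : ℂ) • p) ∈ (VD n)ᗮ := by
      rw [map_add, map_smul]
      refine add_mem ?_ (Submodule.smul_mem _ _ ((Submodule.mem_orthogonal _ _).2 hf))
      rw [Submodule.mem_orthogonal]
      rintro _ ⟨q, hq, rfl⟩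
      simp only [Cas, map_sum, inner_sum]
      refine Finset.sum_eq_zero fun a _ => ?_
      rw [inner_Jp, inner_Jp, hf _ ⟨_, Jp_mem_PD _ _ (Jp_mem_PD _ _ hq), rfl⟩]
      simp
    have h3 : iotaL (Cas p + (mu n : ℂ) • p) = 0 := by
      have := Submodule.inner_right_of_mem_orthogonal h1 h2
      exact inner_self_eq_zero.mp this
    rw [map_add, map_smul] at h3
    rw [neg_smul]
    exact eq_neg_of_add_eq_zero_left h3
  · rw [SetLike.mem_coe, Submodule.mem_orthogonal]
    rintro _ ⟨q, hq, rfl⟩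
    rw [inner_Jp, hf _ ⟨_, Jp_mem_PD _ _ hq, rfl⟩]
    simp

end LandauSphere
end

noncomputable section
namespace LandauSphere

/-! ### The decomposition of `L²` into spherical harmonics -/

lemma Har_orthogonal {m n : ℕ} (h : m ≠ n) : Har m ⟂ Har n := by
  wlog hmn : m < n generalizing m n
  · exact (this h.symm (by omega)).symm
  rw [Submodule.isOrtho_iff_inner_eq]
  intro u hu v hv
  exact Submodule.inner_right_of_mem_orthogonal (VD_mono (by omega : m + 1 ≤ n) hu.1) hv.2

lemma VD_le_iSup (n : ℕ) : VD n ≤ ⨆ k, Har k := by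
  induction n with
  | zero => simp [VD, PD]
  | succ n ih =>
    have h := Submodule.sup_orthogonal_inf_of_hasOrthogonalProjection (VD_mono (Nat.le_succ n))
    rw [← h]
    refine sup_le ih ?_
    rw [inf_comm]
    exact le_iSup Har n

lemma iSup_Har_dense : ⊤ ≤ (⨆ k, Har k).topologicalClosure := by
  intro f _
  have h : Set.range iotaL ⊆ ((⨆ k, Har k : Submodule ℂ L2) : Set L2) := by
    rintro _ ⟨p, rfl⟩
    have hp : ∑ s ∈ p.support, MvPolynomial.monomial s (MvPolynomial.coeff s p)
        ∈ PD (p.totalDegree + 1) := by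
      refine Submodule.sum_mem _ fun s hs => monomial_mem_PD ?_ _
      have := MvPolynomial.le_totalDegree hs
      rw [Finsupp.sum_fintype _ _ (by simp)] at this
      rw [Finsupp.degree_eq_sum]
      omega
    rw [← p.as_sum] at hp
    exact VD_le_iSup _ ⟨p, hp, rfl⟩
  exact closure_mono h (denseRange_iotaL f)

lemma isHilbertSum_Har :
    IsHilbertSum ℂ (fun k => Har k) fun k => (Har k).subtypeₗᵢ :=
  IsHilbertSum.mkInternal Har
    (OrthogonalFamily.of_pairwise fun _ _ h => Har_orthogonal h) iSup_Har_dense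

/-- The projection to the spherical harmonics of degree `k`. -/
def proj (k : ℕ) : L2 →L[ℂ] L2 := (Har k).starProjection

lemma proj_mem (k : ℕ) (f : L2) : proj k f ∈ Har k := Submodule.starProjection_apply_mem _ _

lemma proj_of_mem {k : ℕ} {f : L2} (h : f ∈ Har k) : proj k f = f :=
  Submodule.starProjection_eq_self_iff.2 h

lemma proj_of_mem_ne {j k : ℕ} (hjk : j ≠ k) {f : L2} (h : f ∈ Har j) : proj k f = 0 :=
  (Submodule.starProjection_apply_eq_zero_iff _).2 ((Har_orthogonal hjk) h)

lemma proj_eq_of_hasSum {g : ℕ → L2} (hg : ∀ k, g k ∈ Har k) {f : L2} (h : HasSum g f) (k : ℕ) :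
    proj k f = g k := by
  have h1 := (proj k).hasSum h
  have h2 : HasSum (fun j => proj k (g j)) (g k) := by
    have := hasSum_single (f := fun j => proj k (g j)) k
      (fun j hj => proj_of_mem_ne hj (hg j))
    simpa only [proj_of_mem (hg k)] using this
  exact h1.unique h2

lemma hasSum_proj (f : L2) : HasSum (fun k => proj k f) f := by
  have h := isHilbertSum_Har.hasSum_linearIsometryEquiv_symm (isHilbertSum_Har.linearIsometryEquiv f)
  rw [LinearIsometryEquiv.symm_apply_apply] at h
  convert h using 2 with k
  exact proj_eq_of_hasSum (fun k => Subtype.coe_prop _) h k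

lemma ext_proj {f g : L2} (h : ∀ k, proj k f = proj k g) : f = g := by
  have := hasSum_proj g
  simp only [← h] at this
  exact (hasSum_proj f).unique this

lemma inner_proj {k : ℕ} {ψ : L2} (h : ψ ∈ Har k) (f : L2) :
    inner ℂ ψ f = inner ℂ ψ (proj k f) := by
  unfold proj
  rw [← Submodule.inner_starProjection_left_eq_right, Submodule.starProjection_eq_self_iff.2 h]

lemma hasSum_norm_sq (f : L2) : HasSum (fun k => ‖proj k f‖ ^ 2) (‖f‖ ^ 2) := by
  have h := (innerSL ℂ f).hasSum (hasSum_proj f)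
  have h2 := Complex.reCLM.hasSum h
  simp only [innerSL_apply_apply, Complex.reCLM_apply] at h2
  have e : (inner ℂ f f).re = ‖f‖ ^ 2 := by
    have := inner_self_eq_norm_sq (𝕜 := ℂ) f
    simpa using this
  rw [e] at h2
  convert h2 using 2 with k
  have : inner ℂ f (proj k f) = inner ℂ (proj k f) (proj k f) := by
    rw [← inner_conj_symm, inner_proj (proj_mem k f) f, inner_conj_symm]
  rw [this]
  have := inner_self_eq_norm_sq (𝕜 := ℂ) (proj k f)
  simpa using this.symm

lemma exists_of_summable {g : ℕ → L2} (hg : ∀ k, g k ∈ Har k)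
    (hs : Summable fun k => ‖g k‖ ^ 2) : ∃ f, ∀ k, proj k f = g k := by
  have h := (isHilbertSum_Har.OrthogonalFamily.summable_iff_norm_sq_summable
    (fun k => (⟨g k, hg k⟩ : Har k))).2 (by simpa using hs)
  obtain ⟨f, hf⟩ := h
  exact ⟨f, proj_eq_of_hasSum hg (by simpa using hf)⟩

/-! ### Derivatives along the rotations and spherical harmonics -/

/-- The rotations preserve each space of harmonics and are skew-adjoint. Weak derivatives can
therefore be computed degree by degree. -/
lemma HasJ.proj {a : Fin 3} {f g : L2} (h : HasJ a f g) (k : ℕ) :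
    HasJ a (proj k f) (proj k g) := by
  obtain ⟨q, hq, -, hJ⟩ := exists_pol_of_mem_Har (proj_mem k f)
  have hj := hasJ_iotaL a q
  rw [hq] at hj
  have : LandauSphere.proj k g = iotaL (Jp a q) := by
    rw [← proj_of_mem (hJ a)]
    rw [← sub_eq_zero, ← map_sub]
    unfold LandauSphere.proj
    rw [Submodule.starProjection_apply_eq_zero_iff, Submodule.mem_orthogonal]
    intro ψ hψ
    obtain ⟨p, rfl, -, hp⟩ := exists_pol_of_mem_Har hψ
    rw [inner_sub_right, h.inner_iotaL, hj.inner_iotaL, inner_proj (hp a)]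
    simp
  rwa [this]

lemma hasJ_of_proj {a : Fin 3} {f g : L2} (h : ∀ k, HasJ a (proj k f) (proj k g)) :
    HasJ a f g := by
  intro φ hφ
  have h1 := (pair (res φ hφ.continuous)).hasSum (hasSum_proj g)
  have h2 := ((pair (res (rotDeriv a φ) (contDiff_rotDeriv a hφ).continuous)).hasSum
    (hasSum_proj f)).neg
  simp only [h _ φ hφ] at h1
  exact h1.unique h2

lemma hasJ_closed (a : Fin 3) : IsClosed {p : L2 × L2 | HasJ a p.1 p.2} := by
  simp only [HasJ, Set.ofPred_forall]
  refine isClosed_iInter fun φ => isClosed_iInter fun hφ => ?_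
  exact isClosed_eq (by fun_prop) (by fun_prop)

lemma exists_hasJ_of_mem_Har (a : Fin 3) {k : ℕ} {f : L2} (hf : f ∈ Har k) :
    ∃ g ∈ Har k, HasJ a f g := by
  obtain ⟨q, rfl, -, hJ⟩ := exists_pol_of_mem_Har hf
  exact ⟨_, hJ a, hasJ_iotaL a q⟩

lemma mu_nonneg (k : ℕ) : 0 ≤ mu k := by unfold mu; positivity

/-- Skew-symmetry moves one derivative to the other factor and leaves -⟨∑ J_a² f, f⟩. This is what
ties the weak derivatives to the weights k (k + 1). -/
lemma sum_norm_sq_of_mem_Har {k : ℕ} {f : L2} (hf : f ∈ Har k) {g : Fin 3 → L2}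
    (hg : ∀ a, HasJ a f (g a)) : ∑ a, ‖g a‖ ^ 2 = mu k * ‖f‖ ^ 2 := by
  obtain ⟨q, rfl, hC, hJ⟩ := exists_pol_of_mem_Har hf
  have h1 : ∀ a, g a = iotaL (Jp a q) := fun a => (hg a).unique (hasJ_iotaL a q)
  have h2 : ∑ a, inner ℂ (iotaL (Jp a q)) (iotaL (Jp a q)) = (mu k : ℂ) * inner ℂ (iotaL q) (iotaL q) := by
    have : ∀ a, inner ℂ (iotaL (Jp a q)) (iotaL (Jp a q)) = -inner ℂ (iotaL (Jp a (Jp a q))) (iotaL q) :=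
      fun a => inner_Jp a _ _
    simp only [this]
    rw [Finset.sum_neg_distrib, ← sum_inner, ← map_sum]
    change -inner ℂ (iotaL (Cas q)) _ = _
    rw [hC, inner_smul_left]
    simp
  have h3 := congrArg Complex.re h2
  simp only [h1]
  simp only [inner_self_eq_norm_sq_to_K, Complex.re_sum] at h3
  have e : ∀ x : ℝ, (((x : ℝ) : ℂ) ^ 2).re = x ^ 2 := fun x => by
    rw [← Complex.ofReal_pow, Complex.ofReal_re]
  simpa [e] using h3

open Classical in
/-- The weak derivative along the rotations about the `a`-th axis (`0` if there is none). -/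
def Jop (a : Fin 3) (f : L2) : L2 := if h : ∃ g, HasJ a f g then h.choose else 0

lemma HasJ.Jop_eq {a : Fin 3} {f g : L2} (h : HasJ a f g) : Jop a f = g := by
  unfold Jop
  rw [dif_pos ⟨g, h⟩]
  exact (Exists.choose_spec (p := fun g => HasJ a f g) ⟨g, h⟩).unique h

/-- The Sobolev spaces, in terms of spherical harmonics. -/
def Sob (m : ℕ) (f : L2) : Prop := Summable fun k : ℕ => ((k : ℝ) + 1) ^ (2 * m) * ‖proj k f‖ ^ 2

lemma sob_zero (f : L2) : Sob 0 f := by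
  simpa [Sob] using (hasSum_norm_sq f).summable

lemma mu_le (k : ℕ) : mu k ≤ ((k : ℝ) + 1) ^ 2 := by unfold mu; nlinarith [Nat.cast_nonneg (α := ℝ) k]

lemma le_mu (k : ℕ) (hk : 1 ≤ k) : ((k : ℝ) + 1) ^ 2 ≤ 2 * mu k := by
  unfold mu
  have : (1 : ℝ) ≤ k := by exact_mod_cast hk
  nlinarith

lemma Sob.of_le {m : ℕ} {f g : L2} (h : Sob m f) {C : ℝ} (hC : ∀ k, ‖proj k g‖ ≤ C * ‖proj k f‖) :
    Sob m g := by
  unfold Sob at *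
  refine Summable.of_nonneg_of_le (fun k => by positivity) (fun k => ?_) (h.mul_left (C ^ 2))
  have := pow_le_pow_left₀ (norm_nonneg _) (hC k) 2
  calc ((k : ℝ) + 1) ^ (2 * m) * ‖proj k g‖ ^ 2
      ≤ ((k : ℝ) + 1) ^ (2 * m) * (C * ‖proj k f‖) ^ 2 := by gcongr
    _ = _ := by ring

lemma Sob.exists_hasJ {m : ℕ} {f : L2} (h : Sob (m + 1) f) (a : Fin 3) :
    ∃ g, Sob m g ∧ HasJ a f g := by
  choose g hg hJ using fun k => fun a => exists_hasJ_of_mem_Har a (proj_mem k f)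
  have hle : ∀ k, ‖g k a‖ ^ 2 ≤ ((k : ℝ) + 1) ^ 2 * ‖proj k f‖ ^ 2 := by
    intro k
    have h1 := sum_norm_sq_of_mem_Har (proj_mem k f) (hJ k)
    have h2 : ‖g k a‖ ^ 2 ≤ ∑ a, ‖g k a‖ ^ 2 :=
      Finset.single_le_sum (f := fun a => ‖g k a‖ ^ 2) (fun _ _ => by positivity) (Finset.mem_univ a)
    rw [h1] at h2
    refine h2.trans ?_
    gcongr
    exact mu_le k
  have hS : Summable fun k : ℕ => ((k : ℝ) + 1) ^ (2 * m) * ‖g k a‖ ^ 2 := by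
    refine Summable.of_nonneg_of_le (fun k => by positivity) (fun k => ?_) h
    calc ((k : ℝ) + 1) ^ (2 * m) * ‖g k a‖ ^ 2
        ≤ ((k : ℝ) + 1) ^ (2 * m) * (((k : ℝ) + 1) ^ 2 * ‖proj k f‖ ^ 2) := by
          gcongr; exact hle k
      _ = _ := by ring
  have hS0 : Summable fun k : ℕ => ‖g k a‖ ^ 2 := by
    refine Summable.of_nonneg_of_le (fun k => by positivity) (fun k => ?_) hS
    have : 1 ≤ ((k : ℝ) + 1) ^ (2 * m) := one_le_pow₀ (by linarith [Nat.cast_nonneg (α := ℝ) k])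
    nlinarith [sq_nonneg ‖g k a‖]
  obtain ⟨F, hF⟩ := exists_of_summable (fun k => hg k a) hS0
  refine ⟨F, ?_, hasJ_of_proj fun k => ?_⟩
  · unfold Sob; simpa only [hF] using hS
  · rw [hF]; exact hJ k a

lemma sob_succ_of_hasJ {m : ℕ} {f : L2} {g : Fin 3 → L2} (hg : ∀ a, Sob m (g a))
    (hJ : ∀ a, HasJ a f (g a)) : Sob (m + 1) f := by
  unfold Sob at *
  have hs : Summable fun k : ℕ =>
      2 * (∑ a, ((k : ℝ) + 1) ^ (2 * m) * ‖proj k (g a)‖ ^ 2) + ‖proj k f‖ ^ 2 :=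
    ((summable_sum fun a _ => hg a).mul_left 2).add (hasSum_norm_sq f).summable
  refine Summable.of_nonneg_of_le (fun k => by positivity) (fun k => ?_) hs
  have h1 := sum_norm_sq_of_mem_Har (proj_mem k f) (fun a => (hJ a).proj k)
  rw [← Finset.mul_sum, h1]
  rcases Nat.eq_zero_or_pos k with rfl | hk
  · simp [mu]
  · have h2 := le_mu k hk
    have h3 : 0 ≤ ((k : ℝ) + 1) ^ (2 * m) * ‖proj k f‖ ^ 2 := by positivity
    have e : ((k : ℝ) + 1) ^ (2 * (m + 1)) * ‖proj k f‖ ^ 2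
        = ((k : ℝ) + 1) ^ 2 * (((k : ℝ) + 1) ^ (2 * m) * ‖proj k f‖ ^ 2) := by ring
    rw [e]
    nlinarith [mul_le_mul_of_nonneg_right h2 h3, sq_nonneg ‖proj k f‖]

lemma Sob.mono_succ {m : ℕ} {f : L2} (h : Sob (m + 1) f) : Sob m f := by
  unfold Sob at *
  refine Summable.of_nonneg_of_le (fun k => by positivity) (fun k => ?_) h
  gcongr <;> first | omega | linarith [Nat.cast_nonneg (α := ℝ) k]

lemma Sob.mono {m n : ℕ} {f : L2} (h : Sob n f) (hmn : m ≤ n) : Sob m f := by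
  induction n, hmn using Nat.le_induction with
  | base => exact h
  | succ n _ ih => exact ih h.mono_succ

lemma Sob.hasJ {m : ℕ} {f : L2} (h : Sob (m + 1) f) (a : Fin 3) : HasJ a f (Jop a f) := by
  obtain ⟨g, -, hg⟩ := h.exists_hasJ a
  rwa [hg.Jop_eq]

lemma Sob.jop {m : ℕ} {f : L2} (h : Sob (m + 1) f) (a : Fin 3) : Sob m (Jop a f) := by
  obtain ⟨g, hs, hg⟩ := h.exists_hasJ a
  rwa [hg.Jop_eq]

lemma Sob.add {m : ℕ} {f g : L2} (hf : Sob m f) (hg : Sob m g) : Sob m (f + g) := by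
  unfold Sob at *
  refine Summable.of_nonneg_of_le (fun k => by positivity) (fun k => ?_)
    ((hf.mul_left 2).add (hg.mul_left 2))
  have h1 : ‖proj k (f + g)‖ ≤ ‖proj k f‖ + ‖proj k g‖ := by rw [map_add]; exact norm_add_le _ _
  have h2 : ‖proj k (f + g)‖ ^ 2 ≤ 2 * ‖proj k f‖ ^ 2 + 2 * ‖proj k g‖ ^ 2 := by
    nlinarith [norm_nonneg (proj k (f + g)), sq_nonneg (‖proj k f‖ - ‖proj k g‖)]
  calc _ ≤ ((k : ℝ) + 1) ^ (2 * m) * (2 * ‖proj k f‖ ^ 2 + 2 * ‖proj k g‖ ^ 2) := by gcongr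
    _ = _ := by ring

lemma Sob.smul {m : ℕ} {f : L2} (c : ℂ) (hf : Sob m f) : Sob m (c • f) :=
  hf.of_le (C := ‖c‖) fun k => by rw [map_smul, norm_smul]

lemma Sob.neg {m : ℕ} {f : L2} (hf : Sob m f) : Sob m (-f) :=
  hf.of_le (C := 1) fun k => by rw [map_neg, norm_neg, one_mul]

lemma Sob.sub {m : ℕ} {f g : L2} (hf : Sob m f) (hg : Sob m g) : Sob m (f - g) := by
  rw [sub_eq_add_neg]; exact hf.add hg.neg

lemma sob_zero_fun (m : ℕ) : Sob m (0 : L2) := by simp [Sob, summable_zero]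

lemma Sob.sum {m : ℕ} {ι : Type*} {s : Finset ι} {f : ι → L2} (h : ∀ i ∈ s, Sob m (f i)) :
    Sob m (∑ i ∈ s, f i) := by
  classical
  induction s using Finset.induction_on with
  | empty => simpa using sob_zero_fun m
  | insert a s ha ih =>
    rw [Finset.sum_insert ha]
    exact (h a (by simp)).add (ih fun i hi => h i (by simp [hi]))

/-! ### Weak tangential derivatives -/

lemma contDiff_coordC (i : Fin 3) : ContDiff ℝ ∞ fun y : E3 => ((y i : ℝ) : ℂ) :=
  Complex.ofRealCLM.contDiff.comp (by fun_prop : ContDiff ℝ ∞ fun y : E3 => y i)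

lemma pev_X (j : Fin 3) : pev (MvPolynomial.X j) = fun y : E3 => ((y j : ℝ) : ℂ) := by
  funext y; simp [pev]

lemma contDiff_adj (i : Fin 3) {φ : E3 → ℂ} (h : ContDiff ℝ ∞ φ) :
    ContDiff ℝ ∞ fun y => 2 * ((y i : ℝ) : ℂ) * φ y - tangDeriv i φ y :=
  ((contDiff_const.mul (contDiff_coordC i)).mul h).sub (contDiff_tangDeriv i h)

lemma hasWeakDeriv_iff (i : Fin 3) (f g : L2) : HasWeakDeriv i f g ↔
    ∀ φ : E3 → ℂ, ∀ h : ContDiff ℝ ∞ φ, pair (res φ h.continuous) g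
      = pair (res _ (contDiff_adj i h).continuous) f := by
  unfold HasWeakDeriv
  simp only [pair_eq_integral, res_apply]

lemma tangDeriv_coord (i j : Fin 3) (y : E3) :
    tangDeriv i (fun y : E3 => ((y j : ℝ) : ℂ)) y
      = (if i = j then 1 else 0) - ((y i : ℝ) : ℂ) * ((y j : ℝ) : ℂ) := by
  unfold tangDeriv
  rw [← pev_X, fderiv_pev, Finset.sum_eq_single j]
  · by_cases h : i = j
    · subst h; simp [pev]
    · simp [pev, h, Ne.symm h]
  · intro k _ hk; simp [pev, MvPolynomial.pderiv_X_of_ne hk.symm]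
  · simp

lemma rotDeriv_coord (a j : Fin 3) (y : E3) :
    rotDeriv a (fun y : E3 => ((y j : ℝ) : ℂ)) y
      = (if j = a + 2 then ((y (a + 1) : ℝ) : ℂ) else 0)
        - (if j = a + 1 then ((y (a + 2) : ℝ) : ℂ) else 0) := by
  rw [← pev_X, rotDeriv_pev, Jp_apply]
  simp only [MvPolynomial.pderiv_X, Pi.single_apply]
  split_ifs <;> simp [pev]

/-- The weak form of `tangDeriv_eq_rotDeriv`: the coordinate factors are moved to the test function,
and their derivatives along the rotations produce the term 2 y_i φ in `HasWeakDeriv`. -/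
lemma hasWeakDeriv_of_hasJ (i : Fin 3) {f : L2} {g : Fin 3 → L2} (h : ∀ a, HasJ a f (g a)) :
    HasWeakDeriv i f (Y (i + 2) • g (i + 1) - Y (i + 1) • g (i + 2)) := by
  rw [hasWeakDeriv_iff]
  intro φ hφ
  have key : ∀ a j : Fin 3, pair (res φ hφ.continuous) (Y j • g a)
      = -pair (res _ (contDiff_rotDeriv a (hφ.mul (contDiff_coordC j))).continuous) f := by
    intro a j
    rw [pair_smul, ← h a _ (hφ.mul (contDiff_coordC j))]
    congr 1
  rw [map_sub, key, key, ← pair_neg, ← pair_neg, ← pair_sub]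
  congr 2
  ext y
  simp only [ContinuousMap.sub_apply, ContinuousMap.neg_apply, res_apply]
  rw [rotDeriv_mul _ hφ (contDiff_coordC _), rotDeriv_mul _ hφ (contDiff_coordC _),
    tangDeriv_eq_rotDeriv, rotDeriv_coord, rotDeriv_coord]
  fin_cases i <;> simp <;> ring

lemma hasJ_of_hasWeakDeriv (a : Fin 3) {f : L2} {d : Fin 3 → L2} (h : ∀ i, HasWeakDeriv i f (d i)) :
    HasJ a f (Y (a + 1) • d (a + 2) - Y (a + 2) • d (a + 1)) := by
  intro φ hφ
  have key : ∀ i j : Fin 3, pair (res φ hφ.continuous) (Y j • d i)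
      = pair (res _ (contDiff_adj i (hφ.mul (contDiff_coordC j))).continuous) f := by
    intro i j
    rw [pair_smul, ← (hasWeakDeriv_iff _ _ _).1 (h i) _ (hφ.mul (contDiff_coordC j))]
    congr 1
  rw [map_sub, key, key, ← pair_neg, ← pair_sub]
  congr 2
  ext y
  simp only [ContinuousMap.sub_apply, ContinuousMap.neg_apply, res_apply]
  rw [tangDeriv_mul _ hφ (contDiff_coordC _), tangDeriv_mul _ hφ (contDiff_coordC _),
    rotDeriv_eq_tangDeriv, tangDeriv_coord, tangDeriv_coord]
  fin_cases a <;> simp <;> ring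

lemma HasWeakDeriv.unique {i : Fin 3} {f g g' : L2} (h : HasWeakDeriv i f g)
    (h' : HasWeakDeriv i f g') : g = g' := by
  rw [hasWeakDeriv_iff] at h h'
  refine ext_pair fun p => ?_
  rw [← res_pev p, h _ (contDiff_pev p), h' _ (contDiff_pev p)]

lemma HasWeakDeriv.weakDeriv_eq {i : Fin 3} {f g : L2} (h : HasWeakDeriv i f g) :
    weakDeriv i f = g := by
  unfold weakDeriv
  rw [dif_pos ⟨g, h⟩]
  exact (Exists.choose_spec (p := fun g => HasWeakDeriv i f g) ⟨g, h⟩).unique h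

lemma HasWeakDeriv.add {i : Fin 3} {f g f' g' : L2} (h : HasWeakDeriv i f g)
    (h' : HasWeakDeriv i f' g') : HasWeakDeriv i (f + f') (g + g') := by
  rw [hasWeakDeriv_iff] at *
  intro φ hφ; simp only [map_add, h φ hφ, h' φ hφ]

lemma HasWeakDeriv.smul {i : Fin 3} {f g : L2} (c : ℂ) (h : HasWeakDeriv i f g) :
    HasWeakDeriv i (c • f) (c • g) := by
  rw [hasWeakDeriv_iff] at *
  intro φ hφ; simp only [map_smul, h φ hφ]

lemma hasWeakDeriv_closed (i : Fin 3) : IsClosed {p : L2 × L2 | HasWeakDeriv i p.1 p.2} := by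
  simp only [hasWeakDeriv_iff, Set.ofPred_forall]
  refine isClosed_iInter fun φ => isClosed_iInter fun hφ => ?_
  exact isClosed_eq (by fun_prop) (by fun_prop)

lemma HasWeakDeriv.mul {i : Fin 3} {f g : L2} (h : HasWeakDeriv i f g) {ψ : E3 → ℂ}
    (hψ : ContDiff ℝ ∞ ψ) :
    HasWeakDeriv i (res ψ hψ.continuous • f)
      (res ψ hψ.continuous • g + res _ (contDiff_tangDeriv i hψ).continuous • f) := by
  rw [hasWeakDeriv_iff] at *
  intro φ hφ
  have e : pair (res φ hφ.continuous) (res ψ hψ.continuous • g)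
      = pair (res _ (contDiff_adj i (hφ.mul hψ)).continuous) f := by
    rw [pair_smul, ← h _ (hφ.mul hψ)]; congr 1
  rw [map_add, e, pair_smul, pair_smul, ← pair_add]
  congr 2
  ext y
  simp only [ContinuousMap.add_apply, ContinuousMap.mul_apply, res_apply]
  rw [tangDeriv_mul _ hφ hψ]
  ring

lemma memH_mono {m : ℕ} : ∀ {f : L2}, MemH (m + 1) f → MemH m f := by
  induction m with
  | zero => intro f _; trivial
  | succ m ih =>
    intro f h i
    obtain ⟨g, hg, hd⟩ := h i
    exact ⟨g, ih hg, hd⟩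

lemma memH_add {m : ℕ} : ∀ {f g : L2}, MemH m f → MemH m g → MemH m (f + g) := by
  induction m with
  | zero => intro f g _ _; trivial
  | succ m ih =>
    intro f g hf hg i
    obtain ⟨f', hf', hd⟩ := hf i
    obtain ⟨g', hg', hd'⟩ := hg i
    exact ⟨f' + g', ih hf' hg', hd.add hd'⟩

lemma memH_mul {m : ℕ} : ∀ {f : L2} {ψ : E3 → ℂ} (hψ : ContDiff ℝ ∞ ψ), MemH m f →
    MemH m (res ψ hψ.continuous • f) := by
  induction m with
  | zero => intro f ψ _ _; trivial
  | succ m ih =>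
    intro f ψ hψ hf i
    obtain ⟨f', hf', hd⟩ := hf i
    exact ⟨_, memH_add (ih hψ hf') (ih (contDiff_tangDeriv i hψ) (memH_mono hf)), hd.mul hψ⟩

lemma Y_eq_res (i : Fin 3) : Y i = res _ (contDiff_coordC i).continuous := rfl

lemma memH_mul_Y {m : ℕ} {f : L2} (i : Fin 3) (h : MemH m f) : MemH m (Y i • f) := by
  rw [Y_eq_res]; exact memH_mul (contDiff_coordC i) h

/-- Each description supplies what the other lacks: multiplication by coordinates is harmless in
`MemH`, derivatives along rotations lower the order in `Sob` by one, and gradients and rotational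
derivatives are combinations of each other with coordinates as coefficients. -/
lemma memH_iff_sob {m : ℕ} : ∀ {f : L2}, MemH m f ↔ Sob m f := by
  induction m with
  | zero => intro f; exact ⟨fun _ => sob_zero f, fun _ => trivial⟩
  | succ m ih =>
    intro f
    have hneg : ∀ {g : L2}, MemH m g → MemH m (-g) := fun h => ih.2 (ih.1 h).neg
    have hsub : ∀ {g g' : L2} (i j : Fin 3), MemH m g → MemH m g' → MemH m (Y i • g - Y j • g') := by
      intro g g' i j h h'
      rw [sub_eq_add_neg]
      exact memH_add (memH_mul_Y i h) (hneg (memH_mul_Y j h'))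
    constructor
    · intro h
      choose d hd hD using h
      exact sob_succ_of_hasJ (g := fun a => Y (a + 1) • d (a + 2) - Y (a + 2) • d (a + 1))
        (fun a => ih.1 (hsub _ _ (hd _) (hd _)))
        (fun a => hasJ_of_hasWeakDeriv a hD)
    · intro h i
      exact ⟨_, hsub _ _ (ih.2 (h.jop _)) (ih.2 (h.jop _)),
        hasWeakDeriv_of_hasJ (g := fun a => Jop a f) i fun a => h.hasJ a⟩

end LandauSphere
end

/-! ### Differential operators on the sphere as multipliers, and the Hodge decomposition of tangent
fields. -/

noncomputable section
namespace LandauSphere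

/-! ### Calculus of weak derivatives -/

lemma Sob.smul_Y {m : ℕ} {f : L2} (i : Fin 3) (h : Sob m f) : Sob m (Y i • f) :=
  memH_iff_sob.1 (memH_mul_Y i (memH_iff_sob.2 h))

lemma Sob.wd_eq {m : ℕ} {f : L2} (h : Sob (m + 1) f) (i : Fin 3) :
    weakDeriv i f = Y (i + 2) • Jop (i + 1) f - Y (i + 1) • Jop (i + 2) f :=
  (hasWeakDeriv_of_hasJ (g := fun a => Jop a f) i fun a => h.hasJ a).weakDeriv_eq

lemma Sob.hasWeakDeriv {m : ℕ} {f : L2} (h : Sob (m + 1) f) (i : Fin 3) :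
    HasWeakDeriv i f (weakDeriv i f) := by
  rw [h.wd_eq]
  exact hasWeakDeriv_of_hasJ (g := fun a => Jop a f) i fun a => h.hasJ a

lemma Sob.jop_eq {m : ℕ} {f : L2} (h : Sob (m + 1) f) (a : Fin 3) :
    Jop a f = Y (a + 1) • weakDeriv (a + 2) f - Y (a + 2) • weakDeriv (a + 1) f :=
  (hasJ_of_hasWeakDeriv (d := fun i => weakDeriv i f) a fun i => h.hasWeakDeriv i).Jop_eq

lemma Sob.wd {m : ℕ} {f : L2} (h : Sob (m + 1) f) (i : Fin 3) : Sob m (weakDeriv i f) := by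
  rw [h.wd_eq]
  exact ((h.jop _).smul_Y _).sub ((h.jop _).smul_Y _)

lemma wd_add {f g : L2} (hf : Sob 1 f) (hg : Sob 1 g) (i : Fin 3) :
    weakDeriv i (f + g) = weakDeriv i f + weakDeriv i g :=
  ((hf.hasWeakDeriv i).add (hg.hasWeakDeriv i)).weakDeriv_eq

lemma wd_smul {f : L2} (c : ℂ) (hf : Sob 1 f) (i : Fin 3) :
    weakDeriv i (c • f) = c • weakDeriv i f :=
  ((hf.hasWeakDeriv i).smul c).weakDeriv_eq

lemma wd_neg {f : L2} (hf : Sob 1 f) (i : Fin 3) : weakDeriv i (-f) = -weakDeriv i f := by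
  have := wd_smul (-1) hf i
  simpa using this

lemma wd_sub {f g : L2} (hf : Sob 1 f) (hg : Sob 1 g) (i : Fin 3) :
    weakDeriv i (f - g) = weakDeriv i f - weakDeriv i g := by
  rw [sub_eq_add_neg, wd_add hf hg.neg, wd_neg hg, ← sub_eq_add_neg]

lemma wd_zero (i : Fin 3) : weakDeriv i (0 : L2) = 0 := by
  simpa using wd_smul 0 (sob_zero_fun 1) i

lemma jop_add {f g : L2} (hf : Sob 1 f) (hg : Sob 1 g) (a : Fin 3) :
    Jop a (f + g) = Jop a f + Jop a g :=
  ((hf.hasJ a).add (hg.hasJ a)).Jop_eq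

lemma jop_smul {f : L2} (c : ℂ) (hf : Sob 1 f) (a : Fin 3) : Jop a (c • f) = c • Jop a f :=
  ((hf.hasJ a).smul c).Jop_eq

lemma jop_neg {f : L2} (hf : Sob 1 f) (a : Fin 3) : Jop a (-f) = -Jop a f := by
  have := jop_smul (-1) hf a
  simpa using this

lemma jop_sub {f g : L2} (hf : Sob 1 f) (hg : Sob 1 g) (a : Fin 3) :
    Jop a (f - g) = Jop a f - Jop a g := by
  rw [sub_eq_add_neg, jop_add hf hg.neg, jop_neg hg, ← sub_eq_add_neg]

lemma wd_Y_smul {f : L2} (hf : Sob 1 f) (i j : Fin 3) :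
    weakDeriv i (Y j • f) = Y j • weakDeriv i f + ((if i = j then 1 else 0) - Y i * Y j) • f := by
  have h := (hf.hasWeakDeriv i).mul (contDiff_coordC j)
  rw [← Y_eq_res] at h
  rw [h.weakDeriv_eq]
  congr 2
  ext y
  simp only [res_apply, tangDeriv_coord]
  split_ifs <;> simp

lemma jop_Y_smul {f : L2} (hf : Sob 1 f) (a j : Fin 3) :
    Jop a (Y j • f) = Y j • Jop a f
      + ((if j = a + 2 then Y (a + 1) else 0) - (if j = a + 1 then Y (a + 2) else 0)) • f := by
  have h : Sob 1 (Y j • f) := hf.smul_Y j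
  rw [Sob.jop_eq (m := 0) h, Sob.jop_eq (m := 0) hf, wd_Y_smul hf, wd_Y_smul hf]
  fin_cases a <;> fin_cases j <;> simp <;> module

lemma sum_Y_smul_wd {f : L2} (hf : Sob 1 f) : ∑ i, Y i • weakDeriv i f = 0 := by
  simp only [Fin.sum_univ_three, Sob.wd_eq (m := 0) hf, Fin.isValue, Fin.reduceAdd]
  module

lemma sum_Y_smul_jop {f : L2} (hf : Sob 1 f) : ∑ i, Y i • Jop i f = 0 := by
  simp only [Fin.sum_univ_three, Sob.jop_eq (m := 0) hf, Fin.isValue, Fin.reduceAdd]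
  module

lemma jop_comm {f : L2} (hf : Sob 2 f) (a : Fin 3) :
    Jop a (Jop (a + 1) f) - Jop (a + 1) (Jop a f) = -Jop (a + 2) f := by
  refine ext_pair fun p => ?_
  rw [map_sub, map_neg, ((hf.jop (a + 1)).hasJ a).pair_iota, ((hf.jop a).hasJ (a + 1)).pair_iota,
    (hf.hasJ _).pair_iota, (hf.hasJ _).pair_iota, (hf.hasJ _).pair_iota]
  have := Jp_comm a p
  simp only [neg_neg]
  rw [← pair_sub, ← map_sub, ← neg_eq_iff_eq_neg.mpr this, neg_sub]

/-! ### Multipliers -/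

/-- `g` is obtained from `f` by multiplication of its component of degree `k` by `m k`. -/
def IsMult (m : ℕ → ℂ) (f g : L2) : Prop := ∀ k, proj k g = m k • proj k f

lemma IsMult.unique {m : ℕ → ℂ} {f g g' : L2} (h : IsMult m f g) (h' : IsMult m f g') : g = g' :=
  ext_proj fun k => by rw [h k, h' k]

lemma exists_isMult {m : ℕ → ℂ} {f : L2} (h : Summable fun k => ‖m k‖ ^ 2 * ‖proj k f‖ ^ 2) :
    ∃ g, IsMult m f g ∧ ‖g‖ ^ 2 = ∑' k, ‖m k‖ ^ 2 * ‖proj k f‖ ^ 2 := by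
  have e : ∀ k, ‖m k • proj k f‖ ^ 2 = ‖m k‖ ^ 2 * ‖proj k f‖ ^ 2 := fun k => by
    rw [norm_smul, mul_pow]
  obtain ⟨g, hg⟩ := exists_of_summable (g := fun k => m k • proj k f)
    (fun k => Submodule.smul_mem _ _ (proj_mem k f)) (by simpa only [e] using h)
  refine ⟨g, hg, ?_⟩
  have := (hasSum_norm_sq g).tsum_eq
  rw [← this]
  exact tsum_congr fun k => by rw [hg k, e]

lemma exists_isMult_of_bound {m : ℕ → ℂ} {C : ℝ} (hC : ∀ k, ‖m k‖ ≤ C) (f : L2) :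
    ∃ g, IsMult m f g ∧ ‖g‖ ≤ C * ‖f‖ := by
  have hC0 : 0 ≤ C := (norm_nonneg _).trans (hC 0)
  have hle : ∀ k, ‖m k‖ ^ 2 * ‖proj k f‖ ^ 2 ≤ C ^ 2 * ‖proj k f‖ ^ 2 := fun k => by
    gcongr; exact hC k
  have hs := (hasSum_norm_sq f).mul_left (C ^ 2)
  obtain ⟨g, hg, hn⟩ := exists_isMult (Summable.of_nonneg_of_le (fun k => by positivity) hle hs.summable)
  refine ⟨g, hg, ?_⟩
  have : ‖g‖ ^ 2 ≤ (C * ‖f‖) ^ 2 := by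
    rw [hn, mul_pow, ← hs.tsum_eq]
    exact Summable.tsum_le_tsum hle (Summable.of_nonneg_of_le (fun k => by positivity) hle hs.summable)
      hs.summable
  exact (pow_le_pow_iff_left₀ (norm_nonneg _) (by positivity) two_ne_zero).1 this

open Classical in
/-- The operator with a given bounded multiplier (`0` if the multiplier is unbounded). -/
def multL (m : ℕ → ℂ) : L2 →L[ℂ] L2 :=
  if h : ∃ C : ℝ, ∀ k, ‖m k‖ ≤ C then
    LinearMap.mkContinuous
      { toFun := fun f => (exists_isMult_of_bound h.choose_spec f).choose
        map_add' := fun f g => ext_proj fun k => by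
          rw [(exists_isMult_of_bound h.choose_spec _).choose_spec.1, map_add, map_add,
            (exists_isMult_of_bound h.choose_spec f).choose_spec.1,
            (exists_isMult_of_bound h.choose_spec g).choose_spec.1, smul_add]
        map_smul' := fun c f => ext_proj fun k => by
          rw [(exists_isMult_of_bound h.choose_spec _).choose_spec.1, map_smul, map_smul,
            (exists_isMult_of_bound h.choose_spec f).choose_spec.1, RingHom.id_apply, smul_comm] }
      h.choose fun f => (exists_isMult_of_bound h.choose_spec f).choose_spec.2
  else 0

lemma proj_multL {m : ℕ → ℂ} {C : ℝ} (hC : ∀ k, ‖m k‖ ≤ C) (f : L2) (k : ℕ) :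
    proj k (multL m f) = m k • proj k f := by
  have h : ∃ C : ℝ, ∀ k, ‖m k‖ ≤ C := ⟨C, hC⟩
  unfold multL
  rw [dif_pos h]
  exact (exists_isMult_of_bound h.choose_spec f).choose_spec.1 k

lemma norm_multL_le {m : ℕ → ℂ} {C : ℝ} (hC : ∀ k, ‖m k‖ ≤ C) : ‖multL m‖ ≤ C := by
  refine ContinuousLinearMap.opNorm_le_bound _ ((norm_nonneg _).trans (hC 0)) fun f => ?_
  obtain ⟨g, hg, hn⟩ := exists_isMult_of_bound hC f
  rwa [IsMult.unique (fun k => proj_multL hC f k) hg]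

lemma proj_proj (j k : ℕ) (f : L2) : proj j (proj k f) = if j = k then proj k f else 0 := by
  split_ifs with h
  · subst h; exact proj_of_mem (proj_mem _ _)
  · exact proj_of_mem_ne (Ne.symm h) (proj_mem _ _)

lemma proj_cas {f : L2} (hf : Sob 2 f) (k : ℕ) :
    proj k (∑ a, Jop a (Jop a f)) = -(mu k : ℂ) • proj k f := by
  obtain ⟨q, hq, hC, -⟩ := exists_pol_of_mem_Har (proj_mem k f)
  have h1 : ∀ a, proj k (Jop a f) = iotaL (Jp a q) := fun a =>
    ((hf.hasJ a).proj k).unique (by rw [← hq]; exact hasJ_iotaL a q)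
  have h2 : ∀ a, proj k (Jop a (Jop a f)) = iotaL (Jp a (Jp a q)) := fun a =>
    (((hf.jop a).hasJ a).proj k).unique (by rw [h1]; exact hasJ_iotaL a _)
  rw [map_sum]
  simp only [h2]
  rw [← map_sum, ← hq]
  rw [← hq] at hC
  exact hC

/-- This makes the Laplace–Beltrami operator, defined by Cartesian components, the multiplier -k (k
+ 1) on spherical harmonics. -/
lemma lapl_eq {f : L2} (hf : Sob 2 f) : lapl f = ∑ a, Jop a (Jop a f) := by
  have h1 : Sob 1 f := hf.mono_succ
  have hJ : ∀ a, Sob 1 (Jop a f) := fun a => hf.jop a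
  have hY : ∀ j a, Sob 1 (Y j • Jop a f) := fun j a => (hJ a).smul_Y j
  have hw : ∀ i, weakDeriv i (weakDeriv i f) = Y (i + 2) • weakDeriv i (Jop (i + 1) f)
      - Y (i + 1) • weakDeriv i (Jop (i + 2) f)
      - (Y i * Y (i + 2)) • Jop (i + 1) f + (Y i * Y (i + 1)) • Jop (i + 2) f := by
    intro i
    rw [hf.wd_eq, wd_sub (hY _ _) (hY _ _), wd_Y_smul (hJ _), wd_Y_smul (hJ _)]
    fin_cases i <;> simp <;> module
  unfold lapl
  simp only [hw]
  simp only [Sob.jop_eq (m := 0) (hJ _), Fin.sum_univ_three, Fin.isValue, Fin.reduceAdd]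
  module

lemma proj_lapl {f : L2} (hf : Sob 2 f) (k : ℕ) : proj k (lapl f) = -(mu k : ℂ) • proj k f := by
  rw [lapl_eq hf, proj_cas hf]

/-! ### The mean value -/

lemma pair_one (f : L2) : pair 1 f = ∫ y, f y ∂area := by simp [pair_eq_integral]

lemma mem_Har_zero {f : L2} (hf : f ∈ Har 0) : ∃ c : ℂ, f = c • iotaL 1 := by
  obtain ⟨⟨p, hp, rfl⟩, -⟩ := hf
  have : (fun s => MvPolynomial.monomial s (1 : ℂ)) '' {s : Fin 3 →₀ ℕ | s.degree < 0 + 1} = {1} := by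
    have : {s : Fin 3 →₀ ℕ | s.degree < 0 + 1} = {0} := by
      ext s
      simp [Finsupp.degree_eq_zero_iff]
    rw [this]; simp
  rw [PD, this, SetLike.mem_coe, Submodule.mem_span_singleton] at hp
  obtain ⟨c, rfl⟩ := hp
  exact ⟨c, by simp⟩

lemma one_mem_Har_zero : iotaL 1 ∈ Har 0 := by
  refine ⟨⟨1, monomial_mem_PD (s := 0) (by simp) 1, rfl⟩, ?_⟩
  have : VD 0 = ⊥ := by simp [VD, PD]
  rw [this]; simp

lemma inner_one_proj (f : L2) : inner ℂ (iotaL 1) (proj 0 f) = ∫ y, f y ∂area := by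
  rw [← inner_proj one_mem_Har_zero, iotaL_apply, inner_toL2, ← pair_one]
  simp

lemma proj_zero_eq_zero_iff (f : L2) : proj 0 f = 0 ↔ ∫ y, f y ∂area = 0 := by
  rw [← inner_one_proj]
  constructor
  · intro h; simp [h]
  · intro h
    obtain ⟨c, hc⟩ := mem_Har_zero (proj_mem 0 f)
    rw [← inner_self_eq_zero (𝕜 := ℂ)]
    conv_lhs => rw [hc]
    rw [inner_smul_left, ← hc, h, mul_zero]

/-- The degree 0 part is a constant, so both sides are multiples of the same square. Only
proportionality matters, and the value of the total area does not enter. -/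
lemma norm_proj_zero_sq_le : ∃ A : ℝ, 0 < A ∧ ∀ f : L2, ‖proj 0 f‖ ^ 2 ≤ A * meanSq f := by
  refine ⟨4 * Real.pi / ‖iotaL 1‖ ^ 2 + 1, by positivity, fun f => ?_⟩
  obtain ⟨c, hc⟩ := mem_Har_zero (proj_mem 0 f)
  have h1 := inner_one_proj f
  have hm : 0 ≤ meanSq f := by unfold meanSq; positivity
  rcases eq_or_ne (iotaL 1) 0 with h0 | h0
  · rw [hc, h0]; simp; positivity
  · have hpos : 0 < ‖iotaL 1‖ := norm_pos_iff.2 h0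
    rw [hc, inner_smul_right, inner_self_eq_norm_sq_to_K] at h1
    have h2 : ‖c‖ * ‖iotaL 1‖ ^ 2 = ‖∫ y, f y ∂area‖ := by
      rw [← h1]; simp
    have : ‖proj 0 f‖ ^ 2 = 4 * Real.pi / ‖iotaL 1‖ ^ 2 * meanSq f := by
      unfold meanSq
      rw [← h2, hc, norm_smul]
      field_simp
    rw [this, add_mul, one_mul]
    linarith

lemma jop_of_mem_Har_zero (a : Fin 3) {f : L2} (hf : f ∈ Har 0) {g : L2} (h : HasJ a f g) :
    g = 0 := by
  choose J _ hJ using fun a => exists_hasJ_of_mem_Har a hf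
  have h1 := sum_norm_sq_of_mem_Har hf hJ
  rw [mu, Nat.cast_zero, zero_mul, zero_mul] at h1
  have h2 := (Finset.sum_eq_zero_iff_of_nonneg (fun _ _ => by positivity)).1 h1 a (Finset.mem_univ a)
  rw [h.unique (hJ a)]
  simpa using h2

lemma proj_zero_jop {f : L2} (hf : Sob 1 f) (a : Fin 3) : proj 0 (Jop a f) = 0 :=
  jop_of_mem_Har_zero a (proj_mem 0 f) ((Sob.hasJ (m := 0) hf a).proj 0)

/-! ### Lower bounds for the Sobolev norms -/

lemma norm_Y_le (i : Fin 3) : ‖Y i‖ ≤ 1 := by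
  refine (ContinuousMap.norm_le _ zero_le_one).2 fun y => ?_
  have := sphere_sq y
  simp only [Y_apply, Complex.norm_real, Real.norm_eq_abs]
  rw [abs_le_one_iff_mul_self_le_one]
  fin_cases i <;> simp <;> nlinarith [sq_nonneg (y.1 0), sq_nonneg (y.1 1), sq_nonneg (y.1 2)]

lemma norm_Y_smul_le (i : Fin 3) (f : L2) : ‖Y i • f‖ ≤ ‖f‖ :=
  (norm_smulC_le _ _).trans (by nlinarith [norm_Y_le i, norm_nonneg f])

lemma norm_jop_sq_le {f : L2} (hf : Sob 1 f) (a : Fin 3) :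
    ‖Jop a f‖ ^ 2 ≤ 2 * ∑ i, ‖weakDeriv i f‖ ^ 2 := by
  have h1 : ‖Jop a f‖ ≤ ‖weakDeriv (a + 2) f‖ + ‖weakDeriv (a + 1) f‖ := by
    rw [Sob.jop_eq (m := 0) hf]
    exact (norm_sub_le _ _).trans (add_le_add (norm_Y_smul_le _ _) (norm_Y_smul_le _ _))
  have h2 : ‖Jop a f‖ ^ 2 ≤ 2 * (‖weakDeriv (a + 2) f‖ ^ 2 + ‖weakDeriv (a + 1) f‖ ^ 2) := by
    nlinarith [norm_nonneg (Jop a f), sq_nonneg (‖weakDeriv (a + 2) f‖ - ‖weakDeriv (a + 1) f‖)]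
  refine h2.trans ?_
  gcongr
  rw [Fin.sum_univ_three]
  fin_cases a <;> simp <;> nlinarith [sq_nonneg ‖weakDeriv 0 f‖, sq_nonneg ‖weakDeriv 1 f‖,
    sq_nonneg ‖weakDeriv 2 f‖]

lemma hasSum_mu_norm_sq {f : L2} (hf : Sob 1 f) :
    HasSum (fun k => mu k * ‖proj k f‖ ^ 2) (∑ a, ‖Jop a f‖ ^ 2) := by
  have h := hasSum_sum (s := Finset.univ) fun a (_ : a ∈ Finset.univ) => hasSum_norm_sq (Jop a f)
  convert h using 2 with k
  exact (sum_norm_sq_of_mem_Har (proj_mem k f) fun a => (Sob.hasJ (m := 0) hf a).proj k).symm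

/-- The weights `k + 1`. -/
def wt (k : ℕ) : ℂ := (k : ℂ) + 1

lemma norm_wt (k : ℕ) : ‖wt k‖ = (k : ℝ) + 1 := by
  unfold wt
  have : ((k : ℂ) + 1) = ((k + 1 : ℕ) : ℂ) := by push_cast; rfl
  rw [this, Complex.norm_natCast]; push_cast; rfl

lemma meanSq_nonneg (f : L2) : 0 ≤ meanSq f := by unfold meanSq; positivity

-- The mean controls degree 0, and (k + 1)² ≤ 2 k (k + 1) for k ≥ 1 gives the factors 2 and 4. Only
-- this direction is computed; the opposite bounds come from the closed graph theorem in `h1Sq_clm`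
-- and `h2Sq_clm`.
set_option maxHeartbeats 800000 in
lemma exists_wt_mult : ∃ C : ℝ, 0 < C ∧
    (∀ f, Sob 1 f → ∃ g, IsMult wt f g ∧ ‖g‖ ^ 2 ≤ C * h1Sq f) ∧
    (∀ f, Sob 2 f → ∃ g, IsMult (fun k => wt k ^ 2) f g ∧ ‖g‖ ^ 2 ≤ C * h2Sq f) := by
  obtain ⟨A, hA, hmean⟩ := norm_proj_zero_sq_le
  refine ⟨A + 12, by positivity, fun f hf => ?_, fun f hf => ?_⟩
  · have hsum : Summable fun k => ‖wt k‖ ^ 2 * ‖proj k f‖ ^ 2 := by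
      simp only [norm_wt]; simpa [Sob] using hf
    obtain ⟨g, hg, hn⟩ := exists_isMult hsum
    refine ⟨g, hg, ?_⟩
    have h0 := hasSum_single (f := fun k => if k = 0 then ‖proj k f‖ ^ 2 else 0) 0 (by
      intro k hk; simp [hk])
    simp only [if_true] at h0
    have hS := h0.add ((hasSum_mu_norm_sq hf).mul_left 2)
    have hle : ‖g‖ ^ 2 ≤ ‖proj 0 f‖ ^ 2 + 2 * ∑ a, ‖Jop a f‖ ^ 2 := by
      rw [hn, ← hS.tsum_eq]
      refine Summable.tsum_le_tsum (fun k => ?_) hsum hS.summable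
      rw [norm_wt]
      rcases Nat.eq_zero_or_pos k with rfl | hk
      · simp [mu]
      · rw [if_neg hk.ne', zero_add, ← mul_assoc]
        gcongr; exact le_mu k hk
    have h2 : ∑ a, ‖Jop a f‖ ^ 2 ≤ ∑ _a : Fin 3, 2 * ∑ i, ‖weakDeriv i f‖ ^ 2 :=
      Finset.sum_le_sum fun a _ => norm_jop_sq_le hf a
    rw [Finset.sum_const, Finset.card_univ, Fintype.card_fin, nsmul_eq_mul] at h2
    push_cast at h2
    unfold h1Sq
    have h3 : 0 ≤ ∑ i, ‖weakDeriv i f‖ ^ 2 := Finset.sum_nonneg fun _ _ => sq_nonneg _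
    have h4 := mul_nonneg hA.le h3
    generalize ∑ i, ‖weakDeriv i f‖ ^ 2 = S at *
    linarith [hmean f, meanSq_nonneg f]
  · have hsum : Summable fun k => ‖wt k ^ 2‖ ^ 2 * ‖proj k f‖ ^ 2 := by
      simp only [norm_pow, norm_wt]; unfold Sob at hf
      refine hf.congr fun k => ?_
      ring
    obtain ⟨g, hg, hn⟩ := exists_isMult hsum
    refine ⟨g, hg, ?_⟩
    have h0 := hasSum_single (f := fun k => if k = 0 then ‖proj k f‖ ^ 2 else 0) 0 (by
      intro k hk; simp [hk])
    simp only [if_true] at h0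
    have hS := h0.add ((hasSum_norm_sq (lapl f)).mul_left 4)
    have hle : ‖g‖ ^ 2 ≤ ‖proj 0 f‖ ^ 2 + 4 * ‖lapl f‖ ^ 2 := by
      rw [hn, ← hS.tsum_eq]
      refine Summable.tsum_le_tsum (fun k => ?_) hsum hS.summable
      rw [norm_pow, norm_wt, proj_lapl hf, norm_smul, norm_neg, Complex.norm_real, Real.norm_eq_abs,
        abs_of_nonneg (mu_nonneg k)]
      rcases Nat.eq_zero_or_pos k with rfl | hk
      · simp [mu]
      · rw [if_neg hk.ne', zero_add, mul_pow, ← mul_assoc]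
        gcongr
        have := le_mu k hk
        calc ((((k : ℝ) + 1) ^ 2) ^ 2) ≤ (2 * mu k) ^ 2 := by gcongr
          _ = _ := by ring
    unfold h2Sq
    have h4 := mul_nonneg hA.le (sq_nonneg ‖lapl f‖)
    linarith [hmean f, meanSq_nonneg f, sq_nonneg ‖lapl f‖]

/-! ### Derivatives of families are continuous -/

/-- The closed graph theorem: a weak derivative that exists on the whole range of a bounded operator
depends boundedly on the argument. This replaces explicit estimates of derivatives. -/
lemma exists_clm_of_closed {E : Type*} [NormedAddCommGroup E] [NormedSpace ℂ E] [CompleteSpace E]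
    (B : E →L[ℂ] L2) {r : L2 → L2 → Prop} (hc : IsClosed {p : L2 × L2 | r p.1 p.2})
    (hadd : ∀ {f g f' g'}, r f g → r f' g' → r (f + f') (g + g'))
    (hsmul : ∀ {f g} (c : ℂ), r f g → r (c • f) (c • g))
    (huniq : ∀ {f g g'}, r f g → r f g' → g = g')
    (h : ∀ u, ∃ g, r (B u) g) : ∃ B' : E →L[ℂ] L2, ∀ u, r (B u) (B' u) := by
  choose b hb using h
  let b' : E →ₗ[ℂ] L2 :=
    { toFun := b
      map_add' := fun u v => huniq (hb _) (by rw [map_add]; exact hadd (hb u) (hb v))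
      map_smul' := fun c u => huniq (hb _) (by rw [map_smul]; exact hsmul c (hb u)) }
  have hg : IsClosed (b'.graph : Set (E × L2)) := by
    have : (b'.graph : Set (E × L2)) = (fun p : E × L2 => (B p.1, p.2)) ⁻¹' {p | r p.1 p.2} := by
      ext ⟨u, g⟩
      simp only [SetLike.mem_coe, LinearMap.mem_graph_iff, Set.mem_preimage, Set.mem_ofPred_eq]
      constructor
      · intro hh; rw [hh]; exact hb u
      · intro hh; exact huniq hh (hb u)
    rw [this]
    exact hc.preimage (by fun_prop)
  exact ⟨ContinuousLinearMap.ofIsClosedGraph hg, fun u => hb u⟩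

lemma exists_clm_wd {E : Type*} [NormedAddCommGroup E] [NormedSpace ℂ E] [CompleteSpace E]
    (B : E →L[ℂ] L2) (h : ∀ u, Sob 1 (B u)) (i : Fin 3) :
    ∃ B' : E →L[ℂ] L2, ∀ u, B' u = weakDeriv i (B u) := by
  obtain ⟨B', hB⟩ := exists_clm_of_closed B (hasWeakDeriv_closed i) (fun h h' => h.add h')
    (fun c h => h.smul c) (fun h h' => h.unique h')
    (fun u => ⟨_, Sob.hasWeakDeriv (m := 0) (h u) i⟩)
  exact ⟨B', fun u => ((hB u).weakDeriv_eq).symm⟩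

lemma exists_clm_jop {E : Type*} [NormedAddCommGroup E] [NormedSpace ℂ E] [CompleteSpace E]
    (B : E →L[ℂ] L2) (h : ∀ u, Sob 1 (B u)) (i : Fin 3) :
    ∃ B' : E →L[ℂ] L2, ∀ u, B' u = Jop i (B u) := by
  obtain ⟨B', hB⟩ := exists_clm_of_closed B (hasJ_closed i) (fun h h' => h.add h')
    (fun c h => h.smul c) (fun h h' => h.unique h')
    (fun u => ⟨_, Sob.hasJ (m := 0) (h u) i⟩)
  exact ⟨B', fun u => ((hB u).Jop_eq).symm⟩

end LandauSphere
end

noncomputable section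
namespace LandauSphere

/-! ### Vector calculus on the sphere -/

lemma mulBy_eq {a : E3 → ℝ} {A : CS} (h : ∀ y : S2, A y = ((a y : ℝ) : ℂ)) (f : L2) :
    mulBy a f = A • f := by
  have hm : MemLp (fun y : S2 => ((a y.1 : ℝ) : ℂ) * f y) 2 area := by
    simpa only [h] using memLp_mul A f
  unfold mulBy
  rw [dif_pos hm]
  refine Lp.ext ?_
  filter_upwards [hm.coeFn_toLp, smulC_coe A f] with y h1 h2
  rw [h1, h2, h]

lemma mulBy_coord (i : Fin 3) (f : L2) : mulBy (coord i) f = Y i • f := mulBy_eq (fun _ => rfl) f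

lemma isTangent_iff (ξ : L2Vec) : IsTangent ξ ↔ ∑ i, Y i • ξ i = 0 := by
  have h : (∑ i, Y i • ξ i : L2) =ᵐ[area] fun y => ∑ i, ((y.1 i : ℝ) : ℂ) * ξ i y := by
    simp only [Fin.sum_univ_three]
    filter_upwards [Lp.coeFn_add (Y 0 • ξ 0 + Y 1 • ξ 1) (Y 2 • ξ 2),
      Lp.coeFn_add (Y 0 • ξ 0) (Y 1 • ξ 1), smulC_coe (Y 0) (ξ 0), smulC_coe (Y 1) (ξ 1),
      smulC_coe (Y 2) (ξ 2)] with y h1 h2 h3 h4 h5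
    rw [h1, Pi.add_apply, h2, Pi.add_apply, h3, h4, h5]
    simp
  unfold IsTangent
  rw [Lp.eq_zero_iff_ae_eq_zero]
  constructor
  · intro h1
    filter_upwards [h, h1] with y h2 h3
    rw [h2, h3]; rfl
  · intro h1
    filter_upwards [h, h1] with y h2 h3
    rw [← h2, h3]; rfl

lemma curl_eq {ξ : L2Vec} (h : ∀ i, Sob 1 (ξ i)) : curl ξ = ∑ k, Jop k (ξ k) := by
  unfold curl
  simp only [mulBy_coord, Fin.sum_univ_three, Sob.jop_eq (m := 0) (h _), Fin.isValue, Fin.reduceAdd]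
  module

lemma rot_eq (η : L2Vec) (i : Fin 3) : rot η i = Y (i + 1) • η (i + 2) - Y (i + 2) • η (i + 1) := by
  simp [rot, mulBy_coord]

lemma rot_grad {f : L2} (h : Sob 1 f) (i : Fin 3) : rot (grad f) i = Jop i f := by
  rw [rot_eq, Sob.jop_eq (m := 0) h]; rfl

/-- Written with rotations only, the second derivatives appear in commutators, and [J_a, J_{a+1}] =
-J_{a+2} turns everything into multiples of y · J f, which is zero. -/
lemma curl_grad_eq_zero {f : L2} (hf : Sob 2 f) : ∑ k, Jop k (weakDeriv k f) = 0 := by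
  have h1 : Sob 1 f := hf.mono_succ
  have hJ : ∀ a, Sob 1 (Jop a f) := fun a => hf.jop a
  have hY : ∀ j a, Sob 1 (Y j • Jop a f) := fun j a => (hJ a).smul_Y j
  have hs := sum_Y_smul_jop h1
  have hw : ∀ k, Jop k (weakDeriv k f) = Y (k + 2) • Jop k (Jop (k + 1) f)
      - Y (k + 1) • Jop k (Jop (k + 2) f) + Y (k + 1) • Jop (k + 1) f + Y (k + 2) • Jop (k + 2) f := by
    intro k
    rw [hf.wd_eq, jop_sub (hY _ _) (hY _ _), jop_Y_smul (hJ _), jop_Y_smul (hJ _)]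
    fin_cases k <;> simp <;> module
  have c0 : Jop 0 (Jop 1 f) - Jop 1 (Jop 0 f) = -Jop 2 f := jop_comm hf 0
  have c1 : Jop 1 (Jop 2 f) - Jop 2 (Jop 1 f) = -Jop 0 f := jop_comm hf 1
  have c2 : Jop 2 (Jop 0 f) - Jop 0 (Jop 2 f) = -Jop 1 f := jop_comm hf 2
  simp only [hw]
  simp only [Fin.sum_univ_three, Fin.isValue, Fin.reduceAdd] at hs ⊢
  linear_combination (norm := module) Y 2 • c0 + Y 0 • c1 + Y 1 • c2 + hs

lemma div_jop_eq_zero {f : L2} (hf : Sob 2 f) : ∑ k, weakDeriv k (Jop k f) = 0 := by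
  have h1 : Sob 1 f := hf.mono_succ
  have hJ : ∀ a, Sob 1 (Jop a f) := fun a => hf.jop a
  have hs := sum_Y_smul_jop h1
  have c0 : Jop 0 (Jop 1 f) - Jop 1 (Jop 0 f) = -Jop 2 f := jop_comm hf 0
  have c1 : Jop 1 (Jop 2 f) - Jop 2 (Jop 1 f) = -Jop 0 f := jop_comm hf 1
  have c2 : Jop 2 (Jop 0 f) - Jop 0 (Jop 2 f) = -Jop 1 f := jop_comm hf 2
  simp only [Sob.wd_eq (m := 0) (hJ _)]
  simp only [Fin.sum_univ_three, Fin.isValue, Fin.reduceAdd] at hs ⊢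
  linear_combination (norm := module) (-Y 2) • c0 - Y 0 • c1 - Y 1 • c2 + hs

/-! ### The Hodge decomposition of tangent fields -/

/-- The multiplier of the inverse Laplacian on functions of mean zero. -/
def invMu (k : ℕ) : ℂ := -(mu k : ℂ)⁻¹

lemma mu_pos {k : ℕ} (hk : k ≠ 0) : 0 < mu k := by
  have : (0 : ℝ) < k := by exact_mod_cast Nat.pos_of_ne_zero hk
  unfold mu; positivity

lemma norm_invMu_mul_le (k : ℕ) : ((k : ℝ) + 1) ^ 2 * ‖invMu k‖ ≤ 2 := by
  unfold invMu
  rw [norm_neg, norm_inv, Complex.norm_real, Real.norm_eq_abs, abs_of_nonneg (mu_nonneg k)]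
  rcases eq_or_ne k 0 with rfl | hk
  · simp [mu]
  · rw [← div_eq_mul_inv, div_le_iff₀ (mu_pos hk)]
    exact le_mu k (Nat.one_le_iff_ne_zero.2 hk)

lemma norm_invMu_le (k : ℕ) : ‖invMu k‖ ≤ 2 := by
  have h := norm_invMu_mul_le k
  have h1 : 1 ≤ ((k : ℝ) + 1) ^ 2 := one_le_pow₀ (by linarith [Nat.cast_nonneg (α := ℝ) k])
  nlinarith [norm_nonneg (invMu k)]

/-- The inverse Laplacian. -/
def invLap : L2 →L[ℂ] L2 := multL invMu

lemma proj_invLap (f : L2) (k : ℕ) : proj k (invLap f) = invMu k • proj k f :=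
  proj_multL norm_invMu_le f k

lemma Sob.invLap {m : ℕ} {f : L2} (h : Sob m f) : Sob (m + 2) (invLap f) := by
  unfold Sob at *
  refine Summable.of_nonneg_of_le (fun k => by positivity) (fun k => ?_) (h.mul_left 4)
  rw [proj_invLap, norm_smul]
  have h1 := pow_le_pow_left₀ (by positivity) (norm_invMu_mul_le k) 2
  calc ((k : ℝ) + 1) ^ (2 * (m + 2)) * (‖invMu k‖ * ‖LandauSphere.proj k f‖) ^ 2
      = (((k : ℝ) + 1) ^ 2 * ‖invMu k‖) ^ 2 * (((k : ℝ) + 1) ^ (2 * m) * ‖LandauSphere.proj k f‖ ^ 2) := by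
        ring
    _ ≤ 2 ^ 2 * (((k : ℝ) + 1) ^ (2 * m) * ‖LandauSphere.proj k f‖ ^ 2) := by gcongr
    _ = _ := by ring

lemma lapl_invLap (f : L2) : lapl (invLap f) = f - proj 0 f := by
  refine ext_proj fun k => ?_
  rw [proj_lapl (sob_zero f).invLap, proj_invLap, map_sub, proj_proj, smul_smul]
  -- In degree 0 the convention 0⁻¹ = 0 makes `invMu` vanish, so exactly the mean of f is lost.
  rcases eq_or_ne k 0 with rfl | hk
  · simp [mu]
  · rw [if_neg hk, sub_zero, invMu, neg_mul_neg, mul_inv_cancel₀, one_smul]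
    exact_mod_cast (mu_pos hk).ne'

lemma invLap_lapl {f : L2} (hf : Sob 2 f) : invLap (lapl f) = f - proj 0 f := by
  refine ext_proj fun k => ?_
  rw [proj_invLap, proj_lapl hf, map_sub, proj_proj, smul_smul]
  rcases eq_or_ne k 0 with rfl | hk
  · simp [mu]
  · rw [if_neg hk, sub_zero, invMu, neg_mul_neg, inv_mul_cancel₀, one_smul]
    exact_mod_cast (mu_pos hk).ne'

/-- The tangent field with given curl and divergence (of mean zero). -/
def field (c d : L2) : L2Vec := fun i => Jop i (invLap c) + weakDeriv i (invLap d)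

lemma sob_proj (m k : ℕ) (f : L2) : Sob m (proj k f) := by
  unfold Sob
  refine summable_of_ne_finset_zero (s := {k}) fun j hj => ?_
  rw [proj_proj, if_neg (by simpa using hj)]; simp

lemma sob_field {m : ℕ} {c d : L2} (hc : Sob m c) (hd : Sob m d) (i : Fin 3) :
    Sob (m + 1) (field c d i) :=
  (hc.invLap.jop i).add (hd.invLap.wd i)

lemma field_tangent (c d : L2) : ∑ i, Y i • field c d i = 0 := by
  simp only [field, smul_add, Finset.sum_add_distrib]
  rw [sum_Y_smul_jop (sob_zero c).invLap.mono_succ, sum_Y_smul_wd (sob_zero d).invLap.mono_succ,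
    add_zero]

lemma sob_field_one (c d : L2) (i : Fin 3) : Sob 1 (field c d i) := sob_field (sob_zero c) (sob_zero d) i

lemma curl_field (c d : L2) : curl (field c d) = c - proj 0 c := by
  have hc : Sob 2 (invLap c) := (sob_zero c).invLap
  have hd : Sob 2 (invLap d) := (sob_zero d).invLap
  rw [curl_eq (sob_field_one c d)]
  simp only [field, jop_add (hc.jop _) (hd.wd _), Finset.sum_add_distrib]
  rw [curl_grad_eq_zero hd, add_zero, ← lapl_eq hc, lapl_invLap]

lemma divg_field (c d : L2) : divg (field c d) = d - proj 0 d := by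
  have hc : Sob 2 (invLap c) := (sob_zero c).invLap
  have hd : Sob 2 (invLap d) := (sob_zero d).invLap
  unfold divg
  simp only [field, wd_add (hc.jop _) (hd.wd _), Finset.sum_add_distrib]
  rw [div_jop_eq_zero hc, zero_add, ← lapl_invLap]
  rfl

lemma field_add (c c' d d' : L2) : field (c + c') (d + d') = field c d + field c' d' := by
  have h : ∀ f : L2, Sob 1 (invLap f) := fun f => (sob_zero f).invLap.mono_succ
  funext i
  simp only [field, map_add, jop_add (h _) (h _), wd_add (h _) (h _), Pi.add_apply]
  abel

lemma field_smul (z : ℂ) (c d : L2) : field (z • c) (z • d) = z • field c d := by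
  have h : ∀ f : L2, Sob 1 (invLap f) := fun f => (sob_zero f).invLap.mono_succ
  funext i
  simp only [field, map_smul, jop_smul _ (h _), wd_smul _ (h _), Pi.smul_apply, smul_add]

lemma field_neg (c d : L2) : field (-c) (-d) = -field c d := by
  have := field_smul (-1) c d
  simpa using this

lemma wd_of_mem_Har_zero {f : L2} (hf : f ∈ Har 0) (i : Fin 3) : weakDeriv i f = 0 := by
  have h : ∀ a, HasJ a f 0 := fun a => by
    obtain ⟨g, -, hg⟩ := exists_hasJ_of_mem_Har a hf
    rwa [jop_of_mem_Har_zero a hf hg] at hg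
  have := (hasWeakDeriv_of_hasJ (g := fun _ => 0) i h).weakDeriv_eq
  simpa using this

lemma grad_eq_field {f : L2} (hf : Sob 2 f) : grad f = field 0 (lapl f) := by
  have h1 : Sob 1 f := hf.mono_succ
  have h0 : ∀ i, Jop i (0 : L2) = 0 := fun i => by simpa using jop_smul 0 (sob_zero_fun 1) i
  funext i
  simp only [field, map_zero, h0, zero_add, invLap_lapl hf]
  rw [wd_sub h1 (sob_proj _ _ _), wd_of_mem_Har_zero (proj_mem 0 f), sub_zero]
  rfl

lemma rot_grad_eq_field {f : L2} (hf : Sob 2 f) : rot (grad f) = field (lapl f) 0 := by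
  have h1 : Sob 1 f := hf.mono_succ
  funext i
  simp only [rot_grad h1, field, map_zero, wd_zero, add_zero, invLap_lapl hf]
  rw [jop_sub h1 (sob_proj _ _ _), jop_of_mem_Har_zero i (proj_mem 0 f)
    (Sob.hasJ (m := 0) (sob_proj _ _ _) i), sub_zero]

/-- Tested against the constant 1, the weak derivatives add up to the integral of 2 y · ξ, which is
zero for a tangent field. -/
lemma proj_zero_divg {ξ : L2Vec} (h : ∀ i, Sob 1 (ξ i)) (ht : ∑ i, Y i • ξ i = 0) :
    proj 0 (divg ξ) = 0 := by
  rw [proj_zero_eq_zero_iff, ← pair_one]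
  have h1 : ∀ i, pair 1 (weakDeriv i (ξ i)) = 2 * pair 1 (Y i • ξ i) := by
    intro i
    have c1 : ContDiff ℝ ∞ fun _ : E3 => (1 : ℂ) := contDiff_const
    have := (hasWeakDeriv_iff _ _ _).1 (Sob.hasWeakDeriv (m := 0) (h i) i) _ c1
    have e : res (fun _ : E3 => (1 : ℂ)) c1.continuous = 1 := by ext y; simp
    rw [e] at this
    rw [this, pair_smul, one_mul, two_mul, ← pair_add]
    congr 2
    ext y
    simp [tangDeriv, two_mul]
  unfold divg
  rw [map_sum]
  simp only [h1]
  rw [← Finset.mul_sum, ← map_sum, ht]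
  simp

lemma proj_zero_curl {ξ : L2Vec} (h : ∀ i, Sob 1 (ξ i)) : proj 0 (curl ξ) = 0 := by
  rw [curl_eq h, map_sum]
  exact Finset.sum_eq_zero fun i _ => proj_zero_jop (h i) i

/-- The vectorial identity `J × ξ = - ξ - (div ξ) y` for tangent fields. -/
lemma jop_cross {ξ : L2Vec} (h : ∀ i, Sob 1 (ξ i)) (ht : ∑ i, Y i • ξ i = 0) (i : Fin 3) :
    Jop (i + 1) (ξ (i + 2)) - Jop (i + 2) (ξ (i + 1)) = -ξ i - Y i • divg ξ := by
  have hY : ∀ j, Sob 1 (Y j • ξ j) := fun j => (h j).smul_Y j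
  -- The undifferentiated term -ξ_i comes from the derivatives of the coordinates in y · ξ = 0.
  have hd : weakDeriv i (∑ j, Y j • ξ j) = 0 := by rw [ht, wd_zero]
  rw [Fin.sum_univ_three, wd_add ((hY 0).add (hY 1)) (hY 2), wd_add (hY 0) (hY 1),
    wd_Y_smul (h 0), wd_Y_smul (h 1), wd_Y_smul (h 2)] at hd
  rw [Fin.sum_univ_three] at ht
  unfold divg
  simp only [Sob.jop_eq (m := 0) (h _), Fin.sum_univ_three]
  fin_cases i
  · simp only [Fin.isValue, Fin.zero_eta, Fin.reduceAdd, zero_add, zero_ne_one, if_true, if_false,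
      reduceCtorEq, Fin.reduceEq] at hd ⊢
    linear_combination (norm := module) hd + Y 0 • ht
  · simp only [Fin.isValue, Fin.mk_one, Fin.reduceAdd, one_ne_zero, if_true, if_false,
      reduceCtorEq, Fin.reduceEq] at hd ⊢
    linear_combination (norm := module) hd + Y 1 • ht
  · simp only [Fin.isValue, Fin.reduceFinMk, Fin.reduceAdd, if_true, if_false,
      reduceCtorEq, Fin.reduceEq] at hd ⊢
    linear_combination (norm := module) hd + Y 2 • ht

/-- The hypotheses say J · ξ = 0 and, by `jop_cross`, J × ξ = -ξ. Expanding J × (J × ξ) with the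
commutation relations and comparing with the Casimir operator gives k (k + 1) ξ_k = 0 for the part
ξ_k of degree k. In degree 0 all derivatives vanish, and J × ξ = -ξ itself gives ξ = 0. -/
lemma eq_zero_of_curl_divg {ξ : L2Vec} (h : ∀ i, Sob 1 (ξ i)) (ht : ∑ i, Y i • ξ i = 0)
    (hc : curl ξ = 0) (hd : divg ξ = 0) : ξ = 0 := by
  have hX : ∀ i, Jop (i + 1) (ξ (i + 2)) - Jop (i + 2) (ξ (i + 1)) = -ξ i := by
    intro i; rw [jop_cross h ht, hd]; simp
  rw [curl_eq h] at hc
  funext i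
  refine ext_proj fun k => ?_
  rw [Pi.zero_apply, map_zero]
  set x : Fin 3 → L2 := fun i => proj k (ξ i) with hx
  have hs : ∀ m i, Sob m (x i) := fun m i => sob_proj _ _ _
  have hJ : ∀ a i, proj k (Jop a (ξ i)) = Jop a (x i) := fun a i =>
    (((Sob.hasJ (m := 0) (h i) a).proj k).Jop_eq).symm
  have hx1 : ∀ i, Jop (i + 1) (x (i + 2)) - Jop (i + 2) (x (i + 1)) = -x i := by
    intro i
    have := congrArg (proj k) (hX i)
    rwa [map_sub, map_neg, hJ, hJ] at this
  have hc1 : ∑ a, Jop a (x a) = 0 := by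
    have := congrArg (proj k) hc
    simpa only [map_sum, map_zero, hJ] using this
  have hcas : ∀ i, ∑ a, Jop a (Jop a (x i)) = -(mu k : ℂ) • x i := by
    intro i
    refine ext_proj fun j => ?_
    rw [proj_cas (hs 2 i), map_smul, hx, proj_proj]
    split_ifs with hjk
    · rw [hjk]
    · simp
  have e0 : Jop 1 (x 2) - Jop 2 (x 1) = -x 0 := hx1 0
  have e1 : Jop 2 (x 0) - Jop 0 (x 2) = -x 1 := hx1 1
  have e2 : Jop 0 (x 1) - Jop 1 (x 0) = -x 2 := hx1 2
  have hJe : ∀ {f g l : L2} (a : Fin 3), Sob 1 f → Sob 1 g → Sob 1 l → f - g = -l →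
      Jop a f - Jop a g = -Jop a l := by
    intro f g l a hf hg hl hh
    rw [← jop_sub hf hg, hh, jop_neg hl]
  have hcJ : ∀ b : Fin 3, ∑ a, Jop b (Jop a (x a)) = 0 := by
    intro b
    have := congrArg (Jop b) hc1
    rw [Fin.sum_univ_three, jop_add (((hs 2 0).jop _).add ((hs 2 1).jop _)) ((hs 2 2).jop _),
      jop_add ((hs 2 0).jop _) ((hs 2 1).jop _)] at this
    rw [Fin.sum_univ_three, this]
    simpa using jop_smul 0 (sob_zero_fun 1) b
  have comm0 : ∀ i, Jop 0 (Jop 1 (x i)) - Jop 1 (Jop 0 (x i)) = -Jop 2 (x i) := fun i => jop_comm (hs 2 i) 0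
  have comm1 : ∀ i, Jop 1 (Jop 2 (x i)) - Jop 2 (Jop 1 (x i)) = -Jop 0 (x i) := fun i => jop_comm (hs 2 i) 1
  have comm2 : ∀ i, Jop 2 (Jop 0 (x i)) - Jop 0 (Jop 2 (x i)) = -Jop 1 (x i) := fun i => jop_comm (hs 2 i) 2
  have hmu : (mu k : ℂ) • x i = 0 := by
    have c := hcas i
    have hd := hcJ i
    rw [Fin.sum_univ_three] at c hd
    have q : ∀ a b : Fin 3, Sob 1 (Jop a (x b)) := fun a b => (hs 2 b).jop a
    fin_cases i
    · simp only [Fin.isValue, Fin.zero_eta] at c hd ⊢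
      have f1 := hJe 1 (q 0 1) (q 1 0) (hs 1 2) e2
      have f2 := hJe 2 (q 2 0) (q 0 2) (hs 1 1) e1
      linear_combination (norm := module) c - hd + comm0 1 - comm2 2 + f1 - f2
    · simp only [Fin.isValue, Fin.mk_one] at c hd ⊢
      have f1 := hJe 2 (q 1 2) (q 2 1) (hs 1 0) e0
      have f2 := hJe 0 (q 0 1) (q 1 0) (hs 1 2) e2
      linear_combination (norm := module) c - hd + comm1 2 - comm0 0 + f1 - f2
    · simp only [Fin.isValue, Fin.reduceFinMk] at c hd ⊢
      have f1 := hJe 0 (q 2 0) (q 0 2) (hs 1 1) e1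
      have f2 := hJe 1 (q 1 2) (q 2 1) (hs 1 0) e0
      linear_combination (norm := module) c - hd + comm2 0 - comm1 1 + f1 - f2
  rcases eq_or_ne k 0 with rfl | hk
  · have hz : ∀ a i, Jop a (x i) = 0 := fun a i =>
      jop_of_mem_Har_zero a (proj_mem 0 (ξ i)) (Sob.hasJ (m := 0) (hs 1 i) a)
    have := hx1 i
    rw [hz, hz, sub_zero] at this
    exact neg_eq_zero.1 this.symm
  · exact (smul_eq_zero.1 hmu).resolve_left (by exact_mod_cast (mu_pos hk).ne')

/-- Both fields are tangent and have the same curl and divergence, since these have mean zero;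
`eq_zero_of_curl_divg` applies to the difference. -/
lemma eq_field {ξ : L2Vec} (h : ∀ i, Sob 1 (ξ i)) (ht : ∑ i, Y i • ξ i = 0) :
    ξ = field (curl ξ) (divg ξ) := by
  set η := field (curl ξ) (divg ξ) with hη
  have hs : ∀ i, Sob 1 (η i) := sob_field_one _ _
  have hs' : ∀ i, Sob 1 ((ξ - η) i) := fun i => (h i).sub (hs i)
  have ht' : ∑ i, Y i • (ξ - η) i = 0 := by
    simp only [Pi.sub_apply, smul_sub, Finset.sum_sub_distrib]
    rw [ht, field_tangent, sub_zero]
  refine sub_eq_zero.1 (eq_zero_of_curl_divg hs' ht' ?_ ?_)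
  · rw [curl_eq hs']
    simp only [Pi.sub_apply, jop_sub (h _) (hs _), Finset.sum_sub_distrib]
    rw [← curl_eq h, ← curl_eq hs, hη, curl_field, proj_zero_curl h]; simp
  · unfold divg
    simp only [Pi.sub_apply, wd_sub (h _) (hs _), Finset.sum_sub_distrib]
    change divg ξ - divg η = 0
    rw [hη, divg_field, proj_zero_divg h ht]; simp

end LandauSphere
end

/-! ### Reduction of L₀ to triangular six by six matrices, one for each degree. -/

noncomputable section
namespace LandauSphere

/-! ### Matrices of multipliers -/

/-- Sextuples of square integrable functions. -/
abbrev V6 : Type := Fin 6 → L2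

/-- Six by six matrices. -/
abbrev M6 : Type := Matrix (Fin 6) (Fin 6) ℂ

/-- The entries of a sequence of matrices are bounded by `C`. -/
def EntryBound (M : ℕ → M6) (C : ℝ) : Prop := ∀ k i j, ‖M k i j‖ ≤ C

/-- The operator which acts as the matrix `M k` on the harmonics of degree `k`. -/
def opM (M : ℕ → M6) : V6 →L[ℂ] V6 :=
  ContinuousLinearMap.pi fun i =>
    ∑ j, (multL fun k => M k i j).comp (ContinuousLinearMap.proj j)

lemma proj_opM {M : ℕ → M6} {C : ℝ} (h : EntryBound M C) (u : V6) (k : ℕ) (i : Fin 6) :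
    proj k (opM M u i) = ∑ j, M k i j • proj k (u j) := by
  simp only [opM, ContinuousLinearMap.coe_pi', sum_apply, map_sum]
  exact Finset.sum_congr rfl fun j _ => proj_multL (fun k => h k i j) (u j) k

lemma EntryBound.nonneg {M : ℕ → M6} {C : ℝ} (h : EntryBound M C) : 0 ≤ C :=
  (norm_nonneg _).trans (h 0 0 0)

lemma norm_opM_le {M : ℕ → M6} {C : ℝ} (h : EntryBound M C) : ‖opM M‖ ≤ 6 * C := by
  have hC := h.nonneg
  refine ContinuousLinearMap.opNorm_le_bound _ (by positivity) fun u => ?_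
  rw [pi_norm_le_iff_of_nonneg (by positivity)]
  intro i
  simp only [opM, ContinuousLinearMap.coe_pi', sum_apply]
  calc ‖∑ j, (multL fun k => M k i j) (u j)‖ ≤ ∑ j : Fin 6, C * ‖u‖ := by
        refine norm_sum_le_of_le _ fun j _ => ?_
        refine (ContinuousLinearMap.le_opNorm _ _).trans ?_
        exact mul_le_mul (norm_multL_le fun k => h k i j) (norm_le_pi_norm u j) (norm_nonneg _) hC
    _ = _ := by simp; ring

lemma ext_V6 {u v : V6} (h : ∀ k i, proj k (u i) = proj k (v i)) : u = v :=
  funext fun i => ext_proj fun k => h k i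

lemma entryBound_one : EntryBound (fun _ => 1) 1 := by
  intro k i j
  change ‖(1 : M6) i j‖ ≤ 1
  rw [Matrix.one_apply]
  split_ifs <;> simp

lemma opM_one (u : V6) : opM (fun _ => 1) u = u := by
  refine ext_V6 fun k i => ?_
  rw [proj_opM entryBound_one]
  simp [Matrix.one_apply]

/-! ### The components of a state -/

/-- The potentials of a state: `(curl ξ, div ξ, curl ξ', div ξ', ϑ, ϑ*)`. -/
def comp (Ξ : State) : V6 :=
  ![curl Ξ.1, divg Ξ.1, curl Ξ.2.1, divg Ξ.2.1, Ξ.2.2.1, Ξ.2.2.2]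

/-- The state with given potentials. -/
def ofComp (x : V6) : State := (field (x 0) (x 1), field (x 2) (x 3), x 4, x 5)

/-- The orders of regularity of the potentials of the elements of `X`. -/
def ord : Fin 6 → ℕ := ![1, 1, 0, 0, 2, 1]

lemma mem_X_iff {Ξ : State} : Ξ ∈ X ↔ (∑ i, Y i • Ξ.1 i = 0) ∧ (∀ i, Sob 2 (Ξ.1 i)) ∧
    (∑ i, Y i • Ξ.2.1 i = 0) ∧ (∀ i, Sob 1 (Ξ.2.1 i)) ∧ Sob 2 Ξ.2.2.1 ∧ proj 0 Ξ.2.2.1 = 0 ∧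
    Sob 1 Ξ.2.2.2 := by
  simp only [X, Set.mem_ofPred_eq, isTangent_iff, memH_iff_sob, proj_zero_eq_zero_iff]

lemma mem_D_iff {Ξ : State} : Ξ ∈ D ↔ (∑ i, Y i • Ξ.1 i = 0) ∧ (∀ i, Sob 3 (Ξ.1 i)) ∧
    (∑ i, Y i • Ξ.2.1 i = 0) ∧ (∀ i, Sob 2 (Ξ.2.1 i)) ∧ Sob 3 Ξ.2.2.1 ∧ proj 0 Ξ.2.2.1 = 0 ∧
    Sob 2 Ξ.2.2.2 := by
  simp only [D, Set.mem_ofPred_eq, isTangent_iff, memH_iff_sob, proj_zero_eq_zero_iff]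

lemma D_subset_X : D ⊆ X := by
  intro Ξ h
  rw [mem_D_iff] at h
  rw [mem_X_iff]
  exact ⟨h.1, fun i => (h.2.1 i).mono_succ, h.2.2.1, fun i => (h.2.2.2.1 i).mono_succ,
    h.2.2.2.2.1.mono_succ, h.2.2.2.2.2.1, h.2.2.2.2.2.2.mono_succ⟩

lemma sob_curl {m : ℕ} {ξ : L2Vec} (h : ∀ i, Sob (m + 1) (ξ i)) : Sob m (curl ξ) := by
  rw [curl_eq fun i => (h i).mono (by omega)]
  exact Sob.sum fun i _ => (h i).jop i

lemma sob_divg {m : ℕ} {ξ : L2Vec} (h : ∀ i, Sob (m + 1) (ξ i)) : Sob m (divg ξ) :=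
  Sob.sum fun i _ => (h i).wd i

lemma sob_comp {Ξ : State} (h : Ξ ∈ X) (i : Fin 6) : Sob (ord i) (comp Ξ i) := by
  rw [mem_X_iff] at h
  obtain ⟨-, h1, -, h2, h3, -, h4⟩ := h
  fin_cases i
  · exact sob_curl h1
  · exact sob_divg h1
  · exact sob_curl h2
  · exact sob_divg h2
  · exact h3
  · exact h4

lemma sob_comp_D {Ξ : State} (h : Ξ ∈ D) (i : Fin 6) : Sob (ord i + 1) (comp Ξ i) := by
  rw [mem_D_iff] at h
  obtain ⟨-, h1, -, h2, h3, -, h4⟩ := h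
  fin_cases i
  · exact sob_curl h1
  · exact sob_divg h1
  · exact sob_curl h2
  · exact sob_divg h2
  · exact h3
  · exact h4

/-- Curls, divergences and ϑ have mean zero, so in degree 0 only ϑ* survives. The five dead modes
are the reason for the cut-off in `iwgt` and for `chiMat`. -/
lemma proj_zero_comp {Ξ : State} (h : Ξ ∈ X) (i : Fin 6) (hi : i ≠ 5) : proj 0 (comp Ξ i) = 0 := by
  rw [mem_X_iff] at h
  obtain ⟨t1, h1, t2, h2, h3, t3, h4⟩ := h
  have h1' : ∀ i, Sob 1 (Ξ.1 i) := fun i => (h1 i).mono_succ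
  fin_cases i
  · exact proj_zero_curl h1'
  · exact proj_zero_divg h1' t1
  · exact proj_zero_curl h2
  · exact proj_zero_divg h2 t2
  · exact t3
  · exact absurd rfl hi

lemma ofComp_comp {Ξ : State} (h : Ξ ∈ X) : ofComp (comp Ξ) = Ξ := by
  rw [mem_X_iff] at h
  obtain ⟨t1, h1, t2, h2, h3, t3, h4⟩ := h
  refine Prod.ext ?_ (Prod.ext ?_ rfl)
  · exact (eq_field (fun i => (h1 i).mono_succ) t1).symm
  · exact (eq_field h2 t2).symm

lemma comp_ofComp {x : V6} (h : ∀ i, i ≠ 5 → proj 0 (x i) = 0) : comp (ofComp x) = x := by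
  have e0 := h 0 (by decide)
  have e1 := h 1 (by decide)
  have e2 := h 2 (by decide)
  have e3 := h 3 (by decide)
  funext i
  fin_cases i
  · simp [comp, ofComp, curl_field, e0]
  · simp [comp, ofComp, divg_field, e1]
  · simp [comp, ofComp, curl_field, e2]
  · simp [comp, ofComp, divg_field, e3]
  · rfl
  · rfl

lemma ofComp_mem_X {x : V6} (h : ∀ i, Sob (ord i) (x i)) (h4 : proj 0 (x 4) = 0) : ofComp x ∈ X := by
  rw [mem_X_iff]
  exact ⟨field_tangent _ _, fun i => sob_field (h 0) (h 1) i, field_tangent _ _,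
    fun i => sob_field (h 2) (h 3) i, h 4, h4, h 5⟩

lemma ofComp_mem_D {x : V6} (h : ∀ i, Sob (ord i + 1) (x i)) (h4 : proj 0 (x 4) = 0) :
    ofComp x ∈ D := by
  rw [mem_D_iff]
  exact ⟨field_tangent _ _, fun i => sob_field (h 0) (h 1) i, field_tangent _ _,
    fun i => sob_field (h 2) (h 3) i, h 4, h4, h 5⟩

/-! ### `L₀` in terms of the potentials -/

/-- The potentials of `L₀ Ξ`, in terms of those of `Ξ`. -/
def l0Comp (x : V6) : V6 :=
  ![-x 2, -x 3, -x 2 + lapl (x 0), -x 3 + lapl ((2 : ℂ) • x 1 + (3 : ℂ) • x 4 + x 5),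
    x 1 + x 4, -((2 : ℂ) • x 5) - (3 : ℂ) • x 1 - (3 : ℂ) • x 4 + lapl (x 4)]

lemma lapl_add {f g : L2} (hf : Sob 2 f) (hg : Sob 2 g) : lapl (f + g) = lapl f + lapl g := by
  unfold lapl
  simp only [wd_add hf.mono_succ hg.mono_succ, wd_add (hf.wd _) (hg.wd _), Finset.sum_add_distrib]

lemma lapl_smul {f : L2} (c : ℂ) (hf : Sob 2 f) : lapl (c • f) = c • lapl f := by
  unfold lapl
  simp only [wd_smul c hf.mono_succ, wd_smul c (hf.wd _), Finset.smul_sum]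

/-- Gradients and rotated gradients do not mix: ∇f has divergence Δf and no curl, its rotation has
curl Δf and no divergence (`grad_eq_field`, `rot_grad_eq_field`). It remains to insert q = -(div ξ +
ϑ + ϑ*). -/
lemma opL0_eq {Ξ : State} (h : Ξ ∈ D) : opL0 Ξ = ofComp (l0Comp (comp Ξ)) := by
  have hX := D_subset_X h
  have hs := sob_comp_D h
  rw [mem_D_iff] at h
  obtain ⟨t1, h1, t2, h2, h3, t3, h4⟩ := h
  have e1 := eq_field (fun i => (h2 i).mono_succ) t2
  have s0 : Sob 2 (curl Ξ.1) := hs 0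
  have s1 : Sob 2 (divg Ξ.1) := hs 1
  have s4 : Sob 3 Ξ.2.2.1 := hs 4
  have s5 : Sob 2 Ξ.2.2.2 := hs 5
  have hq : Sob 2 (pressure Ξ) := ((s1.add s4.mono_succ).add s5).neg
  have hq2 : Sob 2 (pressure Ξ - (2 : ℂ) • Ξ.2.2.1) := hq.sub (s4.mono_succ.smul 2)
  refine Prod.ext ?_ (Prod.ext ?_ (Prod.ext ?_ ?_))
  · change -Ξ.2.1 = field (-curl Ξ.2.1) (-divg Ξ.2.1)
    rw [field_neg, ← e1]
  · change -Ξ.2.1 + (grad (divg Ξ.1) + rot (grad (curl Ξ.1))) - grad (pressure Ξ - (2 : ℂ) • Ξ.2.2.1)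
      = field (-curl Ξ.2.1 + lapl (curl Ξ.1))
          (-divg Ξ.2.1 + lapl ((2 : ℂ) • divg Ξ.1 + (3 : ℂ) • Ξ.2.2.1 + Ξ.2.2.2))
    have e2 : lapl ((2 : ℂ) • divg Ξ.1 + (3 : ℂ) • Ξ.2.2.1 + Ξ.2.2.2)
        = lapl (divg Ξ.1) + -lapl (pressure Ξ - (2 : ℂ) • Ξ.2.2.1) := by
      rw [← neg_one_smul ℂ (lapl (pressure Ξ - _)), ← lapl_smul _ hq2, ← lapl_add s1 (hq2.smul _)]
      congr 1
      unfold pressure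
      module
    rw [e2, grad_eq_field s1, grad_eq_field hq2, rot_grad_eq_field s0, field_add, field_neg, ← e1]
    have e3 : field (lapl (curl Ξ.1)) (lapl (divg Ξ.1) + -lapl (pressure Ξ - (2 : ℂ) • Ξ.2.2.1))
        = field 0 (lapl (divg Ξ.1)) + field (lapl (curl Ξ.1)) 0
          - field 0 (lapl (pressure Ξ - (2 : ℂ) • Ξ.2.2.1)) := by
      generalize lapl (pressure Ξ - (2 : ℂ) • Ξ.2.2.1) = p
      rw [sub_eq_add_neg, ← field_neg, ← field_add, ← field_add]
      simp
    rw [e3]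
    abel
  · change -Ξ.2.2.2 - pressure Ξ = divg Ξ.1 + Ξ.2.2.1
    unfold pressure
    abel
  · change Ξ.2.2.2 + (3 : ℂ) • pressure Ξ + lapl Ξ.2.2.1 =
      -((2 : ℂ) • Ξ.2.2.2) - (3 : ℂ) • divg Ξ.1 - (3 : ℂ) • Ξ.2.2.1 + lapl Ξ.2.2.1
    unfold pressure
    module

/-! ### The weighted parametrization of `X` -/

/-- The weights which turn the potentials of the elements of `X` into square integrable
functions. -/
def wgt : Fin 6 → ℕ → ℂ :=
  ![wt, wt, fun _ => 1, fun _ => 1, fun k => wt k ^ 2, wt]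

/-- The inverse weights, cut off where the potentials of the elements of `X` vanish. -/
def iwgt (i : Fin 6) (k : ℕ) : ℂ := if k = 0 ∧ i ≠ 5 then 0 else (wgt i k)⁻¹

lemma norm_wgt (i : Fin 6) (k : ℕ) : ‖wgt i k‖ = ((k : ℝ) + 1) ^ ord i := by
  fin_cases i <;> simp [wgt, ord, norm_wt]

lemma wgt_ne_zero (i : Fin 6) (k : ℕ) : wgt i k ≠ 0 := by
  rw [← norm_ne_zero_iff, norm_wgt]; positivity

lemma norm_iwgt_mul_le (i : Fin 6) (k : ℕ) : ((k : ℝ) + 1) ^ ord i * ‖iwgt i k‖ ≤ 1 := by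
  unfold iwgt
  split_ifs
  · simp
  · rw [norm_inv, norm_wgt, mul_inv_cancel₀ (by positivity)]

lemma norm_iwgt_le (i : Fin 6) (k : ℕ) : ‖iwgt i k‖ ≤ 1 := by
  refine le_trans ?_ (norm_iwgt_mul_le i k)
  exact le_mul_of_one_le_left (norm_nonneg _)
    (one_le_pow₀ (by linarith [Nat.cast_nonneg (α := ℝ) k]))

/-- The potentials with given weighted potentials. -/
def pot (i : Fin 6) : V6 →L[ℂ] L2 := (multL (iwgt i)).comp (ContinuousLinearMap.proj i)

lemma proj_pot (i : Fin 6) (v : V6) (k : ℕ) : proj k (pot i v) = iwgt i k • proj k (v i) :=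
  proj_multL (norm_iwgt_le i) (v i) k

lemma proj_zero_pot (i : Fin 6) (hi : i ≠ 5) (v : V6) : proj 0 (pot i v) = 0 := by
  rw [proj_pot]; simp [iwgt, hi]

lemma sob_pot {m : ℕ} {i : Fin 6} {v : V6} (h : Sob m (v i)) : Sob (ord i + m) (pot i v) := by
  unfold Sob at *
  refine Summable.of_nonneg_of_le (fun k => by positivity) (fun k => ?_) h
  rw [proj_pot, norm_smul]
  have h1 := pow_le_pow_left₀ (by positivity) (norm_iwgt_mul_le i k) 2
  calc ((k : ℝ) + 1) ^ (2 * (ord i + m)) * (‖iwgt i k‖ * ‖proj k (v i)‖) ^ 2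
      = (((k : ℝ) + 1) ^ ord i * ‖iwgt i k‖) ^ 2 * (((k : ℝ) + 1) ^ (2 * m) * ‖proj k (v i)‖ ^ 2) := by
        rw [mul_add, pow_add, mul_comm 2 (ord i), pow_mul]; ring
    _ ≤ 1 ^ 2 * (((k : ℝ) + 1) ^ (2 * m) * ‖proj k (v i)‖ ^ 2) := by gcongr
    _ = _ := by ring

lemma exists_clm_field {E : Type*} [NormedAddCommGroup E] [NormedSpace ℂ E] [CompleteSpace E]
    (B B' : E →L[ℂ] L2) : ∃ F : E →L[ℂ] L2Vec, ∀ u, F u = field (B u) (B' u) := by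
  choose J hJ using exists_clm_jop (invLap.comp B) (fun u => (sob_zero _).invLap.mono_succ)
  choose W hW using exists_clm_wd (invLap.comp B') (fun u => (sob_zero _).invLap.mono_succ)
  refine ⟨ContinuousLinearMap.pi fun i => J i + W i, fun u => ?_⟩
  funext i
  simp [hJ, hW, field]

lemma exists_wparam : ∃ T : V6 →L[ℂ] State, ∀ v, T v = ofComp fun i => pot i v := by
  obtain ⟨F, hF⟩ := exists_clm_field (pot 0) (pot 1)
  obtain ⟨G, hG⟩ := exists_clm_field (pot 2) (pot 3)
  refine ⟨F.prod (G.prod ((pot 4).prod (pot 5))), fun v => ?_⟩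
  simp [hF, hG, ofComp]

/-- The states with given weighted potentials. -/
def wparam : V6 →L[ℂ] State := exists_wparam.choose

lemma wparam_eq (v : V6) : wparam v = ofComp fun i => pot i v := exists_wparam.choose_spec v

lemma comp_wparam (v : V6) (i : Fin 6) : comp (wparam v) i = pot i v := by
  rw [wparam_eq, comp_ofComp fun i hi => proj_zero_pot i hi v]

lemma wparam_mem_X (v : V6) : wparam v ∈ X := by
  rw [wparam_eq]
  exact ofComp_mem_X (fun i => sob_pot (m := 0) (sob_zero _)) (proj_zero_pot 4 (by decide) v)

lemma wparam_mem_D {v : V6} (h : ∀ i, Sob 1 (v i)) : wparam v ∈ D := by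
  rw [wparam_eq]
  exact ofComp_mem_D (fun i => sob_pot (m := 1) (h i)) (proj_zero_pot 4 (by decide) v)

lemma wparam_of_isMult {Ξ : State} (h : Ξ ∈ X) {v : V6} (hv : ∀ i, IsMult (wgt i) (comp Ξ i) (v i)) :
    wparam v = Ξ := by
  rw [wparam_eq, ← ofComp_comp h]
  congr 1
  refine ext_V6 fun k i => ?_
  rw [proj_pot, hv i k, smul_smul]
  unfold iwgt
  split_ifs with hk
  · rw [hk.1, proj_zero_comp h i hk.2, smul_zero]
  · rw [inv_mul_cancel₀ (wgt_ne_zero i k), one_smul]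

lemma meanSq_clm {E : Type*} [NormedAddCommGroup E] [NormedSpace ℂ E] (B : E →L[ℂ] L2) :
    ∃ C : ℝ, 0 ≤ C ∧ ∀ u, meanSq (B u) ≤ C * ‖u‖ ^ 2 := by
  refine ⟨‖(pair 1).comp B‖ ^ 2 / (4 * Real.pi), by positivity, fun u => ?_⟩
  unfold meanSq
  rw [← pair_one, div_mul_eq_mul_div, ← mul_pow]
  gcongr
  exact ((pair 1).comp B).le_opNorm u

lemma norm_sq_clm {E : Type*} [NormedAddCommGroup E] [NormedSpace ℂ E] (B : E →L[ℂ] L2) (u : E) :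
    ‖B u‖ ^ 2 ≤ ‖B‖ ^ 2 * ‖u‖ ^ 2 := by
  rw [← mul_pow]; gcongr; exact B.le_opNorm u

lemma h1Sq_clm {E : Type*} [NormedAddCommGroup E] [NormedSpace ℂ E] [CompleteSpace E]
    (B : E →L[ℂ] L2) (h : ∀ u, Sob 1 (B u)) : ∃ C : ℝ, 0 ≤ C ∧ ∀ u, h1Sq (B u) ≤ C * ‖u‖ ^ 2 := by
  obtain ⟨C, hC, hm⟩ := meanSq_clm B
  choose W hW using exists_clm_wd B h
  refine ⟨C + ∑ i, ‖W i‖ ^ 2, by positivity, fun u => ?_⟩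
  unfold h1Sq
  rw [add_mul, Finset.sum_mul]
  refine add_le_add (hm u) (Finset.sum_le_sum fun i _ => ?_)
  rw [← hW]; exact norm_sq_clm _ _

lemma h2Sq_clm {E : Type*} [NormedAddCommGroup E] [NormedSpace ℂ E] [CompleteSpace E]
    (B : E →L[ℂ] L2) (h : ∀ u, Sob 2 (B u)) : ∃ C : ℝ, 0 ≤ C ∧ ∀ u, h2Sq (B u) ≤ C * ‖u‖ ^ 2 := by
  obtain ⟨C, hC, hm⟩ := meanSq_clm B
  choose W hW using exists_clm_wd B (fun u => (h u).mono_succ)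
  have hWs : ∀ i u, Sob 1 (W i u) := fun i u => by rw [hW]; exact (h u).wd i
  choose Z hZ using fun i => exists_clm_wd (W i) (hWs i) i
  refine ⟨C + ‖∑ i, Z i‖ ^ 2, by positivity, fun u => ?_⟩
  unfold h2Sq
  rw [add_mul]
  have : lapl (B u) = (∑ i, Z i) u := by
    rw [sum_apply]
    exact Finset.sum_congr rfl fun i _ => by rw [hZ, hW]
  rw [this]
  exact add_le_add (hm u) (norm_sq_clm _ _)

lemma xNorm_wparam_le : ∃ C : ℝ, 0 < C ∧ ∀ v, xNorm (wparam v) ≤ C * ‖v‖ := by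
  have hs : ∀ i v, Sob (ord i) (pot i v) := fun i v => sob_pot (m := 0) (sob_zero _)
  obtain ⟨C0, h0, H0⟩ := h1Sq_clm (pot 0) (hs 0)
  obtain ⟨C1, h1, H1⟩ := h1Sq_clm (-pot 1) (fun v => (hs 1 v).neg)
  obtain ⟨C4, h4, H4⟩ := h2Sq_clm (pot 4) (hs 4)
  obtain ⟨C5, h5, H5⟩ := h1Sq_clm (pot 5) (hs 5)
  set S := C0 + C1 + ‖pot 2‖ ^ 2 + ‖-pot 3‖ ^ 2 + C4 + C5 with hS
  have hS0 : 0 ≤ S := by positivity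
  refine ⟨Real.sqrt S + 1, by positivity, fun v => ?_⟩
  have e0 : curl (wparam v).1 = pot 0 v := comp_wparam v 0
  have e1 : dstar (wparam v).1 = (-pot 1) v := congrArg Neg.neg (comp_wparam v 1)
  have e2 : curl (wparam v).2.1 = pot 2 v := comp_wparam v 2
  have e3 : dstar (wparam v).2.1 = (-pot 3) v := congrArg Neg.neg (comp_wparam v 3)
  have e4 : (wparam v).2.2.1 = pot 4 v := comp_wparam v 4
  have e5 : (wparam v).2.2.2 = pot 5 v := comp_wparam v 5
  unfold xNorm
  rw [e0, e1, e2, e3, e4, e5]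
  have hle : h1Sq (pot 0 v) + h1Sq ((-pot 1) v) + ‖pot 2 v‖ ^ 2 + ‖(-pot 3) v‖ ^ 2 + h2Sq (pot 4 v)
      + h1Sq (pot 5 v) ≤ S * ‖v‖ ^ 2 := by
    rw [hS]
    linarith [H0 v, H1 v, H4 v, H5 v, norm_sq_clm (pot 2) v, norm_sq_clm (-pot 3) v]
  calc _ ≤ Real.sqrt (S * ‖v‖ ^ 2) := Real.sqrt_le_sqrt hle
    _ = Real.sqrt S * ‖v‖ := by rw [Real.sqrt_mul hS0, Real.sqrt_sq (norm_nonneg _)]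
    _ ≤ _ := by linarith [norm_nonneg v]

lemma h1Sq_nonneg (f : L2) : 0 ≤ h1Sq f :=
  add_nonneg (meanSq_nonneg f) (Finset.sum_nonneg fun _ _ => sq_nonneg _)

lemma h2Sq_nonneg (f : L2) : 0 ≤ h2Sq f := add_nonneg (meanSq_nonneg f) (sq_nonneg _)

lemma h1Sq_neg {f : L2} (h : Sob 1 f) : h1Sq (-f) = h1Sq f := by
  unfold h1Sq meanSq
  simp only [← pair_one, map_neg, norm_neg, wd_neg h]

/-- Together with `xNorm_wparam_le`, this makes the norm of X equivalent to the L² norm of the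
weighted potentials. -/
lemma exists_weighted : ∃ C : ℝ, 0 < C ∧ ∀ Ξ ∈ X, ∃ v : V6,
    (∀ i, IsMult (wgt i) (comp Ξ i) (v i)) ∧ ‖v‖ ≤ C * xNorm Ξ := by
  obtain ⟨C, hC, H1, H2⟩ := exists_wt_mult
  refine ⟨Real.sqrt (C + 1), by positivity, fun Ξ h => ?_⟩
  have hs := sob_comp h
  have hN : xNorm Ξ ^ 2 = h1Sq (curl Ξ.1) + h1Sq (dstar Ξ.1) + ‖curl Ξ.2.1‖ ^ 2 +
      ‖dstar Ξ.2.1‖ ^ 2 + h2Sq Ξ.2.2.1 + h1Sq Ξ.2.2.2 := by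
    unfold xNorm
    refine Real.sq_sqrt ?_
    have a1 := h1Sq_nonneg (curl Ξ.1)
    have a2 := h1Sq_nonneg (dstar Ξ.1)
    have a3 := h2Sq_nonneg Ξ.2.2.1
    have a4 := h1Sq_nonneg Ξ.2.2.2
    positivity
  have a1 := h1Sq_nonneg (curl Ξ.1)
  have a2 := h1Sq_nonneg (dstar Ξ.1)
  have a3 := h2Sq_nonneg Ξ.2.2.1
  have a4 := h1Sq_nonneg Ξ.2.2.2
  have a5 := sq_nonneg ‖curl Ξ.2.1‖
  have a6 := sq_nonneg ‖dstar Ξ.2.1‖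
  have e1 : h1Sq (dstar Ξ.1) = h1Sq (divg Ξ.1) := h1Sq_neg (hs 1)
  have e3 : ‖dstar Ξ.2.1‖ = ‖divg Ξ.2.1‖ := norm_neg _
  have hex : ∀ i, ∃ g, IsMult (wgt i) (comp Ξ i) g ∧ ‖g‖ ^ 2 ≤ (C + 1) * xNorm Ξ ^ 2 := by
    intro i
    have key : ∀ {f : L2} {x : ℝ}, ‖f‖ ^ 2 ≤ C * x → 0 ≤ x → x ≤ xNorm Ξ ^ 2 →
        ‖f‖ ^ 2 ≤ (C + 1) * xNorm Ξ ^ 2 := fun hf hx hxN => by nlinarith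
    have key' : ∀ {f : L2}, ‖f‖ ^ 2 ≤ xNorm Ξ ^ 2 → ‖f‖ ^ 2 ≤ (C + 1) * xNorm Ξ ^ 2 :=
      fun hf => by nlinarith [sq_nonneg (xNorm Ξ)]
    fin_cases i
    · obtain ⟨g, hg, hn⟩ := H1 _ (hs 0)
      exact ⟨g, hg, key hn a1 (by rw [hN]; change h1Sq (curl Ξ.1) ≤ _; linarith)⟩
    · obtain ⟨g, hg, hn⟩ := H1 _ (hs 1)
      exact ⟨g, hg, key hn (h1Sq_nonneg _) (by rw [hN]; change h1Sq (divg Ξ.1) ≤ _; linarith)⟩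
    · exact ⟨curl Ξ.2.1, fun k => (one_smul ℂ _).symm, key' (by rw [hN]; linarith)⟩
    · exact ⟨divg Ξ.2.1, fun k => (one_smul ℂ _).symm, key' (by rw [hN, ← e3]; linarith)⟩
    · obtain ⟨g, hg, hn⟩ := H2 _ (hs 4)
      exact ⟨g, hg, key hn a3 (by rw [hN]; change h2Sq Ξ.2.2.1 ≤ _; linarith)⟩
    · obtain ⟨g, hg, hn⟩ := H1 _ (hs 5)
      exact ⟨g, hg, key hn a4 (by rw [hN]; change h1Sq Ξ.2.2.2 ≤ _; linarith)⟩
  choose v hv hn using hex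
  refine ⟨v, hv, ?_⟩
  have hx : 0 ≤ xNorm Ξ := Real.sqrt_nonneg _
  rw [pi_norm_le_iff_of_nonneg (by positivity)]
  intro i
  refine (pow_le_pow_iff_left₀ (norm_nonneg _) (by positivity) two_ne_zero).1 ?_
  rw [mul_pow, Real.sq_sqrt (by positivity)]
  exact hn i

end LandauSphere
end

noncomputable section
namespace LandauSphere

/-! ### Diagonalization of `L₀` -/

/-- The action of a matrix on sextuples. -/
def act (M : M6) (x : V6) : V6 := fun i => ∑ j, M i j • x j

lemma act_mul (M N : M6) (x : V6) : act (M * N) x = act M (act N x) := by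
  funext i
  simp only [act, Matrix.mul_apply, Finset.smul_sum, Finset.sum_smul, smul_smul]
  exact Finset.sum_comm

lemma act_one (x : V6) : act 1 x = x := by
  funext i; simp [act, Matrix.one_apply]

/-- The components of degree `k` of a sextuple. -/
def projV (k : ℕ) (u : V6) : V6 := fun i => proj k (u i)

lemma projV_opM {M : ℕ → M6} {C : ℝ} (h : EntryBound M C) (u : V6) (k : ℕ) :
    projV k (opM M u) = act (M k) (projV k u) :=
  funext fun i => proj_opM h u k i

lemma ext_projV {u v : V6} (h : ∀ k, projV k u = projV k v) : u = v :=
  ext_V6 fun k i => congrFun (h k) i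

/-- The matrix of `L₀` in the weighted potentials. -/
def lMat (k : ℕ) : M6 :=
  !![0, 0, -((k : ℂ) + 1), 0, 0, 0;
     0, 0, 0, -((k : ℂ) + 1), 0, 0;
     -(k : ℂ), 0, -1, 0, 0, 0;
     0, -(2 * (k : ℂ)), 0, -1, -(3 * (k : ℂ) / (k + 1)), -(k : ℂ);
     0, (k : ℂ) + 1, 0, 0, 1, 0;
     0, -3, 0, 0, -((3 + (k : ℂ) * (k + 1)) / (k + 1)), -2]

/-- The functions of the operator with matrix `nMat id`. -/
def nMat (g : ℤ → ℂ) (k : ℕ) : M6 :=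
  !![g k, 0, 0, 0, 0, 0;
     0, g (-k - 1), 0, 0, 0, 0;
     0, 0, g (k + 1), ((k : ℂ) + 1) / 2 * (g (k + 1) - g (k - 1)), 0, 0;
     0, 0, 0, g (k - 1), 0, 0;
     0, 0, 0, 0, g (-k), (k : ℂ) / 2 * (g (-k - 2) - g (-k));
     0, 0, 0, 0, 0, g (-k - 2)]

/-- The matrix with the single entry `c`, in the last place. -/
def lastMat (c : ℂ) : M6 :=
  !![0, 0, 0, 0, 0, 0; 0, 0, 0, 0, 0, 0; 0, 0, 0, 0, 0, 0; 0, 0, 0, 0, 0, 0; 0, 0, 0, 0, 0, 0;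
     0, 0, 0, 0, 0, c]

/-- The change of basis in degrees `k ≥ 1`. -/
def sMat1 (k : ℕ) : M6 :=
  !![1, 1, 0, 0, 0, 0;
     0, 0, (k : ℂ) / (k + 1), 1, -1, -((k : ℂ) / (k + 1));
     -((k : ℂ) / (k + 1)), 1, 0, 0, 0, 0;
     0, 0, -((k : ℂ) / (k + 1)), (1 - 2 * (k : ℂ)) / (k + 1), -((k : ℂ) / (k + 1)),
       -((k : ℂ) / (k + 1) * ((2 * (k : ℂ) + 3) / (k + 1)));
     0, 0, 1, 0, 1, 0;
     0, 0, -1, ((k : ℂ) - 2) / (k + 1), (k : ℂ) / (k + 1), -(((k : ℂ) + 3) / (k + 1))]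

/-- The inverse change of basis in degrees `k ≥ 1`, in terms of the five fractions in it. -/
def siMatAux (r s p t q : ℂ) : M6 :=
  !![r, 0, -r, 0, 0, 0;
     s, 0, r, 0, 0, 0;
     0, r - r * p * r - s * r * q, 0, r * r * t - s * r * q, r + r * p * s - s * r * q,
       -(r * p * r) - s * r * q;
     0, p * r, 0, -(r * t), -(p * s), p * r;
     0, -(r - r * p * r - s * r * q), 0, -(r * r * t - s * r * q), 1 - (r + r * p * s - s * r * q),
       r * p * r + s * r * q;
     0, -(r * q), 0, -(r * q), -(r * q), -(r * q)]

/-- The inverse change of basis in degrees `k ≥ 1`. -/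
def siMat1 (k : ℕ) : M6 :=
  siMatAux (((k : ℂ) + 1) / (2 * k + 1)) ((k : ℂ) / (2 * k + 1)) ((k : ℂ) / (2 * k - 1))
    (((k : ℂ) + 1) / (2 * k - 1)) (((k : ℂ) + 1) / (2 * k + 3))

/-- The change of basis which brings `L₀` to triangular form. -/
def sMat (k : ℕ) : M6 := if k = 0 then lastMat (-3) else sMat1 k

/-- The inverse change of basis. -/
def siMat (k : ℕ) : M6 := if k = 0 then lastMat (-(1 / 3)) else siMat1 k

/-- The projection to the effective modes. -/
def chiMat (k : ℕ) : M6 := if k = 0 then lastMat 1 else 1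

lemma denominators (k : ℕ) :
    (k : ℂ) + 1 ≠ 0 ∧ 2 * (k : ℂ) + 1 ≠ 0 ∧ 2 * (k : ℂ) - 1 ≠ 0 ∧ 2 * (k : ℂ) + 3 ≠ 0 := by
  refine ⟨by exact_mod_cast Nat.succ_ne_zero k, by exact_mod_cast Nat.succ_ne_zero (2 * k), ?_,
    by exact_mod_cast Nat.succ_ne_zero (2 * k + 2)⟩
  have : (2 * (k : ℤ) - 1) ≠ 0 := by omega
  exact_mod_cast this

set_option maxHeartbeats 1600000 in
lemma sMat1_mul_siMat1 (k : ℕ) : sMat1 k * siMat1 k = 1 := by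
  obtain ⟨h1, h2, h3, h4⟩ := denominators k
  ext i j
  rw [Matrix.mul_apply, Fin.sum_univ_six]
  rw [mul_comm] at h2 h3 h4
  fin_cases i <;> fin_cases j <;> simp [sMat1, siMat1, siMatAux] <;> field_simp <;> ring

lemma siMat1_mul_sMat1 (k : ℕ) : siMat1 k * sMat1 k = 1 :=
  mul_eq_one_comm.1 (sMat1_mul_siMat1 k)

lemma lastMat_mul (c d : ℂ) : lastMat c * lastMat d = lastMat (c * d) := by
  ext i j
  rw [Matrix.mul_apply, Fin.sum_univ_six]
  fin_cases i <;> fin_cases j <;> simp [lastMat]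

lemma sMat_mul_siMat (k : ℕ) : sMat k * siMat k = chiMat k := by
  unfold sMat siMat chiMat
  split_ifs
  · rw [lastMat_mul]; norm_num
  · exact sMat1_mul_siMat1 k

lemma siMat_mul_sMat (k : ℕ) : siMat k * sMat k = chiMat k := by
  unfold sMat siMat chiMat
  split_ifs
  · rw [lastMat_mul]; norm_num
  · exact siMat1_mul_sMat1 k

lemma chiMat_mul_siMat (k : ℕ) : chiMat k * siMat k = siMat k := by
  unfold siMat chiMat
  split_ifs
  · rw [lastMat_mul, one_mul]
  · rw [one_mul]

-- For k ≥ 1, columns 0, 1, 2 and 4 of `sMat1` are eigenvectors, for k, -k-1, k+1 and -k. Columns 3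
-- and 5, for k-1 and -k-2, are coupled to columns 2 and 4 with the coefficients k+1 and -k. The
-- true eigenvectors for k-1 and -k-2 would align with columns 2 and 4 as k grows, and the change of
-- basis would not have uniformly bounded condition number.
set_option maxHeartbeats 1600000 in
lemma sMat_mul_nMat (k : ℕ) : sMat k * nMat (fun n => n) k = lMat k * sMat k := by
  obtain ⟨h1, h2, h3, h4⟩ := denominators k
  ext i j
  rw [Matrix.mul_apply, Fin.sum_univ_six, Matrix.mul_apply, Fin.sum_univ_six]
  unfold sMat
  split_ifs with hk
  · subst hk
    fin_cases i <;> fin_cases j <;> simp [lastMat, lMat, nMat]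
    norm_num
  · fin_cases i <;> fin_cases j <;> simp [sMat1, lMat, nMat] <;> field_simp <;> ring

/-- In degree 0 the identity fails as one of matrices, because the last row of `lMat 0` involves
dead modes. That degree is treated on actual states, in `opL0_of_mem_D`. -/
lemma nMat_mul_siMat_of_ne {k : ℕ} (hk : k ≠ 0) :
    nMat (fun n => n) k * siMat k = siMat k * lMat k := by
  have h := sMat_mul_nMat k
  have h1 := sMat1_mul_siMat1 k
  have h2 := siMat1_mul_sMat1 k
  simp only [sMat, siMat, if_neg hk] at h ⊢
  calc _ = siMat1 k * (sMat1 k * nMat (fun n => n) k) * siMat1 k := by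
        rw [← mul_assoc (siMat1 k), h2, one_mul]
    _ = siMat1 k * lMat k * (sMat1 k * siMat1 k) := by rw [h]; simp only [mul_assoc]
    _ = _ := by rw [h1, mul_one]

/-! ### Bounds of the entries -/

/-- A bounded sequence. -/
def Bdd (m : ℕ → ℂ) : Prop := ∃ C : ℝ, ∀ k, ‖m k‖ ≤ C

lemma Bdd.const (c : ℂ) : Bdd fun _ => c := ⟨‖c‖, fun _ => le_rfl⟩

lemma Bdd.neg {m : ℕ → ℂ} (h : Bdd m) : Bdd fun k => -m k := by
  obtain ⟨C, hC⟩ := h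
  exact ⟨C, fun k => by rw [norm_neg]; exact hC k⟩

lemma Bdd.add {m n : ℕ → ℂ} (h : Bdd m) (h' : Bdd n) : Bdd fun k => m k + n k := by
  obtain ⟨C, hC⟩ := h
  obtain ⟨C', hC'⟩ := h'
  exact ⟨C + C', fun k => (norm_add_le _ _).trans (add_le_add (hC k) (hC' k))⟩

lemma Bdd.sub {m n : ℕ → ℂ} (h : Bdd m) (h' : Bdd n) : Bdd fun k => m k - n k := by
  simp only [sub_eq_add_neg]; exact h.add h'.neg

lemma Bdd.mul {m n : ℕ → ℂ} (h : Bdd m) (h' : Bdd n) : Bdd fun k => m k * n k := by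
  obtain ⟨C, hC⟩ := h
  obtain ⟨C', hC'⟩ := h'
  exact ⟨C * C', fun k => by
    rw [norm_mul]
    exact mul_le_mul (hC k) (hC' k) (norm_nonneg _) ((norm_nonneg _).trans (hC k))⟩

lemma bdd_div {a b : ℕ → ℂ} (x y : ℕ → ℝ) (C : ℝ) (ha : ∀ k, a k = x k) (hb : ∀ k, b k = y k)
    (hy : ∀ k, y k ≠ 0) (h : ∀ k, |x k| ≤ C * |y k|) : Bdd fun k => a k / b k :=
  ⟨C, fun k => by
    change ‖a k / b k‖ ≤ C
    rw [ha, hb, norm_div, Complex.norm_real, Complex.norm_real, Real.norm_eq_abs, Real.norm_eq_abs,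
      div_le_iff₀ (abs_pos.2 (hy k))]
    exact h k⟩

lemma Bdd.exists_entryBound {M : ℕ → M6} (h : ∀ i j, Bdd fun k => M k i j) :
    ∃ C, EntryBound M C := by
  choose C hC using h
  refine ⟨∑ i, ∑ j, |C i j|, fun k i j => (hC i j k).trans ((le_abs_self _).trans ?_)⟩
  refine le_trans ?_ (Finset.single_le_sum (f := fun i => ∑ j, |C i j|)
    (fun i _ => Finset.sum_nonneg fun j _ => abs_nonneg _) (Finset.mem_univ i))
  exact Finset.single_le_sum (f := fun j => |C i j|) (fun j _ => abs_nonneg _) (Finset.mem_univ j)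

lemma exists_entryBound_ite {M : ℕ → M6} {C : ℝ} (h : EntryBound M C) (N : M6) :
    ∃ C', EntryBound (fun k => if k = 0 then N else M k) C' := by
  refine Bdd.exists_entryBound fun i j => ?_
  refine ⟨‖N i j‖ + C, fun k => ?_⟩
  simp only
  split_ifs
  · linarith [h.nonneg]
  · linarith [h k i j, norm_nonneg (N i j)]

lemma bdd_fractions : (Bdd fun k => (k : ℂ) / (k + 1)) ∧ (Bdd fun k => (1 - 2 * (k : ℂ)) / (k + 1)) ∧
    (Bdd fun k => (2 * (k : ℂ) + 3) / (k + 1)) ∧ (Bdd fun k => ((k : ℂ) - 2) / (k + 1)) ∧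
    (Bdd fun k => ((k : ℂ) + 3) / (k + 1)) := by
  have hk : ∀ k : ℕ, (0 : ℝ) ≤ k := fun k => Nat.cast_nonneg k
  have hy : ∀ k : ℕ, ((k : ℝ) + 1) ≠ 0 := fun k => by have := hk k; positivity
  have ha : ∀ k : ℕ, |(k : ℝ) + 1| = k + 1 := fun k => abs_of_nonneg (by linarith [hk k])
  refine ⟨bdd_div (fun k => k) (fun k => k + 1) 1 ?_ ?_ hy ?_,
    bdd_div (fun k => 1 - 2 * k) (fun k => k + 1) 3 ?_ ?_ hy ?_,
    bdd_div (fun k => 2 * k + 3) (fun k => k + 1) 3 ?_ ?_ hy ?_,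
    bdd_div (fun k => k - 2) (fun k => k + 1) 3 ?_ ?_ hy ?_,
    bdd_div (fun k => k + 3) (fun k => k + 1) 3 ?_ ?_ hy ?_⟩
  all_goals intro k
  all_goals first
    | (push_cast; rfl)
    | (rw [ha, abs_le]; have := hk k; constructor <;> linarith)

lemma bdd_fractions' : (Bdd fun k => ((k : ℂ) + 1) / (2 * k + 1)) ∧
    (Bdd fun k => (k : ℂ) / (2 * k + 1)) ∧ (Bdd fun k => (k : ℂ) / (2 * k - 1)) ∧
    (Bdd fun k => ((k : ℂ) + 1) / (2 * k - 1)) ∧ (Bdd fun k => ((k : ℂ) + 1) / (2 * k + 3)) := by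
  have hk : ∀ k : ℕ, (0 : ℝ) ≤ k := fun k => Nat.cast_nonneg k
  have hy1 : ∀ k : ℕ, (2 * (k : ℝ) + 1) ≠ 0 := fun k => by have := hk k; positivity
  have hy3 : ∀ k : ℕ, (2 * (k : ℝ) + 3) ≠ 0 := fun k => by have := hk k; positivity
  have hy2 : ∀ k : ℕ, (2 * (k : ℝ) - 1) ≠ 0 := fun k => by
    have := (denominators k).2.2.1
    exact_mod_cast this
  have h2 : ∀ k : ℕ, (k : ℝ) + 1 ≤ 2 * |2 * (k : ℝ) - 1| := fun k => by
    rcases Nat.eq_zero_or_pos k with rfl | h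
    · norm_num
    · have : (1 : ℝ) ≤ k := by exact_mod_cast h
      linarith [le_abs_self (2 * (k : ℝ) - 1)]
  refine ⟨bdd_div (fun k => k + 1) (fun k => 2 * k + 1) 2 ?_ ?_ hy1 ?_,
    bdd_div (fun k => k) (fun k => 2 * k + 1) 2 ?_ ?_ hy1 ?_,
    bdd_div (fun k => k) (fun k => 2 * k - 1) 2 ?_ ?_ hy2 ?_,
    bdd_div (fun k => k + 1) (fun k => 2 * k - 1) 2 ?_ ?_ hy2 ?_,
    bdd_div (fun k => k + 1) (fun k => 2 * k + 3) 2 ?_ ?_ hy3 ?_⟩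
  all_goals intro k
  all_goals have := hk k
  all_goals first
    | (push_cast; rfl)
    | (rw [abs_of_nonneg (by linarith)]
       first
         | (have := h2 k; linarith)
         | (rw [abs_of_nonneg (by linarith)]; linarith))

lemma exists_entryBound_sMat : ∃ C, EntryBound sMat C := by
  obtain ⟨h1, h2, h3, h4, h5⟩ := bdd_fractions
  obtain ⟨C, hC⟩ : ∃ C, EntryBound sMat1 C := by
    refine Bdd.exists_entryBound fun i j => ?_
    fin_cases i <;> fin_cases j <;>
      first
        | exact Bdd.const _
        | exact h1
        | exact h2
        | exact h4
        | exact h1.neg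
        | exact h5.neg
        | exact (h1.mul h3).neg
  exact exists_entryBound_ite hC _

lemma exists_entryBound_siMat : ∃ C, EntryBound siMat C := by
  obtain ⟨hr, hs, hp, ht, hq⟩ := bdd_fractions'
  have a := (hs.mul hr).mul hq
  have b := (hr.mul hp).mul hr
  have c := (hr.mul hp).mul hs
  have d := (hr.mul hr).mul ht
  obtain ⟨C, hC⟩ : ∃ C, EntryBound siMat1 C := by
    refine Bdd.exists_entryBound fun i j => ?_
    fin_cases i <;> fin_cases j <;>
      first
        | exact Bdd.const _
        | exact hr
        | exact hs
        | exact hr.neg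
        | exact (hr.sub b).sub a
        | exact d.sub a
        | exact (hr.add c).sub a
        | exact b.neg.sub a
        | exact hp.mul hr
        | exact (hr.mul ht).neg
        | exact (hp.mul hs).neg
        | exact ((hr.sub b).sub a).neg
        | exact (d.sub a).neg
        | exact (Bdd.const 1).sub ((hr.add c).sub a)
        | exact b.add a
        | exact (hr.mul hq).neg
  exact exists_entryBound_ite hC _

lemma exists_entryBound_chiMat : ∃ C, EntryBound chiMat C :=
  exists_entryBound_ite entryBound_one _

/-! ### Functions of `L₀` -/

/-- The condition for a function of `L₀` to be bounded. -/
def Adm (g : ℤ → ℂ) (B : ℝ) : Prop :=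
  (∀ n, ‖g n‖ ≤ B) ∧ ∀ n : ℤ, ‖(n : ℂ) + 2‖ * ‖g (n + 2) - g n‖ ≤ 2 * B

lemma Adm.nonneg {g : ℤ → ℂ} {B : ℝ} (h : Adm g B) : 0 ≤ B := (norm_nonneg _).trans (h.1 0)

/-- The off-diagonal entries are differences of g over a step of two, times (k + 1) / 2 or k / 2;
they are the second condition in `Adm` at n = k - 1 and n = -k - 2. -/
lemma Adm.entryBound {g : ℤ → ℂ} {B : ℝ} (h : Adm g B) : EntryBound (nMat g) B := by
  have h0 := h.nonneg
  intro k i j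
  have c1 : ‖((k : ℂ) + 1) / 2 * (g (k + 1) - g (k - 1))‖ ≤ B := by
    have := h.2 ((k : ℤ) - 1)
    rw [show ((k : ℤ) - 1 + 2) = k + 1 by ring] at this
    push_cast at this
    rw [show ((k : ℂ) - 1 + 2) = k + 1 by ring] at this
    rw [norm_mul, norm_div, Complex.norm_ofNat]
    linarith
  have c2 : ‖(k : ℂ) / 2 * (g (-k - 2) - g (-k))‖ ≤ B := by
    have := h.2 (-(k : ℤ) - 2)
    rw [show (-(k : ℤ) - 2 + 2) = -k by ring] at this
    push_cast at this
    rw [show (-(k : ℂ) - 2 + 2) = -k by ring, norm_neg, norm_sub_rev] at this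
    rw [norm_mul, norm_div, Complex.norm_ofNat]
    linarith
  fin_cases i <;> fin_cases j <;>
    first
      | exact h.1 _
      | exact c1
      | exact c2
      | exact norm_zero.trans_le h0

/-- The off-diagonal entries are multiples of divided differences of g at pairs of eigenvalues, and
divided differences obey the product rule. So `nMat` is a functional calculus for the triangular
form of L₀. -/
lemma nMat_mul (g h : ℤ → ℂ) (k : ℕ) : nMat g k * nMat h k = nMat (fun n => g n * h n) k := by
  ext i j
  rw [Matrix.mul_apply, Fin.sum_univ_six]
  fin_cases i <;> fin_cases j <;> simp [nMat]
  all_goals ring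

lemma nMat_one (k : ℕ) : nMat (fun _ => 1) k = 1 := by
  ext i j
  fin_cases i <;> fin_cases j <;> simp [nMat]

end LandauSphere
end

noncomputable section
namespace LandauSphere

/-! ### `L₀` in the weighted potentials -/

lemma proj_l0Comp_aux (k : ℕ) : (wt k : ℂ) = k + 1 ∧ ((mu k : ℝ) : ℂ) = k * (k + 1) :=
  ⟨rfl, by unfold mu; push_cast; rfl⟩

lemma act_apply (M : M6) (x : V6) (i : Fin 6) : act M x i = M i 0 • x 0 + M i 1 • x 1 + M i 2 • x 2
    + M i 3 • x 3 + M i 4 • x 4 + M i 5 • x 5 := by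
  simp [act, Fin.sum_univ_six]

lemma l0Comp_apply (x : V6) : l0Comp x 0 = -x 2 ∧ l0Comp x 1 = -x 3 ∧
    l0Comp x 2 = -x 2 + lapl (x 0) ∧
    l0Comp x 3 = -x 3 + lapl ((2 : ℂ) • x 1 + (3 : ℂ) • x 4 + x 5) ∧ l0Comp x 4 = x 1 + x 4 ∧
    l0Comp x 5 = -((2 : ℂ) • x 5) - (3 : ℂ) • x 1 - (3 : ℂ) • x 4 + lapl (x 4) :=
  ⟨rfl, rfl, rfl, rfl, rfl, rfl⟩

lemma act_lMat (k : ℕ) (x : V6) : act (lMat k) x 0 = -((k : ℂ) + 1) • x 2 ∧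
    act (lMat k) x 1 = -((k : ℂ) + 1) • x 3 ∧ act (lMat k) x 2 = -(k : ℂ) • x 0 - x 2 ∧
    act (lMat k) x 3 = -(2 * (k : ℂ)) • x 1 - x 3 - (3 * (k : ℂ) / (k + 1)) • x 4 - (k : ℂ) • x 5 ∧
    act (lMat k) x 4 = ((k : ℂ) + 1) • x 1 + x 4 ∧
    act (lMat k) x 5 = (-3 : ℂ) • x 1 - ((3 + (k : ℂ) * (k + 1)) / (k + 1)) • x 4 - (2 : ℂ) • x 5 := by
  simp only [act_apply, lMat, Matrix.of_apply, Matrix.cons_val', Matrix.cons_val]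
  refine ⟨?_, ?_, ?_, ?_, ?_, ?_⟩ <;> module

lemma wgt_apply (k : ℕ) : wgt 0 k = k + 1 ∧ wgt 1 k = k + 1 ∧ wgt 2 k = 1 ∧ wgt 3 k = 1 ∧
    wgt 4 k = ((k : ℂ) + 1) ^ 2 ∧ wgt 5 k = k + 1 := ⟨rfl, rfl, rfl, rfl, rfl, rfl⟩

lemma proj_l0Comp {v : V6} (hv : ∀ i, Sob 1 (v i)) (hd : ∀ i, i ≠ 5 → proj 0 (v i) = 0)
    (k : ℕ) (i : Fin 6) :
    proj k (l0Comp (fun i => pot i v) i) = iwgt i k • act (lMat k) (projV k v) i := by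
  have s0 : Sob 2 (pot 0 v) := sob_pot (m := 1) (i := 0) (v := v) (hv 0)
  have s1 : Sob 2 (pot 1 v) := sob_pot (m := 1) (i := 1) (v := v) (hv 1)
  have s4' : Sob 3 (pot 4 v) := sob_pot (m := 1) (i := 4) (v := v) (hv 4)
  have s4 : Sob 2 (pot 4 v) := s4'.mono_succ
  have s5 : Sob 2 (pot 5 v) := sob_pot (m := 1) (i := 5) (v := v) (hv 5)
  have s6 : Sob 2 ((2 : ℂ) • pot 1 v + (3 : ℂ) • pot 4 v + pot 5 v) := ((s1.smul 2).add (s4.smul 3)).add s5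
  obtain ⟨hw, hm⟩ := proj_l0Comp_aux k
  have hk1 : (k : ℂ) + 1 ≠ 0 := (denominators k).1
  obtain ⟨c0, c1, c2, c3, c4, c5⟩ := l0Comp_apply fun i => pot i v
  obtain ⟨a0, a1, a2, a3, a4, a5⟩ := act_lMat k (projV k v)
  obtain ⟨w0, w1, w2, w3, w4, w5⟩ := wgt_apply k
  have q : ∀ i, proj k (pot i v) = iwgt i k • projV k v i := fun i => proj_pot i v k
  rcases eq_or_ne k 0 with rfl | hk
  · have e : ∀ i, i ≠ 5 → projV 0 v i = 0 := hd
    have e0 := e 0 (by decide)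
    have e1 := e 1 (by decide)
    have e2 := e 2 (by decide)
    have e3 := e 3 (by decide)
    have e4 := e 4 (by decide)
    have m0 : mu 0 = 0 := by simp [mu]
    fin_cases i
    · simp only [Fin.zero_eta]; rw [c0, a0, map_neg, q, e2]; simp
    · simp only [Fin.mk_one]; rw [c1, a1, map_neg, q, e3]; simp
    · simp only [Fin.reduceFinMk]; rw [c2, a2, map_add, map_neg, q, proj_lapl s0, q, e0, e2]; simp
    · simp only [Fin.reduceFinMk]; rw [c3, a3, map_add, map_neg, q, proj_lapl s6, m0, e1, e3, e4]; simp
    · simp only [Fin.reduceFinMk]; rw [c4, a4, map_add, q, q, e1, e4]; simp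
    · simp only [Fin.reduceFinMk]; rw [c5, a5, map_add, map_sub, map_sub, map_neg, map_smul, map_smul, map_smul,
        proj_lapl s4, q, q, q, e1, e4, m0]
      module
  · have hi : ∀ i, iwgt i k = (wgt i k)⁻¹ := fun i => by rw [iwgt, if_neg (fun h => hk h.1)]
    simp only [hi] at q ⊢
    generalize projV k v = x at *
    fin_cases i
    · simp only [Fin.zero_eta]; rw [c0, a0, map_neg, q, w0, w2]
      match_scalars <;> field_simp
    · simp only [Fin.mk_one]; rw [c1, a1, map_neg, q, w1, w3]
      match_scalars <;> field_simp
    · simp only [Fin.reduceFinMk]; rw [c2, a2, map_add, map_neg, proj_lapl s0, hm, q, q, w0, w2]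
      match_scalars <;> field_simp
    · simp only [Fin.reduceFinMk]; rw [c3, a3, map_add, map_neg, proj_lapl s6, hm, map_add, map_add, map_smul,
        map_smul, q, q, q, q, w1, w3, w4, w5]
      match_scalars <;> field_simp
    · simp only [Fin.reduceFinMk]; rw [c4, a4, map_add, q, q, w1, w4]
      match_scalars <;> field_simp
    · simp only [Fin.reduceFinMk]; rw [c5, a5, map_add, map_sub, map_sub, map_neg, map_smul, map_smul, map_smul,
        proj_lapl s4, hm, q, q, q, w1, w4, w5]
      match_scalars <;> field_simp <;> ring

/-! ### The parametrization which diagonalizes `L₀` -/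

/-- The parametrization of `X` in which `L₀` is triangular. -/
def param : V6 →L[ℂ] State := wparam.comp (opM sMat)

/-- The projection to the effective modes. -/
def chi : V6 →L[ℂ] V6 := opM chiMat

/-- `w = A u`, where `A` is the triangular form of `L₀`. -/
def ARel (u w : V6) : Prop := ∀ k, projV k w = act (nMat (fun n => n) k) (projV k u)

lemma projV_S (u : V6) (k : ℕ) : projV k (opM sMat u) = act (sMat k) (projV k u) := by
  obtain ⟨C, hC⟩ := exists_entryBound_sMat
  exact projV_opM hC u k

lemma projV_Si (u : V6) (k : ℕ) : projV k (opM siMat u) = act (siMat k) (projV k u) := by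
  obtain ⟨C, hC⟩ := exists_entryBound_siMat
  exact projV_opM hC u k

lemma projV_chi (u : V6) (k : ℕ) : projV k (chi u) = act (chiMat k) (projV k u) := by
  obtain ⟨C, hC⟩ := exists_entryBound_chiMat
  exact projV_opM hC u k

lemma opM_sMat_dead (u : V6) (i : Fin 6) (hi : i ≠ 5) : proj 0 (opM sMat u i) = 0 := by
  have := congrFun (projV_S u 0) i
  rw [act_apply] at this
  change proj 0 (opM sMat u i) = _ at this
  rw [this]
  simp only [sMat, if_true]
  fin_cases i <;> first | exact absurd rfl hi | simp [lastMat]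

lemma act_lastMat (c : ℂ) (x : V6) : act (lastMat c) x = Pi.single 5 (c • x 5) := by
  funext i
  rw [act_apply]
  fin_cases i <;> simp [lastMat, Pi.single_apply]

lemma wparam_chi (v : V6) : wparam (chi v) = wparam v := by
  rw [wparam_eq, wparam_eq]
  congr 1
  refine ext_V6 fun k i => ?_
  rw [proj_pot, proj_pot]
  have h := congrFun (projV_chi v k) i
  change proj k (chi v i) = _ at h
  rw [h]
  unfold chiMat
  split_ifs with hk
  · subst hk
    rw [act_lastMat]
    rcases eq_or_ne i 5 with rfl | hi
    · simp [projV]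
    · simp [iwgt, hi]
  · rw [act_one]; rfl

lemma opM_S_Si (v : V6) : opM sMat (opM siMat v) = chi v := by
  refine ext_projV fun k => ?_
  rw [projV_S, projV_Si, projV_chi, ← act_mul, sMat_mul_siMat]

lemma opM_Si_S (v : V6) : opM siMat (opM sMat v) = chi v := by
  refine ext_projV fun k => ?_
  rw [projV_chi, projV_Si, projV_S, ← act_mul, siMat_mul_sMat]

lemma param_opM_siMat (v : V6) : param (opM siMat v) = wparam v := by
  change wparam (opM sMat (opM siMat v)) = _
  rw [opM_S_Si, wparam_chi]

lemma param_mem_X (u : V6) : param u ∈ X := wparam_mem_X _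

lemma isMult_wgt_wparam {v : V6} (hd : ∀ i, i ≠ 5 → proj 0 (v i) = 0) (i : Fin 6) :
    IsMult (wgt i) (comp (wparam v) i) (v i) := by
  intro k
  rw [comp_wparam, proj_pot, smul_smul, iwgt]
  split_ifs with h
  · rw [h.1, hd i h.2, smul_zero]
  · rw [mul_inv_cancel₀ (wgt_ne_zero i k), one_smul]

lemma isMult_wgt_dead {Ξ : State} (h : Ξ ∈ X) {v : V6} (hv : ∀ i, IsMult (wgt i) (comp Ξ i) (v i))
    (i : Fin 6) (hi : i ≠ 5) : proj 0 (v i) = 0 := by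
  rw [hv i 0, proj_zero_comp h i hi, smul_zero]

lemma sob_one_of_isMult {f g : L2} (h : IsMult wt f g) : Sob 1 f := by
  have := sob_zero g
  unfold Sob at *
  refine this.congr fun k => ?_
  rw [h k, norm_smul, norm_wt]; ring

/-- The diagonal entries grow like k, so the triangular system can be solved for (k + 1) times the
components of u, with bounded coefficients. This is the gain of one degree of regularity that puts
`param u` into `D`. -/
lemma ARel.exists_isMult {u w : V6} (h : ARel u w) : ∃ g : V6, ∀ i, IsMult wt (u i) (g i) := by
  have hc := fun k i => congrFun (h k) i
  simp only [act_apply] at hc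
  refine ⟨![w 0 + u 0, -w 1, w 2 - (w 3 + (2 : ℂ) • u 3), w 3 + (2 : ℂ) • u 3,
    u 4 - w 4 + w 5 + (2 : ℂ) • u 5, -w 5 - u 5], fun i k => ?_⟩
  have e0 : proj k (w 0) = _ := hc k 0
  have e1 : proj k (w 1) = _ := hc k 1
  have e2 : proj k (w 2) = _ := hc k 2
  have e3 : proj k (w 3) = _ := hc k 3
  have e4 : proj k (w 4) = _ := hc k 4
  have e5 : proj k (w 5) = _ := hc k 5
  simp only [nMat, projV, Matrix.of_apply, Matrix.cons_val', Matrix.cons_val, Fin.isValue,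
    zero_smul, add_zero, zero_add] at e0 e1 e2 e3 e4 e5
  push_cast at e0 e1 e2 e3 e4 e5
  fin_cases i
  · change proj k (w 0 + u 0) = wt k • proj k (u 0)
    rw [map_add, e0, wt]; module
  · change proj k (-w 1) = wt k • proj k (u 1)
    rw [map_neg, e1, wt]; module
  · change proj k (w 2 - (w 3 + (2 : ℂ) • u 3)) = wt k • proj k (u 2)
    rw [map_sub, map_add, map_smul, e2, e3, wt]; module
  · change proj k (w 3 + (2 : ℂ) • u 3) = wt k • proj k (u 3)
    rw [map_add, map_smul, e3, wt]; module
  · change proj k (u 4 - w 4 + w 5 + (2 : ℂ) • u 5) = wt k • proj k (u 4)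
    rw [map_add, map_add, map_sub, map_smul, e4, e5, wt]; module
  · change proj k (-w 5 - u 5) = wt k • proj k (u 5)
    rw [map_sub, map_neg, e5, wt]; module

lemma sob_opM {M : ℕ → M6} {C : ℝ} (hM : EntryBound M C) {u : V6} (hu : ∀ i, ∃ g, IsMult wt (u i) g)
    (i : Fin 6) : Sob 1 (opM M u i) := by
  choose g hg using hu
  refine sob_one_of_isMult (g := opM M g i) fun k => ?_
  rw [proj_opM hM, proj_opM hM, Finset.smul_sum]
  exact Finset.sum_congr rfl fun j _ => by rw [hg j k, smul_comm]

lemma opL0_param {u w : V6} (h : ARel u w) : param u ∈ D ∧ opL0 (param u) = param w := by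
  obtain ⟨g, hg⟩ := h.exists_isMult
  obtain ⟨C, hC⟩ := exists_entryBound_sMat
  have hs := sob_opM hC (fun i => ⟨g i, hg i⟩)
  have hD : param u ∈ D := wparam_mem_D hs
  refine ⟨hD, ?_⟩
  rw [opL0_eq hD]
  have e : comp (param u) = fun i => pot i (opM sMat u) := funext fun i => comp_wparam _ i
  have e' : param w = ofComp fun i => pot i (opM sMat w) := wparam_eq _
  rw [e, e']
  congr 1
  refine ext_V6 fun k i => ?_
  rw [proj_l0Comp hs (opM_sMat_dead u), proj_pot, projV_S, ← act_mul, ← sMat_mul_nMat, act_mul, ← h k,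
    ← projV_S]
  rfl

lemma chi_opM_siMat (v : V6) : chi (opM siMat v) = opM siMat v := by
  refine ext_projV fun k => ?_
  rw [projV_chi, projV_Si, ← act_mul, chiMat_mul_siMat]

lemma act_nMat_zero_lastMat (c : ℂ) : nMat (fun n => n) 0 * lastMat c = lastMat (-2 * c) := by
  ext i j
  rw [Matrix.mul_apply, Fin.sum_univ_six]
  fin_cases i <;> fin_cases j <;> simp [nMat, lastMat]

lemma opL0_of_mem_D {Ξ : State} (h : Ξ ∈ D) {v v' : V6}
    (hv : ∀ i, IsMult (wgt i) (comp Ξ i) (v i)) (hv' : ∀ i, IsMult (wgt i) (comp (opL0 Ξ) i) (v' i)) :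
    ARel (opM siMat v) (opM siMat v') := by
  have hX := D_subset_X h
  have hd := isMult_wgt_dead hX hv
  have hs : ∀ i, Sob 1 (v i) := by
    intro i
    have := sob_comp_D h i
    unfold Sob at *
    refine this.congr fun k => ?_
    rw [hv i k, norm_smul, norm_wgt]
    ring
  have e : comp Ξ = fun i => pot i v := by
    rw [← wparam_of_isMult hX hv]; exact funext fun i => comp_wparam _ i
  have hL : ∀ k, projV k v' = fun i => (wgt i k * iwgt i k) • act (lMat k) (projV k v) i := by
    intro k
    funext i
    change proj k (v' i) = _
    rw [hv' i k, opL0_eq h, comp_ofComp, e, proj_l0Comp hs hd, smul_smul]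
    intro j hj
    rw [e, proj_l0Comp hs hd]
    simp [iwgt, hj]
  intro k
  rw [projV_Si, projV_Si, ← act_mul]
  -- In degree 0 the dead modes of v vanish, and L₀ multiplies the mean of ϑ* by -2.
  rcases eq_or_ne k 0 with rfl | hk
  · have h5 : projV 0 v' 5 = (-2 : ℂ) • projV 0 v 5 := by
      have e1 : projV 0 v 1 = 0 := hd 1 (by decide)
      have e4 : projV 0 v 4 = 0 := hd 4 (by decide)
      rw [hL 0]
      simp only [act_apply, e1, e4]
      simp [iwgt, wgt, lMat, wt]
    have es : siMat 0 = lastMat (-(1 / 3)) := by simp [siMat]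
    rw [es, act_nMat_zero_lastMat, act_lastMat, act_lastMat, h5, smul_smul]
    congr 2
    ring
  · rw [nMat_mul_siMat_of_ne hk, act_mul]
    congr 1
    rw [hL k]
    funext i
    rw [iwgt, if_neg fun hh => hk hh.1, mul_inv_cancel₀ (wgt_ne_zero i k), one_smul]

/-- A bounded right inverse of the parametrization. -/
lemma exists_coord : ∃ C : ℝ, 0 < C ∧ ∃ Q : State → V6, (∀ Ξ ∈ X, param (Q Ξ) = Ξ) ∧
    (∀ Ξ ∈ X, ‖Q Ξ‖ ≤ C * xNorm Ξ) ∧ (∀ Ξ ∈ X, chi (Q Ξ) = Q Ξ) ∧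
    (∀ u, Q (param u) = chi u) ∧ (∀ Ξ ∈ D, opL0 Ξ ∈ X → ARel (Q Ξ) (Q (opL0 Ξ))) := by
  obtain ⟨C, hC, H⟩ := exists_weighted
  -- The inverse is chosen pointwise, without linearity; what is needed of it is recovered from `Q
  -- (param u) = chi u`.
  choose! V hV hn using H
  obtain ⟨C', hC'⟩ := exists_entryBound_siMat
  refine ⟨(‖opM siMat‖ + 1) * C, by positivity, fun Ξ => opM siMat (V Ξ), fun Ξ h => ?_, fun Ξ h => ?_,
    fun Ξ h => chi_opM_siMat _, fun u => ?_, fun Ξ h h' => ?_⟩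
  · rw [param_opM_siMat, wparam_of_isMult h (hV Ξ h)]
  · refine ((opM siMat).le_opNorm _).trans ?_
    rw [mul_assoc]
    have := hn Ξ h
    have h1 := norm_nonneg (opM siMat)
    have h2 := norm_nonneg (V Ξ)
    gcongr
    linarith
  · have : V (param u) = opM sMat u := funext fun i =>
      (hV _ (param_mem_X u) i).unique (isMult_wgt_wparam (opM_sMat_dead u) i)
    simp only [this, opM_Si_S]
  · exact opL0_of_mem_D h (hV Ξ (D_subset_X h)) (hV _ h')

lemma opL0_mem_X {Ξ : State} (h : Ξ ∈ D) : opL0 Ξ ∈ X := by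
  have hX := D_subset_X h
  obtain ⟨C, hC, H⟩ := exists_weighted
  obtain ⟨v, hv, -⟩ := H Ξ hX
  have hd := isMult_wgt_dead hX hv
  rw [opL0_eq h]
  have hc := sob_comp_D h
  have s0 : Sob 2 (comp Ξ 0) := hc 0
  have s1 : Sob 2 (comp Ξ 1) := hc 1
  have s2 : Sob 1 (comp Ξ 2) := hc 2
  have s3 : Sob 1 (comp Ξ 3) := hc 3
  have s4 : Sob 3 (comp Ξ 4) := hc 4
  have s5 : Sob 2 (comp Ξ 5) := hc 5
  have hl : ∀ {m : ℕ} {f : L2}, Sob (m + 2) f → Sob m (lapl f) := fun hf =>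
    Sob.sum fun i _ => (hf.wd i).wd i
  refine ofComp_mem_X (fun i => ?_) ?_
  · fin_cases i
    · exact s2.neg
    · exact s3.neg
    · exact sob_zero _
    · exact sob_zero _
    · exact s1.add s4.mono_succ
    · exact (((s5.mono_succ.smul 2).neg.sub (s1.mono_succ.smul 3)).sub
        (s4.mono_succ.mono_succ.smul 3)).add (hl s4)
  · change proj 0 (comp Ξ 1 + comp Ξ 4) = 0
    rw [map_add, proj_zero_comp hX 1 (by decide), proj_zero_comp hX 4 (by decide), add_zero]

end LandauSphere
end

/-! ### The Landau solutions for small force, and the boundedness of the perturbation K on X. -/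

noncomputable section
namespace LandauSphere

/-! ### The parameter of the Landau solutions -/

lemma landauF_eq {ε : ℝ} : landauF ε =
    16 * Real.pi * (1 / ε - 1 / ε ^ 2 * (1 / 2 * Real.log ((1 + ε) / (1 - ε))) +
      4 * ε / (3 * (1 - ε ^ 2))) := by
  unfold landauF
  rw [← inv_div (1 + ε) (1 - ε), Real.log_inv]
  ring

/-- The number 1/2 log ((1 + ε) / (1 - ε)) lies between ε and ε + ε³ / (1 - ε²), so the singular
terms 1/ε cancel. The lower bound yields ε = O(|b|), the upper one the existence of ε. -/
lemma landauF_bounds {ε : ℝ} (h0 : 0 ≤ ε) (h1 : ε < 1) :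
    16 * Real.pi * (ε / 3) ≤ landauF ε ∧
      landauF ε ≤ 16 * Real.pi * (4 * ε / (3 * (1 - ε ^ 2))) := by
  rcases h0.eq_or_lt with rfl | hpos
  · simp [landauF]
  have hq : 0 < 1 - ε ^ 2 := by nlinarith
  have u1 := Real.log_div_le_sum_range_add h0 h1 1
  have u2 := Real.sum_range_le_log_div h0 h1 1
  simp only [Finset.sum_range_one, mul_zero, zero_add, pow_one, Nat.cast_zero, div_one, mul_one] at u1 u2
  rw [landauF_eq]
  set l := 1 / 2 * Real.log ((1 + ε) / (1 - ε))
  have hi : 0 ≤ 1 / ε ^ 2 := by positivity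
  have v1 := mul_le_mul_of_nonneg_left u1 hi
  have v2 := mul_le_mul_of_nonneg_left u2 hi
  have e1 : 1 / ε ^ 2 * ε = 1 / ε := by field_simp
  have e2 : 1 / ε ^ 2 * (ε + ε ^ (2 + 1) / (1 - ε ^ 2)) = 1 / ε + ε / (1 - ε ^ 2) := by
    field_simp
    ring
  rw [e1] at v2
  rw [e2] at v1
  have e3 : 4 * ε / (3 * (1 - ε ^ 2)) = ε / (1 - ε ^ 2) + ε / (1 - ε ^ 2) / 3 := by
    field_simp; ring
  have e4 : ε ≤ ε / (1 - ε ^ 2) := by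
    rw [le_div_iff₀ hq]; nlinarith [pow_pos hpos 3]
  constructor
  · gcongr
    linarith
  · gcongr
    linarith

lemma exists_landauF_eq {β : ℝ} (h0 : 0 ≤ β) (h1 : β ≤ 2 * Real.pi) :
    ∃ ε ∈ Set.Ico (0 : ℝ) 1, landauF ε = β := by
  rcases h0.eq_or_lt with rfl | hpos
  · exact ⟨0, by simp, by simp [landauF]⟩
  have hpi := Real.pi_pos
  -- For ε ≤ 1/2 the upper bound of `landauF_bounds` is at most 32πε, so the value at δ is at most
  -- β, while the value at 1/2 is at least 8π/3 > 2π. Starting at δ > 0 avoids the removable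
  -- singularity at 0.
  set δ := β / (32 * Real.pi) with hδ
  have hδ0 : 0 < δ := by positivity
  have hδ1 : δ ≤ 1 / 2 := by
    rw [hδ, div_le_iff₀ (by positivity)]; linarith
  have hβ : β = 32 * Real.pi * δ := by rw [hδ]; field_simp
  have hlow : landauF δ ≤ β := by
    refine (landauF_bounds hδ0.le (by linarith)).2.trans ?_
    have hq : 3 / 4 ≤ 1 - δ ^ 2 := by nlinarith
    have : 4 * δ / (3 * (1 - δ ^ 2)) ≤ 2 * δ := by
      rw [div_le_iff₀ (by positivity)]; nlinarith
    calc _ ≤ 16 * Real.pi * (2 * δ) := by gcongr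
      _ = β := by rw [hβ]; ring
  have hhigh : β ≤ landauF (1 / 2) := by
    refine le_trans ?_ (landauF_bounds (by norm_num) (by norm_num)).1
    linarith
  have hc : ContinuousOn landauF (Set.Icc δ (1 / 2)) := by
    intro x hx
    have hx0 : x ≠ 0 := by linarith [hx.1]
    have hx1 : 0 < 1 - x ^ 2 := by nlinarith [hx.1, hx.2]
    have hx2 : (1 - x) / (1 + x) ≠ 0 := by
      have : 0 < 1 - x := by linarith [hx.2]
      have : 0 < 1 + x := by linarith [hx.1]
      positivity
    have hx3 : (1 + x) ≠ 0 := by linarith [hx.1]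
    unfold landauF
    refine ContinuousAt.continuousWithinAt ?_
    refine continuousAt_const.mul (((continuousAt_const.div continuousAt_id hx0).add
      ((continuousAt_const.div (by fun_prop) (by positivity)).mul
        (ContinuousAt.log (ContinuousAt.div (by fun_prop) (by fun_prop) hx3) hx2))).add
      (ContinuousAt.div (by fun_prop) (by fun_prop) (by positivity)))
  obtain ⟨ε, hε, he⟩ := intermediate_value_Icc hδ1 hc ⟨hlow, hhigh⟩
  exact ⟨ε, ⟨by linarith [hε.1], by linarith [hε.2]⟩, he⟩

/-- Uniqueness of ε plays no role: every solution in [0, 1) satisfies 16πε/3 ≤ |b| by the lower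
bound in `landauF_bounds`. -/
lemma landauEps_mem {b : E3} (h : ‖b‖ ≤ 2 * Real.pi) :
    0 ≤ landauEps b ∧ landauEps b ≤ ‖b‖ / 5 ∧ landauEps b ≤ 1 / 2 := by
  obtain ⟨hm, he⟩ := Function.invFunOn_pos (f := landauF) (exists_landauF_eq (norm_nonneg b) h)
  change landauEps b ∈ Set.Ico (0 : ℝ) 1 at hm
  change landauF (landauEps b) = ‖b‖ at he
  have hb := (landauF_bounds hm.1 hm.2).1
  rw [he] at hb
  have hpi := Real.pi_gt_three
  have h0 := hm.1
  refine ⟨h0, ?_, ?_⟩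
  · rw [le_div_iff₀ (by norm_num)]
    nlinarith
  · nlinarith

/-! ### Smooth families of functions -/

/-- The parameters of the Landau solutions, the size and the direction. -/
abbrev Par : Type := ℝ × E3

/-- The compact set of parameters which is used. -/
def parSet : Set Par := Set.Icc 0 (1 / 2) ×ˢ Metric.closedBall 0 1

lemma isCompact_parSet : IsCompact parSet := isCompact_Icc.prod (isCompact_closedBall 0 1)

lemma contDiff_slice {ψ : Par × E3 → ℝ} (h : ContDiff ℝ ∞ ψ) (p : Par) :
    ContDiff ℝ ∞ fun y : E3 => ((ψ (p, y) : ℝ) : ℂ) :=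
  Complex.ofRealCLM.contDiff.comp (h.comp (by fun_prop))

/-- The multiplier given by a smooth family of functions. -/
def fam {ψ : Par × E3 → ℝ} (h : ContDiff ℝ ∞ ψ) (p : Par) : CS :=
  res _ (contDiff_slice h p).continuous

/-- The tangential derivatives of a family of functions. -/
def famDeriv (i : Fin 3) (ψ : Par × E3 → ℝ) (x : Par × E3) : ℝ :=
  fderiv ℝ ψ x (0, EuclideanSpace.single i (1 : ℝ) - x.2 i • x.2)

lemma contDiff_famDeriv (i : Fin 3) {ψ : Par × E3 → ℝ} (h : ContDiff ℝ ∞ ψ) :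
    ContDiff ℝ ∞ (famDeriv i ψ) := by
  unfold famDeriv
  exact (h.fderiv_right (m := ∞) (by simp)).clm_apply (by fun_prop)

lemma famDeriv_eq (i : Fin 3) {ψ : Par × E3 → ℝ} (h : ContDiff ℝ ∞ ψ) (p : Par) (y : E3) :
    tangDeriv i (fun y => ψ (p, y)) y = famDeriv i ψ (p, y) := by
  have h1 : HasFDerivAt ψ (fderiv ℝ ψ (p, y)) (p, y) :=
    (h.differentiable (by simp) _).hasFDerivAt
  have h2 : HasFDerivAt (fun y : E3 => (p, y)) (ContinuousLinearMap.inr ℝ Par E3) y :=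
    hasFDerivAt_prodMk_right p y
  have h3 := h1.comp y h2
  unfold tangDeriv famDeriv
  change fderiv ℝ (ψ ∘ fun y => (p, y)) y _ = _
  rw [h3.fderiv]
  simp

lemma tangDeriv_ofReal (i : Fin 3) {φ : E3 → ℝ} {y : E3} (h : DifferentiableAt ℝ φ y) :
    tangDeriv i (fun y => ((φ y : ℝ) : ℂ)) y = ((tangDeriv i φ y : ℝ) : ℂ) := by
  unfold tangDeriv
  have := (Complex.ofRealCLM.hasFDerivAt (x := φ y)).comp y h.hasFDerivAt
  change fderiv ℝ (⇑Complex.ofRealCLM ∘ φ) y _ = _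
  rw [this.fderiv]
  simp

lemma exists_bound_fam {ψ : Par × E3 → ℝ} (h : ContDiff ℝ ∞ ψ) :
    ∃ C : ℝ, 0 ≤ C ∧ ∀ p ∈ parSet, ‖fam h p‖ ≤ C := by
  obtain ⟨C, hC⟩ := (isCompact_parSet.prod (isCompact_sphere (0 : E3) 1)).exists_bound_of_continuousOn
    h.continuous.continuousOn
  refine ⟨max C 0, le_max_right _ _, fun p hp => ?_⟩
  rw [ContinuousMap.norm_le _ (le_max_right _ _)]
  intro y
  refine le_trans ?_ (le_max_left _ _)
  change ‖((ψ (p, y.1) : ℝ) : ℂ)‖ ≤ C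
  rw [Complex.norm_real]
  exact hC (p, y.1) ⟨hp, y.2⟩

/-- Families of operators into `H¹`, bounded uniformly for the parameters in `parSet`. -/
def Good (G : Par → V6 →L[ℂ] L2) : Prop :=
  (∀ p u, Sob 1 (G p u)) ∧ ∃ C : ℝ, 0 ≤ C ∧ ∀ p ∈ parSet, ∀ u,
    ‖G p u‖ ≤ C * ‖u‖ ∧ ∀ i, ‖weakDeriv i (G p u)‖ ≤ C * ‖u‖

lemma Good.const {B : V6 →L[ℂ] L2} (h : ∀ u, Sob 1 (B u)) : Good fun _ => B := by
  choose W hW using exists_clm_wd B h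
  refine ⟨fun _ => h, ‖B‖ + ∑ i, ‖W i‖, by positivity, fun p _ u => ⟨?_, fun i => ?_⟩⟩
  · refine (B.le_opNorm u).trans ?_
    gcongr
    exact le_add_of_nonneg_right (by positivity)
  · rw [← hW]
    refine ((W i).le_opNorm u).trans ?_
    gcongr
    have := Finset.single_le_sum (f := fun i => ‖W i‖) (fun i _ => norm_nonneg _) (Finset.mem_univ i)
    linarith [norm_nonneg B]

lemma Good.add {G G' : Par → V6 →L[ℂ] L2} (h : Good G) (h' : Good G') : Good fun p => G p + G' p := by
  obtain ⟨hs, C, hC, H⟩ := h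
  obtain ⟨hs', C', hC', H'⟩ := h'
  refine ⟨fun p u => (hs p u).add (hs' p u), C + C', by positivity, fun p hp u => ?_⟩
  obtain ⟨a, b⟩ := H p hp u
  obtain ⟨a', b'⟩ := H' p hp u
  refine ⟨?_, fun i => ?_⟩
  · rw [add_apply, add_mul]
    exact (norm_add_le _ _).trans (add_le_add a a')
  · rw [add_apply, add_mul, wd_add (hs p u) (hs' p u)]
    exact (norm_add_le _ _).trans (add_le_add (b i) (b' i))

lemma Good.smul {G : Par → V6 →L[ℂ] L2} (c : ℂ) (h : Good G) : Good fun p => c • G p := by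
  obtain ⟨hs, C, hC, H⟩ := h
  refine ⟨fun p u => (hs p u).smul c, ‖c‖ * C, by positivity, fun p hp u => ?_⟩
  obtain ⟨a, b⟩ := H p hp u
  refine ⟨?_, fun i => ?_⟩
  · rw [smul_apply, norm_smul, mul_assoc]; gcongr
  · rw [smul_apply, wd_smul c (hs p u), norm_smul, mul_assoc]; gcongr; exact b i

lemma Good.sum {ι : Type*} (s : Finset ι) {G : ι → Par → V6 →L[ℂ] L2} (h : ∀ i, Good (G i)) :
    Good fun p => ∑ i ∈ s, G i p := by
  classical
  induction s using Finset.induction_on with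
  | empty => simpa using Good.const (B := 0) fun _ => sob_zero_fun 1
  | insert a s ha ih =>
    simp only [Finset.sum_insert ha]
    exact (h a).add ih

/-- Leibniz's rule; the family and its tangential derivatives are bounded uniformly because `parSet`
and the sphere are compact. -/
lemma Good.mul {G : Par → V6 →L[ℂ] L2} (h : Good G) {ψ : Par × E3 → ℝ} (hψ : ContDiff ℝ ∞ ψ) :
    Good fun p => (mulL (fam hψ p)).comp (G p) := by
  obtain ⟨hs, C, hC, H⟩ := h
  obtain ⟨M, hM, hb⟩ := exists_bound_fam hψ
  choose N hN hbN using fun i => exists_bound_fam (contDiff_famDeriv i hψ)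
  refine ⟨fun p u => memH_iff_sob.1 (memH_mul (contDiff_slice hψ p) (memH_iff_sob.2 (hs p u))),
    M * C + ∑ i, N i * C,
    add_nonneg (by positivity) (Finset.sum_nonneg fun i _ => mul_nonneg (hN i) hC), fun p hp u => ?_⟩
  obtain ⟨a, b⟩ := H p hp u
  have hNs : 0 ≤ ∑ i, N i * C := Finset.sum_nonneg fun i _ => mul_nonneg (hN i) hC
  have hA : ∀ {f : L2}, ‖f‖ ≤ C * ‖u‖ → ‖fam hψ p • f‖ ≤ M * C * ‖u‖ := fun {f} hf => by
    refine (norm_smulC_le _ _).trans ?_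
    rw [mul_assoc]
    exact mul_le_mul (hb p hp) hf (norm_nonneg _) hM
  refine ⟨?_, fun i => ?_⟩
  · refine (hA a).trans ?_
    gcongr
    linarith
  · have hd := ((Sob.hasWeakDeriv (m := 0) (hs p u) i).mul (contDiff_slice hψ p)).weakDeriv_eq
    have e : res _ (contDiff_tangDeriv i (contDiff_slice hψ p)).continuous
        = fam (contDiff_famDeriv i hψ) p := by
      ext y
      simp only [res_apply, fam]
      rw [tangDeriv_ofReal, famDeriv_eq i hψ]
      exact (hψ.comp (by fun_prop : ContDiff ℝ ∞ fun y : E3 => (p, y))).differentiable (by simp) _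
    rw [e] at hd
    change ‖weakDeriv i (res _ (contDiff_slice hψ p).continuous • G p u)‖ ≤ _
    rw [hd]
    have h2 : ‖fam (contDiff_famDeriv i hψ) p • G p u‖ ≤ N i * C * ‖u‖ := by
      refine (norm_smulC_le _ _).trans ?_
      rw [mul_assoc]
      exact mul_le_mul (hbN i p hp) a (norm_nonneg _) (hN i)
    have h3 := Finset.single_le_sum (f := fun i => N i * C) (fun i _ => mul_nonneg (hN i) hC)
      (Finset.mem_univ i)
    refine ((norm_add_le _ _).trans (add_le_add (hA (b i)) h2)).trans ?_
    rw [← add_mul]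
    gcongr

/-! ### The Landau fields as smooth families -/

/-- A smooth function on the line which agrees with `1 / (1 - z)` for `|z| < 3 / 4`. -/
lemma exists_cutoff : ∃ h : ℝ → ℝ, ContDiff ℝ ∞ h ∧ ∀ z, |z| < 3 / 4 → h z = 1 / (1 - z) := by
  let χ : ContDiffBump (0 : ℝ) := ⟨3 / 4, 7 / 8, by norm_num, by norm_num⟩
  refine ⟨fun z => χ z / (1 - z), ?_, fun z hz => ?_⟩
  · rw [contDiff_iff_contDiffAt]
    intro z
    rcases eq_or_ne z 1 with rfl | hz
    · have : (fun z => χ z / (1 - z)) =ᶠ[𝓝 1] fun _ => 0 := by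
        have : ∀ᶠ z : ℝ in 𝓝 1, 7 / 8 < z := lt_mem_nhds (by norm_num)
        filter_upwards [this] with z hz
        rw [χ.zero_of_le_dist, zero_div]
        rw [Real.dist_eq, sub_zero]
        exact hz.le.trans (le_abs_self z)
      exact contDiffAt_const.congr_of_eventuallyEq this
    · exact χ.contDiff.contDiffAt.div (by fun_prop) (sub_ne_zero.2 hz.symm)
  · simp only
    rw [χ.one_of_mem_closedBall]
    rw [mem_closedBall_zero_iff]
    exact hz.le

/-- The cut-off of `1 / (1 - z)`. -/
def cutoff : ℝ → ℝ := exists_cutoff.choose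

lemma contDiff_cutoff : ContDiff ℝ ∞ cutoff := exists_cutoff.choose_spec.1

lemma cutoff_eq {z : ℝ} (h : |z| < 3 / 4) : cutoff z = 1 / (1 - z) := exists_cutoff.choose_spec.2 z h

/-- The components of `V / ε`, as a smooth family. -/
def famV (i : Fin 3) (x : Par × E3) : ℝ :=
  -(2 * cutoff (x.1.1 * inner ℝ x.2 x.1.2)) * (inner ℝ x.2 x.1.2 * x.2 i - x.1.2 i)

/-- The function `F / ε`, as a smooth family. -/
def famR (x : Par × E3) : ℝ :=
  2 * (2 * inner ℝ x.2 x.1.2 - x.1.1 - x.1.1 * inner ℝ x.2 x.1.2 ^ 2) *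
    cutoff (x.1.1 * inner ℝ x.2 x.1.2) ^ 2

lemma contDiff_inner_par : ContDiff ℝ ∞ fun x : Par × E3 => inner ℝ x.2 x.1.2 :=
  ContDiff.inner ℝ (by fun_prop) (by fun_prop)

lemma contDiff_cutoff_par :
    ContDiff ℝ ∞ fun x : Par × E3 => cutoff (x.1.1 * inner ℝ x.2 x.1.2) :=
  contDiff_cutoff.comp (ContDiff.mul (by fun_prop) contDiff_inner_par)

lemma contDiff_famV (i : Fin 3) : ContDiff ℝ ∞ (famV i) :=
  (contDiff_const.mul contDiff_cutoff_par).neg.mul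
    ((contDiff_inner_par.mul (by fun_prop)).sub (by fun_prop))

lemma contDiff_famR : ContDiff ℝ ∞ famR :=
  (contDiff_const.mul (((contDiff_const.mul contDiff_inner_par).sub (by fun_prop)).sub
    (ContDiff.mul (by fun_prop) (contDiff_inner_par.pow 2)))).mul (contDiff_cutoff_par.pow 2)

/-- The parameter of the Landau solution with force `b`. -/
def landauPar (b : E3) : Par := (landauEps b, landauDir b)

lemma norm_landauDir_le (b : E3) : ‖landauDir b‖ ≤ 1 := by
  unfold landauDir
  rw [norm_smul, norm_inv, norm_norm]
  exact inv_mul_le_one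

lemma landauPar_mem {b : E3} (h : ‖b‖ ≤ 2 * Real.pi) : landauPar b ∈ parSet := by
  obtain ⟨h0, -, h1⟩ := landauEps_mem h
  exact ⟨⟨h0, h1⟩, by rw [mem_closedBall_zero_iff]; exact norm_landauDir_le b⟩

lemma abs_eps_cosAngle_lt {b : E3} (h : ‖b‖ ≤ 2 * Real.pi) (y : S2) :
    |landauEps b * cosAngle b y| < 3 / 4 := by
  obtain ⟨h0, -, h1⟩ := landauEps_mem h
  have h2 : |cosAngle b y| ≤ 1 := by
    refine (abs_real_inner_le_norm _ _).trans ?_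
    have hy : ‖(y : E3)‖ = 1 := by simp
    rw [hy, one_mul]
    exact norm_landauDir_le b
  rw [abs_mul, abs_of_nonneg h0]
  nlinarith [abs_nonneg (cosAngle b y)]

lemma eventually_abs_lt {b : E3} (h : ‖b‖ ≤ 2 * Real.pi) (y : S2) :
    ∀ᶠ x : E3 in 𝓝 (y : E3), |landauEps b * cosAngle b x| < 3 / 4 := by
  have hc : Continuous fun x : E3 => |landauEps b * cosAngle b x| := by
    unfold cosAngle; fun_prop
  exact hc.continuousAt.eventually_lt continuousAt_const (abs_eps_cosAngle_lt h y)

/-- The explicit factor ε is what makes K of order |b|. The cut-off makes the family smooth on the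
whole space, and is not seen near the sphere, where |ε cos θ| < 3/4. -/
lemma landauV_eq {b y : E3} (h : |landauEps b * cosAngle b y| < 3 / 4) (i : Fin 3) :
    landauV b i y = landauEps b * famV i (landauPar b, y) := by
  unfold landauV famV landauPar
  change _ = landauEps b * (-(2 * cutoff (landauEps b * cosAngle b y)) *
    (cosAngle b y * y i - landauDir b i))
  rw [cutoff_eq h]
  ring

lemma landauR_eq {b y : E3} (h : |landauEps b * cosAngle b y| < 3 / 4) :
    landauR b y = landauEps b * famR (landauPar b, y) := by
  unfold landauR famR landauPar
  change _ = landauEps b * (2 * (2 * cosAngle b y - landauEps b - landauEps b * cosAngle b y ^ 2) *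
    cutoff (landauEps b * cosAngle b y) ^ 2)
  rw [cutoff_eq h]
  have : 1 - landauEps b * cosAngle b y ≠ 0 := by
    have := (abs_lt.1 h).2
    linarith
  field_simp
  ring

lemma tangDeriv_congr_smul {φ : E3 → ℝ} {ψ : Par × E3 → ℝ} (hψ : ContDiff ℝ ∞ ψ) {c : ℝ} {p : Par}
    {y : E3} (h : φ =ᶠ[𝓝 y] fun y => c * ψ (p, y)) (i : Fin 3) :
    tangDeriv i φ y = c * famDeriv i ψ (p, y) := by
  rw [← famDeriv_eq i hψ]
  unfold tangDeriv
  rw [h.fderiv_eq, fderiv_const_mul]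
  · rfl
  · exact (hψ.comp (by fun_prop : ContDiff ℝ ∞ fun y : E3 => (p, y))).differentiable (by simp) _

lemma mulBy_fam {a : E3 → ℝ} {ψ : Par × E3 → ℝ} (hψ : ContDiff ℝ ∞ ψ) {c : ℝ} {p : Par}
    (h : ∀ y : S2, a y = c * ψ (p, y)) (f : L2) :
    mulBy a f = (c : ℂ) • (fam hψ p • f) := by
  have : ∀ y : S2, ((c : ℂ) • fam hψ p) y = ((a y : ℝ) : ℂ) := fun y => by
    rw [h y]
    simp [fam]
  rw [mulBy_eq this, smul_assoc]

lemma mulBy_landauV {b : E3} (h : ‖b‖ ≤ 2 * Real.pi) (i : Fin 3) (f : L2) :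
    mulBy (landauV b i) f = (landauEps b : ℂ) • (fam (contDiff_famV i) (landauPar b) • f) :=
  mulBy_fam _ (fun y => landauV_eq (abs_eps_cosAngle_lt h y) i) f

lemma mulBy_landauR {b : E3} (h : ‖b‖ ≤ 2 * Real.pi) (f : L2) :
    mulBy (landauR b) f = (landauEps b : ℂ) • (fam contDiff_famR (landauPar b) • f) :=
  mulBy_fam _ (fun y => landauR_eq (abs_eps_cosAngle_lt h y)) f

lemma mulBy_tangDeriv_landauV {b : E3} (h : ‖b‖ ≤ 2 * Real.pi) (i j : Fin 3) (f : L2) :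
    mulBy (tangDeriv j (landauV b i)) f =
      (landauEps b : ℂ) • (fam (contDiff_famDeriv j (contDiff_famV i)) (landauPar b) • f) :=
  mulBy_fam _ (fun y => tangDeriv_congr_smul (contDiff_famV i)
    ((eventually_abs_lt h y).mono fun _ hx => landauV_eq hx i) j) f

lemma mulBy_tangDeriv_landauR {b : E3} (h : ‖b‖ ≤ 2 * Real.pi) (j : Fin 3) (f : L2) :
    mulBy (tangDeriv j (landauR b)) f =
      (landauEps b : ℂ) • (fam (contDiff_famDeriv j contDiff_famR) (landauPar b) • f) :=
  mulBy_fam _ (fun y => tangDeriv_congr_smul contDiff_famR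
    ((eventually_abs_lt h y).mono fun _ hx => landauR_eq hx) j) f

/-! ### The operator `K` -/

/-- K differentiates ξ and ϑ, which lie in H², at most once, and multiplies the other entries and q,
which lie in H¹, by smooth functions. So its two nonzero components lie in H¹, which is what X
requires of ξ' and ϑ*. -/
lemma opK_param : ∃ (G : Fin 3 → Par → V6 →L[ℂ] L2) (H : Par → V6 →L[ℂ] L2),
    (∀ i, Good (G i)) ∧ Good H ∧ ∀ b : E3, ‖b‖ ≤ 2 * Real.pi → ∀ u, opK b (param u) =
      (0, fun i => (landauEps b : ℂ) • G i (landauPar b) u, 0, (landauEps b : ℂ) • H (landauPar b) u) := by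
  have hX := fun u => mem_X_iff.1 (param_mem_X u)
  let Z : Fin 3 → V6 →L[ℂ] L2 := fun i =>
    (ContinuousLinearMap.proj i).comp ((ContinuousLinearMap.fst ℂ L2Vec (L2Vec × L2 × L2)).comp param)
  let S : V6 →L[ℂ] L2Vec × L2 × L2 := (ContinuousLinearMap.snd ℂ L2Vec (L2Vec × L2 × L2)).comp param
  let Z' : Fin 3 → V6 →L[ℂ] L2 := fun i =>
    (ContinuousLinearMap.proj i).comp ((ContinuousLinearMap.fst ℂ L2Vec (L2 × L2)).comp S)
  let S' : V6 →L[ℂ] L2 × L2 := (ContinuousLinearMap.snd ℂ L2Vec (L2 × L2)).comp S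
  let t : V6 →L[ℂ] L2 := (ContinuousLinearMap.fst ℂ L2 L2).comp S'
  let t' : V6 →L[ℂ] L2 := (ContinuousLinearMap.snd ℂ L2 L2).comp S'
  have z2 : ∀ i u, Sob 2 (Z i u) := fun i u => (hX u).2.1 i
  have z1 : ∀ i u, Sob 1 (Z i u) := fun i u => (z2 i u).mono_succ
  have z1' : ∀ i u, Sob 1 (Z' i u) := fun i u => (hX u).2.2.2.1 i
  have t2 : ∀ u, Sob 2 (t u) := fun u => (hX u).2.2.2.2.1
  have t1 : ∀ u, Sob 1 (t u) := fun u => (t2 u).mono_succ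
  have t1' : ∀ u, Sob 1 (t' u) := fun u => (hX u).2.2.2.2.2.2
  choose W hW using fun j i => exists_clm_wd (Z i) (z1 i) j
  choose w hw using fun j => exists_clm_wd t t1 j
  have W1 : ∀ j i u, Sob 1 (W j i u) := fun j i u => by rw [hW]; exact (z2 i u).wd j
  have w1 : ∀ j u, Sob 1 (w j u) := fun j u => by rw [hw]; exact (t2 u).wd j
  let q : V6 →L[ℂ] L2 := -((∑ i, W i i) + t + t')
  have q1 : ∀ u, Sob 1 (q u) := fun u => by
    simp only [q, neg_apply, add_apply, sum_apply]
    exact (((Sob.sum fun i _ => W1 i i u).add (t1 u)).add (t1' u)).neg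
  have hq : ∀ u, pressure (param u) = q u := fun u => by
    simp only [q, neg_apply, add_apply, sum_apply, hW]
    rfl
  have cY : ∀ i : Fin 3, ContDiff ℝ ∞ fun x : Par × E3 => x.2 i := fun i => by fun_prop
  have famY : ∀ i p, fam (cY i) p = Y i := fun i p => rfl
  let tp : (Fin 3 → Par → V6 →L[ℂ] L2) → Fin 3 → Par → V6 →L[ℂ] L2 := fun η i p =>
    η i p + (-1 : ℂ) • ∑ l, (mulL (fam (cY i) p)).comp ((mulL (fam (cY l) p)).comp (η l p))
  have tpg : ∀ {η}, (∀ i, Good (η i)) → ∀ i, Good (tp η i) := fun h i =>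
    (h i).add ((Good.sum _ fun l => ((h l).mul (cY l)).mul (cY i)).smul _)
  have tpe : ∀ η : Fin 3 → Par → V6 →L[ℂ] L2, ∀ (c : ℂ) p u i,
      tangProj (fun i => c • η i p u) i = c • tp η i p u := fun η c p u i => by
    simp only [tangProj, mulBy_coord, tp, add_apply, smul_apply, sum_apply,
      ContinuousLinearMap.comp_apply, mulL_apply, famY, smul_comm (Y _) c, ← Finset.smul_sum]
    module
  let η : Fin 3 → Par → V6 →L[ℂ] L2 := fun i p => ∑ j, (mulL (fam (contDiff_famV j) p)).comp (W j i)
  let ζ : Fin 3 → Par → V6 →L[ℂ] L2 := fun i p =>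
    ∑ j, (mulL (fam (contDiff_famDeriv j (contDiff_famV i)) p)).comp (Z j)
  have gη : ∀ i, Good (η i) := fun i => Good.sum _ fun j => (Good.const (W1 j i)).mul _
  have gζ : ∀ i, Good (ζ i) := fun i => Good.sum _ fun j => (Good.const (z1 j)).mul _
  refine ⟨fun i p => (-1 : ℂ) • tp η i p + (-1 : ℂ) • tp ζ i p
      + (-1 : ℂ) • (mulL (fam contDiff_famR p)).comp (Z' i),
    fun p => (-1 : ℂ) • (∑ j, (mulL (fam (contDiff_famV j) p)).comp (w j))
      + (-1 : ℂ) • (∑ j, (mulL (fam (contDiff_famDeriv j contDiff_famR) p)).comp (Z j))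
      + (2 : ℂ) • (∑ j, (mulL (fam (contDiff_famV j) p)).comp (Z j))
      + (2 : ℂ) • (mulL (fam contDiff_famR p)).comp t + (-1 : ℂ) • (mulL (fam contDiff_famR p)).comp t'
      + (-1 : ℂ) • (mulL (fam contDiff_famR p)).comp q, fun i => ?_, ?_, fun b hb u => ?_⟩
  · exact (((tpg gη i).smul _).add ((tpg gζ i).smul _)).add (((Good.const (z1' i)).mul _).smul _)
  · exact (((((Good.sum _ fun j => (Good.const (w1 j)).mul _).smul _).add
      ((Good.sum _ fun j => (Good.const (z1 j)).mul _).smul _)).add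
      ((Good.sum _ fun j => (Good.const (z1 j)).mul _).smul _)).add
      (((Good.const t1).mul _).smul _)).add (((Good.const t1').mul _).smul _) |>.add
      (((Good.const q1).mul _).smul _)
  · refine Prod.ext rfl (Prod.ext ?_ (Prod.ext rfl ?_))
    · funext i
      have e1 : covV b (param u).1 i = (landauEps b : ℂ) • tp η i (landauPar b) u := by
        rw [← tpe]
        unfold covV
        congr 2
        funext i
        simp only [η, mulBy_landauV hb, sum_apply, ContinuousLinearMap.comp_apply, mulL_apply, hW,
          Finset.smul_sum]
        rfl
      have e2 : covXiV b (param u).1 i = (landauEps b : ℂ) • tp ζ i (landauPar b) u := by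
        rw [← tpe]
        unfold covXiV
        congr 2
        funext i
        simp only [ζ, mulBy_tangDeriv_landauV hb, sum_apply, ContinuousLinearMap.comp_apply, mulL_apply,
          Finset.smul_sum]
        rfl
      change -covV b (param u).1 i - covXiV b (param u).1 i - mulBy (landauR b) ((param u).2.1 i) = _
      rw [e1, e2, mulBy_landauR hb]
      simp only [add_apply, smul_apply, ContinuousLinearMap.comp_apply, mulL_apply]
      change _ = (landauEps b : ℂ) • ((-1 : ℂ) • tp η i (landauPar b) u + (-1 : ℂ) • tp ζ i (landauPar b) u
        + (-1 : ℂ) • (fam contDiff_famR (landauPar b) • (param u).2.1 i))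
      module
    · change -(∑ j, mulBy (landauV b j) (weakDeriv j (t u)))
        - (∑ j, mulBy (tangDeriv j (landauR b)) (Z j u))
        + (2 : ℂ) • (∑ j, mulBy (landauV b j) (Z j u))
        + (2 : ℂ) • mulBy (landauR b) (t u)
        - mulBy (landauR b) (t' u)
        - mulBy (landauR b) (pressure (param u)) = _
      simp only [mulBy_landauV hb, mulBy_landauR hb, mulBy_tangDeriv_landauR hb, hq, ← hw,
        ← Finset.smul_sum, add_apply, smul_apply, sum_apply, ContinuousLinearMap.comp_apply, mulL_apply]
      module

lemma tangent_tangProj (η : L2Vec) : ∑ i, Y i • tangProj η i = 0 := by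
  have h : (Y 0 ^ 2 + Y 1 ^ 2 + Y 2 ^ 2) • (∑ j, Y j • η j) = ∑ j, Y j • η j := by
    rw [Y_sq, one_smul]
  simp only [tangProj, mulBy_coord, ← Finset.smul_sum, Fin.sum_univ_three] at h ⊢
  linear_combination (norm := module) -h

lemma opK_mem_X {b : E3} (h : ‖b‖ ≤ 2 * Real.pi) (u : V6) : opK b (param u) ∈ X := by
  obtain ⟨G, H, hG, hH, e⟩ := opK_param
  rw [mem_X_iff]
  have hX := mem_X_iff.1 (param_mem_X u)
  refine ⟨?_, ?_, ?_, ?_, ?_, ?_, ?_⟩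
  · simp [opK]
  · intro i; exact sob_zero_fun 2
  · change ∑ i, Y i • (-tangProj _ i - tangProj _ i - mulBy (landauR b) ((param u).2.1 i)) = 0
    simp only [smul_sub, smul_neg, Finset.sum_sub_distrib, Finset.sum_neg_distrib, tangent_tangProj,
      mulBy_landauR h, smul_comm (Y _) (landauEps b : ℂ), smul_comm (Y _) (fam contDiff_famR (landauPar b)),
      ← Finset.smul_sum, hX.2.2.1]
    simp
  · intro i
    rw [e b h]
    exact ((hG i).1 _ _).smul _
  · exact sob_zero_fun 2
  · simp [opK]
  · rw [e b h]
    exact (hH.1 _ _).smul _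

lemma curl_zero : curl 0 = 0 := by
  rw [curl_eq (ξ := 0) fun i => sob_zero_fun 1]
  refine Finset.sum_eq_zero fun i _ => ?_
  simpa using jop_smul 0 (sob_zero_fun 1) i

lemma divg_zero : divg 0 = 0 := Finset.sum_eq_zero fun i _ => wd_zero i

lemma integral_zero_L2 : ∫ y, (0 : L2) y ∂area = 0 := by rw [← pair_one, map_zero]

lemma h1Sq_zero : h1Sq 0 = 0 := by
  unfold h1Sq meanSq
  simp only [wd_zero]
  rw [integral_zero_L2]
  simp [wd_zero]

lemma h2Sq_zero : h2Sq 0 = 0 := by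
  unfold h2Sq meanSq lapl
  simp only [wd_zero]
  rw [integral_zero_L2]
  simp [wd_zero]

lemma xNorm_opK_le : ∃ C : ℝ, 0 < C ∧ ∀ b : E3, ‖b‖ ≤ 2 * Real.pi → ∀ u,
    xNorm (opK b (param u)) ≤ C * ‖b‖ * ‖u‖ := by
  obtain ⟨G, H, hG, hH, e⟩ := opK_param
  have hGs := fun i => (hG i).1
  choose CG hCG0 hCG using fun i => (hG i).2
  obtain ⟨hHs, CH, hCH0, hCH⟩ := hH
  set M := ∑ i, CG i + CH with hM
  have hM0 : 0 ≤ M := add_nonneg (Finset.sum_nonneg fun i _ => hCG0 i) hCH0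
  have hCGM : ∀ i, CG i ≤ M := fun i => by
    have := Finset.single_le_sum (f := CG) (fun i _ => hCG0 i) (Finset.mem_univ i)
    linarith
  have hCHM : CH ≤ M := by linarith [Finset.sum_nonneg fun (i : Fin 3) (_ : i ∈ Finset.univ) => hCG0 i]
  obtain ⟨A, hA0, hA⟩ := meanSq_clm (ContinuousLinearMap.id ℂ L2)
  -- The curl, the divergence and the last component contribute 36 N², 9 N² and (A + 3) N², and A +
  -- 48 ≤ (A + 60)².
  refine ⟨M * (A + 60) + 1, by positivity, fun b hb u => ?_⟩
  obtain ⟨h0, h5, -⟩ := landauEps_mem hb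
  have hp := landauPar_mem hb
  set ε := landauEps b with hε
  set N := ε * (M * ‖u‖) with hN
  have hN0 : 0 ≤ N := by positivity
  have hnε : ‖(ε : ℂ)‖ = ε := by rw [Complex.norm_real, Real.norm_eq_abs, abs_of_nonneg h0]
  have wG : ∀ i j, ‖weakDeriv j ((ε : ℂ) • G i (landauPar b) u)‖ ≤ N := fun i j => by
    rw [wd_smul _ (hGs i _ _), norm_smul, hnε]
    refine mul_le_mul_of_nonneg_left (((hCG i _ hp u).2 j).trans ?_) h0
    exact mul_le_mul_of_nonneg_right (hCGM i) (norm_nonneg _)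
  have wH : ∀ j, ‖weakDeriv j ((ε : ℂ) • H (landauPar b) u)‖ ≤ N := fun j => by
    rw [wd_smul _ (hHs _ _), norm_smul, hnε]
    refine mul_le_mul_of_nonneg_left (((hCH _ hp u).2 j).trans ?_) h0
    exact mul_le_mul_of_nonneg_right hCHM (norm_nonneg _)
  have nH : ‖(ε : ℂ) • H (landauPar b) u‖ ≤ N := by
    rw [norm_smul, hnε]
    refine mul_le_mul_of_nonneg_left ((hCH _ hp u).1.trans ?_) h0
    exact mul_le_mul_of_nonneg_right hCHM (norm_nonneg _)
  rw [e b hb]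
  unfold xNorm
  simp only
  set η : L2Vec := fun i => (ε : ℂ) • G i (landauPar b) u with hη
  set f : L2 := (ε : ℂ) • H (landauPar b) u with hf
  have c1 : ‖curl η‖ ≤ 6 * N := by
    unfold curl
    refine (norm_sum_le _ _).trans ?_
    calc _ ≤ ∑ i : Fin 3, 2 * N := by
          refine Finset.sum_le_sum fun i _ => ?_
          rw [mulBy_coord]
          refine (norm_Y_smul_le _ _).trans ((norm_sub_le _ _).trans ?_)
          linarith [wG (i + 2) (i + 1), wG (i + 1) (i + 2)]
      _ = _ := by simp; ring
  have c2 : ‖dstar η‖ ≤ 3 * N := by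
    unfold dstar divg
    rw [norm_neg]
    refine (norm_sum_le _ _).trans ?_
    calc _ ≤ ∑ i : Fin 3, N := Finset.sum_le_sum fun i _ => wG i i
      _ = _ := by simp
  have c3 : h1Sq f ≤ (A + 3) * N ^ 2 := by
    unfold h1Sq
    have a1 : meanSq f ≤ A * N ^ 2 := (hA f).trans (by gcongr)
    have a2 : ∑ i, ‖weakDeriv i f‖ ^ 2 ≤ ∑ i : Fin 3, N ^ 2 :=
      Finset.sum_le_sum fun i _ => by gcongr; exact wH i
    simp only [Finset.sum_const, Finset.card_univ, Fintype.card_fin, nsmul_eq_mul] at a2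
    push_cast at a2
    linarith only [a1, a2]
  have c1' : ‖curl η‖ ^ 2 ≤ 36 * N ^ 2 := by nlinarith [norm_nonneg (curl η)]
  have c2' : ‖dstar η‖ ^ 2 ≤ 9 * N ^ 2 := by nlinarith [norm_nonneg (dstar η)]
  have d0 : dstar 0 = 0 := by rw [dstar, divg_zero, neg_zero]
  rw [curl_zero, d0, h1Sq_zero, h2Sq_zero]
  have hNb : N ≤ M * (‖b‖ * ‖u‖) := by
    have : ε ≤ ‖b‖ := h5.trans (by linarith [norm_nonneg b])
    calc N = M * (ε * ‖u‖) := by rw [hN]; ring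
      _ ≤ _ := by gcongr
  calc _ ≤ Real.sqrt (((A + 60) * N) ^ 2) := by
        apply Real.sqrt_le_sqrt
        nlinarith [mul_nonneg hA0 (sq_nonneg N), mul_nonneg (mul_nonneg hA0 hA0) (sq_nonneg N), sq_nonneg N]
    _ = (A + 60) * N := Real.sqrt_sq (by positivity)
    _ ≤ (A + 60) * (M * (‖b‖ * ‖u‖)) := by gcongr
    _ ≤ _ := by
      have := mul_nonneg (norm_nonneg b) (norm_nonneg u)
      nlinarith

end LandauSphere
end

/-! ### Scalar Cauchy integrals over the unbounded contours. -/

noncomputable section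
namespace LandauSphere

/-! ### The curves `Re z = a + |Im z| ^ (8 / 7)` -/

/-- The curve `Re z = a + |Im z| ^ (8 / 7)`, traversed downwards. -/
def crv (a t : ℝ) : ℂ := ((a + |t| ^ (8 / 7 : ℝ) : ℝ) : ℂ) - (t : ℂ) * Complex.I

/-- The derivative of `crv a`. -/
def dcrv (t : ℝ) : ℂ := ((8 / 7 * |t| ^ ((8 / 7 : ℝ) - 2) * t : ℝ) : ℂ) - Complex.I

/-- The weight `1 + |t|`. -/
def rho (t : ℝ) : ℝ := 1 + |t|

lemma one_le_rho (t : ℝ) : 1 ≤ rho t := le_add_of_nonneg_right (abs_nonneg t)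

lemma rho_pos (t : ℝ) : 0 < rho t := one_pos.trans_le (one_le_rho t)

lemma abs_le_rho (t : ℝ) : |t| ≤ rho t := by unfold rho; linarith

@[fun_prop] lemma continuous_rho : Continuous rho := by unfold rho; fun_prop

@[simp] lemma crv_re (a t : ℝ) : (crv a t).re = a + |t| ^ (8 / 7 : ℝ) := by simp [crv]

@[simp] lemma crv_im (a t : ℝ) : (crv a t).im = -t := by simp [crv]

lemma hasDerivAt_crv (a t : ℝ) : HasDerivAt (crv a) (dcrv t) t := by
  have h1 := (hasDerivAt_abs_rpow t (p := 8 / 7) (by norm_num)).const_add a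
  have h2 : HasDerivAt (fun t : ℝ => (t : ℂ) * Complex.I) Complex.I t := by
    simpa using (Complex.ofRealCLM.hasDerivAt (x := t)).mul_const Complex.I
  exact h1.ofReal_comp.sub h2

lemma deriv_crv (a : ℝ) : deriv (crv a) = dcrv := funext fun t => (hasDerivAt_crv a t).deriv

lemma continuous_abs_rpow {p : ℝ} (hp : 0 ≤ p) : Continuous fun t : ℝ => |t| ^ p :=
  continuous_abs.rpow_const fun _ => Or.inr hp

lemma continuous_crv (a : ℝ) : Continuous (crv a) :=
  continuous_iff_continuousAt.2 fun t => (hasDerivAt_crv a t).continuousAt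

lemma continuous_dcrv : Continuous dcrv := by
  have h : ContDiff ℝ 1 fun t : ℝ => ‖t‖ ^ (8 / 7 : ℝ) := contDiff_norm_rpow (by norm_num)
  have h1 : deriv (fun t : ℝ => ‖t‖ ^ (8 / 7 : ℝ)) = fun t => 8 / 7 * |t| ^ ((8 / 7 : ℝ) - 2) * t :=
    funext fun t => (hasDerivAt_abs_rpow t (p := 8 / 7) (by norm_num)).deriv
  have h2 := h.continuous_deriv le_rfl
  rw [h1] at h2
  unfold dcrv
  fun_prop

lemma norm_dcrv_le (t : ℝ) : ‖dcrv t‖ ≤ 3 * rho t ^ (1 / 7 : ℝ) := by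
  have h1 : |t| ^ ((8 / 7 : ℝ) - 2) * |t| ≤ rho t ^ (1 / 7 : ℝ) := by
    rcases eq_or_ne t 0 with rfl | ht
    · simp [rho]
    · have : 0 < |t| := abs_pos.2 ht
      nth_rewrite 2 [← Real.rpow_one |t|]
      rw [← Real.rpow_add this]
      norm_num
      exact Real.rpow_le_rpow this.le (abs_le_rho t) (by norm_num)
  have h2 : 1 ≤ rho t ^ (1 / 7 : ℝ) := Real.one_le_rpow (one_le_rho t) (by norm_num)
  unfold dcrv
  refine (norm_sub_le _ _).trans ?_
  rw [Complex.norm_real, Complex.norm_I, Real.norm_eq_abs, abs_mul, abs_mul,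
    abs_of_nonneg (Real.rpow_nonneg (abs_nonneg t) _), abs_of_nonneg (by norm_num : (0 : ℝ) ≤ 8 / 7),
    mul_assoc]
  linarith

lemma rpow_le_rho {q : ℝ} (h0 : 0 ≤ q) (h1 : q ≤ 1) (t : ℝ) : rho t ^ q ≤ rho t := by
  nth_rewrite 2 [← Real.rpow_one (rho t)]
  exact Real.rpow_le_rpow_of_exponent_le (one_le_rho t) h1

lemma norm_dcrv_le' (t : ℝ) : ‖dcrv t‖ ≤ 3 * rho t :=
  (norm_dcrv_le t).trans (by linarith [rpow_le_rho (q := 1 / 7) (by norm_num) (by norm_num) t])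

lemma abs_sub_one_le (t : ℝ) : |t| - 1 ≤ |t| ^ (8 / 7 : ℝ) := by
  rcases le_total |t| 1 with h | h
  · linarith [Real.rpow_nonneg (abs_nonneg t) (8 / 7 : ℝ)]
  · have := Real.rpow_le_rpow_of_exponent_le h (by norm_num : (1 : ℝ) ≤ 8 / 7)
    rw [Real.rpow_one] at this
    linarith

/-- Bernoulli's inequality at x / y is the convexity bound y^p - x^p ≤ p y^(p-1) (y - x) with p =
8/7, and y^(1/7) ≤ 1 + y. -/
lemma rpow_sub_rpow_le {x y : ℝ} (hx : 0 ≤ x) (hxy : x ≤ y) :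
    y ^ (8 / 7 : ℝ) - x ^ (8 / 7 : ℝ) ≤ 2 * (1 + y) * (y - x) := by
  rcases (hx.trans hxy).eq_or_lt with h | hy
  · have : x = 0 := le_antisymm (hxy.trans h.symm.le) hx
    subst h; subst this; simp
  have hb := one_add_mul_self_le_rpow_one_add (s := x / y - 1) (by
    have : 0 ≤ x / y := by positivity
    linarith) (p := 8 / 7) (by norm_num)
  rw [add_sub_cancel, Real.div_rpow hx hy.le, le_div_iff₀ (by positivity)] at hb
  have e : y ^ (8 / 7 : ℝ) = y ^ (1 / 7 : ℝ) * y := by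
    nth_rewrite 3 [← Real.rpow_one y]
    rw [← Real.rpow_add hy]; norm_num
  have h1 : y ^ (1 / 7 : ℝ) ≤ 1 + y := by
    have := rpow_le_rho (q := 1 / 7) (by norm_num) (by norm_num) y
    rw [rho, abs_of_pos hy] at this
    exact (Real.rpow_le_rpow hy.le (by linarith) (by norm_num)).trans this
  have e2 : (1 + 8 / 7 * (x / y - 1)) * y ^ (8 / 7 : ℝ)
      = y ^ (8 / 7 : ℝ) - 8 / 7 * y ^ (1 / 7 : ℝ) * (y - x) := by
    rw [e]; field_simp; ring
  rw [e2] at hb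
  have h2 : y ^ (1 / 7 : ℝ) * (y - x) ≤ (1 + y) * (y - x) :=
    mul_le_mul_of_nonneg_right h1 (by linarith)
  have h3 : 0 ≤ (1 + y) * (y - x) := mul_nonneg (by linarith) (by linarith)
  linarith

lemma abs_rpow_sub_le (t t' : ℝ) :
    |t| ^ (8 / 7 : ℝ) - |t'| ^ (8 / 7 : ℝ) ≤ 2 * (rho t * rho t') * |t - t'| := by
  have h0 : 0 ≤ 2 * (rho t * rho t') * |t - t'| := by
    have := rho_pos t; have := rho_pos t'; positivity
  rcases le_total |t| |t'| with h | h
  · have := Real.rpow_le_rpow (abs_nonneg t) h (by norm_num : (0 : ℝ) ≤ 8 / 7)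
    linarith
  · refine (rpow_sub_rpow_le (abs_nonneg t') h).trans ?_
    have h1 : |t| - |t'| ≤ |t - t'| := abs_sub_abs_le_abs_sub t t'
    have h2 : rho t ≤ rho t * rho t' := le_mul_of_one_le_right (rho_pos t).le (one_le_rho t')
    change 2 * rho t * (|t| - |t'|) ≤ _
    have := rho_pos t
    gcongr
    linarith

/-- The tangents of the curves turn horizontal at infinity, so a horizontal translate approaches the
curve. The distance decays at most polynomially; the weights are absorbed later by the decay of
e^{zs}. -/
lemma crv_separated {a b : ℝ} (h : a ≤ b) (t t' : ℝ) :
    b - a ≤ 3 * (rho t * rho t') * ‖crv b t' - crv a t‖ := by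
  have h1 := Complex.abs_re_le_norm (crv b t' - crv a t)
  have h2 := Complex.abs_im_le_norm (crv b t' - crv a t)
  simp only [Complex.sub_re, Complex.sub_im, crv_re, crv_im] at h1 h2
  rw [show -t' - -t = t - t' by ring] at h2
  have h3 := abs_rpow_sub_le t t'
  have h4 := le_abs_self (b + |t'| ^ (8 / 7 : ℝ) - (a + |t| ^ (8 / 7 : ℝ)))
  have h5 : 1 ≤ rho t * rho t' := one_le_mul_of_one_le_of_one_le (one_le_rho t) (one_le_rho t')
  set n := ‖crv b t' - crv a t‖
  have hn : 0 ≤ n := norm_nonneg _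
  have h6 : 2 * (rho t * rho t') * |t - t'| ≤ 2 * (rho t * rho t') * n := by gcongr
  nlinarith

/-! ### Integrable weights -/

lemma integrable_rho_rpow {q : ℝ} (hq : q < -1) : Integrable fun t => rho t ^ q := by
  have := integrable_one_add_norm (E := ℝ) (μ := volume) (r := -q) (by simp; linarith)
  simpa [rho] using this

lemma exp_mul_rho_pow_le {s : ℝ} (hs : s < 0) (k : ℕ) : ∃ C : ℝ, 0 ≤ C ∧ ∀ t : ℝ,
    Real.exp (s * |t| ^ (8 / 7 : ℝ)) * rho t ^ k ≤ C * rho t ^ (-2 : ℝ) := by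
  refine ⟨(k + 2).factorial / (-s) ^ (k + 2) * Real.exp (-(2 * s)), ?_, fun t => ?_⟩
  · have : 0 < -s := by linarith
    positivity
  have hc : 0 < -s := by linarith
  have hr := rho_pos t
  have h1 := Real.pow_div_factorial_le_exp (-s * rho t) (by positivity) (k + 2)
  have h2 : Real.exp (s * |t| ^ (8 / 7 : ℝ)) ≤ Real.exp (-(2 * s)) * Real.exp (-(-s * rho t)) := by
    rw [← Real.exp_add]
    apply Real.exp_le_exp.2
    unfold rho
    nlinarith [abs_sub_one_le t]
  have h3 : rho t ^ (k + 2) ≤ (k + 2).factorial / (-s) ^ (k + 2) * Real.exp (-s * rho t) := by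
    rw [div_le_iff₀ (by positivity), mul_pow] at h1
    rw [div_mul_eq_mul_div, le_div_iff₀ (by positivity)]
    linarith
  have h4 : rho t ^ (-2 : ℝ) * rho t ^ (k + 2) = rho t ^ k := by
    rw [← Real.rpow_natCast _ (k + 2), ← Real.rpow_add hr, ← Real.rpow_natCast _ k]
    congr 1; push_cast; ring
  rw [← h4]
  have h5 : 0 < rho t ^ (-2 : ℝ) := by positivity
  calc _ ≤ Real.exp (-(2 * s)) * Real.exp (-(-s * rho t)) * (rho t ^ (-2 : ℝ) *
        ((k + 2).factorial / (-s) ^ (k + 2) * Real.exp (-s * rho t))) := by gcongr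
    _ = (k + 2).factorial / (-s) ^ (k + 2) * Real.exp (-(2 * s)) * rho t ^ (-2 : ℝ)
        * (Real.exp (-(-s * rho t)) * Real.exp (-s * rho t)) := by ring
    _ = _ := by rw [← Real.exp_add]; simp

lemma integrable_exp_mul_rho_pow {s : ℝ} (hs : s < 0) (k : ℕ) :
    Integrable fun t : ℝ => Real.exp (s * |t| ^ (8 / 7 : ℝ)) * rho t ^ k := by
  obtain ⟨C, -, hC⟩ := exp_mul_rho_pow_le hs k
  refine ((integrable_rho_rpow (q := -2) (by norm_num)).const_mul C).mono' ?_ ?_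
  · have := continuous_abs_rpow (p := 8 / 7) (by norm_num)
    exact Continuous.aestronglyMeasurable (by fun_prop)
  · refine Eventually.of_forall fun t => ?_
    have := rho_pos t
    rw [Real.norm_of_nonneg (by positivity)]
    exact hC t

lemma norm_exp_crv (a s t : ℝ) :
    ‖Complex.exp (crv a t * s)‖ = Real.exp (a * s) * Real.exp (s * |t| ^ (8 / 7 : ℝ)) := by
  rw [Complex.norm_exp, ← Real.exp_add]
  congr 1
  simp
  ring

/-! ### Cauchy integrals over the curves -/

/-- The truncated Cauchy integral. -/
def trunc (a : ℝ) (z : ℂ) (r : ℝ) : ℂ := ∫ t in (-r)..r, dcrv t / (crv a t - z)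

lemma crv_div_tendsto (a : ℝ) (z : ℂ) (σ : ℝ) (hσ : |σ| = 1) :
    Tendsto (fun r : ℝ => (crv a (σ * r) - z) / ((r ^ (8 / 7 : ℝ) : ℝ) : ℂ)) atTop (𝓝 1) := by
  have h1 : Tendsto (fun r : ℝ => r ^ (-(8 / 7 : ℝ))) atTop (𝓝 0) := tendsto_rpow_neg_atTop (by norm_num)
  have h2 : Tendsto (fun r : ℝ => r ^ (-(1 / 7 : ℝ))) atTop (𝓝 0) := tendsto_rpow_neg_atTop (by norm_num)
  have h1' := (Complex.continuous_ofReal.tendsto 0).comp h1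
  have h2' := (Complex.continuous_ofReal.tendsto 0).comp h2
  have h3 : Tendsto (fun r : ℝ => ((a : ℂ) - z) * ((r ^ (-(8 / 7 : ℝ)) : ℝ) : ℂ) + 1
      - (σ : ℂ) * Complex.I * ((r ^ (-(1 / 7 : ℝ)) : ℝ) : ℂ)) atTop (𝓝 1) := by
    have := ((h1'.const_mul ((a : ℂ) - z)).add_const 1).sub (h2'.const_mul ((σ : ℂ) * Complex.I))
    simpa using this
  refine h3.congr' ?_
  filter_upwards [eventually_gt_atTop 0] with r hr
  have e0 : (((r ^ (8 / 7 : ℝ) : ℝ)) : ℂ) ≠ 0 := by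
    exact_mod_cast (Real.rpow_pos_of_pos hr _).ne'
  have e1 : ((r ^ (-(8 / 7 : ℝ)) : ℝ) : ℂ) * ((r ^ (8 / 7 : ℝ) : ℝ) : ℂ) = 1 := by
    rw [← Complex.ofReal_mul, ← Real.rpow_add hr]; norm_num
  have e2 : ((r ^ (-(1 / 7 : ℝ)) : ℝ) : ℂ) * ((r ^ (8 / 7 : ℝ) : ℝ) : ℂ) = r := by
    rw [← Complex.ofReal_mul, ← Real.rpow_add hr]; norm_num
  rw [eq_div_iff e0]
  unfold crv
  rw [abs_mul, hσ, one_mul, abs_of_pos hr]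
  push_cast
  linear_combination ((a : ℂ) - z) * e1 - (σ : ℂ) * Complex.I * e2

/-- For z to the left of the curve, crv - z avoids the negative real axis, and the principal
logarithm is a primitive. Both end points are asymptotic to r^(8/7), since their imaginary parts are
only of order r, and the two logarithms cancel in the limit. -/
lemma trunc_outside {a : ℝ} {z : ℂ} (h : z.re < a + |z.im| ^ (8 / 7 : ℝ)) :
    Tendsto (trunc a z) atTop (𝓝 0) := by
  have hs : ∀ t, crv a t - z ∈ Complex.slitPlane := by
    intro t
    rw [Complex.mem_slitPlane_iff]
    simp only [Complex.sub_re, Complex.sub_im, crv_re, crv_im]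
    by_cases ht : -t - z.im = 0
    · left
      have : |t| = |z.im| := by rw [← abs_neg t]; congr 1; linarith
      rw [this]; linarith
    · exact Or.inr ht
  have hd : ∀ t, HasDerivAt (fun t => Complex.log (crv a t - z)) (dcrv t / (crv a t - z)) t := fun t =>
    ((hasDerivAt_crv a t).sub_const z).clog_real (hs t)
  have hc : Continuous fun t => dcrv t / (crv a t - z) :=
    continuous_dcrv.div ((continuous_crv a).sub continuous_const)
      fun t => Complex.slitPlane_ne_zero (hs t)
  have he : ∀ r, trunc a z r = Complex.log (crv a r - z) - Complex.log (crv a (-r) - z) := fun r =>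
    intervalIntegral.integral_eq_sub_of_hasDerivAt (fun t _ => hd t) (hc.intervalIntegrable _ _)
  have l1 := crv_div_tendsto a z 1 (by simp)
  have l2 := crv_div_tendsto a z (-1) (by simp)
  have hl : ContinuousAt Complex.log 1 := continuousAt_clog (by simp)
  have l3 := (hl.tendsto.comp l1).sub (hl.tendsto.comp l2)
  rw [sub_self] at l3
  refine l3.congr' ?_
  filter_upwards [eventually_gt_atTop 0] with r hr
  have hp : 0 < r ^ (8 / 7 : ℝ) := Real.rpow_pos_of_pos hr _
  have hp' : ((r ^ (8 / 7 : ℝ) : ℝ) : ℂ) ≠ 0 := by exact_mod_cast hp.ne'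
  have key : ∀ w : ℂ, w ≠ 0 → Complex.log w
      = Real.log (r ^ (8 / 7 : ℝ)) + Complex.log (w / ((r ^ (8 / 7 : ℝ) : ℝ) : ℂ)) := fun w hw => by
    rw [← Complex.log_ofReal_mul hp (div_ne_zero hw hp'), mul_div_cancel₀ _ hp']
  rw [he, key _ (Complex.slitPlane_ne_zero (hs r)), key _ (Complex.slitPlane_ne_zero (hs (-r)))]
  simp only [Function.comp, one_mul, neg_one_mul]
  ring

/-- Now z - crv avoids the negative real axis. Divided by r^(8/7), its two end points tend to -1
from opposite sides of the cut, where the logarithm jumps by 2πi. -/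
lemma trunc_inside {a : ℝ} {z : ℂ} (h : a + |z.im| ^ (8 / 7 : ℝ) < z.re) :
    Tendsto (trunc a z) atTop (𝓝 (2 * Real.pi * Complex.I)) := by
  have hs : ∀ t, z - crv a t ∈ Complex.slitPlane := by
    intro t
    rw [Complex.mem_slitPlane_iff]
    simp only [Complex.sub_re, Complex.sub_im, crv_re, crv_im]
    by_cases ht : z.im - -t = 0
    · left
      have : |t| = |z.im| := by rw [← abs_neg t]; congr 1; linarith
      rw [this]; linarith
    · exact Or.inr ht
  have hne : ∀ t, crv a t - z ≠ 0 := fun t => by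
    rw [← neg_sub]; exact neg_ne_zero.2 (Complex.slitPlane_ne_zero (hs t))
  have hd : ∀ t, HasDerivAt (fun t => Complex.log (z - crv a t)) (dcrv t / (crv a t - z)) t := fun t => by
    have := ((hasDerivAt_crv a t).const_sub z).clog_real (hs t)
    rwa [← neg_sub (crv a t), neg_div_neg_eq] at this
  have hc : Continuous fun t => dcrv t / (crv a t - z) :=
    continuous_dcrv.div ((continuous_crv a).sub continuous_const) hne
  have he : ∀ r, trunc a z r = Complex.log (z - crv a r) - Complex.log (z - crv a (-r)) := fun r =>
    intervalIntegral.integral_eq_sub_of_hasDerivAt (fun t _ => hd t) (hc.intervalIntegrable _ _)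
  have l1 := (crv_div_tendsto a z 1 (by simp)).neg
  have l2 := (crv_div_tendsto a z (-1) (by simp)).neg
  have m1 := Complex.tendsto_log_nhdsWithin_im_nonneg_of_re_neg_of_im_zero (z := -1) (by simp) (by simp)
  have m2 := Complex.tendsto_log_nhdsWithin_im_neg_of_re_neg_of_im_zero (z := -1) (by simp) (by simp)
  have im_div : ∀ (w : ℂ) (x : ℝ), (w / (x : ℂ)).im = w.im / x := fun w x => Complex.div_ofReal_im w x
  have n1 := m1.comp (tendsto_nhdsWithin_iff.2 ⟨l1, by
    filter_upwards [eventually_gt_atTop (|z.im|), eventually_gt_atTop 0] with r hr hr0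
    have hp : 0 < r ^ (8 / 7 : ℝ) := Real.rpow_pos_of_pos hr0 _
    change 0 ≤ (-((crv a (1 * r) - z) / ((r ^ (8 / 7 : ℝ) : ℝ) : ℂ))).im
    rw [← neg_div, im_div]
    simp only [Complex.neg_im, Complex.sub_im, crv_im]
    have := neg_abs_le z.im
    exact div_nonneg (by linarith) hp.le⟩)
  have n2 := m2.comp (tendsto_nhdsWithin_iff.2 ⟨l2, by
    filter_upwards [eventually_gt_atTop (|z.im|), eventually_gt_atTop 0] with r hr hr0
    have hp : 0 < r ^ (8 / 7 : ℝ) := Real.rpow_pos_of_pos hr0 _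
    change (-((crv a (-1 * r) - z) / ((r ^ (8 / 7 : ℝ) : ℝ) : ℂ))).im < 0
    rw [← neg_div, im_div]
    simp only [Complex.neg_im, Complex.sub_im, crv_im]
    have := le_abs_self z.im
    exact div_neg_of_neg_of_pos (by linarith) hp⟩)
  have l3 := n1.sub n2
  have e3 : ((Real.log ‖(-1 : ℂ)‖ : ℝ) : ℂ) + Real.pi * Complex.I
      - (((Real.log ‖(-1 : ℂ)‖ : ℝ) : ℂ) - Real.pi * Complex.I) = 2 * Real.pi * Complex.I := by ring
  rw [e3] at l3
  refine l3.congr' ?_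
  filter_upwards [eventually_gt_atTop 0] with r hr
  have hp : 0 < r ^ (8 / 7 : ℝ) := Real.rpow_pos_of_pos hr _
  have hp' : ((r ^ (8 / 7 : ℝ) : ℝ) : ℂ) ≠ 0 := by exact_mod_cast hp.ne'
  have key : ∀ w : ℂ, w ≠ 0 → Complex.log w
      = Real.log (r ^ (8 / 7 : ℝ)) + Complex.log (w / ((r ^ (8 / 7 : ℝ) : ℝ) : ℂ)) := fun w hw => by
    rw [← Complex.log_ofReal_mul hp (div_ne_zero hw hp'), mul_div_cancel₀ _ hp']
  rw [he, key _ (Complex.slitPlane_ne_zero (hs r)), key _ (Complex.slitPlane_ne_zero (hs (-r)))]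
  simp only [Function.comp, one_mul, neg_one_mul, ← neg_div, neg_sub]
  ring

lemma tendsto_id_div_crv (c : ℝ) : Tendsto (fun r : ℝ => r / (c + r ^ (8 / 7 : ℝ))) atTop (𝓝 0) := by
  have h1 : Tendsto (fun r : ℝ => r ^ (-(8 / 7 : ℝ))) atTop (𝓝 0) := tendsto_rpow_neg_atTop (by norm_num)
  have h2 : Tendsto (fun r : ℝ => r ^ (-(1 / 7 : ℝ))) atTop (𝓝 0) := tendsto_rpow_neg_atTop (by norm_num)
  have h3 := h2.div ((h1.const_mul c).add_const 1) (by simp)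
  rw [zero_div] at h3
  refine h3.congr' ?_
  filter_upwards [eventually_gt_atTop 0] with r hr
  have e1 : r ^ (-(8 / 7 : ℝ)) * r ^ (8 / 7 : ℝ) = 1 := by rw [← Real.rpow_add hr]; norm_num
  have e2 : r ^ (-(1 / 7 : ℝ)) * r ^ (8 / 7 : ℝ) = r := by rw [← Real.rpow_add hr]; norm_num
  have hp : r ^ (8 / 7 : ℝ) ≠ 0 := (Real.rpow_pos_of_pos hr _).ne'
  simp only [Pi.div_apply]
  rw [← mul_div_mul_right _ _ hp, e2, add_mul, mul_assoc, e1]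
  ring

/-- The Cauchy integral with an exponential weight. -/
lemma crv_integral {a s : ℝ} {z J : ℂ} {d : ℝ} (hs : s < 0) (hd : 0 < d)
    (hz : ∀ t, d ≤ rho t * ‖crv a t - z‖) (hJ : Tendsto (trunc a z) atTop (𝓝 J)) :
    Integrable (fun t => Complex.exp (crv a t * s) * dcrv t / (crv a t - z)) ∧
      ∫ t, Complex.exp (crv a t * s) * dcrv t / (crv a t - z) = J * Complex.exp (z * s) := by
  have hne : ∀ t, crv a t - z ≠ 0 := fun t h => by
    have := hz t; rw [h, norm_zero, mul_zero] at this; linarith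
  have hcc := continuous_crv a
  have hcd := continuous_dcrv
  have hint : Integrable (fun t => Complex.exp (crv a t * s) * dcrv t / (crv a t - z)) := by
    refine ((integrable_exp_mul_rho_pow hs 2).const_mul (Real.exp (a * s) * 3 / d)).mono' ?_ ?_
    · exact (Continuous.div (by fun_prop) (by fun_prop) hne).aestronglyMeasurable
    · refine Eventually.of_forall fun t => ?_
      have hr := rho_pos t
      rw [norm_div, norm_mul, norm_exp_crv]
      have h1 : ‖crv a t - z‖⁻¹ ≤ rho t / d := by
        rw [inv_le_comm₀ (norm_pos_iff.2 (hne t)) (by positivity), inv_div, div_le_iff₀ hr, mul_comm]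
        exact hz t
      calc _ = Real.exp (a * s) * Real.exp (s * |t| ^ (8 / 7 : ℝ)) * ‖dcrv t‖ * ‖crv a t - z‖⁻¹ := by
            rw [div_eq_mul_inv]
        _ ≤ Real.exp (a * s) * Real.exp (s * |t| ^ (8 / 7 : ℝ)) * (3 * rho t) * (rho t / d) := by
            gcongr; exact norm_dcrv_le' t
        _ = _ := by ring
  refine ⟨hint, ?_⟩
  -- Write e^{ws} = 1 + w h(w) with h entire, at w = crv - z. The term 1 gives the truncated
  -- integral with limit J; h has an entire primitive H, so no contour has to be closed.
  let g : ℂ → ℂ := fun w => Complex.exp (w * s)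
  let h : ℂ → ℂ := dslope g 0
  have hgd : Differentiable ℂ g := by fun_prop
  have hhd : Differentiable ℂ h := by
    rw [← differentiableOn_univ, Complex.differentiableOn_dslope univ_mem]
    exact hgd.differentiableOn
  obtain ⟨H, hH⟩ := hhd.isExactOn_univ
  have hh : ∀ w, w ≠ 0 → h w = (Complex.exp (w * s) - 1) / w := fun w hw => by
    simp only [h, g]
    rw [dslope_of_ne _ hw, slope_def_field]
    simp
  have hL : Tendsto (fun r : ℝ => ∫ t in (-r)..r,
      Complex.exp (crv a t * s) * dcrv t / (crv a t - z)) atTop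
      (𝓝 (∫ t, Complex.exp (crv a t * s) * dcrv t / (crv a t - z))) :=
    intervalIntegral_tendsto_integral hint tendsto_neg_atTop_atBot tendsto_id
  refine tendsto_nhds_unique hL ?_
  have hdH : ∀ t, HasDerivAt (fun t => H (crv a t - z)) (h (crv a t - z) * dcrv t) t := fun t =>
    (hH _ (Set.mem_univ _)).comp_of_eq t ((hasDerivAt_crv a t).sub_const z) rfl
  have hch : Continuous fun t => h (crv a t - z) * dcrv t :=
    (hhd.continuous.comp (hcc.sub continuous_const)).mul hcd
  have hct : Continuous fun t => dcrv t / (crv a t - z) := hcd.div (hcc.sub continuous_const) hne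
  have he : ∀ r : ℝ, (∫ t in (-r)..r, Complex.exp (crv a t * s) * dcrv t / (crv a t - z)) =
      (trunc a z r + (H (crv a r - z) - H (crv a (-r) - z))) * Complex.exp (z * s) := by
    intro r
    rw [← intervalIntegral.integral_eq_sub_of_hasDerivAt (fun t _ => hdH t)
      (hch.intervalIntegrable _ _), trunc, ← intervalIntegral.integral_add
      (hct.intervalIntegrable _ _) (hch.intervalIntegrable _ _),
      ← intervalIntegral.integral_mul_const]
    refine intervalIntegral.integral_congr fun t _ => ?_
    rw [hh _ (hne t), show crv a t * (s : ℂ) = (crv a t - z) * s + z * s by ring, Complex.exp_add]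
    have := hne t
    field_simp
    ring
  simp only [he]
  refine Tendsto.mul_const _ ?_
  rw [← add_zero J]
  refine hJ.add ?_
  have l := (tendsto_id_div_crv (a - z.re)).const_mul 4
  rw [mul_zero] at l
  refine squeeze_zero_norm' ?_ l
  have hX : Tendsto (fun r : ℝ => a - z.re + r ^ (8 / 7 : ℝ)) atTop atTop :=
    tendsto_atTop_add_const_left _ _ (tendsto_rpow_atTop (by norm_num))
  filter_upwards [hX.eventually_gt_atTop 0, eventually_gt_atTop 0] with r hr hr0
  set x := a - z.re + r ^ (8 / 7 : ℝ) with hx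
  -- The segment between the end points has length 2r, which is of lower order than x ~ r^(8/7); so
  -- the increment of H, at most 4r / x, tends to zero.
  have hre : ∀ w : ℂ, x ≤ w.re → ‖h w‖ ≤ 2 / x := by
    intro w hw
    have hw0 : 0 < w.re := hr.trans_le hw
    have hwn : w.re ≤ ‖w‖ := (le_abs_self _).trans (Complex.abs_re_le_norm w)
    have hwne : w ≠ 0 := norm_pos_iff.1 (hw0.trans_le hwn)
    rw [hh w hwne, norm_div]
    have h1 : ‖Complex.exp (w * s) - 1‖ ≤ 2 := by
      refine (norm_sub_le _ _).trans ?_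
      rw [norm_one, Complex.norm_exp]
      have : (w * (s : ℂ)).re ≤ 0 := by
        simp only [Complex.mul_re, Complex.ofReal_re, Complex.ofReal_im, mul_zero, sub_zero]
        nlinarith
      linarith [Real.exp_le_one_iff.2 this]
    gcongr
    linarith
  have hconv : Convex ℝ {w : ℂ | x ≤ w.re} := convex_halfSpace_re_ge x
  have hb := hconv.norm_image_sub_le_of_norm_hasDerivWithin_le (𝕜 := ℂ) (f := H) (f' := h) (C := 2 / x)
    (fun w _ => (hH w (Set.mem_univ _)).hasDerivWithinAt) (fun w hw => hre w hw)
    (x := crv a (-r) - z) (y := crv a r - z)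
    (by change x ≤ (crv a (-r) - z).re; rw [Complex.sub_re, crv_re, abs_neg, abs_of_pos hr0]; linarith)
    (by change x ≤ (crv a r - z).re; rw [Complex.sub_re, crv_re, abs_of_pos hr0]; linarith)
  refine hb.trans (le_of_eq ?_)
  have : crv a r - z - (crv a (-r) - z) = -((2 * r : ℝ) : ℂ) * Complex.I := by
    unfold crv
    rw [abs_neg]
    push_cast
    ring
  rw [this, norm_mul, norm_neg, Complex.norm_I, mul_one, Complex.norm_real,
    Real.norm_of_nonneg (by linarith)]
  ring

end LandauSphere
end

/-! ### The resolvents of L₀ and of L. -/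

noncomputable section
namespace LandauSphere

/-! ### The resolvent of `L₀` -/

/-- The function `g` of the operator with the matrix `nMat id`. -/
def fn (g : ℤ → ℂ) : V6 →L[ℂ] V6 := opM (nMat g)

lemma norm_fn_le {g : ℤ → ℂ} {B : ℝ} (h : Adm g B) : ‖fn g‖ ≤ 6 * B := norm_opM_le h.entryBound

lemma projV_fn {g : ℤ → ℂ} {B : ℝ} (h : Adm g B) (u : V6) (k : ℕ) :
    projV k (fn g u) = act (nMat g k) (projV k u) := projV_opM h.entryBound u k

lemma fn_mul {g h f : ℤ → ℂ} {B B' B'' : ℝ} (hg : Adm g B) (hh : Adm h B') (hf : Adm f B'')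
    (he : ∀ n, g n * h n = f n) : fn g * fn h = fn f := by
  ext1 u
  refine ext_projV fun k => ?_
  change projV k (fn g (fn h u)) = _
  rw [projV_fn hg, projV_fn hh, projV_fn hf, ← act_mul, nMat_mul]
  simp only [he]

/-- The points at which the functions of degree `k` are evaluated. -/
def nodes (k : ℕ) : Fin 6 → ℤ := ![k, -k - 1, k + 1, k - 1, -k, -k - 2]

/-- The components of a sextuple which belong to the points `nodes k`. -/
def nodeVec (k : ℕ) (x : V6) : Fin 6 → V6 :=
  ![![x 0, 0, 0, 0, 0, 0], ![0, x 1, 0, 0, 0, 0], ![0, 0, x 2 + (((k : ℂ) + 1) / 2) • x 3, 0, 0, 0],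
    ![0, 0, -(((k : ℂ) + 1) / 2) • x 3, x 3, 0, 0], ![0, 0, 0, 0, x 4 - ((k : ℂ) / 2) • x 5, 0],
    ![0, 0, 0, 0, ((k : ℂ) / 2) • x 5, x 5]]

/-- The matrix is linear in the values of g at the six eigenvalues. Identities between functions on
the integers thus pass to operators term by term. -/
lemma act_nMat (g : ℤ → ℂ) (k : ℕ) (x : V6) :
    act (nMat g k) x = ∑ j, g (nodes k j) • nodeVec k x j := by
  funext i
  rw [act_apply, Fin.sum_univ_six]
  simp only [Pi.add_apply, Pi.smul_apply]
  fin_cases i <;> simp [nMat, nodes, nodeVec] <;> module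

/-- A region which avoids the spectrum of `L₀`, and contains the contours. -/
def Reg : Set ℂ :=
  {z | (∀ n : ℤ, rho z.im ≤ 9 * ‖z - n‖) ∧ ‖z - 1 / 2‖ ≤ 8 * rho z.im ^ (8 / 7 : ℝ)}

lemma Reg.ne {z : ℂ} (h : z ∈ Reg) (n : ℤ) : z - n ≠ 0 := fun h0 => by
  have := h.1 n
  rw [h0, norm_zero, mul_zero] at this
  linarith [rho_pos z.im]

lemma Reg.norm_le {z : ℂ} (h : z ∈ Reg) : ‖z‖ ≤ 9 * rho z.im ^ (8 / 7 : ℝ) := by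
  have h1 : 1 ≤ rho z.im ^ (8 / 7 : ℝ) := Real.one_le_rpow (one_le_rho _) (by norm_num)
  have h2 := norm_add_le (z - 1 / 2) (1 / 2)
  have h3 : ‖(1 / 2 : ℂ)‖ = 1 / 2 := by norm_num
  rw [sub_add_cancel, h3] at h2
  linarith [h.2]

/-- The resolvent of the operator with the matrix `nMat id`. -/
def res0 (z : ℂ) : V6 →L[ℂ] V6 := fn fun n => (z - n)⁻¹

/-- With n + 2 = z - (z - (n + 2)), the second condition in `Adm` reduces to |z| / (|z - n| |z - n -
2|) and one more resolvent term. On `Reg` the quotient is at most 9 ρ^(8/7) · 81 ρ^(-2) = 729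
ρ^(-6/7), and the other term adds 9. -/
lemma adm_res0 {z : ℂ} (h : z ∈ Reg) :
    Adm (fun n => (z - n)⁻¹) (738 * rho z.im ^ (-(6 / 7) : ℝ)) := by
  have hr := rho_pos z.im
  have h1 := one_le_rho z.im
  have hinv : ∀ n : ℤ, ‖(z - n)⁻¹‖ ≤ 9 / rho z.im := fun n => by
    have hp : 0 < ‖z - n‖ := norm_pos_iff.2 (Reg.ne h n)
    rw [norm_inv, inv_eq_one_div, div_le_div_iff₀ hp hr]
    linarith [h.1 n]
  have hq : 1 / rho z.im ≤ rho z.im ^ (-(6 / 7) : ℝ) := by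
    rw [one_div, ← Real.rpow_neg_one]
    exact Real.rpow_le_rpow_of_exponent_le h1 (by norm_num)
  have hpos : 0 < rho z.im ^ (-(6 / 7) : ℝ) := by positivity
  refine ⟨fun n => (hinv n).trans ?_, fun n => ?_⟩
  · rw [div_eq_mul_one_div]; nlinarith
  · have e : ((z - (n + 2 : ℤ))⁻¹ - (z - n)⁻¹) = 2 * ((z - (n + 2 : ℤ))⁻¹ * (z - n)⁻¹) := by
      have a := Reg.ne h (n + 2)
      have b := Reg.ne h n
      field_simp
      push_cast
      ring
    have e2 : ((n : ℂ) + 2) * ((z - (n + 2 : ℤ))⁻¹ - (z - n)⁻¹) =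
        2 * (z * ((z - (n + 2 : ℤ))⁻¹ * (z - n)⁻¹) - (z - n)⁻¹) := by
      have a := Reg.ne h (n + 2)
      rw [e]
      field_simp
      push_cast
      ring
    rw [← norm_mul, e2, norm_mul, Complex.norm_ofNat]
    gcongr
    refine (norm_sub_le _ _).trans ?_
    rw [norm_mul, norm_mul]
    have h3 : ‖z‖ * (‖(z - (n + 2 : ℤ))⁻¹‖ * ‖(z - n)⁻¹‖) ≤
        9 * rho z.im ^ (8 / 7 : ℝ) * (9 / rho z.im * (9 / rho z.im)) := by
      gcongr
      exacts [Reg.norm_le h, hinv _, hinv _]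
    have h4 : 9 * rho z.im ^ (8 / 7 : ℝ) * (9 / rho z.im * (9 / rho z.im)) =
        729 * rho z.im ^ (-(6 / 7) : ℝ) := by
      have : rho z.im ^ (-(6 / 7) : ℝ) * rho z.im ^ (2 : ℝ) = rho z.im ^ (8 / 7 : ℝ) := by
        rw [← Real.rpow_add hr]; norm_num
      rw [← this, Real.rpow_two]
      field_simp
      norm_num
    have h5 := hinv n
    rw [div_eq_mul_one_div] at h5
    nlinarith

lemma norm_res0_le {z : ℂ} (h : z ∈ Reg) : ‖res0 z‖ ≤ 4428 * rho z.im ^ (-(6 / 7) : ℝ) :=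
  (norm_fn_le (adm_res0 h)).trans_eq (by ring)

lemma res0_sub {z w : ℂ} (hz : z ∈ Reg) (hw : w ∈ Reg) :
    res0 z - res0 w = (w - z) • (res0 z * res0 w) := by
  ext1 u
  refine ext_projV fun k => ?_
  have h1 : projV k ((res0 z - res0 w) u) = projV k (res0 z u) - projV k (res0 w u) :=
    funext fun i => map_sub (proj k) _ _
  have h2 : projV k (((w - z) • (res0 z * res0 w)) u) = (w - z) • projV k (res0 z (res0 w u)) :=
    funext fun i => map_smul (proj k) _ _
  have h3 : projV k (res0 z u) = _ := projV_fn (adm_res0 hz) u k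
  have h4 : projV k (res0 w u) = _ := projV_fn (adm_res0 hw) u k
  have h5 : projV k (res0 z (res0 w u)) = _ := projV_fn (adm_res0 hz) _ k
  rw [h1, h2, h5, h3, h4, ← act_mul, nMat_mul, act_nMat, act_nMat, act_nMat,
    ← Finset.sum_sub_distrib, Finset.smul_sum]
  refine Finset.sum_congr rfl fun j _ => ?_
  rw [smul_smul, ← sub_smul]
  have a := Reg.ne hz (nodes k j)
  have b := Reg.ne hw (nodes k j)
  congr 1
  field_simp
  ring

lemma projV_sub (k : ℕ) (u v : V6) : projV k (u - v) = projV k u - projV k v :=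
  funext fun i => map_sub (proj k) _ _

lemma projV_smul (k : ℕ) (c : ℂ) (u : V6) : projV k (c • u) = c • projV k u :=
  funext fun i => map_smul (proj k) _ _

lemma nodeVec_add_smul (k : ℕ) (x y : V6) (c : ℂ) (j : Fin 6) :
    nodeVec k (c • x - y) j = c • nodeVec k x j - nodeVec k y j := by
  funext i
  fin_cases j <;> fin_cases i <;> simp [nodeVec] <;> module

lemma ARel_res0 {z : ℂ} (h : z ∈ Reg) (f : V6) : ARel (res0 z f) (z • res0 z f - f) := by
  intro k
  have h3 : projV k (res0 z f) = _ := projV_fn (adm_res0 h) f k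
  rw [projV_sub, projV_smul, h3, ← act_mul, nMat_mul, act_nMat, act_nMat]
  nth_rewrite 2 [← act_one (projV k f)]
  rw [← nMat_one k, act_nMat, Finset.smul_sum, ← Finset.sum_sub_distrib]
  refine Finset.sum_congr rfl fun j _ => ?_
  rw [smul_smul, ← sub_smul]
  have a := Reg.ne h (nodes k j)
  congr 1
  field_simp
  ring

lemma ARel.res0_eq {z : ℂ} (h : z ∈ Reg) {u w : V6} (hu : ARel u w) : res0 z (z • u - w) = u := by
  refine ext_projV fun k => ?_
  have h3 : projV k (res0 z (z • u - w)) = _ := projV_fn (adm_res0 h) _ k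
  have h4 : act (nMat (fun n => (z - n)⁻¹) k) (projV k w) = ∑ j, ((z - nodes k j)⁻¹ * nodes k j) •
      nodeVec k (projV k u) j := by
    rw [hu k, ← act_mul, nMat_mul, act_nMat]
  rw [h3, act_nMat, projV_sub, projV_smul]
  rw [act_nMat] at h4
  simp only [nodeVec_add_smul, smul_sub, Finset.sum_sub_distrib]
  rw [h4]
  nth_rewrite 3 [← act_one (projV k u)]
  rw [← nMat_one k, act_nMat, ← Finset.sum_sub_distrib]
  refine Finset.sum_congr rfl fun j _ => ?_
  rw [smul_smul, ← sub_smul]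
  have a := Reg.ne h (nodes k j)
  congr 1
  field_simp

/-! ### The resolvent of `L` -/

lemma smul_sub_opL_param {b : E3} {z : ℂ} {K : V6 →L[ℂ] V6} (hz : z ∈ Reg)
    (hK : ∀ u, param (K u) = opK b (param u)) {f u : V6} (hu : u = res0 z (f + K u)) :
    param u ∈ D ∧ z • param u - opL b (param u) = param f := by
  have h := ARel_res0 hz (f + K u)
  rw [← hu] at h
  obtain ⟨h1, h2⟩ := opL0_param h
  refine ⟨h1, ?_⟩
  rw [opL, h2, ← hK, map_sub, map_add, map_smul]
  abel

/-- The perturbation in the parametrizing space, and the description of the resolvent of `L`. -/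
lemma exists_model : ∃ C : ℝ, 0 < C ∧ ∃ Q : State → V6, (∀ Ξ ∈ X, param (Q Ξ) = Ξ) ∧
    (∀ Ξ ∈ X, ‖Q Ξ‖ ≤ C * xNorm Ξ) ∧ (∀ Ξ ∈ X, chi (Q Ξ) = Q Ξ) ∧ (∀ u, Q (param u) = chi u) ∧
    (∀ Ξ ∈ D, ∀ z ∈ Reg, ∃ f, Q Ξ = res0 z f) ∧ ∀ b : E3, ‖b‖ ≤ 2 * Real.pi → ∃ K : V6 →L[ℂ] V6, ‖K‖ ≤ C * ‖b‖ ∧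
      ∀ (z : ℂ) (R : V6 →L[ℂ] V6), z ∈ Reg → R = res0 z + res0 z * K * R →
        R = res0 z + R * K * res0 z → InResolventSet b z ∧
        ∀ Ξ ∈ X, resolventL b z Ξ = param (R (Q Ξ)) ∧ chi (R (Q Ξ)) = R (Q Ξ) := by
  obtain ⟨C, hC, Q, hQ1, hQ2, hQ3, hQ4, hQ5⟩ := exists_coord
  obtain ⟨C', hC', hK⟩ := xNorm_opK_le
  obtain ⟨CP, hCP, hP⟩ := xNorm_wparam_le
  obtain ⟨G, H, -, -, e⟩ := opK_param
  refine ⟨C * C' + C, by positivity, Q, hQ1, fun Ξ h => ?_, hQ3, hQ4,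
    fun Ξ h z hz => ⟨_, ((hQ5 Ξ h (opL0_mem_X h)).res0_eq hz).symm⟩, fun b hb => ?_⟩
  · refine (hQ2 Ξ h).trans ?_
    have : 0 ≤ xNorm Ξ := Real.sqrt_nonneg _
    gcongr
    nlinarith
  have hadd : ∀ u v, opK b (param (u + v)) = opK b (param u) + opK b (param v) := fun u v => by
    rw [e b hb, e b hb, e b hb]
    refine Prod.ext ?_ (Prod.ext (funext fun i => ?_) (Prod.ext ?_ ?_)) <;> simp
  have hsmul : ∀ (c : ℂ) u, opK b (param (c • u)) = c • opK b (param u) := fun c u => by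
    rw [e b hb, e b hb]
    refine Prod.ext ?_ (Prod.ext (funext fun i => ?_) (Prod.ext ?_ ?_)) <;>
      simp <;> exact smul_comm _ _ _
  have hkp : ∀ u, param (Q (opK b (param u))) = opK b (param u) := fun u => hQ1 _ (opK_mem_X hb u)
  have hkc : ∀ u, chi (Q (opK b (param u))) = Q (opK b (param u)) := fun u => hQ3 _ (opK_mem_X hb u)
  -- Linearity comes from that of `opK ∘ param`: each value is written as `param` of something, and
  -- `Q ∘ param = chi` is linear and fixes the range of Q on X.
  let K0 : V6 →ₗ[ℂ] V6 :=
    { toFun := fun u => Q (opK b (param u))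
      map_add' := fun u v => by
        rw [hadd, ← hkp u, ← hkp v, ← map_add, hQ4, map_add, hkp, hkp, hkc, hkc]
      map_smul' := fun c u => by
        rw [hsmul, ← hkp u, ← map_smul, hQ4, map_smul, hkp, hkc]; rfl }
  have hbd : ∀ u, ‖K0 u‖ ≤ (C * C' + C) * ‖b‖ * ‖u‖ := fun u => by
    refine (hQ2 _ (opK_mem_X hb u)).trans ?_
    have h1 := hK b hb u
    have h2 : 0 ≤ C * ‖b‖ * ‖u‖ := by positivity
    nlinarith
  let K : V6 →L[ℂ] V6 := K0.mkContinuous _ hbd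
  have hKp : ∀ u, param (K u) = opK b (param u) := hkp
  have hKc : ∀ u, chi (K u) = K u := hkc
  refine ⟨K, ContinuousLinearMap.opNorm_le_bound _ (by positivity) hbd, fun z R hz hR1 hR2 => ?_⟩
  have hsol : ∀ f, R f = res0 z (f + K (R f)) := fun f => by
    conv_lhs => rw [hR1]
    change res0 z f + res0 z (K (R f)) = _
    rw [map_add]
  -- Injectivity uses R = R₀ + R K R₀, surjectivity uses R = R₀ + R₀ K R.
  have huniq : ∀ Ξ ∈ D, z • Ξ - opL b Ξ ∈ X ∧ Q Ξ = R (Q (z • Ξ - opL b Ξ)) := by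
    intro Ξ hΞ
    have hX := D_subset_X hΞ
    have hL0 := opL0_mem_X hΞ
    have e1 := hQ1 Ξ hX
    have e2 := hQ1 _ hL0
    have e3 : z • Ξ - opL b Ξ = param (z • Q Ξ - Q (opL0 Ξ) - K (Q Ξ)) := by
      rw [map_sub, map_sub, map_smul, hKp, e1, e2, opL]; abel
    have hq : Q (z • Ξ - opL b Ξ) = z • Q Ξ - Q (opL0 Ξ) - K (Q Ξ) := by
      rw [e3, hQ4, map_sub, map_sub, map_smul, hKc, hQ3 _ hX, hQ3 _ hL0]
    refine ⟨e3 ▸ param_mem_X _, ?_⟩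
    have h0 := (hQ5 Ξ hΞ hL0).res0_eq hz
    rw [hq, map_sub]
    have h1 : R (K (Q Ξ)) = R (K (res0 z (z • Q Ξ - Q (opL0 Ξ)))) := by rw [h0]
    have h2 : R (z • Q Ξ - Q (opL0 Ξ)) = res0 z (z • Q Ξ - Q (opL0 Ξ)) +
        R (K (res0 z (z • Q Ξ - Q (opL0 Ξ)))) := by
      conv_lhs => rw [hR2]
      rfl
    rw [h2, h1, h0, add_sub_cancel_right]
  have hsurj : ∀ Ξ ∈ X, param (R (Q Ξ)) ∈ D ∧
      z • param (R (Q Ξ)) - opL b (param (R (Q Ξ))) = Ξ := fun Ξ h => by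
    have := smul_sub_opL_param hz hKp (hsol (Q Ξ))
    rwa [hQ1 Ξ h] at this
  have hbij : Set.BijOn (fun Ξ => z • Ξ - opL b Ξ) D X := by
    refine ⟨fun Ξ h => (huniq Ξ h).1, fun Ξ h Ξ' h' he => ?_, fun Ξ h => ?_⟩
    · rw [← hQ1 Ξ (D_subset_X h), ← hQ1 Ξ' (D_subset_X h'), (huniq Ξ h).2, (huniq Ξ' h').2]
      simp only at he
      rw [he]
    · exact ⟨_, (hsurj Ξ h).1, (hsurj Ξ h).2⟩
  refine ⟨⟨hbij, CP * ‖opM sMat‖ * ‖R‖ * C, fun Ξ h => ?_⟩, fun Ξ h => ?_⟩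
  · obtain ⟨h1, h2⟩ := huniq Ξ h
    calc xNorm Ξ = xNorm (param (Q Ξ)) := by rw [hQ1 Ξ (D_subset_X h)]
      _ ≤ CP * ‖opM sMat (Q Ξ)‖ := hP _
      _ ≤ CP * (‖opM sMat‖ * ‖Q Ξ‖) := by gcongr; exact (opM sMat).le_opNorm _
      _ ≤ CP * (‖opM sMat‖ * (‖R‖ * (C * xNorm (z • Ξ - opL b Ξ)))) := by
        rw [h2]
        gcongr
        exact (R.le_opNorm _).trans (by gcongr; exact hQ2 _ h1)
      _ = _ := by ring
  · have hr : resolventL b z Ξ = param (R (Q Ξ)) := by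
      have hm : ∃ Θ ∈ D, (fun Ξ => z • Ξ - opL b Ξ) Θ = Ξ := ⟨_, (hsurj Ξ h).1, (hsurj Ξ h).2⟩
      obtain ⟨h1, h2⟩ := Function.invFunOn_pos hm
      refine hbij.injOn h1 (hsurj Ξ h).1 ?_
      rw [h2]; exact (hsurj Ξ h).2.symm
    refine ⟨hr, ?_⟩
    obtain ⟨h1, h2⟩ := hsurj Ξ h
    have h3 := (huniq _ h1).2
    rw [h2] at h3
    rw [← h3]
    exact hQ3 _ (D_subset_X h1)

end LandauSphere
end

/-! ### Products of contour integrals of a resolvent, and nested families of idempotents. -/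

noncomputable section
namespace LandauSphere

/-! ### Integrals of resolvents over weighted paths -/

section Paths

variable {A : Type*} [NormedRing A] [NormedAlgebra ℂ A]

/-- A bounded function on `S` which satisfies the resolvent identity. -/
structure IsRes (R : ℂ → A) (S : Set ℂ) : Prop where
  sub_eq : ∀ z ∈ S, ∀ w ∈ S, R z - R w = (w - z) • (R z * R w)
  bdd : ∃ M : ℝ, ∀ z ∈ S, ‖R z‖ ≤ M

lemma IsRes.continuousOn {R : ℂ → A} {S : Set ℂ} (h : IsRes R S) : ContinuousOn R S := by
  obtain ⟨M, hM⟩ := h.bdd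
  intro z hz
  rw [ContinuousWithinAt, tendsto_iff_norm_sub_tendsto_zero]
  have hl : Tendsto (fun w : ℂ => ‖z - w‖ * (M * M)) (𝓝[S] z) (𝓝 0) := by
    have : Tendsto (fun w : ℂ => ‖z - w‖ * (M * M)) (𝓝 z) (𝓝 (‖z - z‖ * (M * M))) :=
      Continuous.tendsto (by fun_prop) z
    rw [sub_self, norm_zero, zero_mul] at this
    exact this.mono_left nhdsWithin_le_nhds
  refine squeeze_zero' (Eventually.of_forall fun w => norm_nonneg _) ?_ hl
  filter_upwards [self_mem_nhdsWithin] with w hw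
  rw [h.sub_eq w hw z hz, norm_smul]
  have h1 := hM z hz
  have h2 := hM w hw
  have h3 := norm_nonneg (R z)
  have h4 := norm_nonneg (R w)
  gcongr
  exact (norm_mul_le _ _).trans (mul_le_mul h2 h1 h3 (h4.trans h2))

/-- The reflection of a resolvent at `1 / 2`. -/
lemma IsRes.reflect {R : ℂ → A} {S : Set ℂ} (h : IsRes R S) (hS : ∀ z ∈ S, 1 - z ∈ S) :
    IsRes (fun z => -R (1 - z)) S := by
  obtain ⟨M, hM⟩ := h.bdd
  refine ⟨fun z hz w hw => ?_, M, fun z hz => ?_⟩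
  · have := h.sub_eq _ (hS z hz) _ (hS w hw)
    rw [neg_mul_neg, show (w - z : ℂ) = -(1 - w - (1 - z)) by ring, neg_smul, ← this]
    abel
  · rw [norm_neg]; exact hM _ (hS z hz)

/-- A path with a weight. -/
structure Path where
  /-- The measure on the parameters. -/
  μ : Measure ℝ
  /-- The weight. -/
  φ : ℝ → ℂ
  /-- The curve. -/
  γ : ℝ → ℂ
  sfinite : SFinite μ
  contφ : Continuous φ
  contγ : Continuous γ
  integrable : Integrable (fun t => ‖φ t‖ * rho t) μ

namespace Path

attribute [instance] Path.sfinite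

variable (p q : Path)

/-- The integral over a weighted path. -/
def int (R : ℂ → A) : A := ∫ t, p.φ t • R (p.γ t) ∂p.μ

/-- The Cauchy transform of a weighted path. -/
def cauchy (z : ℂ) : ℂ := ∫ t, p.φ t / (p.γ t - z) ∂p.μ

/-- Two disjoint paths, quantitatively. -/
def Sep : Prop := ∃ d : ℝ, 0 < d ∧ ∀ t t', d ≤ rho t * rho t' * ‖q.γ t' - p.γ t‖

variable {p q}

lemma Sep.symm (h : Sep p q) : Sep q p := by
  obtain ⟨d, hd, H⟩ := h
  exact ⟨d, hd, fun t t' => by rw [norm_sub_rev, mul_comm (rho t)]; exact H t' t⟩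

lemma Sep.ne (h : Sep p q) (t t' : ℝ) : q.γ t' - p.γ t ≠ 0 := fun h0 => by
  obtain ⟨d, hd, H⟩ := h
  have := H t t'
  rw [h0, norm_zero, mul_zero] at this
  linarith

lemma integrable_smul {f : ℝ → A} (hf : Continuous f) {M : ℝ} (hM : ∀ t, ‖f t‖ ≤ M) :
    Integrable (fun t => p.φ t • f t) p.μ := by
  have h1 := p.contφ
  refine (p.integrable.mul_const M).mono' (Continuous.aestronglyMeasurable (by fun_prop))
    (Eventually.of_forall fun t => ?_)
  rw [norm_smul, mul_assoc]
  have := one_le_rho t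
  have h2 := norm_nonneg (f t)
  have h3 := hM t
  gcongr
  nlinarith

lemma continuous_comp {R : ℂ → A} {S : Set ℂ} (h : IsRes R S) (hp : ∀ t, p.γ t ∈ S) :
    Continuous fun t => R (p.γ t) :=
  h.continuousOn.comp_continuous p.contγ hp

lemma integrable_res {R : ℂ → A} {S : Set ℂ} (h : IsRes R S) (hp : ∀ t, p.γ t ∈ S) :
    Integrable (fun t => p.φ t • R (p.γ t)) p.μ := by
  obtain ⟨M, hM⟩ := h.bdd
  exact integrable_smul (continuous_comp h hp) fun t => hM _ (hp t)

lemma Sep.integrable_prod (h : Sep p q) {f : ℝ × ℝ → A} (hf : Continuous f) {M : ℝ} (hM : ∀ t, ‖f t‖ ≤ M) :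
    Integrable (fun x : ℝ × ℝ => (p.φ x.1 * q.φ x.2 / (q.γ x.2 - p.γ x.1)) • f x)
      (p.μ.prod q.μ) := by
  have hne := h.ne
  obtain ⟨d, hd, H⟩ := h
  have h1 := p.contφ
  have h2 := p.contγ
  have h3 := q.contφ
  have h4 := q.contγ
  have hc : Continuous fun x : ℝ × ℝ => p.φ x.1 * q.φ x.2 / (q.γ x.2 - p.γ x.1) :=
    Continuous.div (by fun_prop) (by fun_prop) fun x => hne _ _
  refine ((p.integrable.mul_prod q.integrable).mul_const (M / d)).mono'
    (Continuous.aestronglyMeasurable (by fun_prop)) (Eventually.of_forall fun x => ?_)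
  rw [norm_smul, norm_div, norm_mul]
  have hx : 0 < ‖q.γ x.2 - p.γ x.1‖ := norm_pos_iff.2 (hne _ _)
  have hM0 : 0 ≤ M := (norm_nonneg _).trans (hM x)
  calc ‖p.φ x.1‖ * ‖q.φ x.2‖ / ‖q.γ x.2 - p.γ x.1‖ * ‖f x‖
      ≤ ‖p.φ x.1‖ * ‖q.φ x.2‖ * (rho x.1 * rho x.2 / d) * M := by
        rw [div_eq_mul_inv]
        have h5 : ‖q.γ x.2 - p.γ x.1‖⁻¹ ≤ rho x.1 * rho x.2 / d := by
          rw [inv_eq_one_div, div_le_div_iff₀ hx hd, one_mul]; exact H _ _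
        have := rho_pos x.1
        have := rho_pos x.2
        have := hM x
        gcongr
    _ = _ := by ring

variable [CompleteSpace A]

/-- The product of two integrals of a resolvent. -/
lemma Sep.int_mul_int (h : Sep p q) {R : ℂ → A} {S : Set ℂ} (hR : IsRes R S) (hp : ∀ t, p.γ t ∈ S)
    (hq : ∀ t, q.γ t ∈ S) : p.int R * q.int R =
      ∫ t, (p.φ t * q.cauchy (p.γ t)) • R (p.γ t) ∂p.μ +
        ∫ t, (q.φ t * p.cauchy (q.γ t)) • R (q.γ t) ∂q.μ := by
  have hip := integrable_res hR hp
  have hiq := integrable_res hR hq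
  have hcp := continuous_comp hR hp
  have hcq := continuous_comp hR hq
  obtain ⟨M, hM⟩ := hR.bdd
  have i1 := h.integrable_prod (f := fun x => R (p.γ x.1)) (hcp.comp continuous_fst) (M := M) fun x => hM _ (hp _)
  have i2 := h.integrable_prod (f := fun x => R (q.γ x.2)) (hcq.comp continuous_snd) (M := M) fun x => hM _ (hq _)
  have e1 : p.int R * q.int R = ∫ t, ∫ t', (p.φ t * q.φ t' / (q.γ t' - p.γ t)) • R (p.γ t) -
      (p.φ t * q.φ t' / (q.γ t' - p.γ t)) • R (q.γ t') ∂q.μ ∂p.μ := by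
    rw [int, int]
    have := ((ContinuousLinearMap.mul ℂ A).flip (∫ t', q.φ t' • R (q.γ t') ∂q.μ)).integral_comp_comm hip
    simp only [ContinuousLinearMap.flip_apply, ContinuousLinearMap.mul_apply'] at this
    rw [← this]
    refine integral_congr_ae (Eventually.of_forall fun t => ?_)
    have := (ContinuousLinearMap.mul ℂ A (p.φ t • R (p.γ t))).integral_comp_comm hiq
    simp only [ContinuousLinearMap.mul_apply'] at this
    simp only
    rw [← this]
    refine integral_congr_ae (Eventually.of_forall fun t' => ?_)
    simp only
    -- R(z) R(w) = (R(z) - R(w)) / (w - z). The two terms are integrable separately because the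
    -- paths are separated, so each can be integrated first in the variable on which its resolvent
    -- does not depend.
    rw [← smul_sub, hR.sub_eq _ (hp t) _ (hq t'), smul_smul, smul_mul_smul_comm,
      div_mul_cancel₀ _ (h.ne t t')]
  have e2 : ∫ t, ∫ t', (p.φ t * q.φ t' / (q.γ t' - p.γ t)) • R (p.γ t) -
      (p.φ t * q.φ t' / (q.γ t' - p.γ t)) • R (q.γ t') ∂q.μ ∂p.μ =
      ∫ t, ∫ t', (p.φ t * q.φ t' / (q.γ t' - p.γ t)) • R (p.γ t) ∂q.μ ∂p.μ -
      ∫ t, ∫ t', (p.φ t * q.φ t' / (q.γ t' - p.γ t)) • R (q.γ t') ∂q.μ ∂p.μ :=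
    integral_integral_sub i1 i2
  rw [e1, e2, integral_integral_swap (f := fun t t' => (p.φ t * q.φ t' / (q.γ t' - p.γ t)) • R (q.γ t')) i2,
    sub_eq_add_neg, ← integral_neg]
  congr 1
  · refine integral_congr_ae (Eventually.of_forall fun t => ?_)
    simp only
    rw [integral_smul_const, cauchy, ← integral_const_mul]
    congr 1
    refine integral_congr_ae (Eventually.of_forall fun t' => ?_)
    simp only
    ring
  · refine integral_congr_ae (Eventually.of_forall fun t => ?_)
    simp only
    rw [integral_smul_const, cauchy, ← integral_const_mul, ← neg_smul, ← integral_neg]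
    congr 1
    refine integral_congr_ae (Eventually.of_forall fun t' => ?_)
    simp only
    rw [← neg_sub (q.γ t), div_neg]
    ring

/-- Two integrals with vanishing Cauchy transforms. -/
lemma Sep.int_mul_int_eq_zero (h : Sep p q) {R : ℂ → A} {S : Set ℂ} (hR : IsRes R S) (hp : ∀ t, p.γ t ∈ S)
    (hq : ∀ t, q.γ t ∈ S) (h1 : ∀ t, q.cauchy (p.γ t) = 0) (h2 : ∀ t, p.cauchy (q.γ t) = 0) :
    p.int R * q.int R = 0 := by
  rw [h.int_mul_int hR hp hq]
  simp [h1, h2]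

/-- Nested paths: `q` lies in the interior of `p`, and `p` outside of `q`. -/
lemma Sep.int_mul_int_of_nested (h : Sep p q) {R : ℂ → A} {S : Set ℂ} (hR : IsRes R S)
    (hp : ∀ t, p.γ t ∈ S) (hq : ∀ t, q.γ t ∈ S) {f : ℂ → ℂ} (h1 : ∀ t, q.cauchy (p.γ t) = 0)
    (h2 : ∀ t, p.cauchy (q.γ t) = f (q.γ t)) :
    p.int R * q.int R = ∫ t, (q.φ t * f (q.γ t)) • R (q.γ t) ∂q.μ ∧
    q.int R * p.int R = ∫ t, (q.φ t * f (q.γ t)) • R (q.γ t) ∂q.μ := by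
  rw [h.int_mul_int hR hp hq, h.symm.int_mul_int hR hq hp]
  simp [h1, h2]

end Path

/-! ### Families of projections -/

/-- An idempotent of norm less than one vanishes. -/
lemma eq_zero_of_mul_self {x : A} (h : x * x = x) (hx : ‖x‖ < 1) : x = 0 := by
  have h1 := norm_mul_le x x
  rw [h] at h1
  have h2 := norm_nonneg x
  exact norm_eq_zero.1 (by nlinarith)

/-- A decreasing family of elements which act as units on the later ones is constant, as long as
its variation is less than one. -/
lemma eq_of_nested {P : ℝ → A} {a b : ℝ} (hab : a < b)
    (hm : ∀ x y, a ≤ x → x < y → y ≤ b → P x * P y = P y ∧ P y * P x = P y)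
    (hc : ∀ x y, a ≤ x → x ≤ b → a ≤ y → y ≤ b → ‖P x - P y‖ ≤ 1 / 2)
    (hca : Tendsto P (𝓝[>] a) (𝓝 (P a))) :
    P a * P a = P a ∧ ∀ x, a ≤ x → x ≤ b → P x * P x = P x → P x = P a := by
  have hev : ∀ᶠ x in 𝓝[>] a, x ∈ Set.Ioo a b := Ioo_mem_nhdsGT hab
  have h1 : P a * P a = P a := by
    -- P a is idempotent as the limit of P a * P x = P x, although the product on one and the same
    -- contour has no direct meaning.
    refine tendsto_nhds_unique (hca.const_mul (P a)) (hca.congr' ?_)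
    filter_upwards [hev] with x hx
    exact (hm a x le_rfl hx.1 hx.2.le).1.symm
  refine ⟨h1, fun x hx hxb hxx => ?_⟩
  rcases eq_or_lt_of_le hx with rfl | hlt
  · rfl
  have h2 := hm a x le_rfl hlt hxb
  have h3 : (P a - P x) * (P a - P x) = P a - P x := by
    rw [mul_sub, sub_mul, sub_mul, h1, h2.1, h2.2, hxx]; abel
  have h4 := eq_zero_of_mul_self h3 ((hc a x le_rfl hab.le hx hxb).trans_lt (by norm_num))
  exact (sub_eq_zero.1 h4).symm

end Paths

end LandauSphere
end

/-! ### The perturbed resolvent, and the products over the actual contours. -/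

noncomputable section
namespace LandauSphere

/-! ### The perturbed resolvent -/

/-- The resolvent of the sum of `K` and the operator with the matrix `nMat id`. -/
def rsv (K : V6 →L[ℂ] V6) (z : ℂ) : V6 →L[ℂ] V6 := Ring.inverse (1 - res0 z * K) * res0 z

section Res

variable {K : V6 →L[ℂ] V6}

/-- On `Reg` the norm of R₀ is at most 4428 = 6 · 738, so the hypothesis on K makes both products
have norm at most 1/2. -/
lemma isUnit_one_sub (hK : 8856 * ‖K‖ ≤ 1) {z : ℂ} (hz : z ∈ Reg) :
    IsUnit (1 - res0 z * K) ∧ IsUnit (1 - K * res0 z) ∧ ‖res0 z * K‖ ≤ 1 / 2 := by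
  have h1 : ‖res0 z‖ ≤ 4428 := by
    refine (norm_res0_le hz).trans ?_
    have : rho z.im ^ (-(6 / 7) : ℝ) ≤ 1 :=
      Real.rpow_le_one_of_one_le_of_nonpos (one_le_rho _) (by norm_num)
    linarith
  have h2 := norm_nonneg K
  have h3 := norm_nonneg (res0 z)
  have h4 : ‖res0 z * K‖ ≤ 1 / 2 := (norm_mul_le _ _).trans (by nlinarith)
  have h5 : ‖K * res0 z‖ ≤ 1 / 2 := (norm_mul_le _ _).trans (by nlinarith)
  exact ⟨isUnit_one_sub_of_norm_lt_one (h4.trans_lt (by norm_num)),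
    isUnit_one_sub_of_norm_lt_one (h5.trans_lt (by norm_num)), h4⟩

lemma one_sub_mul_res (hK : 8856 * ‖K‖ ≤ 1) {z : ℂ} (hz : z ∈ Reg) : (1 - res0 z * K) * rsv K z = res0 z := by
  rw [rsv, ← mul_assoc, Ring.mul_inverse_cancel _ (isUnit_one_sub hK hz).1, one_mul]

lemma res_mul_one_sub (hK : 8856 * ‖K‖ ≤ 1) {z : ℂ} (hz : z ∈ Reg) : rsv K z * (1 - K * res0 z) = res0 z := by
  have h : res0 z * (1 - K * res0 z) = (1 - res0 z * K) * res0 z := by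
    rw [mul_sub, sub_mul, mul_one, one_mul, mul_assoc]
  rw [rsv, mul_assoc, h, ← mul_assoc, Ring.inverse_mul_cancel _ (isUnit_one_sub hK hz).1, one_mul]

lemma res_eq (hK : 8856 * ‖K‖ ≤ 1) {z : ℂ} (hz : z ∈ Reg) : rsv K z = res0 z + res0 z * K * rsv K z := by
  have := one_sub_mul_res hK hz
  rw [sub_mul, one_mul] at this
  exact eq_add_of_sub_eq this

lemma res_eq' (hK : 8856 * ‖K‖ ≤ 1) {z : ℂ} (hz : z ∈ Reg) : rsv K z = res0 z + rsv K z * K * res0 z := by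
  have := res_mul_one_sub hK hz
  rw [mul_sub, mul_one, ← mul_assoc] at this
  exact eq_add_of_sub_eq this

lemma norm_res_le (hK : 8856 * ‖K‖ ≤ 1) {z : ℂ} (hz : z ∈ Reg) : ‖rsv K z‖ ≤ 8856 * rho z.im ^ (-(6 / 7) : ℝ) := by
  have h1 : ‖rsv K z‖ ≤ ‖res0 z‖ + 1 / 2 * ‖rsv K z‖ := by
    conv_lhs => rw [res_eq hK hz]
    refine (norm_add_le _ _).trans ?_
    gcongr
    exact (norm_mul_le _ _).trans (by gcongr; exact (isUnit_one_sub hK hz).2.2)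
  have := norm_res0_le hz
  linarith

/-- The difference is R₀KR and contains two resolvents, so the exponent -6/7 doubles. This is the
gain that makes the correction integrable along the contours. -/
lemma norm_res_sub_res0_le (hK : 8856 * ‖K‖ ≤ 1) {z : ℂ} (hz : z ∈ Reg) :
    ‖rsv K z - res0 z‖ ≤ 4428 * 8856 * ‖K‖ * rho z.im ^ (-(12 / 7) : ℝ) := by
  have h : rsv K z - res0 z = res0 z * K * rsv K z := by
    conv_lhs => rw [res_eq hK hz]
    abel
  rw [h]
  have e : rho z.im ^ (-(12 / 7) : ℝ) = rho z.im ^ (-(6 / 7) : ℝ) * rho z.im ^ (-(6 / 7) : ℝ) := by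
    rw [← Real.rpow_add (rho_pos _)]; norm_num
  calc _ ≤ ‖res0 z‖ * ‖K‖ * ‖rsv K z‖ :=
        (norm_mul_le _ _).trans (by gcongr; exact norm_mul_le _ _)
    _ ≤ (4428 * rho z.im ^ (-(6 / 7) : ℝ)) * ‖K‖ * (8856 * rho z.im ^ (-(6 / 7) : ℝ)) := by
        have := rho_pos z.im
        gcongr
        exacts [norm_res0_le hz, norm_res_le hK hz]
    _ = _ := by rw [e]; ring

/-- (1 - R₀(z)K) (R(z) - R(w)) (1 - K R₀(w)) = R₀(z) - R₀(w) with invertible outer factors, so the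
resolvent identity is inherited from R₀. -/
lemma isRes_res (hK : 8856 * ‖K‖ ≤ 1) : IsRes (rsv K) Reg := by
  refine ⟨fun z hz w hw => ?_, 8856, fun z hz => (norm_res_le hK hz).trans ?_⟩
  · have h1 := one_sub_mul_res hK hz
    have h2 := res_mul_one_sub hK hw
    refine (isUnit_one_sub hK hz).1.mul_left_cancel ((isUnit_one_sub hK hw).2.1.mul_right_cancel ?_)
    calc (1 - res0 z * K) * (rsv K z - rsv K w) * (1 - K * res0 w)
        = (1 - res0 z * K) * rsv K z * (1 - K * res0 w) -
          (1 - res0 z * K) * (rsv K w * (1 - K * res0 w)) := by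
          rw [mul_sub (1 - res0 z * K), sub_mul _ _ (1 - K * res0 w), mul_assoc _ (rsv K w)]
      _ = res0 z - res0 w := by 
        rw [h1, h2, mul_sub, sub_mul, mul_one, one_mul, mul_assoc]; abel
      _ = (w - z) • ((1 - res0 z * K) * rsv K z * (rsv K w * (1 - K * res0 w))) := by
        rw [h1, h2, res0_sub hz hw]
      _ = _ := by
        rw [mul_smul_comm, smul_mul_assoc]
        simp only [mul_assoc]
  · have : rho z.im ^ (-(6 / 7) : ℝ) ≤ 1 :=
      Real.rpow_le_one_of_one_le_of_nonpos (one_le_rho _) (by norm_num)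
    linarith

end Res

lemma res_zero (z : ℂ) : rsv 0 z = res0 z := by simp [rsv]

lemma isRes_res0 : IsRes res0 Reg := by
  have := isRes_res (K := 0) (by simp)
  simpa only [res_zero, funext_iff, show rsv 0 = res0 from funext res_zero] using this

/-! ### The contours lie in the region -/

/-- The constant 9 in `Reg` suits both cases: 1 + |y| ≤ 9 |y| for |y| ≥ 1/8, and 1 + |y| ≤ 9 · 1/8
for |y| ≤ 1/8. -/
lemma mem_Reg_of {z : ℂ} (h1 : |z.re| ≤ 2 + |z.im| ^ (8 / 7 : ℝ))
    (h2 : |z.im| < 1 / 8 → ∀ n : ℤ, 1 / 8 ≤ ‖z - n‖) : z ∈ Reg := by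
  have h0 := abs_nonneg z.im
  refine ⟨fun n => ?_, ?_⟩
  · by_cases h : |z.im| < 1 / 8
    · have := h2 h n
      unfold rho
      linarith
    · have := Complex.abs_im_le_norm (z - n)
      simp only [Complex.sub_im, Complex.intCast_im, sub_zero] at this
      unfold rho
      linarith
  · have h3 : ‖z‖ ≤ |z.re| + |z.im| := Complex.norm_le_abs_re_add_abs_im z
    have h7 := norm_sub_le z (1 / 2)
    have h8 : ‖(1 / 2 : ℂ)‖ = 1 / 2 := by norm_num
    rw [h8] at h7
    have h4 : |z.im| ^ (8 / 7 : ℝ) ≤ rho z.im ^ (8 / 7 : ℝ) :=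
      Real.rpow_le_rpow h0 (abs_le_rho _) (by norm_num)
    have h5 : rho z.im ≤ rho z.im ^ (8 / 7 : ℝ) := by
      conv_lhs => rw [← Real.rpow_one (rho z.im)]
      exact Real.rpow_le_rpow_of_exponent_le (one_le_rho _) (by norm_num)
    have h6 : 1 + |z.im| = rho z.im := rfl
    have := one_le_rho z.im
    linarith

lemma one_sub_mem_Reg {z : ℂ} (h : z ∈ Reg) : 1 - z ∈ Reg := by
  have e : (1 - z).im = -z.im := by simp
  refine ⟨fun n => ?_, ?_⟩
  · have := h.1 (1 - n)
    rw [e, rho, abs_neg, show 1 - z - (n : ℂ) = -(z - ((1 - n : ℤ) : ℂ)) by push_cast; ring, norm_neg]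
    exact this
  · rw [e, rho, abs_neg, show 1 - z - 1 / 2 = -(z - 1 / 2) by ring, norm_neg]
    exact h.2

/-- Where |t| < 1/8, the real part lies between 3/2 and 7/4 + 1/8, at distance at least 1/8 from the
integers 1 and 2. This leaves room for moving the contour from 3/2 to 7/4. -/
lemma crv_mem_Reg {a : ℝ} (h1 : 3 / 2 ≤ a) (h2 : a ≤ 7 / 4) (t : ℝ) : crv a t ∈ Reg := by
  have h0 : 0 ≤ |t| ^ (8 / 7 : ℝ) := by positivity
  refine mem_Reg_of ?_ fun ht n => ?_
  · rw [crv_re, crv_im, abs_neg, abs_of_nonneg (by linarith)]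
    linarith
  · rw [crv_im, abs_neg] at ht
    have h3 : |t| ^ (8 / 7 : ℝ) ≤ 1 / 8 := by
      calc |t| ^ (8 / 7 : ℝ) ≤ |t| ^ (1 : ℝ) :=
            Real.rpow_le_rpow_of_exponent_ge_of_imp (abs_nonneg t) (by linarith) (by norm_num) (by norm_num)
        _ ≤ 1 / 8 := by rw [Real.rpow_one]; exact ht.le
    refine le_trans ?_ (Complex.abs_re_le_norm _)
    rw [Complex.sub_re, crv_re, Complex.intCast_re, le_abs]
    rcases le_or_gt n 1 with h | h
    · left
      have : (n : ℝ) ≤ 1 := by exact_mod_cast h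
      linarith
    · right
      have : (2 : ℝ) ≤ n := by exact_mod_cast h
      linarith

lemma circle_mem_Reg {c : ℝ} (hc : c = 0 ∨ c = 1) {z : ℂ} (h1 : 1 / 4 ≤ ‖z - c‖) (h2 : ‖z - c‖ ≤ 1 / 2) :
    z ∈ Reg := by
  have hre := (Complex.abs_re_le_norm (z - c)).trans h2
  simp only [Complex.sub_re, Complex.ofReal_re] at hre
  refine mem_Reg_of ?_ fun _ n => ?_
  · have : 0 ≤ |z.im| ^ (8 / 7 : ℝ) := by positivity
    rw [abs_le] at hre ⊢
    rcases hc with rfl | rfl <;> constructor <;> linarith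
  · obtain ⟨m, rfl⟩ : ∃ m : ℤ, c = m := by
      rcases hc with rfl | rfl
      exacts [⟨0, by simp⟩, ⟨1, by simp⟩]
    by_cases h : n = m
    · rw [h]; push_cast at h1; linarith
    · have h3 : (1 : ℝ) ≤ ‖((m : ℂ) - n)‖ := by
        rw [show (m : ℂ) - n = ((m - n : ℤ) : ℂ) by push_cast; ring, Complex.norm_intCast]
        exact_mod_cast Int.one_le_abs (sub_ne_zero.2 (Ne.symm h))
      have h4 : (m : ℂ) - n = (z - n) - (z - (m : ℝ)) := by push_cast; ring
      rw [h4] at h3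
      have := norm_sub_le (z - n) (z - (m : ℝ))
      linarith

end LandauSphere
end

noncomputable section
namespace LandauSphere

/-! ### The weighted contours -/

namespace Path

/-- The curve `crv a` with an exponential weight. -/
def plus (a : ℝ) {s : ℝ} (hs : s < 0) : Path where
  μ := volume
  φ t := Complex.exp (crv a t * s) * dcrv t
  γ := crv a
  sfinite := inferInstance
  contφ := by
    have h1 := continuous_crv a
    have h2 := continuous_dcrv
    fun_prop
  contγ := continuous_crv a
  integrable := by
    have h1 := continuous_crv a
    have h2 := continuous_dcrv
    refine ((integrable_exp_mul_rho_pow hs 2).const_mul (3 * Real.exp (a * s))).mono'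
      (Continuous.aestronglyMeasurable (by fun_prop)) (Eventually.of_forall fun t => ?_)
    have := rho_pos t
    rw [norm_mul, norm_norm, Real.norm_of_nonneg this.le, norm_mul, norm_exp_crv]
    calc _ ≤ Real.exp (a * s) * Real.exp (s * |t| ^ (8 / 7 : ℝ)) * (3 * rho t) * rho t := by
          gcongr; exact norm_dcrv_le' t
      _ = _ := by ring

/-- The reflected curve, with an exponential weight. -/
def minus (a : ℝ) {s : ℝ} (hs : 0 < s) : Path where
  μ := volume
  φ t := Complex.exp ((1 - crv a t) * s) * -dcrv t
  γ t := 1 - crv a t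
  sfinite := inferInstance
  contφ := by
    have h1 := continuous_crv a
    have h2 := continuous_dcrv
    fun_prop
  contγ := by
    have h1 := continuous_crv a
    fun_prop
  integrable := by
    have e : ∀ t, Complex.exp ((1 - crv a t) * s) * -dcrv t =
        -(Complex.exp s * (Complex.exp (crv a t * (-s : ℝ)) * dcrv t)) := fun t => by
      rw [show (1 - crv a t) * s = s + crv a t * (-s : ℝ) by push_cast; ring, Complex.exp_add]
      ring
    simp only [e, norm_neg, norm_mul (Complex.exp s), mul_assoc ‖Complex.exp s‖]
    exact (plus a (neg_neg_of_pos hs)).integrable.const_mul _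

/-- A circle. -/
def circ (c : ℂ) (r : ℝ) : Path where
  μ := volume.restrict (Set.Icc 0 (2 * Real.pi))
  φ t := circleMap 0 r t * Complex.I
  γ := circleMap c r
  sfinite := inferInstance
  contφ := by fun_prop
  contγ := by fun_prop
  integrable := by
    refine ContinuousOn.integrableOn_compact isCompact_Icc (Continuous.continuousOn ?_)
    fun_prop

lemma minus_int {A : Type*} [NormedRing A] [NormedAlgebra ℂ A] (a : ℝ) {s : ℝ} (hs : 0 < s) (R : ℂ → A) :
    (minus a hs).int R = Complex.exp s • (plus a (neg_neg_of_pos hs)).int fun z => -R (1 - z) := by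
  simp only [int, minus, plus]
  rw [← integral_smul]
  refine integral_congr_ae (Eventually.of_forall fun t => ?_)
  simp only
  rw [show (1 - crv a t) * s = s + crv a t * (-s : ℝ) by push_cast; ring, Complex.exp_add, smul_smul,
    smul_neg, ← neg_smul]
  congr 1
  ring

lemma minus_cauchy (a : ℝ) {s : ℝ} (hs : 0 < s) (z : ℂ) :
    (minus a hs).cauchy z = Complex.exp s * (plus a (neg_neg_of_pos hs)).cauchy (1 - z) := by
  simp only [cauchy, minus, plus]
  rw [← integral_const_mul]
  refine integral_congr_ae (Eventually.of_forall fun t => ?_)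
  simp only
  rw [show (1 - crv a t) * s = s + crv a t * (-s : ℝ) by push_cast; ring, Complex.exp_add,
    show 1 - crv a t - z = -(crv a t - (1 - z)) by ring, div_neg]
  ring

lemma le_rho_mul {d x : ℝ} (hd : 0 ≤ d) (h : d ≤ x) (t : ℝ) : d ≤ rho t * x := by
  have := one_le_rho t
  nlinarith

lemma plus_cauchy_of_lt {a s : ℝ} (hs : s < 0) {z : ℂ} (h : z.re < a) : (plus a hs).cauchy z = 0 := by
  have hp : ∀ t : ℝ, 0 ≤ |t| ^ (8 / 7 : ℝ) := fun t => by positivity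
  refine (crv_integral hs (sub_pos.2 h) (fun t => ?_) (trunc_outside (by linarith [hp z.im]))).2.trans (zero_mul _)
  refine le_rho_mul (sub_pos.2 h).le ((le_trans ?_ (le_abs_self _)).trans (Complex.abs_re_le_norm _)) t
  rw [Complex.sub_re, crv_re]
  linarith [hp t]

lemma crv_separated' {a b : ℝ} (h : a < b) (t : ℝ) : 0 < (b - a) / (3 * rho t) ∧
    ∀ t', (b - a) / (3 * rho t) ≤ rho t' * ‖crv b t' - crv a t‖ := by
  have := rho_pos t
  have h' : 0 < b - a := sub_pos.2 h
  refine ⟨by positivity, fun t' => ?_⟩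
  rw [div_le_iff₀ (by positivity)]
  linarith [crv_separated h.le t t']

lemma plus_cauchy_crv_of_lt {a b s : ℝ} (hs : s < 0) (h : a < b) (t : ℝ) :
    (plus b hs).cauchy (crv a t) = 0 := by
  obtain ⟨h1, h2⟩ := crv_separated' h t
  exact (crv_integral hs h1 h2 (trunc_outside (by simpa using h))).2.trans (zero_mul _)

lemma plus_cauchy_crv_of_gt {a b s : ℝ} (hs : s < 0) (h : a < b) (t : ℝ) :
    (plus a hs).cauchy (crv b t) = 2 * Real.pi * Complex.I * Complex.exp (crv b t * s) := by
  have h' : 0 < b - a := sub_pos.2 h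
  have := rho_pos t
  refine (crv_integral hs (d := (b - a) / (3 * rho t)) (by positivity) (fun t' => ?_)
    (trunc_inside (by simpa using h))).2
  rw [div_le_iff₀ (by positivity), norm_sub_rev]
  linarith [crv_separated h.le t' t]

lemma circ_cauchy (c : ℂ) (r : ℝ) (z : ℂ) : (circ c r).cauchy z = ∮ w in C(c, r), (w - z)⁻¹ := by
  simp only [cauchy, circ, circleIntegral]
  rw [integral_Icc_eq_integral_Ioc, ← intervalIntegral.integral_of_le (by positivity)]
  simp [div_eq_mul_inv]

lemma circ_cauchy_of_lt {c z : ℂ} {r : ℝ} (h : ‖z - c‖ < r) :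
    (circ c r).cauchy z = 2 * Real.pi * Complex.I := by
  rw [circ_cauchy, circleIntegral.integral_sub_inv_of_mem_ball (by simpa [dist_eq_norm] using h)]

lemma circ_cauchy_of_gt {c z : ℂ} {r : ℝ} (hr : 0 ≤ r) (h : r < ‖z - c‖) :
    (circ c r).cauchy z = 0 := by
  rw [circ_cauchy]
  refine DiffContOnCl.circleIntegral_eq_zero hr ?_
  have hd : DifferentiableOn ℂ (fun w => (w - z)⁻¹) (Metric.closedBall c r) := by
    refine (differentiableOn_id.sub_const z).inv fun w hw h0 => ?_
    rw [mem_closedBall_iff_norm] at hw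
    rw [show w = z from sub_eq_zero.1 h0] at hw
    linarith
  exact hd.diffContOnCl_ball subset_rfl

/-! ### Separation of the contours -/

lemma sep_of_le {p q : Path} {d : ℝ} (hd : 0 < d) (h : ∀ t t', d ≤ ‖q.γ t' - p.γ t‖) : Sep p q :=
  ⟨d, hd, fun t t' => by
    have h1 := one_le_mul_of_one_le_of_one_le (one_le_rho t) (one_le_rho t')
    have h2 := h t t'
    nlinarith⟩

lemma sep_plus_plus {a b s s' : ℝ} (hs : s < 0) (hs' : s' < 0) (h : a < b) : Sep (plus a hs) (plus b hs') :=
  ⟨(b - a) / 3, by linarith, fun t t' => by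
    change _ ≤ rho t * rho t' * ‖crv b t' - crv a t‖
    linarith [crv_separated h.le t t']⟩

lemma le_re_crv (a t : ℝ) : a ≤ (crv a t).re := by
  rw [crv_re]
  have : 0 ≤ |t| ^ (8 / 7 : ℝ) := by positivity
  linarith

lemma sep_of_re {p q : Path} {x y : ℝ} (hxy : x < y) (hp : ∀ t, (p.γ t).re ≤ x) (hq : ∀ t, y ≤ (q.γ t).re) :
    Sep p q :=
  sep_of_le (sub_pos.2 hxy) fun t t' => by
    refine le_trans ?_ ((le_abs_self _).trans (Complex.abs_re_le_norm _))
    rw [Complex.sub_re]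
    linarith [hp t, hq t']

lemma norm_circleMap_sub {r : ℝ} (hr : 0 ≤ r) (c : ℂ) (t : ℝ) : ‖circleMap c r t - c‖ = r := by
  rw [circleMap_sub_center, norm_circleMap_zero, abs_of_nonneg hr]

lemma circ_re {c r : ℝ} (hr : 0 ≤ r) (t : ℝ) : c - r ≤ ((circ c r).γ t).re ∧ ((circ c r).γ t).re ≤ c + r := by
  have h := (Complex.abs_re_le_norm (circleMap c r t - c)).trans_eq (norm_circleMap_sub hr c t)
  rw [Complex.sub_re, Complex.ofReal_re, abs_le] at h
  change c - r ≤ (circleMap c r t).re ∧ (circleMap c r t).re ≤ c + r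
  constructor <;> linarith

lemma sep_circ_circ {c : ℂ} {r r' : ℝ} (hr' : 0 ≤ r') (h : r' < r) : Sep (circ c r) (circ c r') :=
  sep_of_le (sub_pos.2 h) fun t t' => by
    have h1 := norm_circleMap_sub (hr'.trans h.le) c t
    have h2 := norm_circleMap_sub hr' c t'
    have h3 := norm_sub_norm_le (circleMap c r t - c) (circleMap c r' t' - c)
    rw [sub_sub_sub_cancel_right, h1, h2] at h3
    exact h3.trans_eq (norm_sub_rev _ _)

/-! ### The products of the integrals -/

section Products

variable {A : Type*} [NormedRing A] [NormedAlgebra ℂ A] [CompleteSpace A] {R : ℂ → A}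

/-- The Cauchy transform of the left curve at points of the right one carries the factor e^{zs},
which merges with the weight e^{zs'}; the other transform vanishes. This is the semigroup law on
nested contours. -/
lemma plus_mul_plus (hR : IsRes R Reg) {a b s s' : ℝ} (hs : s < 0) (hs' : s' < 0) (ha : 3 / 2 ≤ a)
    (hab : a < b) (hb : b ≤ 7 / 4) :
    (plus a hs).int R * (plus b hs').int R =
      (2 * Real.pi * Complex.I : ℂ) • (plus b (add_neg hs hs')).int R ∧
    (plus b hs').int R * (plus a hs).int R =
      (2 * Real.pi * Complex.I : ℂ) • (plus b (add_neg hs hs')).int R := by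
  have h := (sep_plus_plus hs hs' hab).int_mul_int_of_nested hR
    (f := fun z => 2 * Real.pi * Complex.I * Complex.exp (z * s))
    (fun t => crv_mem_Reg ha (hab.le.trans hb) t) (fun t => crv_mem_Reg (ha.trans hab.le) hb t)
    (fun t => plus_cauchy_crv_of_lt hs' hab t) fun t => plus_cauchy_crv_of_gt hs hab t
  have e : ∫ t, ((plus b hs').φ t * (2 * Real.pi * Complex.I * Complex.exp ((plus b hs').γ t * s))) •
      R ((plus b hs').γ t) ∂(plus b hs').μ =
      (2 * Real.pi * Complex.I : ℂ) • (plus b (add_neg hs hs')).int R := by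
    simp only [int, plus]
    rw [← integral_smul]
    refine integral_congr_ae (Eventually.of_forall fun t => ?_)
    simp only
    rw [smul_smul, show crv b t * ((s + s' : ℝ) : ℂ) = crv b t * s' + crv b t * s by push_cast; ring,
      Complex.exp_add]
    congr 1
    ring
  rwa [e] at h

lemma circ_mem {c r : ℝ} (hc : c = 0 ∨ c = 1) (h1 : 1 / 4 ≤ r) (h2 : r ≤ 1 / 2) (t : ℝ) :
    (circ c r).γ t ∈ Reg :=
  circle_mem_Reg hc (h1.trans_eq (norm_circleMap_sub (by linarith) _ t).symm)
    ((norm_circleMap_sub (by linarith) _ t).trans_le h2)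

lemma circ_mul_circ (hR : IsRes R Reg) {c r r' : ℝ} (hc : c = 0 ∨ c = 1) (h1 : 1 / 4 ≤ r') (h : r' < r)
    (h2 : r ≤ 1 / 2) :
    (circ c r).int R * (circ c r').int R = (2 * Real.pi * Complex.I : ℂ) • (circ c r').int R ∧
    (circ c r').int R * (circ c r).int R = (2 * Real.pi * Complex.I : ℂ) • (circ c r').int R := by
  have hr' : 0 ≤ r' := by linarith
  have hr : 0 ≤ r := by linarith
  have h := (sep_circ_circ (c := c) hr' h).int_mul_int_of_nested hR
    (f := fun z => 2 * Real.pi * Complex.I)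
    (fun t => circ_mem hc (h1.trans h.le) h2 t) (fun t => circ_mem hc h1 (h.le.trans h2) t)
    (fun t => circ_cauchy_of_gt hr' (h.trans_eq (norm_circleMap_sub hr _ t).symm))
    fun t => circ_cauchy_of_lt ((norm_circleMap_sub hr' _ t).trans_lt h)
  have e : ∫ t, ((circ c r').φ t * (2 * Real.pi * Complex.I)) • R ((circ c r').γ t) ∂(circ c r').μ =
      (2 * Real.pi * Complex.I : ℂ) • (circ c r').int R := by
    rw [int, ← integral_smul]
    refine integral_congr_ae (Eventually.of_forall fun t => ?_)
    simp only
    rw [smul_smul, mul_comm]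
  rwa [e] at h

lemma minus_mem {a s : ℝ} (hs : 0 < s) (ha : 3 / 2 ≤ a) (hb : a ≤ 7 / 4) (t : ℝ) : (minus a hs).γ t ∈ Reg :=
  one_sub_mem_Reg (crv_mem_Reg ha hb t)

lemma minus_re {a s : ℝ} (hs : 0 < s) (t : ℝ) : ((minus a hs).γ t).re ≤ 1 - a := by
  change (1 - crv a t).re ≤ _
  rw [Complex.sub_re, Complex.one_re]
  linarith [le_re_crv a t]

lemma plus_minus (hR : IsRes R Reg) {a a' s s' : ℝ} (hs : s < 0) (hs' : 0 < s') (ha : 3 / 2 ≤ a)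
    (hb : a ≤ 7 / 4) (ha' : 3 / 2 ≤ a') (hb' : a' ≤ 7 / 4) :
    (plus a hs).int R * (minus a' hs').int R = 0 ∧ (minus a' hs').int R * (plus a hs).int R = 0 := by
  have h : Sep (minus a' hs') (plus a hs) := sep_of_re (x := 1 - a') (y := a) (by linarith)
    (fun t => minus_re hs' t) fun t => le_re_crv a t
  have h1 : ∀ t, (minus a' hs').cauchy ((plus a hs).γ t) = 0 := fun t => by
    rw [minus_cauchy, plus_cauchy_of_lt, mul_zero]
    have : a ≤ ((plus a hs).γ t).re := le_re_crv a t
    rw [Complex.sub_re, Complex.one_re]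
    linarith
  have h2 : ∀ t, (plus a hs).cauchy ((minus a' hs').γ t) = 0 := fun t =>
    plus_cauchy_of_lt hs (by linarith [minus_re (a := a') hs' t])
  have hp := fun t => crv_mem_Reg ha hb t
  have hm := fun t => minus_mem hs' ha' hb' t
  exact ⟨h.symm.int_mul_int_eq_zero hR hp hm h1 h2, h.int_mul_int_eq_zero hR hm hp h2 h1⟩

lemma plus_circ (hR : IsRes R Reg) {a c r s : ℝ} (hs : s < 0) (ha : 3 / 2 ≤ a) (hb : a ≤ 7 / 4)
    (hc : c = 0 ∨ c = 1) (h1 : 1 / 4 ≤ r) (h2 : r < 1 / 2) :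
    (plus a hs).int R * (circ c r).int R = 0 ∧ (circ c r).int R * (plus a hs).int R = 0 := by
  have hr : 0 ≤ r := by linarith
  have hc1 : c ≤ 1 := by rcases hc with rfl | rfl <;> norm_num
  have h : Sep (circ c r) (plus a hs) := sep_of_re (x := c + r) (y := a) (by linarith)
    (fun t => (circ_re hr t).2) fun t => le_re_crv a t
  have h3 : ∀ t, (circ c r).cauchy ((plus a hs).γ t) = 0 := fun t => by
    refine circ_cauchy_of_gt hr (lt_of_lt_of_le ?_ ((le_abs_self _).trans (Complex.abs_re_le_norm _)))
    have : a ≤ ((plus a hs).γ t).re := le_re_crv a t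
    rw [Complex.sub_re, Complex.ofReal_re]
    linarith
  have h4 : ∀ t, (plus a hs).cauchy ((circ c r).γ t) = 0 := fun t =>
    plus_cauchy_of_lt hs (by linarith [(circ_re (c := c) hr t).2])
  have hp := fun t => crv_mem_Reg ha hb t
  have hm := fun t => circ_mem hc h1 h2.le t
  exact ⟨h.symm.int_mul_int_eq_zero hR hp hm h3 h4, h.int_mul_int_eq_zero hR hm hp h4 h3⟩

/-- Each contour lies outside the other, so both Cauchy transforms vanish. Strict inequality r < 1/2
is needed for separation, because the circle of radius 1/2 about 0 touches the reflected curve with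
a = 3/2. -/
lemma minus_circ (hR : IsRes R Reg) {a c r s : ℝ} (hs : 0 < s) (ha : 3 / 2 ≤ a) (hb : a ≤ 7 / 4)
    (hc : c = 0 ∨ c = 1) (h1 : 1 / 4 ≤ r) (h2 : r < 1 / 2) :
    (minus a hs).int R * (circ c r).int R = 0 ∧ (circ c r).int R * (minus a hs).int R = 0 := by
  have hr : 0 ≤ r := by linarith
  have hc1 : 0 ≤ c := by rcases hc with rfl | rfl <;> norm_num
  have h : Sep (minus a hs) (circ c r) := sep_of_re (x := 1 - a) (y := c - r) (by linarith)
    (fun t => minus_re hs t) fun t => (circ_re hr t).1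
  have h3 : ∀ t, (circ c r).cauchy ((minus a hs).γ t) = 0 := fun t => by
    refine circ_cauchy_of_gt hr (lt_of_lt_of_le ?_ ((neg_le_abs _).trans (Complex.abs_re_le_norm _)))
    have : ((minus a hs).γ t).re ≤ 1 - a := minus_re hs t
    rw [Complex.sub_re, Complex.ofReal_re]
    linarith
  have h4 : ∀ t, (minus a hs).cauchy ((circ c r).γ t) = 0 := fun t => by
    rw [minus_cauchy, plus_cauchy_of_lt, mul_zero]
    rw [Complex.sub_re, Complex.one_re]
    linarith [(circ_re (c := c) hr t).1]
  have hp := fun t => minus_mem hs ha hb t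
  have hm := fun t => circ_mem hc h1 h2.le t
  exact ⟨h.int_mul_int_eq_zero hR hp hm h3 h4, h.symm.int_mul_int_eq_zero hR hm hp h4 h3⟩

lemma circ_circ (hR : IsRes R Reg) {r : ℝ} (h1 : 1 / 4 ≤ r) (h2 : r < 1 / 2) :
    (circ 0 r).int R * (circ 1 r).int R = 0 ∧ (circ 1 r).int R * (circ 0 r).int R = 0 := by
  have hr : 0 ≤ r := by linarith
  have k0 := fun t => circ_re (c := 0) hr t
  have k1 := fun t => circ_re (c := 1) hr t
  simp only [Complex.ofReal_zero, Complex.ofReal_one] at k0 k1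
  have h : Sep (circ 0 r) (circ 1 r) := sep_of_re (x := 0 + r) (y := 1 - r) (by linarith)
    (fun t => (k0 t).2) fun t => (k1 t).1
  have h3 : ∀ t, (circ 0 r).cauchy ((circ 1 r).γ t) = 0 := fun t => by
    refine circ_cauchy_of_gt hr (lt_of_lt_of_le ?_ ((le_abs_self _).trans (Complex.abs_re_le_norm _)))
    rw [Complex.sub_re, Complex.zero_re]
    linarith [(k1 t).1]
  have h4 : ∀ t, (circ 1 r).cauchy ((circ 0 r).γ t) = 0 := fun t => by
    refine circ_cauchy_of_gt hr (lt_of_lt_of_le ?_ ((neg_le_abs _).trans (Complex.abs_re_le_norm _)))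
    rw [Complex.sub_re, Complex.one_re]
    linarith [(k0 t).2]
  have hp : ∀ t, (circ 0 r).γ t ∈ Reg := fun t => by simpa using circ_mem (c := 0) (.inl rfl) h1 h2.le t
  have hm : ∀ t, (circ 1 r).γ t ∈ Reg := fun t => by simpa using circ_mem (c := 1) (.inr rfl) h1 h2.le t
  exact ⟨h.int_mul_int_eq_zero hR hp hm h4 h3, h.symm.int_mul_int_eq_zero hR hm hp h3 h4⟩

end Products

end Path

end LandauSphere
end

/-! ### Semigroups and spectral projections in the parametrizing space. -/

noncomputable section
namespace LandauSphere

/-! ### Functions of `L₀`: limits and integrals -/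

/-- Dominated convergence in the sum over degrees. Only strong convergence can be expected: e^{ns}
does not converge uniformly in n ≥ 2 as s tends to 0. -/
lemma tendsto_multL {ι : Type*} {l : Filter ι} {m : ι → ℕ → ℂ} {m0 : ℕ → ℂ} {C : ℝ}
    (hC : ∀ s k, ‖m s k‖ ≤ C) (hC0 : ∀ k, ‖m0 k‖ ≤ C) (h : ∀ k, Tendsto (fun s => m s k) l (𝓝 (m0 k)))
    (f : L2) : Tendsto (fun s => multL (m s) f) l (𝓝 (multL m0 f)) := by
  rw [tendsto_iff_norm_sub_tendsto_zero]
  have e : ∀ s, ‖multL (m s) f - multL m0 f‖ ^ 2 = ∑' k, (‖m s k - m0 k‖ * ‖proj k f‖) ^ 2 := fun s => by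
    rw [← (hasSum_norm_sq _).tsum_eq]
    refine tsum_congr fun k => ?_
    rw [map_sub, proj_multL (hC s), proj_multL hC0, ← sub_smul, norm_smul]
  have h1 : Tendsto (fun s => ‖multL (m s) f - multL m0 f‖ ^ 2) l (𝓝 (∑' _ : ℕ, (0 : ℝ))) := by
    simp only [e]
    refine tendsto_tsum_of_dominated_convergence (bound := fun k => (2 * C) ^ 2 * ‖proj k f‖ ^ 2)
      ((hasSum_norm_sq f).summable.mul_left _) (fun k => ?_) (Eventually.of_forall fun s k => ?_)
    · have := (((tendsto_iff_norm_sub_tendsto_zero.1 (h k)).mul_const ‖proj k f‖).pow 2)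
      simpa using this
    · rw [norm_pow, norm_mul, norm_norm, norm_norm, mul_pow]
      have := (norm_sub_le (m s k) (m0 k)).trans (add_le_add (hC s k) (hC0 k))
      rw [← two_mul] at this
      gcongr
  rw [tsum_zero] at h1
  have h2 := (Real.continuous_sqrt.tendsto 0).comp h1
  simpa [Function.comp_def, Real.sqrt_sq] using h2

lemma tendsto_fn {ι : Type*} {l : Filter ι} {g : ι → ℤ → ℂ} {g0 : ℤ → ℂ} {B : ℝ}
    (hB : ∀ s, Adm (g s) B) (hB0 : Adm g0 B) (h : ∀ n, Tendsto (fun s => g s n) l (𝓝 (g0 n))) (v : V6) :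
    Tendsto (fun s => fn (g s) v) l (𝓝 (fn g0 v)) := by
  rw [tendsto_pi_nhds]
  intro i
  simp only [fn, opM, ContinuousLinearMap.coe_pi', sum_apply]
  refine tendsto_finsetSum _ fun j _ => ?_
  refine tendsto_multL (fun s k => (hB s).entryBound k i j) (fun k => hB0.entryBound k i j) (fun k => ?_) _
  fin_cases i <;> fin_cases j <;>
    first
      | exact h _
      | exact tendsto_const_nhds
      | exact tendsto_const_nhds.mul ((h _).sub (h _))

/-- The degree `k` part, as a continuous map. -/
def projVL (k : ℕ) : V6 →L[ℂ] V6 :=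
  ContinuousLinearMap.pi fun i => (proj k).comp (ContinuousLinearMap.proj i)

lemma projVL_apply (k : ℕ) (u : V6) : projVL k u = projV k u := rfl

/-- An integral of functions of `L₀` is computed on the integers. -/
lemma integral_fn {μ : Measure ℝ} {φ : ℝ → ℂ} {G : ℝ → ℤ → ℂ} {g : ℤ → ℂ} {B : ℝ} {B' : ℝ → ℝ}
    (hG : ∀ t, Adm (G t) (B' t)) (hg : Adm g B) (h1 : Integrable (fun t => φ t • fn (G t)) μ)
    (h2 : ∀ n, Integrable (fun t => φ t * G t n) μ) (h3 : ∀ n, ∫ t, φ t * G t n ∂μ = g n) :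
    ∫ t, φ t • fn (G t) ∂μ = fn g := by
  ext1 u
  refine ext_projV fun k => ?_
  have e1 := (ContinuousLinearMap.apply ℂ V6 u).integral_comp_comm h1
  simp only [ContinuousLinearMap.apply_apply] at e1
  have i1 : Integrable (fun t => (φ t • fn (G t)) u) μ :=
    (ContinuousLinearMap.apply ℂ V6 u).integrable_comp h1
  have e2 := (projVL k).integral_comp_comm i1
  rw [← e1, ← projVL_apply, ← e2, projV_fn hg, act_nMat]
  simp only [smul_apply, map_smul, projVL_apply, projV_fn (hG _), act_nMat,
    Finset.smul_sum, smul_smul]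
  rw [integral_finsetSum _ fun j _ => (h2 _).smul_const _]
  refine Finset.sum_congr rfl fun j _ => ?_
  rw [integral_smul_const, h3]

lemma fn_ext {g h : ℤ → ℂ} (e : ∀ n, g n = h n) : fn g = fn h := by rw [funext e]

lemma fn_lin {g h f : ℤ → ℂ} {B B' B'' : ℝ} (hg : Adm g B) (hh : Adm h B') (hf : Adm f B'') (c : ℂ)
    (he : ∀ n, g n + c * h n = f n) : fn g + c • fn h = fn f := by
  ext1 u
  refine ext_projV fun k => ?_
  have e1 : projV k ((fn g + c • fn h) u) = projV k (fn g u) + c • projV k (fn h u) := by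
    rw [← projVL_apply, ← projVL_apply, ← projVL_apply]
    simp only [add_apply, smul_apply, map_add, map_smul]
  rw [e1, projV_fn hg, projV_fn hh, projV_fn hf, act_nMat, act_nMat, act_nMat, Finset.smul_sum,
    ← Finset.sum_add_distrib]
  refine Finset.sum_congr rfl fun j _ => ?_
  rw [smul_smul, ← add_smul, he]

lemma adm_zero : Adm (fun _ => 0) 0 := ⟨by simp, by simp⟩

lemma adm_one : Adm (fun _ => 1) 1 := ⟨by simp, by simp⟩

lemma fn_zero : fn (fun _ => 0) = 0 := by
  have := norm_fn_le adm_zero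
  rw [mul_zero] at this
  exact norm_le_zero_iff.1 this

lemma fn_one : fn (fun _ => 1) = 1 := by
  ext1 u
  rw [fn, show nMat (fun _ => 1) = fun _ => 1 from funext nMat_one, opM_one]
  rfl

/-! ### The labels of the eigenvalues -/

/-- Either the identity or the reflection at `1 / 2`. -/
def Label (ν : ℤ → ℤ) : Prop := (∀ n, ν n = n) ∨ ∀ n, ν n = 1 - n

/-- The reflection n ↦ 1 - n maps steps of two to steps of two and changes |n| by at most one; the
symmetric factor |n| + 2 in the hypothesis covers both labels. -/
lemma Label.adm {ν : ℤ → ℤ} (hν : Label ν) {g : ℤ → ℂ} {B : ℝ} (h1 : ∀ n, ‖g n‖ ≤ B)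
    (h2 : ∀ n : ℤ, (|(n : ℝ)| + 2) * ‖g (n + 2) - g n‖ ≤ 2 * B) : Adm (fun n => g (ν n)) B := by
  refine ⟨fun n => h1 _, fun n => ?_⟩
  rcases hν with h | h
  · simp only [h]
    refine le_trans ?_ (h2 n)
    gcongr
    refine (norm_add_le _ _).trans (le_of_eq ?_)
    rw [Complex.norm_intCast]; norm_num
  · simp only [h]
    refine le_trans ?_ (h2 (1 - (n + 2)))
    rw [show 1 - (n + 2) + 2 = 1 - n by ring, norm_sub_rev (g (1 - n))]
    gcongr
    have e : ((n : ℂ) + 2) = -(((1 - (n + 2) : ℤ) : ℂ) - 1) := by push_cast; ring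
    rw [e, norm_neg]
    refine (norm_sub_le _ _).trans ?_
    rw [Complex.norm_intCast, norm_one]
    linarith

/-- The resolvent of the operator with the matrix `nMat ν`. -/
def rsv0 (ν : ℤ → ℤ) (z : ℂ) : V6 →L[ℂ] V6 := fn fun n => (z - ν n)⁻¹

lemma rsv0_of_reflect {ν : ℤ → ℤ} (h : ∀ n, ν n = 1 - n) {z : ℂ} (hz : z ∈ Reg) :
    rsv0 ν z = -res0 (1 - z) := by
  have h1 := adm_res0 (one_sub_mem_Reg hz)
  have h2 : Adm (fun n => -(1 - z - (n : ℂ))⁻¹) (738 * rho (1 - z).im ^ (-(6 / 7) : ℝ)) :=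
    ⟨fun n => by rw [norm_neg]; exact h1.1 n, fun n => by
      rw [← neg_sub', norm_neg]; exact h1.2 n⟩
  have := fn_lin adm_zero h1 h2 (-1) fun n => by ring
  rw [fn_zero, zero_add] at this
  rw [rsv0, res0, (neg_one_smul ℂ _).symm.trans this]
  refine fn_ext fun n => ?_
  rw [h, ← inv_neg]
  congr 1
  push_cast
  ring

lemma Label.rsv0_eq {ν : ℤ → ℤ} (hν : Label ν) :
    rsv0 ν = res0 ∨ ∀ z, z ∈ Reg → rsv0 ν z = -res0 (1 - z) := by
  rcases hν with h | h
  · left; funext z; simp [rsv0, res0, h]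
  · exact .inr fun z hz => rsv0_of_reflect h hz

lemma Label.adm_rsv0 {ν : ℤ → ℤ} (hν : Label ν) {z : ℂ} (hz : z ∈ Reg) :
    Adm (fun n => (z - ν n)⁻¹) (738 * rho z.im ^ (-(6 / 7) : ℝ)) := by
  rcases hν with h | h
  · simp only [h]; exact adm_res0 hz
  · have h1 := adm_res0 (one_sub_mem_Reg hz)
    have e : ∀ n : ℤ, (z - ν n)⁻¹ = -(1 - z - (n : ℂ))⁻¹ := fun n => by
      rw [h, ← inv_neg]
      congr 1
      push_cast
      ring
    have e1 : (1 - z).im = -z.im := by simp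
    rw [e1, rho, abs_neg] at h1
    refine ⟨fun n => ?_, fun n => ?_⟩
    · simp only [e, norm_neg]; exact h1.1 n
    · simp only [e]; rw [← neg_sub', norm_neg]; exact h1.2 n

lemma Label.norm_rsv0_le {ν : ℤ → ℤ} (hν : Label ν) {z : ℂ} (hz : z ∈ Reg) :
    ‖rsv0 ν z‖ ≤ 4428 * rho z.im ^ (-(6 / 7) : ℝ) :=
  (norm_fn_le (hν.adm_rsv0 hz)).trans_eq (by ring)

lemma Label.isRes {ν : ℤ → ℤ} (hν : Label ν) : IsRes (rsv0 ν) Reg := by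
  rcases hν.rsv0_eq with h | h
  · rw [h]; exact isRes_res0
  · obtain ⟨h1, M, h2⟩ := isRes_res0.reflect fun z => one_sub_mem_Reg
    refine ⟨fun z hz w hw => ?_, M, fun z hz => ?_⟩
    · rw [h z hz, h w hw]; exact h1 z hz w hw
    · rw [h z hz]; exact h2 z hz

/-- The integral of the resolvent of `L₀` over a path. -/
lemma Label.int_rsv0 {ν : ℤ → ℤ} (hν : Label ν) {p : Path} (hp : ∀ t, p.γ t ∈ Reg) {g : ℤ → ℂ} {B : ℝ}
    (hg : Adm g B) (h : ∀ n, p.cauchy (ν n) = g n) : p.int (rsv0 ν) = fn g := by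
  have h1 := p.contγ
  have h2 : Integrable (fun t => p.φ t • rsv0 ν (p.γ t)) p.μ := Path.integrable_res hν.isRes hp
  rw [Path.int]
  simp only [rsv0] at h2 ⊢
  refine integral_fn (fun t => hν.adm_rsv0 (hp t)) hg h2 (fun n => ?_) fun n => ?_
  · refine Path.integrable_smul (f := fun t => (p.γ t - ν n)⁻¹) (M := 9) ?_ fun t => ?_
    · exact Continuous.inv₀ (by fun_prop) fun t => Reg.ne (hp t) _
    · rw [norm_inv]
      refine inv_le_of_inv_le₀ (by norm_num) ?_
      have := (hp t).1 (ν n)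
      have := one_le_rho (p.γ t).im
      linarith
  · rw [← h n, Path.cauchy]
    simp only [div_eq_mul_inv]

/-! ### The exponential weights on the spectrum -/

/-- The function `e^{ns}` on the integers `n ≥ 2`. -/
def expWeight (s : ℝ) (n : ℤ) : ℂ := if 2 ≤ n then Complex.exp (n * s) else 0

lemma norm_expWeight (s : ℝ) {n : ℤ} (h : 2 ≤ n) : ‖expWeight s n‖ = Real.exp (n * s) := by
  rw [expWeight, if_pos h, Complex.norm_exp]
  simp

lemma norm_expWeight_le {s : ℝ} (hs : s ≤ 0) (n : ℤ) : ‖expWeight s n‖ ≤ 16 * Real.exp (7 / 4 * s) := by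
  have h0 := Real.exp_pos (7 / 4 * s)
  by_cases h : 2 ≤ n
  · rw [norm_expWeight s h]
    have h1 : (2 : ℝ) ≤ n := by exact_mod_cast h
    have := Real.exp_le_exp.2 (show n * s ≤ 7 / 4 * s by nlinarith)
    linarith
  · rw [expWeight, if_neg h, norm_zero]
    positivity

/-- For n ≥ 2 the difference yields a factor |s|, and n |s| is paid for by the surplus decay e^{(n -
7/4)s}, as y e^{-y} ≤ 1 for y = (n - 7/4)|s|. The gap between 7/4 and the eigenvalue 2 fixes the
constant: 2 (n + 2) ≤ 32 (n - 7/4) is an equality at n = 2. -/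
lemma expWeight_diff {s : ℝ} (hs : s ≤ 0) (n : ℤ) :
    (|(n : ℝ)| + 2) * ‖expWeight s (n + 2) - expWeight s n‖ ≤ 2 * (16 * Real.exp (7 / 4 * s)) := by
  have h0 := Real.exp_pos (7 / 4 * s)
  rcases lt_or_ge n 0 with h | h
  · rw [expWeight, expWeight, if_neg (by omega), if_neg (by omega), sub_zero, norm_zero]
    linarith
  rcases lt_or_ge n 2 with h' | h'
  · have e : ‖expWeight s (n + 2) - expWeight s n‖ ≤ Real.exp (7 / 4 * s) := by
      rw [show expWeight s n = 0 from if_neg (by omega), sub_zero, norm_expWeight s (by omega)]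
      have h1 : (0 : ℝ) ≤ n := by exact_mod_cast h
      refine Real.exp_le_exp.2 ?_
      push_cast
      nlinarith
    have h3 : |(n : ℝ)| ≤ 1 := by
      rw [abs_of_nonneg (by exact_mod_cast h)]
      exact_mod_cast (by omega : n ≤ 1)
    have := norm_nonneg (expWeight s (n + 2) - expWeight s n)
    have := abs_nonneg (n : ℝ)
    nlinarith
  · have hn : (2 : ℝ) ≤ n := by exact_mod_cast h'
    rw [expWeight, expWeight, if_pos (by omega), if_pos h']
    have e : Complex.exp ((n + 2 : ℤ) * s) - Complex.exp (n * s) =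
        ((Real.exp (n * s) * (Real.exp (2 * s) - 1) : ℝ) : ℂ) := by
      push_cast
      rw [mul_sub, ← Complex.exp_add, mul_one]
      congr 2
      ring
    have h1 : 1 - Real.exp (2 * s) ≤ 2 * -s := by linarith [Real.add_one_le_exp (2 * s)]
    have h2 : Real.exp (2 * s) ≤ 1 := Real.exp_le_one_iff.2 (by linarith)
    rw [e, Complex.norm_real, Real.norm_eq_abs, abs_mul, abs_of_pos (Real.exp_pos _),
      abs_of_nonpos (sub_nonpos.2 h2), abs_of_nonneg (by linarith : (0 : ℝ) ≤ n)]
    have e3 : Real.exp (n * s) = Real.exp (7 / 4 * s) * Real.exp (-((n - 7 / 4) * -s)) := by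
      rw [← Real.exp_add]; congr 1; ring
    set y := ((n : ℝ) - 7 / 4) * -s with hy
    have h4 : y * Real.exp (-y) ≤ 1 := by
      have h5 := Real.add_one_le_exp y
      rw [Real.exp_neg, ← div_eq_mul_inv, div_le_one (Real.exp_pos _)]
      linarith
    have h6 : ((n : ℝ) + 2) * (1 - Real.exp (2 * s)) ≤ 32 * y := by nlinarith
    have h7 := Real.exp_pos (-y)
    rw [e3]
    calc ((n : ℝ) + 2) * (Real.exp (7 / 4 * s) * Real.exp (-y) * -(Real.exp (2 * s) - 1))
        = Real.exp (7 / 4 * s) * Real.exp (-y) * (((n : ℝ) + 2) * (1 - Real.exp (2 * s))) := by ring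
      _ ≤ Real.exp (7 / 4 * s) * Real.exp (-y) * (32 * y) := by gcongr
      _ = 32 * Real.exp (7 / 4 * s) * (y * Real.exp (-y)) := by ring
      _ ≤ 32 * Real.exp (7 / 4 * s) * 1 := by gcongr
      _ = _ := by ring

lemma Label.adm_expWeight {ν : ℤ → ℤ} (hν : Label ν) {s : ℝ} (hs : s ≤ 0) :
    Adm (fun n => expWeight s (ν n)) (16 * Real.exp (7 / 4 * s)) :=
  hν.adm (norm_expWeight_le hs) (expWeight_diff hs)

lemma tendsto_fn_expWeight {ν : ℤ → ℤ} (hν : Label ν) {s0 : ℝ} (hs0 : s0 ≤ 0) (v : V6) :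
    Tendsto (fun s => fn (fun n => expWeight s (ν n)) v) (𝓝[<] s0) (𝓝 (fn (fun n => expWeight s0 (ν n)) v)) := by
  have hm : ∀ s : ℝ, Adm (fun n => expWeight (min s 0) (ν n)) 16 := fun s => by
    have h := hν.adm_expWeight (min_le_right s 0)
    have h1 : Real.exp (7 / 4 * min s 0) ≤ 1 := Real.exp_le_one_iff.2 (by linarith [min_le_right s 0])
    exact ⟨fun n => (h.1 n).trans (by linarith), fun n => (h.2 n).trans (by linarith)⟩
  have h0 := hm s0
  rw [min_eq_left hs0] at h0
  have := tendsto_fn (l := 𝓝[<] s0) hm h0 (fun n => ?_) v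
  · refine this.congr' ?_
    filter_upwards [self_mem_nhdsWithin] with s hs
    rw [min_eq_left ((le_of_lt hs).trans hs0)]
  · have hc : Continuous fun s : ℝ => expWeight (min s 0) (ν n) := by
      unfold expWeight
      split_ifs
      · fun_prop
      · fun_prop
    have := hc.tendsto s0
    rw [min_eq_left hs0] at this
    exact this.mono_left nhdsWithin_le_nhds

end LandauSphere
end

noncomputable section
namespace LandauSphere

/-! ### The semigroups -/

/-- A perturbation of size `η` of the resolvent of `L₀`. -/
structure Spec (ν : ℤ → ℤ) (R : ℂ → V6 →L[ℂ] V6) (η : ℝ) : Prop where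
  label : Label ν
  isRes : IsRes R Reg
  close : ∀ z ∈ Reg, ‖R z - rsv0 ν z‖ ≤ η * rho z.im ^ (-(12 / 7) : ℝ)

/-- The weight of the contour integrals of resolvents. -/
def crvWeight (a s t : ℝ) : ℂ := Complex.exp (crv a t * s) * dcrv t

/-- The bound of the integrals of differences of resolvents. -/
def corrBound : ℝ := ∫ t, 3 * rho t ^ (-(11 / 7) : ℝ)

/-- The integral of the difference of the resolvents. -/
def corr (ν : ℤ → ℤ) (R : ℂ → V6 →L[ℂ] V6) (a s : ℝ) : V6 →L[ℂ] V6 :=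
  (2 * Real.pi * Complex.I : ℂ)⁻¹ • ∫ t, crvWeight a s t • (R (crv a t) - rsv0 ν (crv a t))

/-- The semigroup, for `s ≤ 0`. -/
def semi (ν : ℤ → ℤ) (R : ℂ → V6 →L[ℂ] V6) (a s : ℝ) : V6 →L[ℂ] V6 :=
  fn (fun n => expWeight s (ν n)) + corr ν R a s

lemma norm_two_pi_I_inv_le : ‖(2 * Real.pi * Complex.I : ℂ)⁻¹‖ ≤ 1 := by
  rw [norm_inv]
  refine inv_le_one_of_one_le₀ ?_
  simp only [norm_mul, Complex.norm_ofNat, Complex.norm_real, Complex.norm_I, mul_one]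
  rw [Real.norm_of_nonneg Real.pi_pos.le]
  linarith [Real.pi_gt_three]

lemma rho_crv_im (a t : ℝ) : rho (crv a t).im = rho t := by rw [crv_im, rho, rho, abs_neg]

lemma norm_crvWeight_le {a s : ℝ} (hs : s ≤ 0) (t : ℝ) :
    ‖crvWeight a s t‖ ≤ Real.exp (a * s) * (3 * rho t ^ (1 / 7 : ℝ)) := by
  rw [crvWeight, norm_mul, norm_exp_crv]
  have h1 : Real.exp (s * |t| ^ (8 / 7 : ℝ)) ≤ 1 := by
    refine Real.exp_le_one_iff.2 (mul_nonpos_of_nonpos_of_nonneg hs (by positivity))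
  have h2 := norm_dcrv_le t
  have h3 := Real.exp_pos (a * s)
  gcongr
  nlinarith [Real.exp_pos (s * |t| ^ (8 / 7 : ℝ))]

lemma continuous_crvWeight : Continuous fun x : ℝ × ℝ × ℝ => crvWeight x.1 x.2.1 x.2.2 := by
  have h1 : Continuous fun x : ℝ × ℝ × ℝ => crv x.1 x.2.2 := by
    have h2 := (continuous_abs_rpow (p := 8 / 7) (by norm_num)).comp (continuous_snd.comp (continuous_snd (X := ℝ) (Y := ℝ × ℝ)))
    simp only [Function.comp_def] at h2
    unfold crv
    fun_prop
  have h3 := continuous_dcrv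
  unfold crvWeight
  fun_prop

lemma continuous_crv_left (t : ℝ) : Continuous fun a => crv a t := by unfold crv; fun_prop

lemma integrable_corrBound : Integrable fun t => 3 * rho t ^ (-(11 / 7) : ℝ) :=
  (integrable_rho_rpow (by norm_num)).const_mul 3

lemma corrBound_nonneg : 0 ≤ corrBound := by
  refine integral_nonneg fun t => ?_
  have := rho_pos t
  positivity

namespace Spec

variable {ν : ℤ → ℤ} {R : ℂ → V6 →L[ℂ] V6} {η : ℝ}

lemma nonneg (S : Spec ν R η) : 0 ≤ η := by
  have h := (norm_nonneg _).trans (S.close _ (crv_mem_Reg le_rfl (by norm_num) 0))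
  have := rho_pos (crv (3 / 2) 0).im
  exact nonneg_of_mul_nonneg_left h (by positivity)

/-- The speed of the curve and the difference of the resolvents combine to the exponent 1/7 - 12/7 =
-11/7 < -1, so the bound is integrable, and uniformly so up to s = 0. -/
lemma norm_integrand_le (S : Spec ν R η) {a s : ℝ} (ha : 3 / 2 ≤ a) (hb : a ≤ 7 / 4) (hs : s ≤ 0) (t : ℝ) :
    ‖crvWeight a s t • (R (crv a t) - rsv0 ν (crv a t))‖ ≤
      Real.exp (a * s) * (η * (3 * rho t ^ (-(11 / 7) : ℝ))) := by
  have h1 := S.close _ (crv_mem_Reg ha hb t)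
  rw [rho_crv_im] at h1
  have h2 := norm_crvWeight_le (a := a) hs t
  have hr := rho_pos t
  have e : rho t ^ (-(11 / 7) : ℝ) = rho t ^ (1 / 7 : ℝ) * rho t ^ (-(12 / 7) : ℝ) := by
    rw [← Real.rpow_add hr]; norm_num
  rw [norm_smul, e]
  calc _ ≤ Real.exp (a * s) * (3 * rho t ^ (1 / 7 : ℝ)) * (η * rho t ^ (-(12 / 7) : ℝ)) := by gcongr
    _ = _ := by ring

lemma continuous_res (S : Spec ν R η) {a : ℝ} (ha : 3 / 2 ≤ a) (hb : a ≤ 7 / 4) :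
    Continuous fun t => R (crv a t) - rsv0 ν (crv a t) :=
  (S.isRes.continuousOn.comp_continuous (continuous_crv a) fun t => crv_mem_Reg ha hb t).sub
    (S.label.isRes.continuousOn.comp_continuous (continuous_crv a) fun t => crv_mem_Reg ha hb t)

lemma continuous_integrand (S : Spec ν R η) {a : ℝ} (ha : 3 / 2 ≤ a) (hb : a ≤ 7 / 4) (s : ℝ) :
    Continuous fun t => crvWeight a s t • (R (crv a t) - rsv0 ν (crv a t)) := by
  have h1 := S.continuous_res ha hb
  have h2 : Continuous fun t => crvWeight a s t := continuous_crvWeight.comp (by fun_prop : Continuous fun t => (a, s, t))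
  fun_prop

lemma integrable_integrand (S : Spec ν R η) {a s : ℝ} (ha : 3 / 2 ≤ a) (hb : a ≤ 7 / 4) (hs : s ≤ 0) :
    Integrable fun t => crvWeight a s t • (R (crv a t) - rsv0 ν (crv a t)) :=
  ((integrable_corrBound.const_mul η).const_mul (Real.exp (a * s))).mono'
    (S.continuous_integrand ha hb s).aestronglyMeasurable
    (Eventually.of_forall (S.norm_integrand_le ha hb hs))

lemma norm_corr_le (S : Spec ν R η) {a s : ℝ} (ha : 3 / 2 ≤ a) (hb : a ≤ 7 / 4) (hs : s ≤ 0) :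
    ‖corr ν R a s‖ ≤ η * corrBound * Real.exp (a * s) := by
  rw [corr, norm_smul]
  have h1 := norm_integral_le_of_norm_le ((integrable_corrBound.const_mul η).const_mul (Real.exp (a * s)))
    (Eventually.of_forall (S.norm_integrand_le ha hb hs))
  rw [integral_const_mul, integral_const_mul] at h1
  have h2 := norm_two_pi_I_inv_le
  change _ ≤ Real.exp (a * s) * (η * corrBound) at h1
  have h3 := norm_nonneg (∫ t, crvWeight a s t • (R (crv a t) - rsv0 ν (crv a t)))
  nlinarith

lemma norm_semi_le (S : Spec ν R η) {a s : ℝ} (ha : 3 / 2 ≤ a) (hb : a ≤ 7 / 4) (hs : s ≤ 0) :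
    ‖semi ν R a s‖ ≤ (96 + η * corrBound) * Real.exp (a * s) := by
  have h1 := norm_fn_le (S.label.adm_expWeight hs)
  have h2 := S.norm_corr_le ha hb hs
  have h3 := norm_add_le (fn fun n => expWeight s (ν n)) (corr ν R a s)
  have h4 := Real.exp_le_exp.2 (show 7 / 4 * s ≤ a * s by nlinarith)
  rw [semi]
  linarith

/-- The semigroup as a contour integral. -/
lemma semi_eq (S : Spec ν R η) {a s : ℝ} (ha : 3 / 2 ≤ a) (hb : a ≤ 7 / 4) (hs : s < 0) :
    semi ν R a s = (2 * Real.pi * Complex.I : ℂ)⁻¹ • (Path.plus a hs).int R := by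
  have hp := fun t => crv_mem_Reg ha hb t
  have hpi := Complex.two_pi_I_ne_zero
  have h1 : (Path.plus a hs).int (rsv0 ν) = (2 * Real.pi * Complex.I : ℂ) • fn fun n => expWeight s (ν n) := by
    have hA := S.label.adm_expWeight hs.le
    have hA' : Adm (fun n => 2 * Real.pi * Complex.I * expWeight s (ν n))
        (‖(2 * Real.pi * Complex.I : ℂ)‖ * (16 * Real.exp (7 / 4 * s))) := by
      refine ⟨fun n => ?_, fun n => ?_⟩
      · rw [norm_mul]; gcongr; exact hA.1 n
      · rw [← mul_sub, norm_mul]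
        have := hA.2 n
        have := norm_nonneg (2 * Real.pi * Complex.I : ℂ)
        nlinarith
    rw [S.label.int_rsv0 (p := Path.plus a hs) hp hA' fun n => ?_]
    · have := fn_lin adm_zero hA hA' (2 * Real.pi * Complex.I) fun n => zero_add _
      rw [fn_zero, zero_add] at this
      exact this.symm
    -- The integers n ≥ 2 lie inside the curve and those with n ≤ 1 outside, for every a between 3/2
    -- and 7/4.
    · rw [expWeight]
      split_ifs with h
      · have h2 : (2 : ℝ) ≤ ν n := by exact_mod_cast h
        have hd : ∀ t, 1 / 9 ≤ rho t * ‖crv a t - (ν n : ℂ)‖ := fun t => by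
          have h3 := (crv_mem_Reg ha hb t).1 (ν n)
          rw [rho_crv_im] at h3
          have := one_le_rho t
          nlinarith
        refine (crv_integral hs (by norm_num) hd (trunc_inside ?_)).2
        simp only [Complex.intCast_im, Complex.intCast_re, abs_zero]
        rw [Real.zero_rpow (by norm_num)]
        linarith
      · have h2 : ((ν n : ℤ) : ℝ) ≤ 1 := by exact_mod_cast (by omega : ν n ≤ 1)
        rw [mul_zero]
        refine Path.plus_cauchy_of_lt hs ?_
        rw [Complex.intCast_re]
        linarith
  have h2 := integral_sub (Path.integrable_res (p := Path.plus a hs) S.isRes hp)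
    (Path.integrable_res (p := Path.plus a hs) S.label.isRes hp)
  have h3 : corr ν R a s = (2 * Real.pi * Complex.I : ℂ)⁻¹ •
      ((Path.plus a hs).int R - (Path.plus a hs).int (rsv0 ν)) := by
    rw [corr]
    congr 1
    exact (integral_congr_ae (Eventually.of_forall fun t => smul_sub _ _ _)).trans h2
  rw [semi, h3, h1, smul_sub, smul_smul, inv_mul_cancel₀ hpi, one_smul, add_sub_cancel]

lemma semi_mul (S : Spec ν R η) {a b s s' : ℝ} (hs : s < 0) (hs' : s' < 0) (ha : 3 / 2 ≤ a) (hab : a < b)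
    (hb : b ≤ 7 / 4) : semi ν R a s * semi ν R b s' = semi ν R b (s + s') ∧
      semi ν R b s' * semi ν R a s = semi ν R b (s + s') := by
  have hpi := Complex.two_pi_I_ne_zero
  rw [S.semi_eq ha (hab.le.trans hb) hs, S.semi_eq (ha.trans hab.le) hb hs',
    S.semi_eq (ha.trans hab.le) hb (add_neg hs hs'), smul_mul_smul_comm, smul_mul_smul_comm]
  obtain ⟨h1, h2⟩ := Path.plus_mul_plus S.isRes hs hs' ha hab hb
  rw [h1, h2, smul_smul, mul_assoc, inv_mul_cancel₀ hpi, mul_one]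
  exact ⟨rfl, rfl⟩

/-- The correction converges in norm by dominated convergence, but the explicit function of L₀ only
strongly; hence the fixed vector v. -/
lemma tendsto_semi (S : Spec ν R η) {a s0 : ℝ} (ha : 3 / 2 ≤ a) (hb : a ≤ 7 / 4) (hs0 : s0 ≤ 0) (v : V6) :
    Tendsto (fun s => semi ν R a s v) (𝓝[<] s0) (𝓝 (semi ν R a s0 v)) := by
  have h1 : Tendsto (fun s => corr ν R a s) (𝓝[<] s0) (𝓝 (corr ν R a s0)) := by
    refine Tendsto.const_smul ?_ _
    refine tendsto_integral_filter_of_dominated_convergence (fun t => 1 * (η * (3 * rho t ^ (-(11 / 7) : ℝ))))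
      (Eventually.of_forall fun s => (S.continuous_integrand ha hb s).aestronglyMeasurable) ?_
      ((integrable_corrBound.const_mul η).const_mul 1) (Eventually.of_forall fun t => ?_)
    · filter_upwards [self_mem_nhdsWithin] with s hs
      have hs' : s ≤ 0 := (le_of_lt hs).trans hs0
      refine Eventually.of_forall fun t => (S.norm_integrand_le ha hb hs' t).trans ?_
      have := S.nonneg
      have := rho_pos t
      gcongr
      exact Real.exp_le_one_iff.2 (mul_nonpos_of_nonneg_of_nonpos (by linarith) hs')
    · refine Tendsto.smul_const ?_ _
      have hc : Continuous fun s => crvWeight a s t :=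
        continuous_crvWeight.comp (by fun_prop : Continuous fun s : ℝ => (a, s, t))
      exact (hc.tendsto s0).mono_left nhdsWithin_le_nhds
  have h2 := tendsto_fn_expWeight S.label hs0 v
  exact h2.add (((ContinuousLinearMap.apply ℂ V6 v).continuous.tendsto _).comp h1)

/-- The explicit function of L₀ does not depend on the contour, so only the correction varies with
a, and convergence is in norm. -/
lemma tendsto_semi_left (S : Spec ν R η) {a s : ℝ} (ha : 3 / 2 ≤ a) (hb : a < 7 / 4) (hs : s ≤ 0) :
    Tendsto (fun b => semi ν R b s) (𝓝[>] a) (𝓝 (semi ν R a s)) := by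
  refine Tendsto.const_add _ (Tendsto.const_smul ?_ _)
  have hev : ∀ᶠ b in 𝓝[>] a, b ∈ Set.Ioo a (7 / 4) := Ioo_mem_nhdsGT hb
  refine tendsto_integral_filter_of_dominated_convergence (fun t => 1 * (η * (3 * rho t ^ (-(11 / 7) : ℝ))))
    ?_ ?_ ((integrable_corrBound.const_mul η).const_mul 1) (Eventually.of_forall fun t => ?_)
  · filter_upwards [hev] with b hb'
    exact (S.continuous_integrand (ha.trans hb'.1.le) hb'.2.le s).aestronglyMeasurable
  · filter_upwards [hev] with b hb'
    refine Eventually.of_forall fun t => (S.norm_integrand_le (ha.trans hb'.1.le) hb'.2.le hs t).trans ?_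
    have := S.nonneg
    have := rho_pos t
    gcongr
    exact Real.exp_le_one_iff.2 (mul_nonpos_of_nonneg_of_nonpos (by linarith [hb'.1]) hs)
  · have hc : Continuous fun b => crvWeight b s t :=
      continuous_crvWeight.comp (by fun_prop : Continuous fun b : ℝ => (b, s, t))
    refine ((hc.tendsto a).mono_left nhdsWithin_le_nhds).smul ?_
    have hcr : Tendsto (fun b => crv b t) (𝓝[>] a) (𝓝[Reg] (crv a t)) := by
      refine tendsto_nhdsWithin_iff.2 ⟨((continuous_crv_left t).tendsto a).mono_left nhdsWithin_le_nhds, ?_⟩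
      filter_upwards [hev] with b hb'
      exact crv_mem_Reg (ha.trans hb'.1.le) hb'.2.le t
    have hm := crv_mem_Reg ha hb.le t
    exact ((S.isRes.continuousOn _ hm).tendsto.comp hcr).sub
      ((S.label.isRes.continuousOn _ hm).tendsto.comp hcr)

lemma tendsto_add_left (s : ℝ) : Tendsto (fun x : ℝ => x + s) (𝓝[<] 0) (𝓝[<] s) := by
  refine tendsto_nhdsWithin_iff.2 ⟨?_, ?_⟩
  · have : Tendsto (fun x : ℝ => x + s) (𝓝 0) (𝓝 (0 + s)) := Continuous.tendsto (by fun_prop) 0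
    rw [zero_add] at this
    exact this.mono_left nhdsWithin_le_nhds
  · filter_upwards [self_mem_nhdsWithin] with x hx
    have : x < 0 := hx
    exact show x + s < s by linarith

/-- At s = 0 there is no absolutely convergent contour integral; the relations are strong limits of
`semi_mul`. -/
lemma semi_mul_zero (S : Spec ν R η) {a b s : ℝ} (hs : s < 0) (ha : 3 / 2 ≤ a) (hab : a < b)
    (hb : b ≤ 7 / 4) : semi ν R a s * semi ν R b 0 = semi ν R b s ∧
      semi ν R a 0 * semi ν R b s = semi ν R b s ∧ semi ν R b s * semi ν R a 0 = semi ν R b s := by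
  have ha' := hab.le.trans hb
  have hb' := ha.trans hab.le
  have hev : ∀ᶠ x : ℝ in 𝓝[<] 0, x < 0 := self_mem_nhdsWithin
  have lim : ∀ v, Tendsto (fun x => semi ν R b (x + s) v) (𝓝[<] 0) (𝓝 (semi ν R b s v)) := fun v =>
    (S.tendsto_semi hb' hb hs.le v).comp (tendsto_add_left s)
  refine ⟨?_, ?_, ?_⟩ <;> ext1 v
  · refine tendsto_nhds_unique (((semi ν R a s).continuous.tendsto _).comp (S.tendsto_semi hb' hb le_rfl v))
      ((lim v).congr' ?_)
    filter_upwards [hev] with x hx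
    rw [add_comm, ← (S.semi_mul hs hx ha hab hb).1]
    rfl
  · refine tendsto_nhds_unique (S.tendsto_semi ha ha' le_rfl (semi ν R b s v)) ((lim v).congr' ?_)
    filter_upwards [hev] with x hx
    rw [← (S.semi_mul hx hs ha hab hb).1]
    rfl
  · refine tendsto_nhds_unique (((semi ν R b s).continuous.tendsto _).comp (S.tendsto_semi ha ha' le_rfl v))
      ((lim v).congr' ?_)
    filter_upwards [hev] with x hx
    rw [← (S.semi_mul hx hs ha hab hb).2]
    rfl

lemma semi_zero_mul_zero (S : Spec ν R η) {a b : ℝ} (ha : 3 / 2 ≤ a) (hab : a < b) (hb : b ≤ 7 / 4) :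
    semi ν R a 0 * semi ν R b 0 = semi ν R b 0 ∧ semi ν R b 0 * semi ν R a 0 = semi ν R b 0 := by
  have ha' := hab.le.trans hb
  have hb' := ha.trans hab.le
  have hev : ∀ᶠ x : ℝ in 𝓝[<] 0, x < 0 := self_mem_nhdsWithin
  refine ⟨?_, ?_⟩ <;> ext1 v
  · refine tendsto_nhds_unique (((semi ν R a 0).continuous.tendsto _).comp (S.tendsto_semi hb' hb le_rfl v))
      ((S.tendsto_semi hb' hb le_rfl v).congr' ?_)
    filter_upwards [hev] with x hx
    conv_lhs => rw [← (S.semi_mul_zero hx ha hab hb).2.1]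
    rfl
  · refine tendsto_nhds_unique (S.tendsto_semi hb' hb le_rfl (semi ν R a 0 v))
      ((S.tendsto_semi hb' hb le_rfl v).congr' ?_)
    filter_upwards [hev] with x hx
    conv_lhs => rw [← (S.semi_mul_zero hx ha hab hb).2.2]
    rfl

/-- The projection is an idempotent, and the semigroup decays as fast as on the larger contours. -/
lemma idempotent_and_bound (S : Spec ν R η) (hη : η * corrBound ≤ 1 / 4) :
    semi ν R (3 / 2) 0 * semi ν R (3 / 2) 0 = semi ν R (3 / 2) 0 ∧
      ∀ s ≤ 0, ‖semi ν R (3 / 2) s‖ ≤ 97 * Real.exp (7 / 4 * s) := by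
  have hnest : ∀ a, 3 / 2 ≤ a → a < 7 / 4 → semi ν R a 0 * semi ν R a 0 = semi ν R a 0 ∧
      ∀ x, a ≤ x → x ≤ 7 / 4 → semi ν R x 0 * semi ν R x 0 = semi ν R x 0 →
        semi ν R x 0 = semi ν R a 0 := fun a ha ha' => by
    refine eq_of_nested (P := fun a => semi ν R a 0) ha' (fun x y hx hxy hy => ?_)
      (fun x y hx hx' hy hy' => ?_) (S.tendsto_semi_left ha ha' le_rfl)
    · exact S.semi_zero_mul_zero (ha.trans hx) hxy hy
    -- Only the corrections depend on the contour, and each has norm at most 1/4.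
    · have h1 := S.norm_corr_le (ha.trans hx) hx' le_rfl
      have h2 := S.norm_corr_le (ha.trans hy) hy' le_rfl
      rw [mul_zero, Real.exp_zero, mul_one] at h1 h2
      simp only [semi, add_sub_add_left_eq_sub]
      exact (norm_sub_le _ _).trans (by linarith)
  have h32 := hnest (3 / 2) le_rfl (by norm_num)
  refine ⟨h32.1, fun s hs => ?_⟩
  rcases eq_or_lt_of_le hs with rfl | hs'
  · refine (S.norm_semi_le le_rfl (by norm_num) le_rfl).trans ?_
    simp only [mul_zero, Real.exp_zero, mul_one]
    linarith
  -- All contours have the same projection, so composing with it moves the semigroup from 3/2 to b.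
  -- Letting b tend to 3/2 shows that the composition changes nothing; letting b tend to 7/4 gives
  -- the rate.
  have e1 : ∀ b, 3 / 2 < b → b < 7 / 4 → semi ν R (3 / 2) s * semi ν R (3 / 2) 0 = semi ν R b s :=
    fun b hb hb' => by
      rw [← h32.2 b hb.le hb'.le (hnest b hb.le hb').1]
      exact (S.semi_mul_zero hs' le_rfl hb hb'.le).1
  have e2 : semi ν R (3 / 2) s * semi ν R (3 / 2) 0 = semi ν R (3 / 2) s := by
    refine tendsto_nhds_unique (f := fun b => semi ν R b s) (l := 𝓝[>] (3 / 2 : ℝ)) ?_ (S.tendsto_semi_left le_rfl (by norm_num) hs)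
    refine tendsto_const_nhds.congr' ?_
    filter_upwards [Ioo_mem_nhdsGT (show (3 / 2 : ℝ) < 7 / 4 by norm_num)] with b hb
    exact e1 b hb.1 hb.2
  have e3 : ∀ b, 3 / 2 < b → b < 7 / 4 → ‖semi ν R (3 / 2) s‖ ≤ 97 * Real.exp (b * s) := fun b hb hb' => by
    rw [← e2, e1 b hb hb']
    refine (S.norm_semi_le hb.le hb'.le hs).trans ?_
    have := Real.exp_pos (b * s)
    gcongr
    linarith
  have hc : Continuous fun b : ℝ => 97 * Real.exp (b * s) := by fun_prop
  refine ge_of_tendsto ((hc.tendsto (7 / 4)).mono_left (nhdsWithin_le_nhds (s := Set.Iio (7 / 4)))) ?_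
  filter_upwards [Ioo_mem_nhdsLT (show (3 / 2 : ℝ) < 7 / 4 by norm_num)] with b hb
  exact e3 b hb.1 hb.2

end Spec

end LandauSphere
end

noncomputable section
namespace LandauSphere

/-! ### The improper contour integrals -/

lemma Adm.mul {g h : ℤ → ℂ} {B B' : ℝ} (hg : Adm g B) (hh : Adm h B') :
    Adm (fun n => g n * h n) (2 * (B * B')) := by
  have h0 := hg.nonneg
  have h0' := hh.nonneg
  refine ⟨fun n => ?_, fun n => ?_⟩
  · rw [norm_mul]
    have := mul_le_mul (hg.1 n) (hh.1 n) (norm_nonneg _) h0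
    nlinarith
  · have e : g (n + 2) * h (n + 2) - g n * h n = g (n + 2) * (h (n + 2) - h n) + h n * (g (n + 2) - g n) := by
      ring
    have h1 := norm_add_le (g (n + 2) * (h (n + 2) - h n)) (h n * (g (n + 2) - g n))
    rw [← e, norm_mul, norm_mul] at h1
    have h2 := mul_le_mul (hg.1 (n + 2)) (hh.2 n) (by positivity) h0
    have h3 := mul_le_mul (hh.1 n) (hg.2 n) (by positivity) h0'
    have h4 := mul_le_mul_of_nonneg_left h1 (norm_nonneg ((n : ℂ) + 2))
    linarith

lemma Adm.const_mul {g : ℤ → ℂ} {B : ℝ} (hg : Adm g B) (c : ℂ) : Adm (fun n => c * g n) (‖c‖ * B) := by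
  refine ⟨fun n => ?_, fun n => ?_⟩
  · rw [norm_mul]; gcongr; exact hg.1 n
  · rw [← mul_sub, norm_mul]
    have := mul_le_mul_of_nonneg_left (hg.2 n) (norm_nonneg c)
    linarith

lemma fn_smul {g : ℤ → ℂ} {B : ℝ} (hg : Adm g B) (c : ℂ) : fn (fun n => c * g n) = c • fn g := by
  have := fn_lin adm_zero hg (hg.const_mul c) c fun n => zero_add _
  rw [fn_zero, zero_add] at this
  exact this.symm

lemma half_mem_Reg : (1 / 2 : ℂ) ∈ Reg := by
  have := circle_mem_Reg (c := 0) (.inl rfl) (z := 1 / 2) (by norm_num) (by norm_num)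
  exact this

lemma rho_le_norm_crv_sub_half (t : ℝ) : rho t ≤ 2 * ‖crv (3 / 2) t - 1 / 2‖ := by
  have h1 := Complex.abs_re_le_norm (crv (3 / 2) t - 1 / 2)
  have h2 := Complex.abs_im_le_norm (crv (3 / 2) t - 1 / 2)
  have h3 : (crv (3 / 2) t - 1 / 2).im = -t := by simp
  have h4 : (crv (3 / 2) t - 1 / 2).re = (crv (3 / 2) t).re - 1 / 2 := by simp
  rw [h3, abs_neg] at h2
  rw [h4] at h1
  have := le_abs_self ((crv (3 / 2) t).re - 1 / 2)
  have := Path.le_re_crv (3 / 2) t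
  unfold rho
  linarith

lemma tendsto_integral_Icc {E : Type*} [NormedAddCommGroup E] [NormedSpace ℝ E] {F : ℝ → E}
    (h : Integrable F) : Tendsto (fun r : ℝ => ∫ t in Set.Icc (-r) r, F t) atTop (𝓝 (∫ t, F t)) :=
  (aecover_Icc tendsto_neg_atTop_atBot tendsto_id).integral_tendsto_of_countably_generated h

lemma trunc_eq_integral_Icc {a : ℝ} {z : ℂ} {r : ℝ} (hr : 0 ≤ r) :
    trunc a z r = ∫ t in Set.Icc (-r) r, dcrv t / (crv a t - z) := by
  rw [trunc, intervalIntegral.integral_of_le (by linarith), integral_Icc_eq_integral_Ioc]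

lemma crvWeight_zero (a t : ℝ) : crvWeight a 0 t = dcrv t := by simp [crvWeight]

lemma trunc_half_tendsto : Tendsto (trunc (3 / 2) (1 / 2)) atTop (𝓝 0) := by
  refine trunc_outside ?_
  simp only [Complex.div_ofNat_re, Complex.one_re, Complex.div_ofNat_im, Complex.one_im, zero_div, abs_zero]
  rw [Real.zero_rpow (by norm_num)]
  norm_num

/-- The weight of the regularized contour integral. -/
def regWeight (t : ℝ) : ℂ := dcrv t / (1 / 2 - crv (3 / 2) t)

lemma half_sub_crv_ne (t : ℝ) : 1 / 2 - crv (3 / 2) t ≠ 0 := fun h => by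
  have h1 := rho_le_norm_crv_sub_half t
  rw [← norm_neg, neg_sub, h, norm_zero] at h1
  linarith [rho_pos t]

lemma continuous_regWeight : Continuous regWeight :=
  continuous_dcrv.div (by have := continuous_crv (3 / 2); fun_prop) half_sub_crv_ne

lemma norm_regWeight_le (t : ℝ) : ‖regWeight t‖ ≤ 6 * rho t ^ (-(6 / 7) : ℝ) := by
  have h1 := rho_le_norm_crv_sub_half t
  have h2 := norm_dcrv_le t
  have hr := rho_pos t
  have e : rho t ^ (-(6 / 7) : ℝ) * rho t = rho t ^ (1 / 7 : ℝ) := by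
    rw [← Real.rpow_add_one hr.ne']; norm_num
  rw [regWeight, norm_div, norm_sub_rev, div_le_iff₀ (by linarith)]
  calc ‖dcrv t‖ ≤ 3 * (rho t ^ (-(6 / 7) : ℝ) * rho t) := by rw [e]; exact h2
    _ ≤ 3 * (rho t ^ (-(6 / 7) : ℝ) * (2 * ‖crv (3 / 2) t - 1 / 2‖)) := by gcongr
    _ = _ := by ring

lemma integrable_regWeight_smul {E : Type*} [NormedAddCommGroup E] [NormedSpace ℂ E] {F : ℝ → E}
    (hF : Continuous F) {M : ℝ} (hM : ∀ t, ‖F t‖ ≤ M * rho t ^ (-(6 / 7) : ℝ)) :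
    Integrable fun t => regWeight t • F t := by
  have h1 := continuous_regWeight
  refine ((integrable_rho_rpow (q := -(12 / 7)) (by norm_num)).const_mul (6 * M)).mono'
    (Continuous.aestronglyMeasurable (by fun_prop)) (Eventually.of_forall fun t => ?_)
  have e : rho t ^ (-(12 / 7) : ℝ) = rho t ^ (-(6 / 7) : ℝ) * rho t ^ (-(6 / 7) : ℝ) := by
    rw [← Real.rpow_add (rho_pos _)]; norm_num
  rw [norm_smul, e]
  calc _ ≤ 6 * rho t ^ (-(6 / 7) : ℝ) * (M * rho t ^ (-(6 / 7) : ℝ)) :=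
        mul_le_mul (norm_regWeight_le t) (hM t) (norm_nonneg _) (by have := rho_pos t; positivity)
    _ = _ := by ring

lemma crv_mem (t : ℝ) : crv (3 / 2) t ∈ Reg := crv_mem_Reg le_rfl (by norm_num) t

lemma continuous_inv_crv_sub (m : ℤ) : Continuous fun t => (crv (3 / 2) t - m)⁻¹ :=
  Continuous.inv₀ (by have := continuous_crv (3 / 2); fun_prop) fun t => Reg.ne (crv_mem t) m

lemma integrable_regWeight_mul (m : ℤ) : Integrable fun t => regWeight t * (crv (3 / 2) t - m)⁻¹ := by
  refine integrable_regWeight_smul (continuous_inv_crv_sub m) (M := 738) fun t => ?_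
  have h := (adm_res0 (crv_mem t)).1 m
  rwa [rho_crv_im] at h

lemma partial_fractions {x m h d : ℂ} (h1 : x - m ≠ 0) (h2 : x - h ≠ 0) (h3 : h - m ≠ 0) :
    (d / (x - m) - d / (x - h)) * (h - m)⁻¹ = d / (h - x) * (x - m)⁻¹ := by
  have h4 : h - x ≠ 0 := fun e => h2 (by rw [← neg_sub, e, neg_zero])
  field_simp
  ring

/-- By partial fractions, the integral is a difference of truncated Cauchy integrals at m and at
1/2, and the latter tend to zero because 1/2 lies outside the curve. -/
lemma integral_regWeight_mul (m : ℤ) : ∫ t, regWeight t * (crv (3 / 2) t - m)⁻¹ =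
    2 * Real.pi * Complex.I * (expWeight 0 m * (1 / 2 - m : ℂ)⁻¹) := by
  have hm : (1 / 2 - m : ℂ) ≠ 0 := Reg.ne half_mem_Reg m
  have h1 := tendsto_integral_Icc (integrable_regWeight_mul m)
  have h2 : Tendsto (trunc (3 / 2) m) atTop (𝓝 (2 * Real.pi * Complex.I * expWeight 0 m)) := by
    rw [expWeight]
    split_ifs with h
    · have h2 : (2 : ℝ) ≤ m := by exact_mod_cast h
      simp only [Complex.ofReal_zero, mul_zero, Complex.exp_zero, mul_one]
      refine trunc_inside ?_
      simp only [Complex.intCast_im, Complex.intCast_re, abs_zero]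
      rw [Real.zero_rpow (by norm_num)]
      linarith
    · have h2 : (m : ℝ) ≤ 1 := by exact_mod_cast (by omega : m ≤ 1)
      rw [mul_zero]
      refine trunc_outside ?_
      simp only [Complex.intCast_im, Complex.intCast_re, abs_zero]
      rw [Real.zero_rpow (by norm_num)]
      linarith
  have h3 := (h2.sub trunc_half_tendsto).mul_const (1 / 2 - m : ℂ)⁻¹
  rw [sub_zero, mul_assoc] at h3
  refine tendsto_nhds_unique h1 (h3.congr' ?_)
  filter_upwards [eventually_ge_atTop 0] with r hr
  have hc := continuous_dcrv
  have hg := continuous_crv (3 / 2)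
  have hn : ∀ t, crv (3 / 2) t - 1 / 2 ≠ 0 := fun t h => half_sub_crv_ne t (by rw [← neg_sub, h, neg_zero])
  have i1 : IntegrableOn (fun t => dcrv t / (crv (3 / 2) t - m)) (Set.Icc (-r) r) :=
    (Continuous.div (by fun_prop) (by fun_prop) fun t => Reg.ne (crv_mem t) m).continuousOn.integrableOn_compact isCompact_Icc
  have i2 : IntegrableOn (fun t => dcrv t / (crv (3 / 2) t - 1 / 2)) (Set.Icc (-r) r) :=
    (Continuous.div (by fun_prop) (by fun_prop) hn).continuousOn.integrableOn_compact isCompact_Icc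
  rw [trunc_eq_integral_Icc hr, trunc_eq_integral_Icc hr, ← integral_sub i1 i2, ← integral_mul_const]
  refine integral_congr_ae (Eventually.of_forall fun t => ?_)
  have a1 := Reg.ne (crv_mem t) m
  have a2 := hn t
  exact partial_fractions a1 a2 hm

namespace Spec

variable {ν : ℤ → ℤ} {R : ℂ → V6 →L[ℂ] V6} {η : ℝ}

lemma integrable_reg (S : Spec ν R η) : Integrable fun t => regWeight t • rsv0 ν (crv (3 / 2) t) := by
  refine integrable_regWeight_smul (S.label.isRes.continuousOn.comp_continuous (continuous_crv _) crv_mem)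
    (M := 4428) fun t => ?_
  have := S.label.norm_rsv0_le (crv_mem t)
  rwa [rho_crv_im] at this

lemma integral_reg (S : Spec ν R η) : ∫ t, regWeight t • rsv0 ν (crv (3 / 2) t) =
    (2 * Real.pi * Complex.I : ℂ) • (fn (fun n => expWeight 0 (ν n)) * rsv0 ν (1 / 2)) := by
  have hA := S.label.adm_expWeight (s := 0) le_rfl
  have hB := S.label.adm_rsv0 half_mem_Reg
  have hAB := hA.mul hB
  have h1 := S.integrable_reg
  simp only [rsv0] at h1 ⊢
  rw [fn_mul hA hB hAB fun n => rfl, ← fn_smul hAB]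
  exact integral_fn (fun t => S.label.adm_rsv0 (crv_mem t)) (hAB.const_mul _) h1
    (fun n => integrable_regWeight_mul (ν n)) fun n => integral_regWeight_mul (ν n)

/-- On the domain of `L₀`, the projection is an improper contour integral. -/
lemma tendsto_improper (S : Spec ν R η) (f : V6) :
    Tendsto (fun r : ℝ => (2 * Real.pi * Complex.I : ℂ)⁻¹ • ∫ t in Set.Icc (-r) r,
      crvWeight (3 / 2) 0 t • R (crv (3 / 2) t) (rsv0 ν (1 / 2) f)) atTop
      (𝓝 (semi ν R (3 / 2) 0 (rsv0 ν (1 / 2) f))) := by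
  set u := rsv0 ν (1 / 2) f with hu
  have hpi := Complex.two_pi_I_ne_zero
  have hc1 := S.continuous_integrand (a := 3 / 2) le_rfl (by norm_num) 0
  have hi1 := S.integrable_integrand (a := 3 / 2) (s := 0) le_rfl (by norm_num) le_rfl
  have hi2 := S.integrable_reg
  have ap : ∀ v : V6, ∀ {F : ℝ → V6 →L[ℂ] V6}, Integrable F → Integrable (fun t => F t v) ∧
      ∫ t, F t v = (∫ t, F t) v := fun v F h =>
    ⟨(ContinuousLinearMap.apply ℂ V6 v).integrable_comp h,
      (ContinuousLinearMap.apply ℂ V6 v).integral_comp_comm h⟩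
  have l1 := tendsto_integral_Icc (ap u hi1).1
  have l2 := tendsto_integral_Icc (ap f hi2).1
  have l3 := trunc_half_tendsto.smul_const u
  -- For u = R₀(1/2) f the resolvent identity reads R₀(z) u = (R₀(z) f - u) / (1/2 - z). The part
  -- with f is absolutely integrable, the part with u is a scalar truncated Cauchy integral that
  -- tends to zero, and R - R₀ is absolutely integrable anyway.
  have key : ∀ t, crvWeight (3 / 2) 0 t • R (crv (3 / 2) t) u =
      (crvWeight (3 / 2) 0 t • (R (crv (3 / 2) t) - rsv0 ν (crv (3 / 2) t))) u +
      (regWeight t • rsv0 ν (crv (3 / 2) t)) f + (dcrv t / (crv (3 / 2) t - 1 / 2)) • u := fun t => by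
    have h1 := S.label.isRes.sub_eq _ (crv_mem t) _ half_mem_Reg
    have h2 : rsv0 ν (crv (3 / 2) t) f - u = (1 / 2 - crv (3 / 2) t) • rsv0 ν (crv (3 / 2) t) u := by
      have := congrArg (fun T : V6 →L[ℂ] V6 => T f) h1
      exact this
    have h3 : crvWeight (3 / 2) 0 t • rsv0 ν (crv (3 / 2) t) u =
        regWeight t • (rsv0 ν (crv (3 / 2) t) f - u) := by
      rw [h2, smul_smul, regWeight, div_mul_cancel₀ _ (half_sub_crv_ne t), crvWeight_zero]
    have h4 : dcrv t / (crv (3 / 2) t - 1 / 2) = -regWeight t := by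
      rw [regWeight, ← div_neg, neg_sub]
    have h5 : (crvWeight (3 / 2) 0 t • (R (crv (3 / 2) t) - rsv0 ν (crv (3 / 2) t))) u =
        crvWeight (3 / 2) 0 t • R (crv (3 / 2) t) u - crvWeight (3 / 2) 0 t • rsv0 ν (crv (3 / 2) t) u := by
      rw [← smul_sub]; rfl
    rw [h5, h3, h4, smul_apply]
    module
  have hl := ((l1.add l2).add l3).const_smul (2 * Real.pi * Complex.I : ℂ)⁻¹
  have hval : (2 * Real.pi * Complex.I : ℂ)⁻¹ •
      ((∫ t, (crvWeight (3 / 2) 0 t • (R (crv (3 / 2) t) - rsv0 ν (crv (3 / 2) t))) u) +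
        (∫ t, (regWeight t • rsv0 ν (crv (3 / 2) t)) f) + (0 : ℂ) • u) = semi ν R (3 / 2) 0 u := by
    rw [(ap u hi1).2, (ap f hi2).2, S.integral_reg, zero_smul, add_zero, smul_add, smul_apply, smul_smul,
      inv_mul_cancel₀ hpi, one_smul, semi, add_comm]
    rfl
  rw [hval] at hl
  refine hl.congr' ?_
  filter_upwards [eventually_ge_atTop 0] with r hr
  congr 1
  have hc := continuous_dcrv
  have hg := continuous_crv (3 / 2)
  have i3 : IntegrableOn (fun t => dcrv t / (crv (3 / 2) t - 1 / 2)) (Set.Icc (-r) r) :=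
    (Continuous.div (by fun_prop) (by fun_prop) fun t h =>
      half_sub_crv_ne t (by rw [← neg_sub, h, neg_zero])).continuousOn.integrableOn_compact isCompact_Icc
  rw [trunc_eq_integral_Icc hr, ← integral_smul_const, ← integral_add (ap u hi1).1.integrableOn (ap f hi2).1.integrableOn,
    ← integral_add (f := fun t => (crvWeight (3 / 2) 0 t • (R (crv (3 / 2) t) - rsv0 ν (crv (3 / 2) t))) u +
      (regWeight t • rsv0 ν (crv (3 / 2) t)) f)
      ((ap u hi1).1.add (ap f hi2).1).integrableOn (i3.smul_const u)]
  exact integral_congr_ae (Eventually.of_forall fun t => (key t).symm)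

end Spec

end LandauSphere
end

noncomputable section
namespace LandauSphere

/-! ### The projections of the circles -/

/-- The contour integral of a resolvent over a circle. -/
def cproj (R : ℂ → V6 →L[ℂ] V6) (c r : ℝ) : V6 →L[ℂ] V6 :=
  (2 * Real.pi * Complex.I : ℂ)⁻¹ • (Path.circ c r).int R

lemma label_id : Label id := .inl fun _ => rfl

/-- The reflection of the integers at `1 / 2`. -/
def refl (n : ℤ) : ℤ := 1 - n

lemma label_refl : Label refl := .inr fun _ => rfl

/-- The indicator function of a point. -/
def pointWeight (c n : ℤ) : ℂ := if n = c then 1 else 0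

/-- The indicator of 0 or 1 is a bounded function of L₀ since its differences are supported near 0,
where the factor n + 2 is at most 3. -/
lemma adm_pointWeight {c : ℤ} (hc : c = 0 ∨ c = 1) : Adm (pointWeight c) 2 := by
  refine ⟨fun n => ?_, fun n => ?_⟩
  · unfold pointWeight
    split_ifs <;> norm_num
  · unfold pointWeight
    by_cases h1 : n = c
    · rw [if_pos h1, if_neg (by omega), h1]
      rcases hc with rfl | rfl <;> norm_num
    · rw [if_neg h1, sub_zero]
      split_ifs with h2
      · have : n = c - 2 := by omega
        rw [this]
        rcases hc with rfl | rfl <;> norm_num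
      · norm_num

namespace Spec

variable {R : ℂ → V6 →L[ℂ] V6} {η : ℝ}

lemma norm_circ_smul_le (S : Spec id R η) {c : ℤ} (hc : c = 0 ∨ c = 1) {r : ℝ} (h1 : 1 / 4 ≤ r) (h2 : r ≤ 1 / 2) (t : ℝ) :
    ‖(Path.circ (c : ℝ) r).φ t • (R ((Path.circ (c : ℝ) r).γ t) - rsv0 id ((Path.circ (c : ℝ) r).γ t))‖ ≤ η / 2 := by
  have hc' : (c : ℝ) = 0 ∨ (c : ℝ) = 1 := by exact_mod_cast hc
  have hm := Path.circ_mem hc' h1 h2 t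
  have h3 := S.close _ hm
  have h4 : rho ((Path.circ (c : ℝ) r).γ t).im ^ (-(12 / 7) : ℝ) ≤ 1 :=
    Real.rpow_le_one_of_one_le_of_nonpos (one_le_rho _) (by norm_num)
  have h5 := S.nonneg
  have h6 : ‖(Path.circ (c : ℝ) r).φ t‖ = r := by
    change ‖circleMap 0 r t * Complex.I‖ = r
    rw [norm_mul, Complex.norm_I, mul_one, norm_circleMap_zero, abs_of_nonneg (by linarith)]
  rw [norm_smul, h6]
  nlinarith [norm_nonneg (R ((Path.circ (c : ℝ) r).γ t) - rsv0 id ((Path.circ (c : ℝ) r).γ t))]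

lemma norm_cproj_sub_le (S : Spec id R η) {c : ℤ} (hc : c = 0 ∨ c = 1) {r : ℝ} (h1 : 1 / 4 ≤ r) (h2 : r ≤ 1 / 2) :
    ‖cproj R c r - fn (pointWeight c)‖ ≤ 4 * η := by
  have hc' : (c : ℝ) = 0 ∨ (c : ℝ) = 1 := by exact_mod_cast hc
  have hr : 0 ≤ r := by linarith
  have hp := fun t => Path.circ_mem hc' h1 h2 t
  have hpi := Complex.two_pi_I_ne_zero
  have hA := adm_pointWeight hc
  have h3 : (Path.circ (c : ℝ) r).int (rsv0 id) = (2 * Real.pi * Complex.I : ℂ) • fn (pointWeight c) := by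
    rw [← fn_smul hA, label_id.int_rsv0 hp (hA.const_mul _) fun n => ?_]
    rw [pointWeight]
    split_ifs with h
    · rw [mul_one]
      refine Path.circ_cauchy_of_lt ?_
      rw [id, h]
      simp
      linarith
    · rw [mul_zero]
      refine Path.circ_cauchy_of_gt hr ?_
      rw [id, show (n : ℂ) - ((c : ℝ) : ℂ) = ((n - c : ℤ) : ℂ) by push_cast; ring, Complex.norm_intCast]
      have : (1 : ℝ) ≤ |((n - c : ℤ) : ℝ)| := by exact_mod_cast Int.one_le_abs (sub_ne_zero.2 h)
      linarith
  have h4 := integral_sub (Path.integrable_res S.isRes hp) (Path.integrable_res S.label.isRes hp)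
  have h5 : cproj R c r - fn (pointWeight c) = (2 * Real.pi * Complex.I : ℂ)⁻¹ •
      ∫ t, (Path.circ (c : ℝ) r).φ t • (R ((Path.circ (c : ℝ) r).γ t) - rsv0 id ((Path.circ (c : ℝ) r).γ t))
        ∂(Path.circ (c : ℝ) r).μ := by
    have h6 : fn (pointWeight c) = (2 * Real.pi * Complex.I : ℂ)⁻¹ • (Path.circ (c : ℝ) r).int (rsv0 id) := by
      rw [h3, smul_smul, inv_mul_cancel₀ hpi, one_smul]
    rw [cproj, h6]
    refine (smul_sub _ _ _).symm.trans ?_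
    congr 1
    exact h4.symm.trans (integral_congr_ae (Eventually.of_forall fun t => (smul_sub _ _ _).symm))
  have h7 : ‖∫ t, (Path.circ (c : ℝ) r).φ t •
      (R ((Path.circ (c : ℝ) r).γ t) - rsv0 id ((Path.circ (c : ℝ) r).γ t)) ∂(Path.circ (c : ℝ) r).μ‖ ≤
      η / 2 * (2 * Real.pi) := by
    have := norm_setIntegral_le_of_norm_le_const (μ := volume) (s := Set.Icc 0 (2 * Real.pi)) (C := η / 2)
      (f := fun t => (Path.circ (c : ℝ) r).φ t •
        (R ((Path.circ (c : ℝ) r).γ t) - rsv0 id ((Path.circ (c : ℝ) r).γ t))) (by rw [Real.volume_Icc]; exact ENNReal.ofReal_lt_top) fun t _ => S.norm_circ_smul_le hc h1 h2 t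
    refine this.trans (le_of_eq ?_)
    rw [Measure.real, Real.volume_Icc, ENNReal.toReal_ofReal (by linarith [Real.pi_pos]), sub_zero]
  rw [h5, norm_smul]
  have h8 := norm_two_pi_I_inv_le
  have h9 := Real.pi_lt_four
  have h10 := S.nonneg
  have h11 := norm_nonneg (∫ t, (Path.circ (c : ℝ) r).φ t •
      (R ((Path.circ (c : ℝ) r).γ t) - rsv0 id ((Path.circ (c : ℝ) r).γ t)) ∂(Path.circ (c : ℝ) r).μ)
  nlinarith

lemma tendsto_cproj (S : Spec id R η) {c : ℤ} (hc : c = 0 ∨ c = 1) {x0 : ℝ} (h1 : 0 ≤ x0) (h2 : x0 < 1 / 4) :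
    Tendsto (fun x => cproj R c (1 / 2 - x)) (𝓝[>] x0) (𝓝 (cproj R c (1 / 2 - x0))) := by
  have hc' : (c : ℝ) = 0 ∨ (c : ℝ) = 1 := by exact_mod_cast hc
  obtain ⟨M, hM⟩ := S.isRes.bdd
  have hev : ∀ᶠ x in 𝓝[>] x0, x ∈ Set.Ioo x0 (1 / 4) := Ioo_mem_nhdsGT h2
  have hmem : ∀ x ∈ Set.Ioo x0 (1 / 4), ∀ t, circleMap (c : ℝ) (1 / 2 - x) t ∈ Reg := fun x hx t =>
    Path.circ_mem hc' (by linarith [hx.2]) (by linarith [hx.1]) t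
  have hmem0 : ∀ t, circleMap (c : ℝ) (1 / 2 - x0) t ∈ Reg := fun t =>
    Path.circ_mem hc' (by linarith) (by linarith) t
  refine Tendsto.const_smul ?_ _
  refine tendsto_integral_filter_of_dominated_convergence (μ := volume.restrict (Set.Icc 0 (2 * Real.pi)))
    (F := fun x t => (circleMap 0 (1 / 2 - x) t * Complex.I) • R (circleMap (c : ℝ) (1 / 2 - x) t))
    (f := fun t => (circleMap 0 (1 / 2 - x0) t * Complex.I) • R (circleMap (c : ℝ) (1 / 2 - x0) t))
    (fun _ => 1 / 2 * M) ?_ ?_ (integrable_const _) (Eventually.of_forall fun t => ?_)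
  · filter_upwards [hev] with x hx
    have := S.isRes.continuousOn.comp_continuous (continuous_circleMap (c : ℝ) (1 / 2 - x)) (hmem x hx)
    exact (((continuous_circleMap 0 _).mul continuous_const).smul this).aestronglyMeasurable
  · filter_upwards [hev] with x hx
    refine Eventually.of_forall fun t => ?_
    rw [norm_smul, norm_mul, Complex.norm_I, mul_one, norm_circleMap_zero]
    have h3 : |1 / 2 - x| ≤ 1 / 2 := abs_le.2 ⟨by linarith [hx.1, hx.2], by linarith [hx.1]⟩
    exact mul_le_mul h3 (hM _ (hmem x hx t)) (norm_nonneg _) (by norm_num)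
  · have e : ∀ d : ℂ, Continuous fun x : ℝ => circleMap d (1 / 2 - x) t := fun d => by
      unfold circleMap; fun_prop
    refine ((((e 0).mul continuous_const).tendsto x0).mono_left nhdsWithin_le_nhds).smul ?_
    refine (S.isRes.continuousOn _ (hmem0 t)).tendsto.comp (tendsto_nhdsWithin_iff.2
      ⟨((e (c : ℝ)).tendsto x0).mono_left nhdsWithin_le_nhds, ?_⟩)
    filter_upwards [hev] with x hx
    exact hmem x hx t

/-- `eq_of_nested` for concentric circles of radius 1/2 - x, each projection being within 4η ≤ 1/4
of the unperturbed one. The radius 3/8 is recorded because the circles of radius 1/2 touch each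
other and Γ±, whereas the product formulas require separated contours. -/
lemma cproj_mul_self (S : Spec id R η) (hη : 16 * η ≤ 1) {c : ℤ} (hc : c = 0 ∨ c = 1) :
    cproj R c (1 / 2) * cproj R c (1 / 2) = cproj R c (1 / 2) ∧ cproj R c (3 / 8) = cproj R c (1 / 2) := by
  have hc' : (c : ℝ) = 0 ∨ (c : ℝ) = 1 := by exact_mod_cast hc
  have hpi := Complex.two_pi_I_ne_zero
  have hnest : ∀ a : ℝ, 0 ≤ a → a < 1 / 4 → cproj R c (1 / 2 - a) * cproj R c (1 / 2 - a) = cproj R c (1 / 2 - a) ∧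
      ∀ x, a ≤ x → x ≤ 1 / 4 → cproj R c (1 / 2 - x) * cproj R c (1 / 2 - x) = cproj R c (1 / 2 - x) →
        cproj R c (1 / 2 - x) = cproj R c (1 / 2 - a) := fun a ha ha' => by
    refine eq_of_nested (P := fun x => cproj R c (1 / 2 - x)) ha' (fun x y hx hxy hy => ?_)
      (fun x y hx hx' hy hy' => ?_) (S.tendsto_cproj hc ha ha')
    · obtain ⟨h1, h2⟩ := Path.circ_mul_circ S.isRes hc' (r := 1 / 2 - x) (r' := 1 / 2 - y) (by linarith)
        (by linarith) (by linarith)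
      simp only [cproj, smul_mul_smul_comm, h1, h2, smul_smul]
      rw [mul_assoc, inv_mul_cancel₀ hpi, mul_one]
      exact ⟨rfl, rfl⟩
    · have h1 := S.norm_cproj_sub_le hc (r := 1 / 2 - x) (by linarith) (by linarith)
      have h2 := S.norm_cproj_sub_le hc (r := 1 / 2 - y) (by linarith) (by linarith)
      have h3 := norm_sub_le (cproj R c (1 / 2 - x) - fn (pointWeight c)) (cproj R c (1 / 2 - y) - fn (pointWeight c))
      rw [sub_sub_sub_cancel_right] at h3
      exact h3.trans (by linarith)
  have h0 := hnest 0 le_rfl (by norm_num)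
  have h8 := hnest (1 / 8) (by norm_num) (by norm_num)
  have h9 := h0.2 (1 / 8) (by norm_num) (by norm_num) h8.1
  rw [sub_zero] at h0 h9
  rw [show (1 / 2 - 1 / 8 : ℝ) = 3 / 8 by norm_num] at h9
  exact ⟨h0.1, h9⟩

/-! ### The algebra of the projections -/

lemma zero_mul_of_semi {ν : ℤ → ℤ} {Q : ℂ → V6 →L[ℂ] V6} (S : Spec ν Q η) (B : V6 →L[ℂ] V6) (h : ∀ s < 0, semi ν Q (3 / 2) s * B = 0) :
    semi ν Q (3 / 2) 0 * B = 0 := by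
  ext1 v
  refine tendsto_nhds_unique (S.tendsto_semi le_rfl (by norm_num) le_rfl (B v)) ?_
  refine tendsto_const_nhds.congr' ?_
  filter_upwards [self_mem_nhdsWithin] with s hs
  rw [← h s hs]
  rfl

lemma mul_zero_of_semi {ν : ℤ → ℤ} {Q : ℂ → V6 →L[ℂ] V6} (S : Spec ν Q η) (B : V6 →L[ℂ] V6) (h : ∀ s < 0, B * semi ν Q (3 / 2) s = 0) :
    B * semi ν Q (3 / 2) 0 = 0 := by
  ext1 v
  refine tendsto_nhds_unique ((B.continuous.tendsto _).comp (S.tendsto_semi le_rfl (by norm_num) le_rfl v)) ?_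
  refine tendsto_const_nhds.congr' ?_
  filter_upwards [self_mem_nhdsWithin] with s hs
  rw [← h s hs]
  rfl

/-- The semigroup of the reflected resolvent as a contour integral. -/
lemma semi_refl_eq (S' : Spec refl (fun z => -R (1 - z)) η) {s : ℝ} (hs : 0 < s) :
    semi refl (fun z => -R (1 - z)) (3 / 2) (-s) =
      ((2 * Real.pi * Complex.I : ℂ)⁻¹ * Complex.exp (-s)) • (Path.minus (3 / 2) hs).int R := by
  rw [S'.semi_eq le_rfl (by norm_num) (neg_neg_of_pos hs), Path.minus_int, smul_smul,
    mul_assoc (2 * Real.pi * Complex.I : ℂ)⁻¹, ← Complex.exp_add, neg_add_cancel, Complex.exp_zero, mul_one]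

lemma plus_minus_zero (S : Spec id R η) (S' : Spec refl (fun z => -R (1 - z)) η) :
    semi id R (3 / 2) 0 * semi refl (fun z => -R (1 - z)) (3 / 2) 0 = 0 ∧
    semi refl (fun z => -R (1 - z)) (3 / 2) 0 * semi id R (3 / 2) 0 = 0 := by
  have h : ∀ s < 0, ∀ s' < 0, semi id R (3 / 2) s * semi refl (fun z => -R (1 - z)) (3 / 2) s' = 0 ∧
      semi refl (fun z => -R (1 - z)) (3 / 2) s' * semi id R (3 / 2) s = 0 := fun s hs s' hs' => by
    have e := S'.semi_refl_eq (neg_pos.2 hs')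
    rw [neg_neg] at e
    obtain ⟨h1, h2⟩ := Path.plus_minus S.isRes hs (neg_pos.2 hs') (a := 3 / 2) (a' := 3 / 2)
      le_rfl (by norm_num) le_rfl (by norm_num)
    rw [e, S.semi_eq le_rfl (by norm_num) hs, smul_mul_smul_comm, smul_mul_smul_comm, h1, h2, smul_zero, smul_zero]
    exact ⟨rfl, rfl⟩
  exact ⟨S.zero_mul_of_semi _ fun s hs => S'.mul_zero_of_semi _ fun s' hs' => (h s hs s' hs').1,
    S.mul_zero_of_semi _ fun s hs => S'.zero_mul_of_semi _ fun s' hs' => (h s hs s' hs').2⟩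

lemma plus_circ_zero (S : Spec id R η) (hη : 16 * η ≤ 1) {c : ℤ} (hc : c = 0 ∨ c = 1) :
    semi id R (3 / 2) 0 * cproj R c (1 / 2) = 0 ∧ cproj R c (1 / 2) * semi id R (3 / 2) 0 = 0 := by
  have hc' : (c : ℝ) = 0 ∨ (c : ℝ) = 1 := by exact_mod_cast hc
  rw [← (S.cproj_mul_self hη hc).2]
  have h : ∀ s < 0, semi id R (3 / 2) s * cproj R c (3 / 8) = 0 ∧ cproj R c (3 / 8) * semi id R (3 / 2) s = 0 :=
    fun s hs => by
      obtain ⟨h1, h2⟩ := Path.plus_circ S.isRes hs (a := 3 / 2) le_rfl (by norm_num) hc' (r := 3 / 8)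
        (by norm_num) (by norm_num)
      rw [cproj, S.semi_eq le_rfl (by norm_num) hs, smul_mul_smul_comm, smul_mul_smul_comm, h1, h2, smul_zero]
      exact ⟨rfl, rfl⟩
  exact ⟨S.zero_mul_of_semi _ fun s hs => (h s hs).1, S.mul_zero_of_semi _ fun s hs => (h s hs).2⟩

lemma minus_circ_zero (S : Spec id R η) (S' : Spec refl (fun z => -R (1 - z)) η) (hη : 16 * η ≤ 1)
    {c : ℤ} (hc : c = 0 ∨ c = 1) :
    semi refl (fun z => -R (1 - z)) (3 / 2) 0 * cproj R c (1 / 2) = 0 ∧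
      cproj R c (1 / 2) * semi refl (fun z => -R (1 - z)) (3 / 2) 0 = 0 := by
  have hc' : (c : ℝ) = 0 ∨ (c : ℝ) = 1 := by exact_mod_cast hc
  rw [← (S.cproj_mul_self hη hc).2]
  have h : ∀ s < 0, semi refl (fun z => -R (1 - z)) (3 / 2) s * cproj R c (3 / 8) = 0 ∧
      cproj R c (3 / 8) * semi refl (fun z => -R (1 - z)) (3 / 2) s = 0 := fun s hs => by
    have e := S'.semi_refl_eq (neg_pos.2 hs)
    rw [neg_neg] at e
    obtain ⟨h1, h2⟩ := Path.minus_circ S.isRes (neg_pos.2 hs) (a := 3 / 2) le_rfl (by norm_num) hc' (r := 3 / 8)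
      (by norm_num) (by norm_num)
    rw [e, cproj, smul_mul_smul_comm, smul_mul_smul_comm, h1, h2, smul_zero, smul_zero]
    exact ⟨rfl, rfl⟩
  exact ⟨S'.zero_mul_of_semi _ fun s hs => (h s hs).1, S'.mul_zero_of_semi _ fun s hs => (h s hs).2⟩

lemma circ_circ_zero (S : Spec id R η) (hη : 16 * η ≤ 1) :
    cproj R 0 (1 / 2) * cproj R 1 (1 / 2) = 0 ∧ cproj R 1 (1 / 2) * cproj R 0 (1 / 2) = 0 := by
  have h0 := (S.cproj_mul_self hη (c := 0) (.inl rfl)).2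
  have h1 := (S.cproj_mul_self hη (c := 1) (.inr rfl)).2
  rw [Int.cast_zero] at h0
  rw [Int.cast_one] at h1
  rw [← h0, ← h1]
  obtain ⟨h2, h3⟩ := Path.circ_circ S.isRes (r := 3 / 8) (by norm_num) (by norm_num)
  rw [cproj, cproj, Complex.ofReal_zero, Complex.ofReal_one, smul_mul_smul_comm, smul_mul_smul_comm, h2, h3,
    smul_zero]
  exact ⟨rfl, rfl⟩

/-- Every integer is at least 2, at most -1, or equal to 0 or 1; `expWeight 0` after the reflection
is the indicator function of n ≤ -1. -/
lemma fn_sum : fn (fun n => expWeight 0 (id n)) + fn (fun n => expWeight 0 (refl n)) +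
    fn (pointWeight 0) + fn (pointWeight 1) = 1 := by
  have a1 := label_id.adm_expWeight (s := 0) le_rfl
  have a2 := label_refl.adm_expWeight (s := 0) le_rfl
  have a3 := adm_pointWeight (c := 0) (.inl rfl)
  have a4 := adm_pointWeight (c := 1) (.inr rfl)
  ext1 u
  refine ext_projV fun k => ?_
  rw [← fn_one]
  have e1 : projV k ((fn (fun n => expWeight 0 (id n)) + fn (fun n => expWeight 0 (refl n)) +
      fn (pointWeight 0) + fn (pointWeight 1)) u) = projV k (fn (fun n => expWeight 0 (id n)) u) +
      projV k (fn (fun n => expWeight 0 (refl n)) u) + projV k (fn (pointWeight 0) u) +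
      projV k (fn (pointWeight 1) u) := by
    simp only [← projVL_apply, add_apply, map_add]
  rw [e1, projV_fn a1, projV_fn a2, projV_fn a3, projV_fn a4, projV_fn adm_one]
  simp only [act_nMat, ← Finset.sum_add_distrib, ← add_smul]
  refine Finset.sum_congr rfl fun j _ => ?_
  congr 1
  generalize nodes k j = n
  simp only [expWeight, pointWeight, refl, id, Complex.ofReal_zero, mul_zero, Complex.exp_zero]
  rcases lt_trichotomy n 0 with h | h | h
  · rw [if_neg (by omega), if_pos (by omega), if_neg (by omega), if_neg (by omega)]; simp
  · rw [if_neg (by omega), if_neg (by omega), if_pos (by omega), if_neg (by omega)]; simp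
  · rcases eq_or_ne n 1 with h' | h'
    · rw [if_neg (by omega), if_neg (by omega), if_neg (by omega), if_pos h']; simp
    · rw [if_pos (by omega), if_neg (by omega), if_neg (by omega), if_neg h']; simp

/-- The projections add up to the identity. -/
lemma sum_eq_one (S : Spec id R η) (S' : Spec refl (fun z => -R (1 - z)) η) (hη : 16 * η ≤ 1)
    (hη' : η * corrBound ≤ 1 / 8) :
    semi id R (3 / 2) 0 + semi refl (fun z => -R (1 - z)) (3 / 2) 0 + cproj R 0 (1 / 2) +
      cproj R 1 (1 / 2) = 1 := by
  have pp := (S.idempotent_and_bound (by linarith)).1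
  have mm := (S'.idempotent_and_bound (by linarith)).1
  have z0 := (S.cproj_mul_self hη (c := 0) (.inl rfl)).1
  have z1 := (S.cproj_mul_self hη (c := 1) (.inr rfl)).1
  have n0 := S.norm_cproj_sub_le (c := 0) (.inl rfl) (r := 1 / 2) (by norm_num) le_rfl
  have n1 := S.norm_cproj_sub_le (c := 1) (.inr rfl) (r := 1 / 2) (by norm_num) le_rfl
  obtain ⟨pm, mp⟩ := S.plus_minus_zero S'
  obtain ⟨p0, hp0⟩ := S.plus_circ_zero hη (c := 0) (.inl rfl)
  obtain ⟨p1, hp1⟩ := S.plus_circ_zero hη (c := 1) (.inr rfl)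
  obtain ⟨m0, hm0⟩ := S.minus_circ_zero S' hη (c := 0) (.inl rfl)
  obtain ⟨m1, hm1⟩ := S.minus_circ_zero S' hη (c := 1) (.inr rfl)
  obtain ⟨h01, h10⟩ := S.circ_circ_zero hη
  have np := S.norm_corr_le (a := 3 / 2) le_rfl (by norm_num) (le_refl 0)
  have nm := S'.norm_corr_le (a := 3 / 2) le_rfl (by norm_num) (le_refl 0)
  rw [mul_zero, Real.exp_zero, mul_one] at np nm
  have ep : semi id R (3 / 2) 0 - fn (fun n => expWeight 0 (id n)) = corr id R (3 / 2) 0 := add_sub_cancel_left _ _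
  have em : semi refl (fun z => -R (1 - z)) (3 / 2) 0 - fn (fun n => expWeight 0 (refl n)) =
      corr refl (fun z => -R (1 - z)) (3 / 2) 0 := add_sub_cancel_left _ _
  rw [← ep] at np
  rw [← em] at nm
  simp only [Int.cast_zero, Int.cast_one] at z0 z1 n0 n1 p0 hp0 p1 hp1 m0 hm0 m1 hm1
  have hs := fn_sum
  generalize semi id R (3 / 2) 0 = P at *
  generalize semi refl (fun z => -R (1 - z)) (3 / 2) 0 = Q at *
  generalize cproj R 0 (1 / 2) = Z at *
  generalize cproj R 1 (1 / 2) = W at *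
  have hidem : (1 - (P + Q + Z + W)) * (1 - (P + Q + Z + W)) = 1 - (P + Q + Z + W) := by
    have : (P + Q + Z + W) * (P + Q + Z + W) = P + Q + Z + W := by
      simp only [mul_add, add_mul, pp, mm, z0, z1, pm, mp, p0, hp0, p1, hp1, m0, hm0, m1, hm1, h01, h10]
      abel
    rw [mul_sub, sub_mul, sub_mul, this]
    simp
  -- By `fn_sum` only the four corrections remain, with total norm at most 1/8 + 1/8 + 4η + 4η ≤
  -- 3/4.
  have hnorm : ‖1 - (P + Q + Z + W)‖ < 1 := by
    have e : 1 - (P + Q + Z + W) = -((P - fn (fun n => expWeight 0 (id n))) +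
        (Q - fn (fun n => expWeight 0 (refl n))) + (Z - fn (pointWeight 0)) + (W - fn (pointWeight 1))) := by
      rw [← hs]; abel
    rw [e, norm_neg]
    refine (norm_add₄_le).trans_lt ?_
    linarith
  exact (sub_eq_zero.1 (eq_zero_of_mul_self hidem hnorm)).symm

end Spec

end LandauSphere
end

/-! ### Transfer to the space X, and the conclusion. -/

noncomputable section
namespace LandauSphere

/-! ### Continuity of the norm -/

lemma continuous_meanSq_clm {E : Type*} [NormedAddCommGroup E] [NormedSpace ℂ E] (B : E →L[ℂ] L2) :
    Continuous fun u => meanSq (B u) := by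
  unfold meanSq
  simp only [← pair_one]
  fun_prop

lemma continuous_h1Sq_clm {E : Type*} [NormedAddCommGroup E] [NormedSpace ℂ E] [CompleteSpace E]
    (B : E →L[ℂ] L2) (h : ∀ u, Sob 1 (B u)) : Continuous fun u => h1Sq (B u) := by
  have h1 := continuous_meanSq_clm B
  choose W hW using exists_clm_wd B h
  unfold h1Sq
  simp only [← hW]
  fun_prop

lemma continuous_h2Sq_clm {E : Type*} [NormedAddCommGroup E] [NormedSpace ℂ E] [CompleteSpace E]
    (B : E →L[ℂ] L2) (h : ∀ u, Sob 2 (B u)) : Continuous fun u => h2Sq (B u) := by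
  have h1 := continuous_meanSq_clm B
  choose W hW using exists_clm_wd B (fun u => (h u).mono_succ)
  have hWs : ∀ i u, Sob 1 (W i u) := fun i u => by rw [hW]; exact (h u).wd i
  choose Z hZ using fun i => exists_clm_wd (W i) (hWs i) i
  unfold h2Sq lapl
  simp only [← hW, ← hZ]
  fun_prop

lemma continuous_xNorm_wparam : Continuous fun v => xNorm (wparam v) := by
  have hs : ∀ i v, Sob (ord i) (pot i v) := fun i v => sob_pot (m := 0) (sob_zero _)
  have h0 := continuous_h1Sq_clm (pot 0) (hs 0)
  have h1 := continuous_h1Sq_clm (-pot 1) (fun v => (hs 1 v).neg)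
  have h4 := continuous_h2Sq_clm (pot 4) (hs 4)
  have h5 := continuous_h1Sq_clm (pot 5) (hs 5)
  have e0 : ∀ v, curl (wparam v).1 = pot 0 v := fun v => comp_wparam v 0
  have e1 : ∀ v, dstar (wparam v).1 = (-pot 1) v := fun v => congrArg Neg.neg (comp_wparam v 1)
  have e2 : ∀ v, curl (wparam v).2.1 = pot 2 v := fun v => comp_wparam v 2
  have e3 : ∀ v, dstar (wparam v).2.1 = (-pot 3) v := fun v => congrArg Neg.neg (comp_wparam v 3)
  have e4 : ∀ v, (wparam v).2.2.1 = pot 4 v := fun v => comp_wparam v 4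
  have e5 : ∀ v, (wparam v).2.2.2 = pot 5 v := fun v => comp_wparam v 5
  unfold xNorm
  simp only [e0, e1, e2, e3, e4, e5]
  fun_prop

/-- `xNorm` is not continuous on the ambient space of states. Composed with the parametrization it
is, which gives the measurability required in `ConvergesInX`. -/
lemma continuous_xNorm_param : Continuous fun u => xNorm (param u) :=
  continuous_xNorm_wparam.comp (opM sMat).continuous

lemma xNorm_param_le : ∃ C : ℝ, 0 < C ∧ ∀ u, xNorm (param u) ≤ C * ‖u‖ := by
  obtain ⟨C, hC, h⟩ := xNorm_wparam_le
  refine ⟨C * (‖opM sMat‖ + 1), by positivity, fun u => (h _).trans ?_⟩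
  have h1 := (opM sMat).le_opNorm u
  rw [mul_assoc]
  gcongr
  exact h1.trans (by linarith [norm_nonneg u])

lemma tendsto_xNorm_param {ι : Type*} {l : Filter ι} {F : ι → V6} {u : V6} (h : Tendsto F l (𝓝 u)) :
    Tendsto (fun s => xNorm (param (F s) - param u)) l (𝓝 0) := by
  obtain ⟨C, hC, hp⟩ := xNorm_param_le
  have h1 := (tendsto_iff_norm_sub_tendsto_zero.1 h).const_mul C
  rw [mul_zero] at h1
  refine squeeze_zero (fun s => Real.sqrt_nonneg _) (fun s => ?_) h1
  rw [← map_sub]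
  exact hp _

/-! ### The contours -/

lemma contour_mem_Reg (σ : Part) (t : ℝ) : contour σ t ∈ Reg := by
  cases σ
  · exact crv_mem t
  · have e : contour .minus t = 1 - crv (3 / 2) t := by
      simp only [contour, crv]; push_cast; ring
    rw [e]
    exact one_sub_mem_Reg (crv_mem t)
  · have := Path.circ_mem (c := 0) (.inl rfl) (r := 1 / 2) (by norm_num) le_rfl t
    rw [Complex.ofReal_zero] at this
    exact this
  · have := Path.circ_mem (c := 1) (.inr rfl) (r := 1 / 2) (by norm_num) le_rfl t
    rw [Complex.ofReal_one] at this
    exact this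

lemma contour_minus : contour .minus = fun t => 1 - crv (3 / 2) t := by
  funext t
  simp only [contour, crv]; push_cast; ring

lemma deriv_contour_minus (t : ℝ) : deriv (contour .minus) t = -dcrv t := by
  rw [contour_minus, deriv_const_sub, deriv_crv]

/-- A description of the resolvent of `L` by a resolvent in the parametrizing space. -/
structure Model (b : E3) (Q : State → V6) (R : ℂ → V6 →L[ℂ] V6) : Prop where
  isRes : IsRes R Reg
  eq_param : ∀ z ∈ Reg, ∀ Ξ ∈ X, resolventL b z Ξ = param (R z (Q Ξ))
  chi_eq : ∀ z ∈ Reg, ∀ Ξ ∈ X, chi (R z (Q Ξ)) = R z (Q Ξ)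

/-- The weight of the contour integrals. -/
def cWeight (σ : Part) (s t : ℝ) : ℂ := Complex.exp (contour σ t * s) * deriv (contour σ) t

lemma cWeight_plus (s t : ℝ) : cWeight .plus s t = crvWeight (3 / 2) s t := by
  change Complex.exp (crv (3 / 2) t * s) * deriv (crv (3 / 2)) t = _
  rw [deriv_crv]; rfl

lemma cWeight_minus (s t : ℝ) : cWeight .minus s t = Complex.exp ((1 - crv (3 / 2) t) * s) * -dcrv t := by
  rw [cWeight, deriv_contour_minus, contour_minus]

lemma continuous_contour (σ : Part) : Continuous (contour σ) := by
  cases σ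
  · exact continuous_crv _
  · rw [contour_minus]
    have := continuous_crv (3 / 2)
    fun_prop
  · exact continuous_circleMap _ _
  · exact continuous_circleMap _ _

lemma continuous_cWeight (σ : Part) (s : ℝ) : Continuous (cWeight σ s) := by
  have h := continuous_contour σ
  have hd : Continuous (deriv (contour σ)) := by
    cases σ
    · change Continuous (deriv (crv (3 / 2)))
      rw [deriv_crv]; exact continuous_dcrv
    · rw [funext deriv_contour_minus]; exact continuous_dcrv.neg
    · change Continuous (deriv (circleMap 0 (1 / 2)))
      rw [funext (deriv_circleMap _ _)]; fun_prop
    · change Continuous (deriv (circleMap 1 (1 / 2)))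
      rw [funext (deriv_circleMap _ _)]; fun_prop
  unfold cWeight
  fun_prop

namespace Model

variable {b : E3} {Q : State → V6} {R : ℂ → V6 →L[ℂ] V6}

lemma contourIntegrand_eq (M : Model b Q R) (σ : Part) (s : ℝ) {Ξ : State} (h : Ξ ∈ X) (t : ℝ) :
    contourIntegrand b σ s Ξ t = param (cWeight σ s t • R (contour σ t) (Q Ξ)) := by
  rw [map_smul, ← M.eq_param _ (contour_mem_Reg σ t) Ξ h]; rfl

lemma continuous_integrand (M : Model b Q R) (σ : Part) (s : ℝ) :
    Continuous fun t => cWeight σ s t • R (contour σ t) := by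
  have h1 := continuous_cWeight σ s
  have h2 := M.isRes.continuousOn.comp_continuous (continuous_contour σ) (contour_mem_Reg σ)
  exact h1.smul h2

lemma cauchyIntegral_eq (M : Model b Q R) (σ : Part) (s : ℝ) {Ξ : State} (h : Ξ ∈ X) {I : Set ℝ}
    (hI : IntegrableOn (fun t => cWeight σ s t • R (contour σ t)) I) :
    cauchyIntegral b σ I s Ξ =
      param (((2 * Real.pi * Complex.I : ℂ)⁻¹ • ∫ t in I, cWeight σ s t • R (contour σ t)) (Q Ξ)) ∧
    chi (((2 * Real.pi * Complex.I : ℂ)⁻¹ • ∫ t in I, cWeight σ s t • R (contour σ t)) (Q Ξ)) =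
      ((2 * Real.pi * Complex.I : ℂ)⁻¹ • ∫ t in I, cWeight σ s t • R (contour σ t)) (Q Ξ) := by
  have h1 : Integrable (fun t => (cWeight σ s t • R (contour σ t)) (Q Ξ)) (volume.restrict I) :=
    (ContinuousLinearMap.apply ℂ V6 (Q Ξ)).integrable_comp hI
  have h2 : ∫ t in I, (cWeight σ s t • R (contour σ t)) (Q Ξ) =
      (∫ t in I, cWeight σ s t • R (contour σ t)) (Q Ξ) :=
    (ContinuousLinearMap.apply ℂ V6 (Q Ξ)).integral_comp_comm hI
  have h3 := param.integral_comp_comm h1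
  have h4 := chi.integral_comp_comm h1
  rw [smul_apply, map_smul, map_smul, ← h2, ← h3, ← h4, cauchyIntegral]
  refine ⟨?_, ?_⟩
  · congr 1
    exact integral_congr_ae (Eventually.of_forall fun t => M.contourIntegrand_eq σ s h t)
  · congr 1
    refine integral_congr_ae (Eventually.of_forall fun t => ?_)
    simp only
    rw [smul_apply, map_smul, M.chi_eq _ (contour_mem_Reg σ t) Ξ h]

lemma convergesInX (M : Model b Q R) (σ : Part) (s : ℝ) {Ξ : State} (h : Ξ ∈ X)
    (hI : IntegrableOn (fun t => cWeight σ s t • R (contour σ t)) (contourDom σ)) :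
    ConvergesInX b σ s Ξ := by
  have h1 : Integrable (fun t => (cWeight σ s t • R (contour σ t)) (Q Ξ)) (volume.restrict (contourDom σ)) :=
    (ContinuousLinearMap.apply ℂ V6 (Q Ξ)).integrable_comp hI
  have e : contourIntegrand b σ s Ξ = fun t => param ((cWeight σ s t • R (contour σ t)) (Q Ξ)) :=
    funext fun t => M.contourIntegrand_eq σ s h t
  have hc : Continuous fun t => (cWeight σ s t • R (contour σ t)) (Q Ξ) :=
    (ContinuousLinearMap.apply ℂ V6 (Q Ξ)).continuous.comp (M.continuous_integrand σ s)
  obtain ⟨C, hC, hp⟩ := xNorm_param_le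
  refine ⟨fun t _ => by rw [e]; exact param_mem_X _, ?_, ?_⟩
  · rw [e]; exact param.integrable_comp h1
  · rw [e]
    refine (h1.norm.const_mul C).mono' (continuous_xNorm_param.comp hc).aestronglyMeasurable
      (Eventually.of_forall fun t => ?_)
    exact (Real.norm_of_nonneg (Real.sqrt_nonneg _)).trans_le (hp _)

lemma integrable_plus (M : Model b Q R) {s : ℝ} (hs : s < 0) :
    Integrable fun t => cWeight .plus s t • R (contour .plus t) := by
  have := Path.integrable_res (p := Path.plus (3 / 2) hs) M.isRes crv_mem
  simp only [cWeight_plus]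
  exact this

lemma integrable_minus (M : Model b Q R) {s : ℝ} (hs : 0 < s) :
    Integrable fun t => cWeight .minus s t • R (contour .minus t) := by
  have := Path.integrable_res (p := Path.minus (3 / 2) hs) M.isRes fun t => one_sub_mem_Reg (crv_mem t)
  simp only [cWeight_minus, contour_minus]
  exact this

lemma integrableOn_Icc (M : Model b Q R) (σ : Part) (s x y : ℝ) :
    IntegrableOn (fun t => cWeight σ s t • R (contour σ t)) (Set.Icc x y) :=
  (M.continuous_integrand σ s).continuousOn.integrableOn_compact isCompact_Icc

variable {η : ℝ}

lemma cauchyIntegral_plus (M : Model b Q R) (S : Spec id R η) {s : ℝ} (hs : s < 0) {Ξ : State} (h : Ξ ∈ X) :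
    cauchyIntegral b .plus (contourDom .plus) s Ξ = param (semi id R (3 / 2) s (Q Ξ)) ∧
      chi (semi id R (3 / 2) s (Q Ξ)) = semi id R (3 / 2) s (Q Ξ) := by
  have h1 := M.cauchyIntegral_eq .plus s h (I := Set.univ) (M.integrable_plus hs).integrableOn
  have e : semi id R (3 / 2) s = (2 * Real.pi * Complex.I : ℂ)⁻¹ •
      ∫ t in Set.univ, cWeight .plus s t • R (contour .plus t) := by
    rw [S.semi_eq le_rfl (by norm_num) hs, setIntegral_univ]
    simp only [cWeight_plus]
    rfl
  rw [e]
  exact h1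

/-- Under the reflection z = 1 - w the weight e^{zs} becomes e^s e^{w(-s)}; this is the origin of
the factor e^s. -/
lemma cauchyIntegral_minus (M : Model b Q R) (S' : Spec refl (fun z => -R (1 - z)) η) {s : ℝ} (hs : 0 < s)
    {Ξ : State} (h : Ξ ∈ X) :
    cauchyIntegral b .minus (contourDom .minus) s Ξ =
      param (Complex.exp s • semi refl (fun z => -R (1 - z)) (3 / 2) (-s) (Q Ξ)) ∧
    chi (semi refl (fun z => -R (1 - z)) (3 / 2) (-s) (Q Ξ)) =
      semi refl (fun z => -R (1 - z)) (3 / 2) (-s) (Q Ξ) := by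
  have h1 := M.cauchyIntegral_eq .minus s h (I := Set.univ) (M.integrable_minus hs).integrableOn
  have hi : (Path.minus (3 / 2) hs).int R = ∫ t in Set.univ, cWeight .minus s t • R (contour .minus t) := by
    rw [setIntegral_univ]
    simp only [cWeight_minus, contour_minus]
    rfl
  have e := S'.semi_refl_eq hs
  rw [mul_comm, mul_smul, hi] at e
  have e' : Complex.exp s • semi refl (fun z => -R (1 - z)) (3 / 2) (-s) = (2 * Real.pi * Complex.I : ℂ)⁻¹ •
      ∫ t in Set.univ, cWeight .minus s t • R (contour .minus t) := by
    rw [e, smul_smul, ← Complex.exp_add, add_neg_cancel, Complex.exp_zero, one_smul]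
  rw [← smul_apply, e']
  refine ⟨h1.1, ?_⟩
  rw [e, smul_apply, map_smul, h1.2]

lemma specProj_plus (M : Model b Q R) (S : Spec id R η) {Ξ : State} (h : Ξ ∈ X) :
    specProj b .plus Ξ = param (semi id R (3 / 2) 0 (Q Ξ)) ∧
      chi (semi id R (3 / 2) 0 (Q Ξ)) = semi id R (3 / 2) 0 (Q Ξ) := by
  have hl := S.tendsto_semi (a := 3 / 2) le_rfl (by norm_num) le_rfl (Q Ξ)
  refine ⟨Tendsto.limUnder_eq (((param.continuous.tendsto _).comp hl).congr' ?_),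
    tendsto_nhds_unique ((chi.continuous.tendsto _).comp hl) (hl.congr' ?_)⟩
  · filter_upwards [self_mem_nhdsWithin] with s hs
    exact (M.cauchyIntegral_plus S hs h).1.symm
  · filter_upwards [self_mem_nhdsWithin] with s hs
    exact (M.cauchyIntegral_plus S hs h).2.symm

lemma tendsto_neg_right : Tendsto (fun s : ℝ => -s) (𝓝[>] 0) (𝓝[<] 0) := by
  refine tendsto_nhdsWithin_iff.2 ⟨?_, ?_⟩
  · have : Tendsto (fun x : ℝ => -x) (𝓝 0) (𝓝 (-0)) := Continuous.tendsto (by fun_prop) 0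
    rw [neg_zero] at this
    exact this.mono_left nhdsWithin_le_nhds
  · filter_upwards [self_mem_nhdsWithin] with x hx
    exact neg_neg_of_pos (Set.mem_Ioi.1 hx)

lemma tendsto_minus (S' : Spec refl (fun z => -R (1 - z)) η) (u : V6) :
    Tendsto (fun s : ℝ => Complex.exp s • semi refl (fun z => -R (1 - z)) (3 / 2) (-s) u) (𝓝[>] 0)
      (𝓝 (semi refl (fun z => -R (1 - z)) (3 / 2) 0 u)) := by
  have h1 := (S'.tendsto_semi (a := 3 / 2) le_rfl (by norm_num) le_rfl u).comp tendsto_neg_right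
  have h2 : Tendsto (fun s : ℝ => Complex.exp s) (𝓝[>] 0) (𝓝 1) := by
    have hc : Continuous fun s : ℝ => Complex.exp s := by fun_prop
    have := hc.tendsto 0
    rw [Complex.ofReal_zero, Complex.exp_zero] at this
    exact this.mono_left nhdsWithin_le_nhds
  have := h2.smul h1
  rwa [one_smul] at this

lemma specProj_minus (M : Model b Q R) (S' : Spec refl (fun z => -R (1 - z)) η) {Ξ : State} (h : Ξ ∈ X) :
    specProj b .minus Ξ = param (semi refl (fun z => -R (1 - z)) (3 / 2) 0 (Q Ξ)) ∧
      chi (semi refl (fun z => -R (1 - z)) (3 / 2) 0 (Q Ξ)) =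
        semi refl (fun z => -R (1 - z)) (3 / 2) 0 (Q Ξ) := by
  have hl := tendsto_minus S' (Q Ξ)
  refine ⟨Tendsto.limUnder_eq (((param.continuous.tendsto _).comp hl).congr' ?_),
    tendsto_nhds_unique ((chi.continuous.tendsto _).comp hl) (hl.congr' ?_)⟩
  · filter_upwards [self_mem_nhdsWithin] with s hs
    exact (M.cauchyIntegral_minus S' hs h).1.symm
  · filter_upwards [self_mem_nhdsWithin] with s hs
    simp only [Function.comp_apply, map_smul]
    rw [(M.cauchyIntegral_minus S' hs h).2]

lemma expProj_plus (M : Model b Q R) (S : Spec id R η) {s : ℝ} (hs : s ≤ 0) {Ξ : State} (h : Ξ ∈ X) :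
    expProj b .plus s Ξ = param (semi id R (3 / 2) s (Q Ξ)) := by
  unfold expProj
  split_ifs with h0
  · rw [h0]; exact (M.specProj_plus S h).1
  · exact (M.cauchyIntegral_plus S (lt_of_le_of_ne hs h0) h).1

lemma expProj_minus (M : Model b Q R) (S' : Spec refl (fun z => -R (1 - z)) η) {s : ℝ} (hs : 0 ≤ s)
    {Ξ : State} (h : Ξ ∈ X) : expProj b .minus s Ξ =
      param (Complex.exp s • semi refl (fun z => -R (1 - z)) (3 / 2) (-s) (Q Ξ)) := by
  unfold expProj
  split_ifs with h0
  · rw [h0, Complex.ofReal_zero, Complex.exp_zero, one_smul, neg_zero]; exact (M.specProj_minus S' h).1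
  · exact (M.cauchyIntegral_minus S' (lt_of_le_of_ne hs (Ne.symm h0)) h).1

lemma specProj_zero (M : Model b Q R) {Ξ : State} (h : Ξ ∈ X) :
    specProj b .zero Ξ = param (cproj R 0 (1 / 2) (Q Ξ)) ∧
      chi (cproj R 0 (1 / 2) (Q Ξ)) = cproj R 0 (1 / 2) (Q Ξ) := by
  have h1 := M.cauchyIntegral_eq .zero 0 h (M.integrableOn_Icc .zero 0 0 (2 * Real.pi))
  have e : cproj R 0 (1 / 2) = (2 * Real.pi * Complex.I : ℂ)⁻¹ •
      ∫ t in Set.Icc 0 (2 * Real.pi), cWeight .zero 0 t • R (contour .zero t) := by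
    have : ∀ t, cWeight .zero 0 t = circleMap 0 (1 / 2) t * Complex.I := fun t => by
      rw [cWeight, Complex.ofReal_zero, mul_zero, Complex.exp_zero, one_mul]
      exact deriv_circleMap _ _ _
    rw [cproj, Complex.ofReal_zero]
    simp only [this]
    rfl
  rw [e]
  exact h1

lemma specProj_one (M : Model b Q R) {Ξ : State} (h : Ξ ∈ X) :
    specProj b .one Ξ = param (cproj R 1 (1 / 2) (Q Ξ)) ∧
      chi (cproj R 1 (1 / 2) (Q Ξ)) = cproj R 1 (1 / 2) (Q Ξ) := by
  have h1 := M.cauchyIntegral_eq .one 0 h (M.integrableOn_Icc .one 0 0 (2 * Real.pi))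
  have e : cproj R 1 (1 / 2) = (2 * Real.pi * Complex.I : ℂ)⁻¹ •
      ∫ t in Set.Icc 0 (2 * Real.pi), cWeight .one 0 t • R (contour .one t) := by
    have : ∀ t, cWeight .one 0 t = circleMap 0 (1 / 2) t * Complex.I := fun t => by
      rw [cWeight, Complex.ofReal_zero, mul_zero, Complex.exp_zero, one_mul]
      exact deriv_circleMap _ _ _
    rw [cproj, Complex.ofReal_one]
    simp only [this]
    rfl
  rw [e]
  exact h1

/-- The four projections in the parametrizing space. -/
def opP (R : ℂ → V6 →L[ℂ] V6) : Part → V6 →L[ℂ] V6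
  | .plus => semi id R (3 / 2) 0
  | .minus => semi refl (fun z => -R (1 - z)) (3 / 2) 0
  | .zero => cproj R 0 (1 / 2)
  | .one => cproj R 1 (1 / 2)

/-- The second half makes compositions computable: as `Q (param u) = chi u`, applying Q to a
projected state returns exactly the projected vector. -/
lemma specProj_eq (M : Model b Q R) (S : Spec id R η) (S' : Spec refl (fun z => -R (1 - z)) η) (σ : Part)
    {Ξ : State} (h : Ξ ∈ X) :
    specProj b σ Ξ = param (opP R σ (Q Ξ)) ∧ chi (opP R σ (Q Ξ)) = opP R σ (Q Ξ) := by
  cases σ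
  exacts [M.specProj_plus S h, M.specProj_minus S' h, M.specProj_zero h, M.specProj_one h]

lemma opP_mul_self (S : Spec id R η) (S' : Spec refl (fun z => -R (1 - z)) η) (hη : 16 * η ≤ 1)
    (hη' : η * corrBound ≤ 1 / 8) (σ : Part) : opP R σ * opP R σ = opP R σ := by
  have h0 := (S.cproj_mul_self hη (c := 0) (.inl rfl)).1
  have h1 := (S.cproj_mul_self hη (c := 1) (.inr rfl)).1
  rw [Int.cast_zero] at h0
  rw [Int.cast_one] at h1
  cases σ
  exacts [(S.idempotent_and_bound (by linarith)).1, (S'.idempotent_and_bound (by linarith)).1, h0, h1]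

lemma opP_mul_of_ne (S : Spec id R η) (S' : Spec refl (fun z => -R (1 - z)) η) (hη : 16 * η ≤ 1)
    {σ σ' : Part} (h : σ ≠ σ') : opP R σ * opP R σ' = 0 := by
  have pm := S.plus_minus_zero S'
  have p0 := S.plus_circ_zero hη (c := 0) (.inl rfl)
  have p1 := S.plus_circ_zero hη (c := 1) (.inr rfl)
  have m0 := S.minus_circ_zero S' hη (c := 0) (.inl rfl)
  have m1 := S.minus_circ_zero S' hη (c := 1) (.inr rfl)
  have h01 := S.circ_circ_zero hη
  simp only [Int.cast_zero, Int.cast_one] at p0 p1 m0 m1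
  cases σ <;> cases σ'
  exacts [absurd rfl h, pm.1, p0.1, p1.1, pm.2, absurd rfl h, m0.1, m1.1, p0.2, m0.2, absurd rfl h, h01.1,
    p1.2, m1.2, h01.2, absurd rfl h]

lemma tendsto_improper_plus (M : Model b Q R) (S : Spec id R η) {Ξ : State} (h : Ξ ∈ X)
    (hf : ∃ f, Q Ξ = res0 (1 / 2) f) :
    Tendsto (fun r : ℝ => xNorm (cauchyIntegral b .plus (Set.Icc (-r) r) 0 Ξ - specProj b .plus Ξ)) atTop (𝓝 0) := by
  obtain ⟨f, hf⟩ := hf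
  have h1 := S.tendsto_improper f
  change Tendsto _ _ (𝓝 (semi id R (3 / 2) 0 (res0 (1 / 2) f))) at h1
  rw [← hf] at h1
  refine (tendsto_xNorm_param h1).congr fun r => ?_
  rw [(M.specProj_plus S h).1, (M.cauchyIntegral_eq .plus 0 h (M.integrableOn_Icc .plus 0 (-r) r)).1]
  congr 3
  rw [smul_apply]
  congr 1
  have := (ContinuousLinearMap.apply ℂ V6 (Q Ξ)).integral_comp_comm (M.integrableOn_Icc .plus 0 (-r) r)
  refine Eq.trans ?_ this
  refine integral_congr_ae (Eventually.of_forall fun t => ?_)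
  change crvWeight (3 / 2) 0 t • R (crv (3 / 2) t) (rsv0 id (1 / 2) f) = cWeight .plus 0 t • R (crv (3 / 2) t) (Q Ξ)
  rw [cWeight_plus, hf]
  rfl

lemma tendsto_improper_minus (M : Model b Q R) (S' : Spec refl (fun z => -R (1 - z)) η) {Ξ : State} (h : Ξ ∈ X)
    (hf : ∃ f, Q Ξ = res0 (1 / 2) f) :
    Tendsto (fun r : ℝ => xNorm (cauchyIntegral b .minus (Set.Icc (-r) r) 0 Ξ - specProj b .minus Ξ)) atTop (𝓝 0) := by
  obtain ⟨f, hf⟩ := hf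
  have h1 := S'.tendsto_improper (-f)
  -- The point 1/2 is fixed by the reflection, so the reflected resolvent there is minus the
  -- original one.
  have e : rsv0 refl (1 / 2) (-f) = Q Ξ := by
    rw [rsv0_of_reflect (ν := refl) (fun _ => rfl) half_mem_Reg, hf, map_neg, neg_apply, neg_neg]
    norm_num
  rw [e] at h1
  refine (tendsto_xNorm_param h1).congr fun r => ?_
  rw [(M.specProj_minus S' h).1, (M.cauchyIntegral_eq .minus 0 h (M.integrableOn_Icc .minus 0 (-r) r)).1]
  congr 3
  rw [smul_apply]
  congr 1
  have := (ContinuousLinearMap.apply ℂ V6 (Q Ξ)).integral_comp_comm (M.integrableOn_Icc .minus 0 (-r) r)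
  refine Eq.trans ?_ this
  refine integral_congr_ae (Eventually.of_forall fun t => ?_)
  change crvWeight (3 / 2) 0 t • -(R (1 - crv (3 / 2) t) (Q Ξ)) = cWeight .minus 0 t • R (contour .minus t) (Q Ξ)
  rw [cWeight_minus, crvWeight_zero, Complex.ofReal_zero, mul_zero, Complex.exp_zero, one_mul, contour_minus,
    smul_neg, neg_smul]

end Model

lemma spec_id {K : V6 →L[ℂ] V6} (hK : 8856 * ‖K‖ ≤ 1) {η : ℝ} (hη : 4428 * 8856 * ‖K‖ ≤ η) :
    Spec id (rsv K) η := by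
  refine ⟨label_id, isRes_res hK, fun z hz => (norm_res_sub_res0_le hK hz).trans ?_⟩
  have := rho_pos z.im
  gcongr

lemma spec_refl {K : V6 →L[ℂ] V6} (hK : 8856 * ‖K‖ ≤ 1) {η : ℝ} (hη : 4428 * 8856 * ‖K‖ ≤ η) :
    Spec refl (fun z => -rsv K (1 - z)) η := by
  refine ⟨label_refl, (isRes_res hK).reflect fun z => one_sub_mem_Reg, fun z hz => ?_⟩
  have h := norm_res_sub_res0_le hK (one_sub_mem_Reg hz)
  have e : rho (1 - z).im = rho z.im := by simp [rho]
  rw [rsv0_of_reflect (ν := refl) (fun _ => rfl) hz, neg_sub_neg, norm_sub_rev]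
  rw [e] at h
  refine h.trans ?_
  have := rho_pos z.im
  gcongr

end LandauSphere
end

open LandauSphere in
theorem proposition4p2 :
    ∃ κ : ℝ, 0 < κ ∧ ∃ C : ℝ, 0 < C ∧ ∀ b : E3, ‖b‖ < κ →
      -- the contours lie in the resolvent set
      (∀ σ : Part, ∀ t ∈ contourDom σ, InResolventSet b (contour σ t)) ∧
      -- the contour integrals converge absolutely in `X`
      (∀ Ξ ∈ X,
        (∀ s < 0, ConvergesInX b .plus s Ξ) ∧ (∀ s > 0, ConvergesInX b .minus s Ξ) ∧
        (∀ s, ConvergesInX b .zero s Ξ) ∧ (∀ s, ConvergesInX b .one s Ξ)) ∧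
      -- the projections map `X` to `X`, and they are the values at `s = 0`:
      -- as limits on `X`, and as (symmetric) improper contour integrals on `D`
      (∀ Ξ ∈ X, ∀ σ : Part, specProj b σ Ξ ∈ X) ∧
      (∀ Ξ ∈ X,
        Tendsto (fun s => xNorm (expProj b .plus s Ξ - specProj b .plus Ξ)) (𝓝[<] 0) (𝓝 0) ∧
        Tendsto (fun s => xNorm (expProj b .minus s Ξ - specProj b .minus Ξ)) (𝓝[>] 0) (𝓝 0)) ∧
      (∀ Ξ ∈ D, ∀ σ : Part, σ = .plus ∨ σ = .minus →
        Tendsto (fun r : ℝ => xNorm (cauchyIntegral b σ (Set.Icc (-r) r) 0 Ξ - specProj b σ Ξ))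
          atTop (𝓝 0)) ∧
      -- the bounds on the semigroups
      (∀ Ξ ∈ X, ∀ s ≤ 0,
        expProj b .plus s Ξ ∈ X ∧
          xNorm (expProj b .plus s Ξ) ≤ C * Real.exp (7 * s / 4) * xNorm Ξ) ∧
      (∀ Ξ ∈ X, ∀ s ≥ 0,
        expProj b .minus s Ξ ∈ X ∧
          xNorm (expProj b .minus s Ξ) ≤ C * Real.exp (-3 * s / 4) * xNorm Ξ) ∧
      -- the algebra of the projections
      (∀ Ξ ∈ X, ∀ σ : Part, specProj b σ (specProj b σ Ξ) = specProj b σ Ξ) ∧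
      (∀ Ξ ∈ X, ∀ σ σ' : Part, σ ≠ σ' → specProj b σ (specProj b σ' Ξ) = 0) ∧
      (∀ Ξ ∈ X, Ξ = specProj b .plus Ξ + specProj b .minus Ξ +
        specProj b .zero Ξ + specProj b .one Ξ) := by
  obtain ⟨CQ, hCQ, Q, hQ1, hQ2, hQ3, hQ4, hQD, hK⟩ := exists_model
  obtain ⟨CP, hCP, hP⟩ := xNorm_param_le
  have hcb := corrBound_nonneg
  -- With η = 4428 · 8856 · CQ |b|, the condition N |b| ≤ 1 says 16 η (1 + `corrBound`) ≤ 1. It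
  -- contains both requirements, 16 η ≤ 1 for the circles and η `corrBound` ≤ 1/8 for Γ±. The other
  -- bound 2π on |b| guarantees the parameter ε.
  set N : ℝ := 4428 * 8856 * CQ * (16 * (1 + corrBound)) with hN
  have hN0 : 0 < N := by positivity
  refine ⟨min (2 * Real.pi) N⁻¹, lt_min (by positivity) (inv_pos.2 hN0), CP * 97 * CQ, by positivity,
    fun b hb => ?_⟩
  obtain ⟨K, hKn, hKR⟩ := hK b (hb.le.trans (min_le_left _ _))
  have hbN : ‖b‖ * N ≤ 1 := by
    have := mul_le_mul_of_nonneg_right (hb.le.trans (min_le_right _ _)) hN0.le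
    rwa [inv_mul_cancel₀ hN0.ne'] at this
  set η : ℝ := 4428 * 8856 * (CQ * ‖b‖) with hη
  have hηn : 0 ≤ η := by positivity
  have hηN : 16 * η + 16 * (η * corrBound) ≤ 1 := by
    refine le_trans (le_of_eq ?_) hbN
    rw [hη, hN]; ring
  have hη1 : 16 * η ≤ 1 := by nlinarith
  have hη2 : η * corrBound ≤ 1 / 8 := by nlinarith
  have hKη : 4428 * 8856 * ‖K‖ ≤ η := by rw [hη]; gcongr
  have hK1 : 8856 * ‖K‖ ≤ 1 := by nlinarith [norm_nonneg K]
  have S := spec_id hK1 hKη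
  have S' := spec_refl hK1 hKη
  have hres := fun z (hz : z ∈ Reg) => hKR z (rsv K z) hz (res_eq hK1 hz) (res_eq' hK1 hz)
  have M : Model b Q (rsv K) := ⟨isRes_res hK1, fun z hz Ξ h => ((hres z hz).2 Ξ h).1,
    fun z hz Ξ h => ((hres z hz).2 Ξ h).2⟩
  have hsp := fun σ Ξ (h : Ξ ∈ X) => M.specProj_eq S S' σ h
  have hQsp : ∀ σ, ∀ Ξ ∈ X, Q (specProj b σ Ξ) = Model.opP (rsv K) σ (Q Ξ) := fun σ Ξ h => by
    rw [(hsp σ Ξ h).1, hQ4, (hsp σ Ξ h).2]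
  have hX : ∀ σ, ∀ Ξ ∈ X, specProj b σ Ξ ∈ X := fun σ Ξ h => by
    rw [(hsp σ Ξ h).1]; exact param_mem_X _
  have hcomp : ∀ σ σ', ∀ Ξ ∈ X, specProj b σ (specProj b σ' Ξ) =
      param ((Model.opP (rsv K) σ * Model.opP (rsv K) σ') (Q Ξ)) := fun σ σ' Ξ h => by
    rw [(hsp σ _ (hX σ' Ξ h)).1, hQsp σ' Ξ h]; rfl
  have bound : ∀ Ξ ∈ X, ∀ (T : V6 →L[ℂ] V6) (c : ℝ), ‖T‖ ≤ 97 * c →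
      xNorm (param (T (Q Ξ))) ≤ CP * 97 * CQ * c * xNorm Ξ := fun Ξ h T c hT => by
    have h97 : 0 ≤ 97 * c := (norm_nonneg T).trans hT
    calc xNorm (param (T (Q Ξ))) ≤ CP * ‖T (Q Ξ)‖ := hP _
      _ ≤ CP * (97 * c * (CQ * xNorm Ξ)) := by
        gcongr
        exact (T.le_opNorm _).trans (mul_le_mul hT (hQ2 Ξ h) (norm_nonneg _) h97)
      _ = _ := by ring
  refine ⟨fun σ t _ => (hres _ (contour_mem_Reg σ t)).1, fun Ξ h => ⟨fun s hs => ?_, fun s hs => ?_, fun s => ?_, fun s => ?_⟩,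
    fun Ξ h σ => hX σ Ξ h, fun Ξ h => ⟨?_, ?_⟩, fun Ξ h σ hσ => ?_, fun Ξ h s hs => ⟨?_, ?_⟩,
    fun Ξ h s hs => ⟨?_, ?_⟩, fun Ξ h σ => ?_, fun Ξ h σ σ' hσ => ?_, fun Ξ h => ?_⟩
  · exact M.convergesInX .plus s h (M.integrable_plus hs).integrableOn
  · exact M.convergesInX .minus s h (M.integrable_minus hs).integrableOn
  · exact M.convergesInX .zero s h (M.integrableOn_Icc .zero s 0 (2 * Real.pi))
  · exact M.convergesInX .one s h (M.integrableOn_Icc .one s 0 (2 * Real.pi))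
  · refine (tendsto_xNorm_param (S.tendsto_semi le_rfl (by norm_num) le_rfl (Q Ξ))).congr' ?_
    filter_upwards [self_mem_nhdsWithin] with s hs
    rw [M.expProj_plus S (le_of_lt hs) h, (M.specProj_plus S h).1]
  · refine (tendsto_xNorm_param (Model.tendsto_minus S' (Q Ξ))).congr' ?_
    filter_upwards [self_mem_nhdsWithin] with s hs
    rw [M.expProj_minus S' (le_of_lt hs) h, (M.specProj_minus S' h).1]
  · have hf := hQD Ξ h _ half_mem_Reg
    rcases hσ with rfl | rfl
    · exact M.tendsto_improper_plus S (D_subset_X h) hf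
    · exact M.tendsto_improper_minus S' (D_subset_X h) hf
  · rw [M.expProj_plus S hs h]; exact param_mem_X _
  · rw [M.expProj_plus S hs h, show 7 * s / 4 = 7 / 4 * s by ring]
    exact bound Ξ h _ _ ((S.idempotent_and_bound (by linarith)).2 s hs)
  · rw [M.expProj_minus S' hs h]; exact param_mem_X _
  · rw [M.expProj_minus S' hs h]
    refine bound Ξ h (Complex.exp s • semi refl (fun z => -rsv K (1 - z)) (3 / 2) (-s)) _ ?_
    rw [norm_smul, Complex.norm_exp, Complex.ofReal_re]
    calc _ ≤ Real.exp s * (97 * Real.exp (7 / 4 * -s)) := by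
          gcongr
          exact (S'.idempotent_and_bound (by linarith)).2 (-s) (by linarith)
      _ = 97 * (Real.exp s * Real.exp (7 / 4 * -s)) := by ring
      _ = _ := by rw [← Real.exp_add]; ring_nf
  · rw [hcomp σ σ Ξ h, Model.opP_mul_self S S' hη1 hη2, (hsp σ Ξ h).1]
  · rw [hcomp σ σ' Ξ h, Model.opP_mul_of_ne S S' hη1 hσ, zero_apply, map_zero]
  · rw [(hsp .plus Ξ h).1, (hsp .minus Ξ h).1, (hsp .zero Ξ h).1, (hsp .one Ξ h).1, ← map_add, ← map_add,
      ← map_add, ← add_apply, ← add_apply, ← add_apply]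
    have := S.sum_eq_one S' hη1 hη2
    simp only [Model.opP]
    rw [this]
    exact (hQ1 Ξ h).symm
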